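/- **Setting.** Let $\Omega'\subseteq\mathbb R^{n'}$ and $\Omega\subseteq\mathbb R^n$ be open, $p\in\mathbb N$. Nets are indexed by $\varepsilon\in(0,1]$ and all $O$'s are as $\varepsilon\to0$. For a space $E$ with seminorms $(p_i)$, $\mathcal G_E$ is the quotient of the moderate nets ($\forall i\,\exists N:\ p_i(u_\varepsilon)=O(\varepsilon^{-N})$) by the negligible ones ($\forall i\,\forall q:\ p_i(u_\varepsilon)=O(\varepsilon^{q})$); $\widetilde{\mathbb C}=\mathcal G_{\mathbb C}$ with its sharp topology. A *slow scale net* is a net $(r_\varepsilon)$ in $\mathbb C$ such that for every $q\ge0$ there is $c_q>0$ with $|r_\varepsilon|^q\le c_q\varepsilon^{-1}$ for all $\varepsilon\in(0,1]$. *Generalized functions.* $\mathcal G(\Omega)=\mathcal G_{\mathcal C^\infty(\Omega)}$ for the seminorms $p_{K,i}(f)=\sup_{x\in K,|\alpha|\le i}|\partial^\alpha f(x)|$, $K\Subset\Omega$. $\mathcal G_K(\Omega)$ is the set of $u\in\mathcal G(\Omega)$ with support in $K\Subset\Omega$, with the ultra-pseudo-seminorms $e^{-\mathrm{val}_{i}(u)}$,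 $\mathrm{val}_i(u)=\sup\{b\in\mathbb R:\ p_{K',i}(u_\varepsilon)=O(\varepsilon^b)\}$, $i\in\mathbb N$, where $K'\Subset\Omega$ is any compact set with $K\subseteq\operatorname{int}K'$. $\mathcal G_{c}(\Omega)=\bigcup_K\mathcal G_K(\Omega)$ has the inductive limit topology in the category of locally convex topological $\widetilde{\mathbb C}$-modules. $\mathcal G^\infty(\Omega)$ is the set of $u\in\mathcal G(\Omega)$ that have a representative with $\forall K\Subset\Omega\,\exists N\,\forall i:\ p_{K,i}(u_\varepsilon)=O(\varepsilon^{-N})$, with the topology of the ultra-pseudo-seminorms $\mathcal P_{\mathcal G^\infty(K)}(u)=\exp(-\sup\{b:\ \forall i\ \ p_{K,i}(u_\varepsilon)=O(\varepsilon^b)\})$, $K\Subset\Omega$. $\mathcal G^\infty_K(\Omega)=\mathcal G^\infty(\Omega)\cap\mathcal G_K(\Omega)$ has the ultra-pseudo-norm $\mathcal P_{\mathcal G^\infty(K')}$ ($K'$ as above), and $\mathcal G^\infty_c(\Omega)=\mathcal G^\infty(\Omega)\cap\mathcal G_c(\Omega)=\bigcup_K\mathcal G^\infty_K(\Omega)$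 has the inductive limit topology, again in the category of locally convex topological $\widetilde{\mathbb C}$-modules. *Phase functions.* $\mathcal M_\Phi$ is the set of nets $(\phi_\varepsilon)$ of real-valued continuous functions on $\Omega'\times\Omega\times\mathbb R^p$ that are smooth for $\xi\ne0$, positively homogeneous of degree $1$ in $\xi$, with $\nabla_{y,\xi}\phi_\varepsilon\ne0$ for $\xi\neq0$, and such that (a) the net is moderate for the seminorms $\sup_{(x,y)\in K,\ \xi\ne0,\ |\alpha|+|\beta|\le j}|\xi|^{-1+|\alpha|}|\partial_\xi^\alpha\partial_{x,y}^\beta\phi|$, $K\Subset\Omega'\times\Omega$, $j\in\mathbb N$; (b) for all $K'\Subset\Omega'$, $K\Subset\Omega$ the net $\iota_\varepsilon=\inf_{x\in K',y\in K,\xi\ne0}|\nabla_{y,\xi}\phi_\varepsilon(x,y,\xi/|\xi|)|^2$ satisfies $\iota_\varepsilon\ge\varepsilon^r$ for some $r>0$ and all small $\varepsilon$. A generalized phase function $\phi$ is a class of such nets modulo nets that are negligible for the seminorms in (a). It is of *slow scale* if it has a representative for which each seminorm in (a) is $O(s_\varepsilon)$ with some slow scale net $(s_\varepsilon)$, and each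 $\iota_\varepsilon$ is $\ge1/|s_\varepsilon|$ for all small $\varepsilon$ with some slow scale net $(s_\varepsilon)$. *Amplitudes.* Let $m\in\mathbb R$, $0<\rho\le1$, $0\le\delta<1$. $\widetilde{\mathcal S}^m_{\rho,\delta}=\mathcal G_{S^m_{\rho,\delta}(\Omega'\times\Omega\times\mathbb R^p)}$ for the seminorms $|a|^{(m)}_{\rho,\delta,K,j}=\sup_{(x,y)\in K,\ \xi\in\mathbb R^p,\ |\alpha|+|\beta|\le j}\langle\xi\rangle^{-m+\rho|\alpha|-\delta|\beta|}|\partial^\alpha_\xi\partial^\beta_{x,y}a|$, and $\widetilde{\mathcal S}^{-\infty}=\mathcal G_{S^{-\infty}}$ for the seminorms $|\cdot|^{(m)}_{1,0,K,j}$ of all orders $m$. An $a\in\widetilde{\mathcal S}^m_{\rho,\delta}$ is *regular* if for every $K$ it has a representative with $\exists N\,\forall j:\ |a_\varepsilon|^{(m)}_{\rho,\delta,K,j}=O(\varepsilon^{-N})$; an $a\in\widetilde{\mathcal S}^{-\infty}$ is *regular* if for every $K$ it has a representative with $\exists N\,\forall m\,\forall j:\ |a_\varepsilon|^{(m)}_{1,0,K,j}=O(\varepsilon^{-N})$.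 *Operators.* Let $\chi\in\mathcal C_c^\infty(\mathbb R^p)$ with $\chi=1$ for $|\xi|<1/4$ and $\chi=0$ for $|\xi|>1/2$, and for a phase function $\phi$ put $L_\phi=\sum_j a_j\partial_{\xi_j}+\sum_k b_k\partial_{y_k}+c$, where, with $g=|\nabla_{y,\xi}\phi(x,y,\xi/|\xi|)|^{-2}$, $a_j=i(1-\chi)g\,\partial_{\xi_j}\phi$, $b_k=i(1-\chi)|\xi|^{-2}g\,\partial_{y_k}\phi$, $c=\chi+\sum_j\partial_{\xi_j}a_j+\sum_k\partial_{y_k}b_k$. The generalized Fourier integral operator with phase function $\phi$ and amplitude $a$, written $Au(x)=\int e^{i\phi(x,y,\xi)}a(x,y,\xi)u(y)\,dy\,(2\pi)^{-p}d\xi$, is the $\widetilde{\mathbb C}$-linear map $A:\mathcal G_c(\Omega)\to\mathcal G(\Omega')$ such that for all representatives $(\phi_\varepsilon)$ of $\phi$, $(a_\varepsilon)$ of $a$ and $(u_\varepsilon)$ of $u$ with the supports of the $u_\varepsilon$ in a fixed compact subset of $\Omega$, $Au$ is the class of the moderate net of smooth functions $$x\mapsto(2\pi)^{-p}\int_{\Omega\times\mathbb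 R^p}e^{i\phi_\varepsilon}L^h_{\phi_\varepsilon}(a_\varepsilon u_\varepsilon)\,dy\,d\xi$$ (an absolutely convergent integral), for every such $\chi$ and every $h\in\mathbb N$ with $m-h\min\{\rho,1-\delta\}+1<-p$, respectively for every $h\in\mathbb N$ if $a\in\widetilde{\mathcal S}^{-\infty}$. **Theorem.** Let $\phi$ be a slow scale generalized phase function. (i) If $a\in\widetilde{\mathcal S}^m_{\rho,\delta}$ is regular, with $m\in\mathbb R$, $0<\rho\le1$ and $0\le\delta<1$, then the generalized Fourier integral operator $A$ with phase function $\phi$ and amplitude $a$ is well defined (it exists and is unique) and maps $\mathcal G^\infty_c(\Omega)$ continuously into $\mathcal G^\infty(\Omega')$. (ii) If $a\in\widetilde{\mathcal S}^{-\infty}$ is regular, then the generalized Fourier integral operator $A$ with phase function $\phi$ and amplitude $a$ is well defined and maps $\mathcal G_c(\Omega)$ continuously into $\mathcal G^\infty(\Omega')$. -/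

import Mathlib

open Set Filter Topology MeasureTheory TopologicalSpace
open scoped ENNReal NNReal ContDiff

noncomputable section

namespace Colombeau

/-! ### Nets indexed by `(0,1]` and their asymptotic behaviour -/

/-- The index set `(0,1]`. -/
abbrev Eps : Type := Set.Ioc (0 : ℝ) 1

/-- The filter `ε → 0` on `(0,1]`. -/
def toZero : Filter Eps := Filter.comap (fun ε : Eps => (ε : ℝ)) (𝓝 0)

/-- `f ε = O(ε ^ b)` as `ε → 0`. -/
def IsBigOPow (f : Eps → ℝ≥0∞) (b : ℝ) : Prop :=
  ∃ C : ℝ≥0, ∀ᶠ ε in toZero, f ε ≤ C * ENNReal.ofReal ((ε : ℝ) ^ b)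

theorem IsBigOPow.of_le {f g : Eps → ℝ≥0∞} {b : ℝ} (hg : IsBigOPow g b) (h : ∀ ε, f ε ≤ g ε) :
    IsBigOPow f b := by
  obtain ⟨C, hC⟩ := hg
  exact ⟨C, hC.mono fun ε hε => (h ε).trans hε⟩

theorem IsBigOPow.zero (b : ℝ) : IsBigOPow (fun _ => 0) b :=
  ⟨0, Eventually.of_forall fun _ => by simp⟩

theorem IsBigOPow.mono {f : Eps → ℝ≥0∞} {b b' : ℝ} (hf : IsBigOPow f b) (h : b' ≤ b) :
    IsBigOPow f b' := by
  obtain ⟨C, hC⟩ := hf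
  refine ⟨C, hC.mono fun ε hε => hε.trans ?_⟩
  refine mul_le_mul' le_rfl (ENNReal.ofReal_le_ofReal ?_)
  exact Real.rpow_le_rpow_of_exponent_ge ε.2.1 ε.2.2 h

theorem IsBigOPow.add {f g : Eps → ℝ≥0∞} {b : ℝ} (hf : IsBigOPow f b) (hg : IsBigOPow g b) :
    IsBigOPow (fun ε => f ε + g ε) b := by
  obtain ⟨C, hC⟩ := hf
  obtain ⟨D, hD⟩ := hg
  refine ⟨C + D, ?_⟩
  filter_upwards [hC, hD] with ε h1 h2
  rw [ENNReal.coe_add, add_mul]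
  exact add_le_add h1 h2

theorem IsBigOPow.mul {f g : Eps → ℝ≥0∞} {b c : ℝ} (hf : IsBigOPow f b) (hg : IsBigOPow g c) :
    IsBigOPow (fun ε => f ε * g ε) (b + c) := by
  obtain ⟨C, hC⟩ := hf
  obtain ⟨D, hD⟩ := hg
  refine ⟨C * D, ?_⟩
  filter_upwards [hC, hD] with ε h1 h2
  have hε : (0 : ℝ) < ε := ε.2.1
  rw [Real.rpow_add hε, ENNReal.ofReal_mul (Real.rpow_nonneg hε.le _), ENNReal.coe_mul]
  calc f ε * g ε ≤ _ := mul_le_mul' h1 h2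
    _ = _ := by ring

/-- Slow scale nets of complex numbers. -/
def IsSlowScaleNet (r : Eps → ℂ) : Prop :=
  ∀ q : ℝ, 0 ≤ q → ∃ c : ℝ, 0 < c ∧ ∀ ε : Eps, ‖r ε‖ ^ q ≤ c * (ε : ℝ)⁻¹

/-- `f ε = O(s ε)` as `ε → 0` for some slow scale net `s`. -/
def IsSlowScaleBounded (f : Eps → ℝ≥0∞) : Prop :=
  ∃ s : Eps → ℂ, IsSlowScaleNet s ∧ ∃ C : ℝ≥0, ∀ᶠ ε in toZero, f ε ≤ C * ‖s ε‖ₑ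

/-! ### The ring of complex generalized numbers -/

/-- Moderate nets of complex numbers. -/
def CModerate : Subring (Eps → ℂ) where
  carrier := {z | ∃ N : ℕ, IsBigOPow (fun ε => ‖z ε‖ₑ) (-(N : ℝ))}
  zero_mem' := ⟨0, (IsBigOPow.zero _).of_le fun _ => by simp⟩
  one_mem' := ⟨0, 1, Eventually.of_forall fun _ => by simp⟩
  add_mem' := by
    rintro a b ⟨N, hN⟩ ⟨M, hM⟩
    refine ⟨N + M, IsBigOPow.of_le ((hN.mono ?_).add (hM.mono ?_)) fun ε => enorm_add_le _ _⟩ <;>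
    · push_cast
      have := (Nat.cast_nonneg N : (0 : ℝ) ≤ N)
      have := (Nat.cast_nonneg M : (0 : ℝ) ≤ M)
      linarith
  neg_mem' := by
    rintro a ⟨N, hN⟩
    exact ⟨N, hN.of_le fun ε => by simp⟩
  mul_mem' := by
    rintro a b ⟨N, hN⟩ ⟨M, hM⟩
    refine ⟨N + M, ((hN.mul hM).mono ?_).of_le fun ε => by simp [enorm_mul]⟩
    push_cast
    linarith

/-- Negligible nets of complex numbers. -/
def CNegligible : Ideal CModerate where
  carrier := {z | ∀ q : ℕ, IsBigOPow (fun ε => ‖z.1 ε‖ₑ) q}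
  zero_mem' := fun q => (IsBigOPow.zero _).of_le fun _ => by simp
  add_mem' := fun {a b} ha hb q =>
    ((ha q).add (hb q)).of_le fun ε => enorm_add_le (a.1 ε) (b.1 ε)
  smul_mem' := by
    rintro ⟨c, N, hN⟩ a ha q
    refine ((hN.mul (ha (N + q))).mono ?_).of_le fun ε => ?_
    · push_cast
      linarith
    · simp [enorm_mul]

/-- The ring `ℂ̃` of complex generalized numbers. -/
def CTilde : Type := CModerate ⧸ CNegligible

instance : CommRing CTilde := inferInstanceAs (CommRing (CModerate ⧸ CNegligible))

/-- The class of a moderate net of complex numbers. -/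
def CTilde.mk : CModerate →+* CTilde := Ideal.Quotient.mk CNegligible

theorem CTilde.mk_surjective : Function.Surjective CTilde.mk := Ideal.Quotient.mk_surjective

theorem CTilde.mk_eq_zero_iff (r : CModerate) : CTilde.mk r = 0 ↔ r ∈ CNegligible :=
  Ideal.Quotient.eq_zero_iff_mem

/-- The valuation on `ℂ̃`. -/
def CTilde.val (z : CTilde) : EReal :=
  sSup {x | ∃ b : ℝ, x = b ∧ ∃ r : CModerate, CTilde.mk r = z ∧
    IsBigOPow (fun ε => ‖r.1 ε‖ₑ) b}

/-- The ultra-pseudo-norm `|z|_e = e ^ (-val z)` on `ℂ̃`. -/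
def CTilde.absE (z : CTilde) : ℝ≥0∞ := EReal.exp (-z.val)

/-- The topology on an additive group whose subbasis consists of all balls
`{h | P j (h - g) < r}`, for a family `P` of (ultra-pseudo-)seminorms. -/
@[reducible] def seminormTopology {M J : Type} [AddCommGroup M] (P : J → M → ℝ≥0∞) : TopologicalSpace M :=
  generateFrom {W | ∃ (j : J) (g : M) (r : ℝ≥0∞), 0 < r ∧ W = {h | P j (h - g) < r}}

/-- The (sharp) topology of `ℂ̃`. -/
@[reducible] def CTilde.topology : TopologicalSpace CTilde := seminormTopology fun _ : Unit => CTilde.absE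

/-- `t` is a locally convex `ℂ̃`-linear topology: it makes `M` a topological `ℂ̃`-module, and `0`
has a base of neighbourhoods `W` that are `ℂ̃`-convex, i.e. satisfy `W + W ⊆ W`. -/
structure IsLocallyConvexTopology {M : Type} [AddCommGroup M] [Module CTilde M]
    (t : TopologicalSpace M) : Prop where
  addGroup : @IsTopologicalAddGroup M t _
  smul : @ContinuousSMul CTilde M _ CTilde.topology t
  basis : ∀ U ∈ @nhds M t 0, ∃ W ∈ @nhds M t 0, W ⊆ U ∧ ∀ u ∈ W, ∀ v ∈ W, u + v ∈ W

/-- The inductive limit topology in the category of locally convex `ℂ̃`-modules: the finest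
locally convex `ℂ̃`-linear topology on `M` for which all the maps `f j` are continuous.
(In Mathlib's order on topologies `sInf` is the supremum with respect to fineness.) -/
@[reducible] def inductiveLimitTopology {M J : Type} [AddCommGroup M] [Module CTilde M] {X : J → Type}
    (τ : ∀ j, TopologicalSpace (X j)) (f : ∀ j, X j → M) : TopologicalSpace M :=
  sInf {t | IsLocallyConvexTopology t ∧ ∀ j, Continuous[τ j, t] (f j)}

/-! ### Generalized functions based on a locally convex space `E` -/

/-- A family of seminorms on `E` (with values in `[0,∞]`, so that suprema need no side
conditions; in all instances below the values are finite). -/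
structure SeminormFam (E ι : Type) [AddCommGroup E] [Module ℂ E] where
  p : ι → E → ℝ≥0∞
  add_le : ∀ i u v, p i (u + v) ≤ p i u + p i v
  smul_le : ∀ i (c : ℂ) u, p i (c • u) ≤ ‖c‖ₑ * p i u

section GE

variable {E ι : Type} [AddCommGroup E] [Module ℂ E]

theorem SeminormFam.map_zero (P : SeminormFam E ι) (i : ι) : P.p i 0 = 0 := by
  have := P.smul_le i 0 0
  simpa using this

/-- Multiplication of nets in `E` by moderate nets of scalars. -/
instance : Module CModerate (Eps → E) := inferInstance

/-- `E`-moderate nets. -/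
def Moderate (P : SeminormFam E ι) : Submodule CModerate (Eps → E) where
  carrier := {u | ∀ i, ∃ N : ℕ, IsBigOPow (fun ε => P.p i (u ε)) (-(N : ℝ))}
  zero_mem' := fun i => ⟨0, (IsBigOPow.zero _).of_le fun _ => by simp [P.map_zero]⟩
  add_mem' := by
    intro a b ha hb i
    obtain ⟨N, hN⟩ := ha i
    obtain ⟨M, hM⟩ := hb i
    refine ⟨N + M, IsBigOPow.of_le ((hN.mono ?_).add (hM.mono ?_)) fun ε => P.add_le _ _ _⟩ <;>
    · push_cast
      have := (Nat.cast_nonneg N : (0 : ℝ) ≤ N)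
      have := (Nat.cast_nonneg M : (0 : ℝ) ≤ M)
      linarith
  smul_mem' := by
    rintro ⟨c, M, hM⟩ a ha i
    obtain ⟨N, hN⟩ := ha i
    refine ⟨M + N, ((hM.mul hN).mono ?_).of_le fun ε => P.smul_le i (c ε) (a ε)⟩
    push_cast
    linarith

instance (P : SeminormFam E ι) : AddCommGroup (Moderate P) := inferInstance

instance (P : SeminormFam E ι) : Module CModerate (Moderate P) := inferInstance

instance (P : SeminormFam E ι) : SMul CModerate (Moderate P) := inferInstance

/-- `E`-negligible nets. -/
def Negligible (P : SeminormFam E ι) : Submodule CModerate (Moderate P) where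
  carrier := {u | ∀ i, ∀ q : ℕ, IsBigOPow (fun ε => P.p i (u.1 ε)) q}
  zero_mem' := fun i q => (IsBigOPow.zero _).of_le fun _ => by simp [P.map_zero]
  add_mem' := fun {a b} ha hb i q =>
    ((ha i q).add (hb i q)).of_le fun ε => P.add_le i (a.1 ε) (b.1 ε)
  smul_mem' := by
    rintro c a ha i q
    obtain ⟨M, hM⟩ := c.2
    refine ((hM.mul (ha i (M + q))).mono ?_).of_le fun ε => P.smul_le i (c.1 ε) (a.1 ε)
    push_cast
    linarith

/-- The space `𝒢_E` of generalized functions based on `E`. -/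
def GE (P : SeminormFam E ι) : Type := Moderate P ⧸ Negligible P

instance (P : SeminormFam E ι) : AddCommGroup (GE P) :=
  inferInstanceAs (AddCommGroup (Moderate P ⧸ Negligible P))

theorem GE.isTorsionBySet (P : SeminormFam E ι) :
    Module.IsTorsionBySet CModerate (Moderate P ⧸ Negligible P)
      (CNegligible : Set CModerate) := by
  rintro x ⟨c, hc⟩
  obtain ⟨u, rfl⟩ := (Negligible P).mkQ_surjective x
  change c • (Negligible P).mkQ u = 0
  rw [← map_smul, Submodule.mkQ_apply, Submodule.Quotient.mk_eq_zero]
  intro i q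
  obtain ⟨N, hN⟩ := u.2 i
  refine (((hc (q + N)).mul hN).mono ?_).of_le fun ε => P.smul_le i (c.1 ε) (u.1 ε)
  push_cast
  linarith

/-- The `ℂ̃`-module structure of `𝒢_E`: `[c] • [u] = [c • u]`. -/
instance (P : SeminormFam E ι) : Module CTilde (GE P) :=
  (Module.IsTorsionBySet.module (GE.isTorsionBySet P) :
    Module (CModerate ⧸ CNegligible) (Moderate P ⧸ Negligible P))

/-- The class of a moderate net. -/
def GE.mk {P : SeminormFam E ι} (u : Moderate P) : GE P := (Negligible P).mkQ u

theorem GE.mk_surjective {P : SeminormFam E ι} (g : GE P) : ∃ u : Moderate P, GE.mk u = g :=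
  (Negligible P).mkQ_surjective g

theorem GE.mk_zero {P : SeminormFam E ι} : (GE.mk 0 : GE P) = 0 := rfl

theorem GE.mk_add {P : SeminormFam E ι} (u v : Moderate P) :
    GE.mk (u + v) = GE.mk u + GE.mk v := rfl

theorem GE.mk_sub {P : SeminormFam E ι} (u v : Moderate P) :
    GE.mk (u - v) = GE.mk u - GE.mk v := rfl

theorem GE.mk_smul {P : SeminormFam E ι} (c : CModerate) (u : Moderate P) :
    GE.mk (c • u) = CTilde.mk c • GE.mk u := rfl

theorem GE.mk_eq_mk_iff {P : SeminormFam E ι} (u v : Moderate P) :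
    GE.mk u = GE.mk v ↔ u - v ∈ Negligible P := Submodule.Quotient.eq _

/-- The valuation on `𝒢_E` with respect to a set `S` of seminorms:
`sup {b : ∀ i ∈ S, p_i(u_ε) = O(ε^b)}`. For `S = {i}` this is `val_{p_i}`. -/
def GE.val {P : SeminormFam E ι} (S : Set ι) (g : GE P) : EReal :=
  sSup {x | ∃ b : ℝ, x = b ∧ ∃ u : Moderate P, GE.mk u = g ∧
    ∀ i ∈ S, IsBigOPow (fun ε => P.p i (u.1 ε)) b}

/-- The corresponding ultra-pseudo-seminorm `e ^ (-val)`. -/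
def GE.ups {P : SeminormFam E ι} (S : Set ι) (g : GE P) : ℝ≥0∞ := EReal.exp (-(g.val S))

end GE

/-! ### The Colombeau algebra on an open set and its subspaces -/

/-- `ℝⁿ` with its Euclidean norm. -/
abbrev Rn (n : ℕ) : Type := EuclideanSpace ℝ (Fin n)

/-- The `i`-th standard basis vector. -/
abbrev stdVec {n : ℕ} (i : Fin n) : Rn n := EuclideanSpace.single i (1 : ℝ)

/-- The compact subsets of the open set `Ω`. -/
abbrev CompactIn {V : Type} [TopologicalSpace V] (Ω : Opens V) : Type :=
  {K : Set V // IsCompact K ∧ K ⊆ Ω}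

/-- Smooth functions on `Ω`. They are represented by functions on the ambient space, whose values
outside `Ω` are disregarded by all the seminorms below, and so in all the quotients. -/
def Smooth {n : ℕ} (Ω : Opens (Rn n)) : Submodule ℂ (Rn n → ℂ) where
  carrier := {f | ContDiffOn ℝ ∞ f Ω}
  zero_mem' := contDiffOn_const
  add_mem' := fun ha hb => ha.add hb
  smul_mem' := fun _ _ ha => contDiffOn_const.smul ha

theorem contDiffAt_of_opens {V W : Type} [NormedAddCommGroup V] [NormedSpace ℝ V]
    [NormedAddCommGroup W] [NormedSpace ℝ W] {U : Set V} (hU : IsOpen U) {f : V → W}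
    (hf : ContDiffOn ℝ ∞ f U) {x : V} (hx : x ∈ U) (k : ℕ) : ContDiffAt ℝ k f x :=
  (hf.contDiffAt (hU.mem_nhds hx)).of_le (by exact_mod_cast le_top)

/-- The seminorms `p_{K,i}(f) = sup_{x ∈ K, |α| ≤ i} |∂^α f(x)|` on smooth functions. Here the tuple
`J = (J_1, …, J_k)` stands for the partial derivative `∂_{J_1} ⋯ ∂_{J_k}`, of order `k`. -/
def smoothSeminorm {n : ℕ} (K : Set (Rn n)) (i : ℕ) (f : Rn n → ℂ) : ℝ≥0∞ :=
  ⨆ x ∈ K, ⨆ k ≤ i, ⨆ J : Fin k → Fin n,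
    ‖iteratedFDeriv ℝ k f x (fun l => stdVec (J l))‖ₑ

/-- `ℰ(Ω)`, with its seminorms. -/
def smoothFam {n : ℕ} (Ω : Opens (Rn n)) : SeminormFam (Smooth Ω) (CompactIn Ω × ℕ) where
  p := fun i f => smoothSeminorm i.1.1 i.2 f.1
  add_le := by
    rintro ⟨⟨K, hK, hKΩ⟩, i⟩ f g
    refine iSup₂_le fun x hx => iSup₂_le fun k hk => iSup_le fun J => ?_
    change ‖iteratedFDeriv ℝ k (f.1 + g.1) x _‖ₑ ≤ _
    rw [iteratedFDeriv_add_apply (contDiffAt_of_opens Ω.2 f.2 (hKΩ hx) k)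
      (contDiffAt_of_opens Ω.2 g.2 (hKΩ hx) k), add_apply]
    refine (enorm_add_le _ _).trans (add_le_add ?_ ?_)
    · exact le_iSup₂_of_le x hx (le_iSup₂_of_le k hk (le_iSup_of_le J le_rfl))
    · exact le_iSup₂_of_le x hx (le_iSup₂_of_le k hk (le_iSup_of_le J le_rfl))
  smul_le := by
    rintro ⟨⟨K, hK, hKΩ⟩, i⟩ c f
    refine iSup₂_le fun x hx => iSup₂_le fun k hk => iSup_le fun J => ?_
    change ‖iteratedFDeriv ℝ k (c • f.1) x _‖ₑ ≤ _
    rw [iteratedFDeriv_const_smul_apply (contDiffAt_of_opens Ω.2 f.2 (hKΩ hx) k),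
      smul_apply, enorm_smul]
    gcongr
    exact le_iSup₂_of_le x hx (le_iSup₂_of_le k hk (le_iSup_of_le J le_rfl))

/-- The Colombeau algebra `𝒢(Ω)`. -/
abbrev G {n : ℕ} (Ω : Opens (Rn n)) : Type := GE (smoothFam Ω)

section

variable {n : ℕ} {Ω : Opens (Rn n)}

/-- The restriction of `u` to `V ∩ Ω` is zero. -/
def VanishesOn (u : G Ω) (V : Set (Rn n)) : Prop :=
  ∃ r : Moderate (smoothFam Ω), GE.mk r = u ∧ ∀ K : CompactIn Ω, K.1 ⊆ V → ∀ i q : ℕ,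
    IsBigOPow (fun ε => smoothSeminorm K.1 i (r.1 ε).1) q

/-- The support of a generalized function. -/
def supp (u : G Ω) : Set (Rn n) :=
  {x | x ∈ Ω ∧ ¬ ∃ V : Set (Rn n), IsOpen V ∧ x ∈ V ∧ VanishesOn u V}

variable (Ω)

/-- `𝒢_K(Ω)`: the generalized functions with support in `K`. -/
def GK (K : Set (Rn n)) : Submodule CTilde (G Ω) where
  carrier := {u | supp u ⊆ K}
  zero_mem' := by
    rintro x ⟨hx, h⟩
    refine (h ⟨univ, isOpen_univ, mem_univ x, 0, GE.mk_zero, fun K _ i q => ?_⟩).elim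
    exact (IsBigOPow.zero _).of_le fun ε => ((smoothFam Ω).map_zero (K, i)).le
  add_mem' := by
    rintro u v hu hv x ⟨hx, h⟩
    by_contra hxK
    have h1 : ∃ V : Set (Rn n), IsOpen V ∧ x ∈ V ∧ VanishesOn u V := by
      by_contra h1
      exact hxK (hu ⟨hx, h1⟩)
    have h2 : ∃ V : Set (Rn n), IsOpen V ∧ x ∈ V ∧ VanishesOn v V := by
      by_contra h2
      exact hxK (hv ⟨hx, h2⟩)
    obtain ⟨V, hV, hxV, r, rfl, hr⟩ := h1
    obtain ⟨W, hW, hxW, s, rfl, hs⟩ := h2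
    refine h ⟨V ∩ W, hV.inter hW, ⟨hxV, hxW⟩, r + s, GE.mk_add _ _, fun K hK i q => ?_⟩
    exact ((hr K (hK.trans inter_subset_left) i q).add
      (hs K (hK.trans inter_subset_right) i q)).of_le
      fun ε => (smoothFam Ω).add_le (K, i) (r.1 ε) (s.1 ε)
  smul_mem' := by
    rintro c u hu x ⟨hx, h⟩
    by_contra hxK
    have h1 : ∃ V : Set (Rn n), IsOpen V ∧ x ∈ V ∧ VanishesOn u V := by
      by_contra h1
      exact hxK (hu ⟨hx, h1⟩)
    obtain ⟨V, hV, hxV, r, rfl, hr⟩ := h1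
    obtain ⟨⟨c, N, hN⟩, rfl⟩ := CTilde.mk_surjective c
    refine h ⟨V, hV, hxV, (⟨c, N, hN⟩ : CModerate) • r, GE.mk_smul _ _,
      fun K hK i q => ?_⟩
    refine ((hN.mul (hr K hK i (N + q))).mono ?_).of_le
      fun ε => (smoothFam Ω).smul_le (K, i) (c ε) (r.1 ε)
    push_cast
    linarith

theorem GK_mono {K L : Set (Rn n)} (h : K ⊆ L) : GK Ω K ≤ GK Ω L := fun _ hu => hu.trans h

/-- `𝒢_c(Ω)`: the generalized functions with compact support in `Ω`. -/
def Gc : Submodule CTilde (G Ω) where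
  carrier := {u | ∃ K : CompactIn Ω, u ∈ GK Ω K.1}
  zero_mem' := ⟨⟨∅, isCompact_empty, empty_subset _⟩, zero_mem _⟩
  add_mem' := by
    rintro u v ⟨K, hK⟩ ⟨L, hL⟩
    exact ⟨⟨K.1 ∪ L.1, K.2.1.union L.2.1, union_subset K.2.2 L.2.2⟩,
      add_mem (GK_mono Ω subset_union_left hK) (GK_mono Ω subset_union_right hL)⟩
  smul_mem' := by
    rintro c u ⟨K, hK⟩
    exact ⟨K, Submodule.smul_mem _ c hK⟩

/-- The regular nets `ℰ_M^∞(Ω)`: on each compact set, one power of `ε` serves all derivatives. -/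
def IsRegularNet (r : Moderate (smoothFam Ω)) : Prop :=
  ∀ K : CompactIn Ω, ∃ N : ℕ, ∀ i : ℕ,
    IsBigOPow (fun ε => smoothSeminorm K.1 i (r.1 ε).1) (-(N : ℝ))

/-- `𝒢^∞(Ω)`: the regular generalized functions. -/
def GInf : Submodule CTilde (G Ω) where
  carrier := {u | ∃ r : Moderate (smoothFam Ω), GE.mk r = u ∧ IsRegularNet Ω r}
  zero_mem' := ⟨0, GE.mk_zero, fun K => ⟨0, fun i =>
    (IsBigOPow.zero _).of_le fun ε => ((smoothFam Ω).map_zero (K, i)).le⟩⟩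
  add_mem' := by
    rintro _ _ ⟨r, rfl, hr⟩ ⟨s, rfl, hs⟩
    refine ⟨r + s, GE.mk_add _ _, fun K => ?_⟩
    obtain ⟨N, hN⟩ := hr K
    obtain ⟨M, hM⟩ := hs K
    refine ⟨N + M, fun i => IsBigOPow.of_le (((hN i).mono ?_).add ((hM i).mono ?_))
      fun ε => (smoothFam Ω).add_le (K, i) (r.1 ε) (s.1 ε)⟩ <;>
    · push_cast
      have := (Nat.cast_nonneg N : (0 : ℝ) ≤ N)
      have := (Nat.cast_nonneg M : (0 : ℝ) ≤ M)
      linarith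
  smul_mem' := by
    rintro c _ ⟨r, rfl, hr⟩
    obtain ⟨⟨c, M, hM⟩, rfl⟩ := CTilde.mk_surjective c
    refine ⟨(⟨c, M, hM⟩ : CModerate) • r, GE.mk_smul _ _, fun K => ?_⟩
    obtain ⟨N, hN⟩ := hr K
    refine ⟨M + N, fun i => ((hM.mul (hN i)).mono ?_).of_le
      fun ε => (smoothFam Ω).smul_le (K, i) (c ε) (r.1 ε)⟩
    push_cast
    linarith

/-- `𝒢^∞_K(Ω)`. -/
def GInfK (K : Set (Rn n)) : Submodule CTilde (G Ω) := GInf Ω ⊓ GK Ω K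

/-- `𝒢^∞_c(Ω) = 𝒢^∞(Ω) ∩ 𝒢_c(Ω)`. -/
def GcInf : Submodule CTilde (G Ω) := GInf Ω ⊓ Gc Ω

theorem GK_le_Gc (K : CompactIn Ω) : GK Ω K.1 ≤ Gc Ω := fun _ hu => ⟨K, hu⟩

theorem GInfK_le_GcInf (K : CompactIn Ω) : GInfK Ω K.1 ≤ GcInf Ω :=
  inf_le_inf_left _ (GK_le_Gc Ω K)

/-- The ultra-pseudo-seminorm `𝒫_{𝒢^∞(K)}`, coming from the valuation
`sup {b : ∀ α, sup_K |∂^α u_ε| = O(ε^b)}`. -/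
def upsInf (K : CompactIn Ω) (u : G Ω) : ℝ≥0∞ := u.ups {i | i.1 = K}

/-- The topology of `𝒢^∞(Ω)`, given by the ultra-pseudo-seminorms `𝒫_{𝒢^∞(K)}`. -/
@[reducible] def GInf.topology : TopologicalSpace (GInf Ω) :=
  seminormTopology fun (K : CompactIn Ω) (u : GInf Ω) => upsInf Ω K u.1

/-- The compact subsets `K'` of `Ω` that contain `K` in their interior. -/
abbrev CompactNhd (K : Set (Rn n)) : Type := {K' : CompactIn Ω // K ⊆ interior K'.1}

/-- The topology of `𝒢_K(Ω)`, given by the ultra-pseudo-seminorms `exp (-val_{p_{K',i}})`, `i ∈ ℕ`,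
where `K'` is a compact set that contains `K` in its interior; they do not depend on the choice
of `K'`, and all the choices are taken here. -/
@[reducible] def GK.topology (K : Set (Rn n)) : TopologicalSpace (GK Ω K) :=
  seminormTopology fun (j : CompactNhd Ω K × ℕ) (u : GK Ω K) => u.1.ups {(j.1.1, j.2)}

/-- The topology of `𝒢^∞_K(Ω)`, given by the ultra-pseudo-norm `𝒫_{𝒢^∞_K(Ω)}`, that is
`exp (-sup {b : ∀ i, p_{K',i}(u_ε) = O(ε^b)})`, where `K'` is a compact set that contains `K` in
its interior; it does not depend on the choice of `K'`, and all the choices are taken here. -/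
@[reducible] def GInfK.topology (K : Set (Rn n)) : TopologicalSpace (GInfK Ω K) :=
  seminormTopology fun (j : CompactNhd Ω K) (u : GInfK Ω K) => upsInf Ω j.1 u.1

/-- The inductive limit topology of `𝒢_c(Ω)`. -/
@[reducible] def Gc.topology : TopologicalSpace (Gc Ω) :=
  inductiveLimitTopology (fun K : CompactIn Ω => GK.topology Ω K.1)
    (fun K => Submodule.inclusion (GK_le_Gc Ω K))

/-- The inductive limit topology of `𝒢^∞_c(Ω)`. -/
@[reducible] def GcInf.topology : TopologicalSpace (GcInf Ω) :=
  inductiveLimitTopology (fun K : CompactIn Ω => GInfK.topology Ω K.1)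
    (fun K => Submodule.inclusion (GInfK_le_GcInf Ω K))

end

/-! ### Generalized symbols on `Ω' × Ω × ℝᵖ` -/

/-- The space of the variables `(x, y, ξ)`. -/
abbrev Z (n' n p : ℕ) : Type := Rn n' × Rn n × Rn p

section

variable {n' n p : ℕ}

/-- The direction of the variable `y_k`. -/
def dirY (k : Fin n) : Z n' n p := (0, stdVec k, 0)

/-- The direction of the variable `ξ_j`. -/
def dirXi (j : Fin p) : Z n' n p := (0, 0, stdVec j)

/-- The directions of the base variables `(x, y)`. -/
def dirBase : Fin n' ⊕ Fin n → Z n' n p := Sum.elim (fun i => (stdVec i, 0, 0)) dirY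

/-- The mixed partial derivative `∂_ξ^α ∂_{x,y}^β f (z)` with `|α| = k` and `|β| = l`, where `α` and
`β` are listed as tuples of coordinates. -/
def mixedDeriv {W : Type} [NormedAddCommGroup W] [NormedSpace ℝ W] (f : Z n' n p → W)
    (z : Z n' n p) {k l : ℕ} (α : Fin k → Fin p) (β : Fin l → Fin n' ⊕ Fin n) : W :=
  iteratedFDeriv ℝ (k + l) f z
    (Fin.append (fun i => dirXi (α i)) (fun i => dirBase (β i)))

variable (Ω' : Opens (Rn n')) (Ω : Opens (Rn n)) (p)

/-- `Ω' × Ω` as an open set. -/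
def base : Opens (Rn n' × Rn n) :=
  ⟨(Ω' : Set (Rn n')) ×ˢ (Ω : Set (Rn n)), Ω'.2.prod Ω.2⟩

/-- `Ω' × Ω × ℝᵖ`. -/
def dom : Set (Z n' n p) := (Ω' : Set (Rn n')) ×ˢ (Ω : Set (Rn n)) ×ˢ univ

/-- `Ω' × Ω × (ℝᵖ \ 0)`. -/
def dom₀ : Set (Z n' n p) := (Ω' : Set (Rn n')) ×ˢ (Ω : Set (Rn n)) ×ˢ {0}ᶜ

theorem isOpen_dom : IsOpen (dom p Ω' Ω) := Ω'.2.prod (Ω.2.prod isOpen_univ)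

theorem isOpen_dom₀ : IsOpen (dom₀ p Ω' Ω) := Ω'.2.prod (Ω.2.prod isOpen_compl_singleton)

variable {p}

/-- The symbol seminorm `|a|^{(m)}_{ρ,δ,K,j}`, where `⟨ξ⟩ = (1 + |ξ|²)^{1/2}`. -/
def symbolSeminorm (m ρ δ : ℝ) (K : Set (Rn n' × Rn n)) (j : ℕ) (a : Z n' n p → ℂ) : ℝ≥0∞ :=
  ⨆ w ∈ K, ⨆ ξ : Rn p, ⨆ (k : ℕ) (l : ℕ) (_ : k + l ≤ j),
    ⨆ (α : Fin k → Fin p) (β : Fin l → Fin n' ⊕ Fin n),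
      ‖mixedDeriv a (w.1, w.2, ξ) α β‖ₑ *
        ENNReal.ofReal ((1 + ‖ξ‖ ^ 2) ^ ((-m + ρ * k - δ * l) / 2))

theorem mixedDeriv_add {W : Type} [NormedAddCommGroup W] [NormedSpace ℝ W] {U : Set (Z n' n p)}
    (hU : IsOpen U) {f g : Z n' n p → W} (hf : ContDiffOn ℝ ∞ f U) (hg : ContDiffOn ℝ ∞ g U)
    {z : Z n' n p} (hz : z ∈ U) {k l : ℕ} (α : Fin k → Fin p) (β : Fin l → Fin n' ⊕ Fin n) :
    mixedDeriv (f + g) z α β = mixedDeriv f z α β + mixedDeriv g z α β := by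
  unfold mixedDeriv
  rw [iteratedFDeriv_add_apply (contDiffAt_of_opens hU hf hz _)
    (contDiffAt_of_opens hU hg hz _), add_apply]

theorem mixedDeriv_smul {U : Set (Z n' n p)} (hU : IsOpen U) {f : Z n' n p → ℂ}
    (hf : ContDiffOn ℝ ∞ f U) (c : ℂ) {z : Z n' n p} (hz : z ∈ U) {k l : ℕ}
    (α : Fin k → Fin p) (β : Fin l → Fin n' ⊕ Fin n) :
    mixedDeriv (c • f) z α β = c • mixedDeriv f z α β := by
  unfold mixedDeriv
  rw [iteratedFDeriv_const_smul_apply (contDiffAt_of_opens hU hf hz _), smul_apply]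

theorem symbolSeminorm_add_le (m ρ δ : ℝ) (K : CompactIn (base Ω' Ω)) (j : ℕ)
    {a b : Z n' n p → ℂ} (ha : ContDiffOn ℝ ∞ a (dom p Ω' Ω))
    (hb : ContDiffOn ℝ ∞ b (dom p Ω' Ω)) :
    symbolSeminorm m ρ δ K.1 j (a + b)
      ≤ symbolSeminorm m ρ δ K.1 j a + symbolSeminorm m ρ δ K.1 j b := by
  refine iSup₂_le fun w hw => iSup_le fun ξ => iSup₂_le fun k l => iSup_le fun h =>
    iSup₂_le fun α β => ?_
  have hz : ((w.1, w.2, ξ) : Z n' n p) ∈ dom p Ω' Ω := ⟨(K.2.2 hw).1, (K.2.2 hw).2, trivial⟩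
  rw [mixedDeriv_add (isOpen_dom p Ω' Ω) ha hb hz]
  refine (mul_le_mul_left (enorm_add_le _ _) _).trans ?_
  rw [add_mul]
  refine add_le_add ?_ ?_ <;>
  exact le_iSup₂_of_le w hw (le_iSup_of_le ξ (le_iSup₂_of_le k l (le_iSup_of_le h
    (le_iSup₂_of_le α β le_rfl))))

theorem symbolSeminorm_smul_le (m ρ δ : ℝ) (K : CompactIn (base Ω' Ω)) (j : ℕ) (c : ℂ)
    {a : Z n' n p → ℂ} (ha : ContDiffOn ℝ ∞ a (dom p Ω' Ω)) :
    symbolSeminorm m ρ δ K.1 j (c • a) ≤ ‖c‖ₑ * symbolSeminorm m ρ δ K.1 j a := by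
  refine iSup₂_le fun w hw => iSup_le fun ξ => iSup₂_le fun k l => iSup_le fun h =>
    iSup₂_le fun α β => ?_
  have hz : ((w.1, w.2, ξ) : Z n' n p) ∈ dom p Ω' Ω := ⟨(K.2.2 hw).1, (K.2.2 hw).2, trivial⟩
  rw [mixedDeriv_smul (isOpen_dom p Ω' Ω) ha c hz, enorm_smul, mul_assoc]
  gcongr
  exact le_iSup₂_of_le w hw (le_iSup_of_le ξ (le_iSup₂_of_le k l (le_iSup_of_le h
    (le_iSup₂_of_le α β le_rfl))))

theorem symbolSeminorm_zero (m ρ δ : ℝ) (K : CompactIn (base Ω' Ω)) (j : ℕ) :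
    symbolSeminorm m ρ δ K.1 j (0 : Z n' n p → ℂ) = 0 := by
  have := symbolSeminorm_smul_le Ω' Ω m ρ δ K j 0
    (a := (0 : Z n' n p → ℂ)) contDiffOn_const
  simpa using this

variable (p)

/-- `S^m_{ρ,δ}(Ω' × Ω × ℝᵖ)`. -/
def Sym (m ρ δ : ℝ) : Submodule ℂ (Z n' n p → ℂ) where
  carrier := {a | ContDiffOn ℝ ∞ a (dom p Ω' Ω) ∧
    ∀ (K : CompactIn (base Ω' Ω)) (j : ℕ), symbolSeminorm m ρ δ K.1 j a < ⊤}
  zero_mem' := ⟨contDiffOn_const, fun K j => by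
    rw [symbolSeminorm_zero]
    exact ENNReal.zero_lt_top⟩
  add_mem' := fun ha hb => ⟨ha.1.add hb.1, fun K j =>
    (symbolSeminorm_add_le Ω' Ω m ρ δ K j ha.1 hb.1).trans_lt
      (ENNReal.add_lt_top.2 ⟨ha.2 K j, hb.2 K j⟩)⟩
  smul_mem' := fun c _ ha => ⟨contDiffOn_const.smul ha.1, fun K j =>
    (symbolSeminorm_smul_le Ω' Ω m ρ δ K j c ha.1).trans_lt
      (ENNReal.mul_lt_top enorm_lt_top (ha.2 K j))⟩

/-- `S^m_{ρ,δ}(Ω' × Ω × ℝᵖ)` with its seminorms. -/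
def symFam (m ρ δ : ℝ) : SeminormFam (Sym p Ω' Ω m ρ δ) (CompactIn (base Ω' Ω) × ℕ) where
  p := fun i a => symbolSeminorm m ρ δ i.1.1 i.2 a.1
  add_le := fun i a b => symbolSeminorm_add_le Ω' Ω m ρ δ i.1 i.2 a.2.1 b.2.1
  smul_le := fun i c a => symbolSeminorm_smul_le Ω' Ω m ρ δ i.1 i.2 c a.2.1

/-- The space `S̃^m_{ρ,δ}(Ω' × Ω × ℝᵖ)` of generalized symbols. -/
abbrev GSym (m ρ δ : ℝ) : Type := GE (symFam p Ω' Ω m ρ δ)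

/-- `S^{-∞}(Ω' × Ω × ℝᵖ)`. -/
def SymNegInf : Submodule ℂ (Z n' n p → ℂ) := ⨅ m : ℝ, Sym p Ω' Ω m 1 0

theorem contDiffOn_of_mem_symNegInf {a : Z n' n p → ℂ} (ha : a ∈ SymNegInf p Ω' Ω) :
    ContDiffOn ℝ ∞ a (dom p Ω' Ω) :=
  ((Submodule.mem_iInf _).1 ha 0).1

/-- `S^{-∞}(Ω' × Ω × ℝᵖ)` with the seminorms of all orders. -/
def symNegInfFam :
    SeminormFam (SymNegInf p Ω' Ω) (ℝ × CompactIn (base Ω' Ω) × ℕ) where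
  p := fun i a => symbolSeminorm i.1 1 0 i.2.1.1 i.2.2 a.1
  add_le := fun i a b => symbolSeminorm_add_le Ω' Ω i.1 1 0 i.2.1 i.2.2
    (contDiffOn_of_mem_symNegInf p Ω' Ω a.2) (contDiffOn_of_mem_symNegInf p Ω' Ω b.2)
  smul_le := fun i c a => symbolSeminorm_smul_le Ω' Ω i.1 1 0 i.2.1 i.2.2 c
    (contDiffOn_of_mem_symNegInf p Ω' Ω a.2)

/-- The space `S̃^{-∞}(Ω' × Ω × ℝᵖ)` of generalized symbols of order `-∞`. -/
abbrev GSymNegInf : Type := GE (symNegInfFam p Ω' Ω)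

variable {p Ω' Ω}

/-- `a` belongs to `S̃^m_{ρ,δ,rg}(Ω' × Ω × ℝᵖ)`. -/
def IsRegularSymbol {m ρ δ : ℝ} (a : GSym p Ω' Ω m ρ δ) : Prop :=
  ∀ K : CompactIn (base Ω' Ω), ∃ r : Moderate (symFam p Ω' Ω m ρ δ), GE.mk r = a ∧
    ∃ N : ℕ, ∀ j : ℕ,
      IsBigOPow (fun ε => symbolSeminorm m ρ δ K.1 j (r.1 ε).1) (-(N : ℝ))

/-- `a` belongs to `S̃^{-∞}_{rg}(Ω' × Ω × ℝᵖ)`. -/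
def IsRegularSymbolNegInf (a : GSymNegInf p Ω' Ω) : Prop :=
  ∀ K : CompactIn (base Ω' Ω), ∃ r : Moderate (symNegInfFam p Ω' Ω), GE.mk r = a ∧
    ∃ N : ℕ, ∀ (m : ℝ) (j : ℕ),
      IsBigOPow (fun ε => symbolSeminorm m 1 0 K.1 j (r.1 ε).1) (-(N : ℝ))

/-! ### Generalized phase functions -/

/-- `|∇_{y,ξ} φ|²`. -/
def gradSq (φ : Z n' n p → ℝ) (z : Z n' n p) : ℝ :=
  ∑ k : Fin n, (fderiv ℝ φ z (dirY k)) ^ 2 + ∑ j : Fin p, (fderiv ℝ φ z (dirXi j)) ^ 2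

/-- `(x, y, ξ / |ξ|)`. -/
def normalize (z : Z n' n p) : Z n' n p := (z.1, z.2.1, ‖z.2.2‖⁻¹ • z.2.2)

/-- The seminorms `sup |ξ|^{-1+|α|} |∂_ξ^α ∂_{x,y}^β φ|`, over `(x,y) ∈ K`, `ξ ≠ 0` and
`|α| + |β| ≤ j`, of `S^1_hg(Ω' × Ω × ℝᵖ \ 0)`. -/
def hgSeminorm (K : Set (Rn n' × Rn n)) (j : ℕ) (φ : Z n' n p → ℝ) : ℝ≥0∞ :=
  ⨆ w ∈ K, ⨆ ξ : Rn p, ⨆ _ : ξ ≠ 0, ⨆ (k : ℕ) (l : ℕ) (_ : k + l ≤ j),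
    ⨆ (α : Fin k → Fin p) (β : Fin l → Fin n' ⊕ Fin n),
      ‖mixedDeriv φ (w.1, w.2, ξ) α β‖ₑ * ENNReal.ofReal (‖ξ‖ ^ (-1 + (k : ℝ)))

variable (p Ω' Ω)

/-- A phase function in `(y, ξ) ∈ Ω × ℝᵖ` that depends on the parameter `x ∈ Ω'`: real valued,
continuous, smooth off `ξ = 0`, positively homogeneous of degree 1 in `ξ`, and with
`∇_{y,ξ} φ ≠ 0` for `ξ ≠ 0`. -/
structure IsPhase (φ : Z n' n p → ℝ) : Prop where
  continuousOn : ContinuousOn φ (dom p Ω' Ω)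
  contDiffOn : ContDiffOn ℝ ∞ φ (dom₀ p Ω' Ω)
  homogeneous : ∀ x ∈ Ω', ∀ y ∈ Ω, ∀ ξ : Rn p, ∀ t : ℝ, 0 < t →
    φ (x, y, t • ξ) = t * φ (x, y, ξ)
  gradSq_ne_zero : ∀ z ∈ dom₀ p Ω' Ω, gradSq φ z ≠ 0

/-- The set `ℳ_Φ(Ω'; Ω × ℝᵖ)` of moderate nets of phase functions; the last condition says that
the net of the infima of `|∇_{y,ξ} φ_ε(x, y, ξ/|ξ|)|²` over `K' × K × (ℝᵖ \ 0)` is strictly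
nonzero. -/
structure IsModeratePhaseNet (φ : Eps → Z n' n p → ℝ) : Prop where
  isPhase : ∀ ε, IsPhase p Ω' Ω (φ ε)
  moderate : ∀ (K : CompactIn (base Ω' Ω)) (j : ℕ), ∃ N : ℕ,
    IsBigOPow (fun ε => hgSeminorm K.1 j (φ ε)) (-(N : ℝ))
  strictlyNonzero : ∀ (K' : CompactIn Ω') (K : CompactIn Ω),
    ∃ r : ℝ, 0 < r ∧ ∃ η : ℝ, 0 < η ∧ η ≤ 1 ∧ ∀ ε : Eps, (ε : ℝ) ≤ η →
      ∀ x ∈ K'.1, ∀ y ∈ K.1, ∀ ξ : Rn p, ξ ≠ 0 →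
        (ε : ℝ) ^ r ≤ gradSq (φ ε) (normalize (x, y, ξ))

/-- `ℳ_Φ(Ω'; Ω × ℝᵖ)` as a type. -/
abbrev ModeratePhaseNet : Type := {φ : Eps → Z n' n p → ℝ // IsModeratePhaseNet p Ω' Ω φ}

variable {p}

theorem hgSeminorm_add_le (K : CompactIn (base Ω' Ω)) (j : ℕ) {φ ψ : Z n' n p → ℝ}
    (hφ : ContDiffOn ℝ ∞ φ (dom₀ p Ω' Ω)) (hψ : ContDiffOn ℝ ∞ ψ (dom₀ p Ω' Ω)) :
    hgSeminorm K.1 j (φ + ψ) ≤ hgSeminorm K.1 j φ + hgSeminorm K.1 j ψ := by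
  refine iSup₂_le fun w hw => iSup₂_le fun ξ hξ => iSup₂_le fun k l => iSup_le fun h =>
    iSup₂_le fun α β => ?_
  have hz : ((w.1, w.2, ξ) : Z n' n p) ∈ dom₀ p Ω' Ω := ⟨(K.2.2 hw).1, (K.2.2 hw).2, hξ⟩
  rw [mixedDeriv_add (isOpen_dom₀ p Ω' Ω) hφ hψ hz]
  refine (mul_le_mul_left (enorm_add_le _ _) _).trans ?_
  rw [add_mul]
  refine add_le_add ?_ ?_ <;>
  exact le_iSup₂_of_le w hw (le_iSup₂_of_le ξ hξ (le_iSup₂_of_le k l (le_iSup_of_le h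
    (le_iSup₂_of_le α β le_rfl))))

theorem hgSeminorm_neg (K : Set (Rn n' × Rn n)) (j : ℕ) (φ : Z n' n p → ℝ) :
    hgSeminorm K j (-φ) = hgSeminorm K j φ := by
  simp [hgSeminorm, mixedDeriv, iteratedFDeriv_neg_apply]

theorem hgSeminorm_zero (K : Set (Rn n' × Rn n)) (j : ℕ) :
    hgSeminorm K j (0 : Z n' n p → ℝ) = 0 := by
  simp [hgSeminorm, mixedDeriv]

variable (p)

/-- The equivalence of moderate nets of phase functions: the difference is a negligible net in
`S^1_hg(Ω' × Ω × ℝᵖ \ 0)`. -/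
instance phaseSetoid : Setoid (ModeratePhaseNet p Ω' Ω) where
  r := fun φ ψ => ∀ (K : CompactIn (base Ω' Ω)) (j q : ℕ),
    IsBigOPow (fun ε => hgSeminorm K.1 j (φ.1 ε - ψ.1 ε)) q
  iseqv := by
    refine ⟨fun φ K j q => ?_, fun {φ ψ} h K j q => ?_, fun {φ ψ χ} h1 h2 K j q => ?_⟩
    · exact (IsBigOPow.zero _).of_le fun ε => by rw [sub_self, hgSeminorm_zero]
    · exact (h K j q).of_le fun ε => by rw [← hgSeminorm_neg, neg_sub]
    · refine ((h1 K j q).add (h2 K j q)).of_le fun ε => ?_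
      rw [← sub_add_sub_cancel (φ.1 ε) (ψ.1 ε) (χ.1 ε)]
      exact hgSeminorm_add_le Ω' Ω K j
        ((φ.2.isPhase ε).contDiffOn.sub (ψ.2.isPhase ε).contDiffOn)
        ((ψ.2.isPhase ε).contDiffOn.sub (χ.2.isPhase ε).contDiffOn)

/-- The set `Φ̃(Ω'; Ω × ℝᵖ)` of generalized phase functions in the variables of `Ω × ℝᵖ`. -/
abbrev GPhase : Type := Quotient (phaseSetoid p Ω' Ω)

variable {p Ω' Ω}

/-- `φ` belongs to `Φ̃_sc(Ω'; Ω × ℝᵖ)`: some representative is of slow scale type in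
`S^1_hg(Ω' × Ω × ℝᵖ \ 0)`, and the nets of the infima of `|∇_{y,ξ} φ_ε(x, y, ξ/|ξ|)|²` over
`K' × K × (ℝᵖ \ 0)` are slow scale-strictly nonzero. -/
def IsSlowScalePhase (φ : GPhase p Ω' Ω) : Prop :=
  ∃ r : ModeratePhaseNet p Ω' Ω, ⟦r⟧ = φ ∧
    (∀ (K : CompactIn (base Ω' Ω)) (j : ℕ),
      IsSlowScaleBounded fun ε => hgSeminorm K.1 j (r.1 ε)) ∧
    ∀ (K' : CompactIn Ω') (K : CompactIn Ω), ∃ s : Eps → ℂ, IsSlowScaleNet s ∧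
      ∃ η : ℝ, 0 < η ∧ η ≤ 1 ∧ ∀ ε : Eps, (ε : ℝ) ≤ η →
        ∀ x ∈ K'.1, ∀ y ∈ K.1, ∀ ξ : Rn p, ξ ≠ 0 →
          1 ≤ ‖s ε‖ * gradSq (r.1 ε) (normalize (x, y, ξ))

/-! ### Generalized Fourier integral operators -/

/-- Cut-off functions `χ ∈ C_c^∞(ℝᵖ)` with `χ = 1` for `|ξ| < 1/4` and `χ = 0` for `|ξ| > 1/2`. -/
structure IsCutoff (χ : Rn p → ℂ) : Prop where
  contDiff : ContDiff ℝ ∞ χ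
  eq_one : ∀ ξ, ‖ξ‖ < 1 / 4 → χ ξ = 1
  eq_zero : ∀ ξ, 1 / 2 < ‖ξ‖ → χ ξ = 0

/-- The coefficient `a_j = i (1 - χ(ξ)) |∇_{y,ξ} φ(x,y,ξ/|ξ|)|⁻² ∂_{ξ_j} φ`. -/
def coeffA (χ : Rn p → ℂ) (φ : Z n' n p → ℝ) (j : Fin p) (z : Z n' n p) : ℂ :=
  Complex.I * (1 - χ z.2.2) * ((gradSq φ (normalize z))⁻¹ : ℝ) * (fderiv ℝ φ z (dirXi j) : ℝ)

/-- The coefficient `b_k = i (1 - χ(ξ)) |ξ|⁻² |∇_{y,ξ} φ(x,y,ξ/|ξ|)|⁻² ∂_{y_k} φ`. -/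
def coeffB (χ : Rn p → ℂ) (φ : Z n' n p → ℝ) (k : Fin n) (z : Z n' n p) : ℂ :=
  Complex.I * (1 - χ z.2.2) * ((‖z.2.2‖ ^ 2)⁻¹ : ℝ) * ((gradSq φ (normalize z))⁻¹ : ℝ) *
    (fderiv ℝ φ z (dirY k) : ℝ)

/-- The coefficient `c = χ + ∑_j ∂_{ξ_j} a_j + ∑_k ∂_{y_k} b_k`. -/
def coeffC (χ : Rn p → ℂ) (φ : Z n' n p → ℝ) (z : Z n' n p) : ℂ :=
  χ z.2.2 + ∑ j : Fin p, fderiv ℝ (coeffA χ φ j) z (dirXi j) +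
    ∑ k : Fin n, fderiv ℝ (coeffB χ φ k) z (dirY k)

/-- The operator `L_φ = ∑_j a_j ∂_{ξ_j} + ∑_k b_k ∂_{y_k} + c`, whose transpose (with respect to
`(y, ξ)`) leaves `e^{iφ}` invariant. -/
def opL (χ : Rn p → ℂ) (φ : Z n' n p → ℝ) (f : Z n' n p → ℂ) (z : Z n' n p) : ℂ :=
  ∑ j : Fin p, coeffA χ φ j z * fderiv ℝ f z (dirXi j) +
    ∑ k : Fin n, coeffB χ φ k z * fderiv ℝ f z (dirY k) + coeffC χ φ z * f z

/-- The integrand `e^{iφ} L_φ^h (a(x,y,ξ) u(y))`. -/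
def fioIntegrand (χ : Rn p → ℂ) (h : ℕ) (φ : Z n' n p → ℝ) (a : Z n' n p → ℂ) (u : Rn n → ℂ)
    (z : Z n' n p) : ℂ :=
  Complex.exp (Complex.I * (φ z : ℝ)) * (opL χ φ)^[h] (fun z => a z * u z.2.1) z

/-- The common part of the definition of the Fourier integral operator `A`, where `𝒜` is the set of
the representing nets of the amplitude, and `ℋ` the set of admissible exponents `h`: for all
representatives `φ_ε` of the phase function and `a_ε` of the amplitude, and every representative
`u_ε`, with supports in a fixed compact set, of an element `u` of `𝒢_c(Ω)`, the (absolutely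
convergent) integrals
`v_ε(x) = (2π)^{-p} ∫_{Ω × ℝᵖ} e^{iφ_ε} L_{φ_ε}^h (a_ε u_ε) dy dξ`
form a moderate net of smooth functions on `Ω'`, which represents `A u`. -/
def IsFIOWith (φ : GPhase p Ω' Ω) (𝒜 : Set (Eps → Z n' n p → ℂ)) (ℋ : Set ℕ)
    (A : Gc Ω →ₗ[CTilde] G Ω') : Prop :=
  ∀ φr : ModeratePhaseNet p Ω' Ω, ⟦φr⟧ = φ →
  ∀ ar ∈ 𝒜,
  ∀ (ur : Moderate (smoothFam Ω)) (hu : GE.mk ur ∈ Gc Ω),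
    (∃ K : CompactIn Ω, ∀ ε, ∀ y ∈ Ω, y ∉ K.1 → (ur.1 ε).1 y = 0) →
  ∀ χ : Rn p → ℂ, IsCutoff χ → ∀ h ∈ ℋ,
    ∃ v : Moderate (smoothFam Ω'),
      (∀ ε, ∀ x ∈ Ω',
        IntegrableOn (fun w : Rn n × Rn p => fioIntegrand χ h (φr.1 ε) (ar ε) (ur.1 ε).1 (x, w))
          ((Ω : Set (Rn n)) ×ˢ univ) ∧
        (v.1 ε).1 x = (((2 * Real.pi) ^ p)⁻¹ : ℝ) *
          ∫ w in (Ω : Set (Rn n)) ×ˢ (univ : Set (Rn p)),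
            fioIntegrand χ h (φr.1 ε) (ar ε) (ur.1 ε).1 (x, w)) ∧
      A ⟨GE.mk ur, hu⟩ = GE.mk v

/-- `A` is the generalized Fourier integral operator with phase function `φ` and amplitude
`a ∈ S̃^m_{ρ,δ}(Ω' × Ω × ℝᵖ)`. The exponents `h` are those with `m - h s + 1 < -p`, where
`s = min {ρ, 1 - δ}`. -/
def IsFIO {m ρ δ : ℝ} (φ : GPhase p Ω' Ω) (a : GSym p Ω' Ω m ρ δ)
    (A : Gc Ω →ₗ[CTilde] G Ω') : Prop :=
  IsFIOWith φ {ar | ∃ r : Moderate (symFam p Ω' Ω m ρ δ), GE.mk r = a ∧ ∀ ε, ar ε = (r.1 ε).1}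
    {h | m - h * min ρ (1 - δ) + 1 < -(p : ℝ)} A

/-- `A` is the generalized Fourier integral operator with phase function `φ` and amplitude
`a ∈ S̃^{-∞}(Ω' × Ω × ℝᵖ)`. As `a` has every order, all exponents `h` are admissible; for `h = 0`
this is the absolutely convergent integral of `e^{iφ} a u`. -/
def IsFIONegInf (φ : GPhase p Ω' Ω) (a : GSymNegInf p Ω' Ω)
    (A : Gc Ω →ₗ[CTilde] G Ω') : Prop :=
  IsFIOWith φ {ar | ∃ r : Moderate (symNegInfFam p Ω' Ω), GE.mk r = a ∧ ∀ ε, ar ε = (r.1 ε).1}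
    univ A

/-- `A` maps `𝒢^∞_c(Ω)` continuously into `𝒢^∞(Ω')`. -/
def MapsGcInfContinuouslyIntoGInf (A : Gc Ω →ₗ[CTilde] G Ω') : Prop :=
  ∃ hA : ∀ u : GcInf Ω, A ⟨u.1, u.2.2⟩ ∈ GInf Ω',
    Continuous[GcInf.topology Ω, GInf.topology Ω']
      fun u : GcInf Ω => (⟨A ⟨u.1, u.2.2⟩, hA u⟩ : GInf Ω')

/-- `A` maps `𝒢_c(Ω)` continuously into `𝒢^∞(Ω')`. -/
def MapsGcContinuouslyIntoGInf (A : Gc Ω →ₗ[CTilde] G Ω') : Prop :=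
  ∃ hA : ∀ u : Gc Ω, A u ∈ GInf Ω',
    Continuous[Gc.topology Ω, GInf.topology Ω'] fun u : Gc Ω => (⟨A u, hA u⟩ : GInf Ω')

end

end Colombeau

end

open Colombeau

noncomputable section

namespace Colombeau

/-! ### Symmetry of iterated derivatives -/

section Symmetry

variable {E F : Type*} [NormedAddCommGroup E] [NormedSpace ℝ E] [NormedAddCommGroup F]
  [NormedSpace ℝ F]

/-! The transpose of $L_\phi$ fixes $e^{i\phi}$, while $L_\phi$ itself lowers the order of a symbol
of type $(\rho,\delta)$ by $s=\min\{\rho,1-\delta\}$. An $x$-derivative of $e^{i\phi}$ costs one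
power of $\langle\xi\rangle$. Hence $k$ derivatives of $\int e^{i\phi}L_\phi^h(au)\,dy\,d\xi$
converge absolutely as soon as $m-hs+k<-p$. The quantitative form (`exists_fioVal_bound`) is a bound
$C\,B^M A\,U$ for the $k$-jet, where $B$ controls finitely many seminorms of the phase and the
reciprocal of its gradient, $A$ and $U$ are seminorms of $a$ and $u$, and $C$, $M$ are chosen before
$\phi$, $a$, $u$. Uniformity comes from working with jets at $0$ in rescaled affine charts: with $y$
scaled by $\langle\xi\rangle^{-\delta}$ and $\xi$ by $\langle\xi\rangle^{\rho}$, symbol estimates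
become plain $C^j$ bounds, and products, reciprocals and derivatives of symbols are handled by
calculus at one point (`jetO_opL`, `exists_jetLe_opL_iterate`, `exists_bound_slice`).

The choice of $h$ and $\chi$ is immaterial because every such integral is the limit, as
$R\to\infty$, of the same integral cut off to $|\xi|\lesssim R$. For the cut-off integral $L_\phi$
may be removed by integration by parts (`IsPhase.integral_opL`), and the tail is $O(R^{-1})$ with
controlled constants (`exists_tail_bound`). Thus $h$ may be enlarged with the number of derivatives,
which gives smoothness and moderateness. For the choice of representatives, $R$ is taken to be a
large power of $\varepsilon^{-1}$: the tails are then small, and the cut-off integrals differ by a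
negligible amount times a power of $R$ (`mk_fioNet_eq`). Only values need comparison, since a
moderate net that is negligible at order zero is negligible (`isBigOPow_of_order_zero`). Existence,
linearity and uniqueness of $A$ follow.

Regularity rests on the slow scale hypothesis. In $C\,B^M A\,U$ the exponent $M$ grows with the
number of derivatives, but $B^M=O(\varepsilon^{-2})$ for every $M$, and $A=O(\varepsilon^{-N_a})$
with $N_a$ independent of the order by regularity of $a$. All derivatives of $Au$ thus lose the same
number $N$ of powers of $\varepsilon$ against $u$ (`IsFIO.exists_estimate`). In the case of order
$-\infty$ one takes $h=0$, so no derivative falls on $u$ and its supremum suffices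
(`IsFIONegInf.exists_estimate`). A loss of $N$ powers is a factor $e^N$ between
ultra-pseudo-seminorms, and such estimates on each step give continuity on the inductive limit
(`continuous_inductiveLimitTopology`). -/

theorem contDiffAt_iteratedFDeriv {f : E → F} {x : E} {m : ℕ} {n : ℕ}
    (hf : ContDiffAt ℝ (n + m : ℕ) f x) : ContDiffAt ℝ n (iteratedFDeriv ℝ m f) x :=
  hf.iteratedFDeriv_right (by push_cast; rfl)

theorem fderiv_iteratedFDeriv_apply {f : E → F} {x : E} {k : ℕ}
    (hf : ContDiffAt ℝ (k + 1 : ℕ) f x) (u : E) (m : Fin k → E) :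
    fderiv ℝ (iteratedFDeriv ℝ k f) x u m = fderiv ℝ (fun y => iteratedFDeriv ℝ k f y m) x u := by
  have h : ContDiffAt ℝ 1 (iteratedFDeriv ℝ k f) x :=
    contDiffAt_iteratedFDeriv (n := 1) (by rwa [add_comm])
  have hd : DifferentiableAt ℝ (iteratedFDeriv ℝ k f) x := h.differentiableAt (by simp)
  have := ((ContinuousMultilinearMap.apply ℝ (fun _ : Fin k => E) F m).hasFDerivAt.comp x
    hd.hasFDerivAt).fderiv
  change _ = fderiv ℝ (⇑(ContinuousMultilinearMap.apply ℝ (fun _ : Fin k => E) F m) ∘ _) x u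
  rw [this]
  rfl

/-- Freezing all but the first two directions exhibits the value as a second derivative of a single
function, to which the symmetry of second derivatives applies. -/
theorem iteratedFDeriv_add_two_apply {f : E → F} {x : E} {k : ℕ}
    (hf : ContDiffAt ℝ (k + 2 : ℕ) f x) (w : Fin (k + 2) → E) :
    iteratedFDeriv ℝ (k + 2) f x w =
      fderiv ℝ (fderiv ℝ fun y => iteratedFDeriv ℝ k f y (Fin.tail (Fin.tail w))) x
        (w 0) (w 1) := by
  have hg : ContDiffAt ℝ 2 (fun y => iteratedFDeriv ℝ k f y (Fin.tail (Fin.tail w))) x :=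
    (ContinuousMultilinearMap.apply ℝ (fun _ : Fin k => E) F _).contDiff.contDiffAt.comp x
      (contDiffAt_iteratedFDeriv (n := 2) (by rwa [add_comm 2 k]))
  have hd : DifferentiableAt ℝ
      (fderiv ℝ fun y => iteratedFDeriv ℝ k f y (Fin.tail (Fin.tail w))) x :=
    (hg.fderiv_right (m := 1) (by norm_num)).differentiableAt (by simp)
  rw [iteratedFDeriv_succ_apply_left, fderiv_iteratedFDeriv_apply hf]
  have hev : ∀ᶠ y in 𝓝 x, ContDiffAt ℝ (k + 1 : ℕ) f y :=
    (hf.of_le (by exact_mod_cast Nat.le_succ _)).eventually (by simp)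
  have heq : (fun y => iteratedFDeriv ℝ (k + 1) f y (Fin.tail w)) =ᶠ[𝓝 x]
      fun y => fderiv ℝ (fun y => iteratedFDeriv ℝ k f y (Fin.tail (Fin.tail w))) y (w 1) := by
    filter_upwards [hev] with y hy
    rw [iteratedFDeriv_succ_apply_left, fderiv_iteratedFDeriv_apply hy]
    rfl
  rw [heq.fderiv_eq, fderiv_clm_apply hd (by fun_prop)]
  simp

/-- Adjacent transpositions generate the symmetric group. The transposition of the first two slots
is the symmetry of the second derivative; any other one sits inside a derivative of lower order,
where the inductive hypothesis holds on a neighbourhood and can be differentiated. The lemma is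
needed because `mixedDeriv` lists the $\xi$-directions before the base directions. -/
theorem iteratedFDeriv_comp_perm {f : E → F} : ∀ (k : ℕ) {x : E}, ContDiffAt ℝ k f x →
    ∀ (v : Fin k → E) (σ : Equiv.Perm (Fin k)),
      iteratedFDeriv ℝ k f x (v ∘ σ) = iteratedFDeriv ℝ k f x v := by
  intro k
  induction k with
  | zero =>
    intro x _ v σ
    rw [Subsingleton.elim σ 1]
    rfl
  | succ k ih =>
    intro x hf v σ
    have key : ∀ (i : Fin k) (v : Fin (k + 1) → E),
        iteratedFDeriv ℝ (k + 1) f x (v ∘ Equiv.swap i.castSucc i.succ) =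
          iteratedFDeriv ℝ (k + 1) f x v := by
      intro i
      obtain _ | k := k
      · exact i.elim0
      intro v
      induction i using Fin.cases with
      | zero =>
        rw [iteratedFDeriv_add_two_apply hf, iteratedFDeriv_add_two_apply hf]
        have hg : ContDiffAt ℝ 2 (fun y => iteratedFDeriv ℝ k f y (Fin.tail (Fin.tail v))) x :=
          (ContinuousMultilinearMap.apply ℝ (fun _ : Fin k => E) F _).contDiff.contDiffAt.comp x
            (contDiffAt_iteratedFDeriv (n := 2) (by rwa [add_comm 2 k]))
        have hs := hg.isSymmSndFDerivAt (by simp)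
        have h0 : (v ∘ Equiv.swap (Fin.castSucc (0 : Fin (k + 1))) (Fin.succ 0)) 0 = v 1 := by
          simp
        have h1 : (v ∘ Equiv.swap (Fin.castSucc (0 : Fin (k + 1))) (Fin.succ 0)) 1 = v 0 := by
          simp
        have ht : Fin.tail (Fin.tail
            (v ∘ Equiv.swap (Fin.castSucc (0 : Fin (k + 1))) (Fin.succ 0))) =
            Fin.tail (Fin.tail v) := by
          funext j
          simp only [Fin.tail, Function.comp_apply]
          rw [Equiv.swap_apply_of_ne_of_ne]
          · simp [Fin.ext_iff]
          · simp [Fin.ext_iff]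
        rw [h0, h1, ht, hs.eq]
      | succ j =>
        rw [iteratedFDeriv_succ_apply_left, iteratedFDeriv_succ_apply_left]
        have h0 : (v ∘ Equiv.swap (Fin.castSucc j.succ) (Fin.succ j.succ)) 0 = v 0 := by
          simp only [Function.comp_apply]
          rw [Equiv.swap_apply_of_ne_of_ne]
          · simp [Fin.ext_iff]
          · simp [Fin.ext_iff]
        have ht : Fin.tail (v ∘ Equiv.swap (Fin.castSucc j.succ) (Fin.succ j.succ)) =
            Fin.tail v ∘ Equiv.swap j.castSucc j.succ := by
          funext l
          simp only [Fin.tail, Function.comp_apply]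
          congr 1
          simp only [Equiv.swap_apply_def, Fin.ext_iff, Fin.val_succ, Fin.val_castSucc]
          split_ifs <;> simp_all
        rw [h0, ht, fderiv_iteratedFDeriv_apply hf, fderiv_iteratedFDeriv_apply hf]
        congr 1
        refine Filter.EventuallyEq.fderiv_eq ?_
        have hev : ∀ᶠ y in 𝓝 x, ContDiffAt ℝ (k + 1 : ℕ) f y :=
          (hf.of_le (by exact_mod_cast Nat.le_succ _)).eventually (by simp)
        filter_upwards [hev] with y hy
        exact ih hy _ _
    have hmem : σ ∈ Submonoid.closure (Set.range fun i : Fin k => Equiv.swap i.castSucc i.succ) := by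
      rw [Equiv.Perm.mclosure_swap_castSucc_succ]
      trivial
    induction hmem using Submonoid.closure_induction generalizing v with
    | mem y hy =>
      obtain ⟨i, rfl⟩ := hy
      exact key i v
    | one => rfl
    | mul a b _ _ ha hb =>
      have : v ∘ ⇑(a * b) = (v ∘ a) ∘ b := rfl
      rw [this, hb, ha]

end Symmetry

/-! ### Jet bounds -/

section Jets

variable {E E' F G : Type*} [NormedAddCommGroup E] [NormedSpace ℝ E] [NormedAddCommGroup E']
  [NormedSpace ℝ E'] [NormedAddCommGroup F] [NormedSpace ℝ F] [NormedAddCommGroup G]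
  [NormedSpace ℝ G]

/-- `g` is of class `C^j` at `w`, and its derivatives of order at most `j` at `w` are bounded
by `c`. -/
structure JetLe (j : ℕ) (g : E → F) (w : E) (c : ℝ) : Prop where
  contDiffAt : ContDiffAt ℝ j g w
  bound : ∀ k ≤ j, ‖iteratedFDeriv ℝ k g w‖ ≤ c

namespace JetLe

variable {j : ℕ} {f g : E → F} {w : E} {c d : ℝ}

theorem nonneg (h : JetLe j g w c) : 0 ≤ c := (norm_nonneg _).trans (h.bound 0 (Nat.zero_le _))

theorem mono (h : JetLe j g w c) (hcd : c ≤ d) : JetLe j g w d :=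
  ⟨h.1, fun k hk => (h.2 k hk).trans hcd⟩

theorem of_le {i : ℕ} (h : JetLe j g w c) (hij : i ≤ j) : JetLe i g w c :=
  ⟨h.1.of_le (by exact_mod_cast hij), fun k hk => h.2 k (hk.trans hij)⟩

theorem norm_le (h : JetLe j g w c) : ‖g w‖ ≤ c := by
  simpa using h.bound 0 (Nat.zero_le _)

theorem congr (h : JetLe j g w c) (hfg : f =ᶠ[𝓝 w] g) : JetLe j f w c :=
  ⟨h.1.congr_of_eventuallyEq hfg, fun k hk => by
    rw [(hfg.iteratedFDeriv ℝ k).eq_of_nhds]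
    exact h.2 k hk⟩

theorem const (a : F) : JetLe j (fun _ : E => a) w ‖a‖ := by
  refine ⟨contDiffAt_const, fun k _ => ?_⟩
  obtain _ | k := k
  · simp
  · rw [iteratedFDeriv_const_of_ne (by simp)]
    simp

theorem add (hf : JetLe j f w c) (hg : JetLe j g w d) :
    JetLe j (fun x => f x + g x) w (c + d) := by
  refine ⟨hf.1.add hg.1, fun k hk => ?_⟩
  have hk' : (k : ℕ∞ω) ≤ j := by exact_mod_cast hk
  rw [show (fun x => f x + g x) = f + g from rfl,
    iteratedFDeriv_add_apply (hf.1.of_le hk') (hg.1.of_le hk')]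
  exact (norm_add_le _ _).trans (add_le_add (hf.2 k hk) (hg.2 k hk))

theorem clm_comp (L : F →L[ℝ] G) (hf : JetLe j f w c) :
    JetLe j (fun x => L (f x)) w (‖L‖ * c) := by
  refine ⟨L.contDiff.contDiffAt.comp w hf.1, fun k hk => ?_⟩
  refine (L.norm_iteratedFDeriv_comp_left hf.1 (by exact_mod_cast hk)).trans ?_
  exact mul_le_mul_of_nonneg_left (hf.2 k hk) (norm_nonneg _)

/-- On an open neighbourhood, derivatives within the set agree with ordinary ones, so estimates for
the former become estimates at a point. -/
theorem exists_open {g : E → F} {w : E} {j : ℕ} (h : ContDiffAt ℝ j g w) :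
    ∃ U : Set E, IsOpen U ∧ w ∈ U ∧ ContDiffOn ℝ j g U := by
  obtain ⟨U, hU, hc⟩ := h.contDiffOn (m := j) le_rfl (by simp)
  obtain ⟨V, hVU, hV, hw⟩ := mem_nhds_iff.1 (by simpa using hU)
  exact ⟨V, hV, hw, hc.mono hVU⟩

theorem mul {A : Type*} [NormedRing A] [NormedAlgebra ℝ A] {f g : E → A}
    (hf : JetLe j f w c) (hg : JetLe j g w d) :
    JetLe j (fun x => f x * g x) w (2 ^ j * (c * d)) := by
  refine ⟨hf.1.mul hg.1, fun k hk => ?_⟩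
  obtain ⟨U, hU, hwU, hfU⟩ := exists_open hf.1
  obtain ⟨V, hV, hwV, hgV⟩ := exists_open hg.1
  have hk' : (k : ℕ∞ω) ≤ j := by exact_mod_cast hk
  have hUV := hU.inter hV
  have hw : w ∈ U ∩ V := ⟨hwU, hwV⟩
  have := norm_iteratedFDerivWithin_mul_le (hfU.mono inter_subset_left)
    (hgV.mono inter_subset_right) hUV.uniqueDiffOn hw hk'
  simp only [iteratedFDerivWithin_of_isOpen _ hUV hw] at this
  refine this.trans ?_
  have hc := hf.nonneg
  have hd := hg.nonneg
  calc _ ≤ ∑ i ∈ Finset.range (k + 1), (k.choose i : ℝ) * (c * d) := by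
        refine Finset.sum_le_sum fun i hi => ?_
        rw [mul_assoc]
        refine mul_le_mul_of_nonneg_left ?_ (by positivity)
        have hi' : i ≤ k := by
          rw [Finset.mem_range] at hi
          omega
        exact mul_le_mul (hf.2 i (hi'.trans hk)) (hg.2 (k - i) ((Nat.sub_le _ _).trans hk))
          (norm_nonneg _) hc
    _ = 2 ^ k * (c * d) := by
        rw [← Finset.sum_mul]
        congr 1
        exact_mod_cast Nat.sum_range_choose k
    _ ≤ 2 ^ j * (c * d) := by
        gcongr
        norm_num

end JetLe

theorem norm_iteratedFDeriv_comp_clm_le {g : E → F} (S : E' →L[ℝ] E) {w : E'} {j : ℕ}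
    (hg : ContDiffAt ℝ j g (S w)) {k : ℕ} (hk : k ≤ j) :
    ‖iteratedFDeriv ℝ k (fun x => g (S x)) w‖ ≤ ‖S‖ ^ k * ‖iteratedFDeriv ℝ k g (S w)‖ := by
  obtain ⟨U, hU, hwU, hgU⟩ := JetLe.exists_open hg
  have hV : IsOpen (S ⁻¹' U) := hU.preimage S.continuous
  have := S.iteratedFDerivWithin_comp_right hgU hU.uniqueDiffOn hV.uniqueDiffOn hwU
    (by exact_mod_cast hk : (k : ℕ∞ω) ≤ j)
  rw [iteratedFDerivWithin_of_isOpen _ hU hwU, iteratedFDerivWithin_of_isOpen _ hV hwU] at this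
  change ‖iteratedFDeriv ℝ k (g ∘ S) w‖ ≤ _
  rw [this, mul_comm]
  refine (ContinuousMultilinearMap.norm_compContinuousLinearMap_le _ _).trans ?_
  simp

theorem iteratedFDeriv_comp_clm {g : E → F} (S : E' →L[ℝ] E) {w : E'} {j : ℕ}
    (hg : ContDiffAt ℝ j g (S w)) {k : ℕ} (hk : k ≤ j) :
    iteratedFDeriv ℝ k (fun x => g (S x)) w =
      (iteratedFDeriv ℝ k g (S w)).compContinuousLinearMap fun _ => S := by
  obtain ⟨U, hU, hwU, hgU⟩ := JetLe.exists_open hg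
  have hV : IsOpen (S ⁻¹' U) := hU.preimage S.continuous
  have := S.iteratedFDerivWithin_comp_right hgU hU.uniqueDiffOn hV.uniqueDiffOn hwU
    (by exact_mod_cast hk : (k : ℕ∞ω) ≤ j)
  rwa [iteratedFDerivWithin_of_isOpen _ hU hwU, iteratedFDerivWithin_of_isOpen _ hV hwU] at this

theorem JetLe.comp_clm {j : ℕ} {g : E → F} {c r : ℝ} (S : E' →L[ℝ] E) {w : E'}
    (hg : JetLe j g (S w) c) (hS : ‖S‖ ≤ r) (hr : 1 ≤ r) :
    JetLe j (fun x => g (S x)) w (r ^ j * c) := by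
  refine ⟨hg.1.comp w S.contDiff.contDiffAt, fun k hk => ?_⟩
  refine (norm_iteratedFDeriv_comp_clm_le S hg.1 hk).trans ?_
  have := hg.nonneg
  refine mul_le_mul ?_ (hg.2 k hk) (norm_nonneg _) (by positivity)
  exact (pow_le_pow_left₀ (norm_nonneg _) hS k).trans (pow_le_pow_right₀ hr hk)

/-- The directional derivative of a jet-bounded function. -/
theorem JetLe.fderiv_apply {j : ℕ} {g : E → F} {c : ℝ} {w : E} (hg : JetLe (j + 1) g w c) (v : E) :
    JetLe j (fun x => fderiv ℝ g x v) w (‖v‖ * c) := by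
  have h1 : ContDiffAt ℝ j (fderiv ℝ g) w := hg.1.fderiv_right (by push_cast; rfl)
  refine ⟨h1.clm_apply contDiffAt_const, fun k hk => ?_⟩
  refine (norm_iteratedFDeriv_clm_apply_const h1 (by exact_mod_cast hk)).trans ?_
  rw [norm_iteratedFDeriv_fderiv]
  exact mul_le_mul_of_nonneg_left (hg.2 _ (by omega)) (norm_nonneg _)

/-- Composition with a function of one real variable. -/
theorem norm_iteratedFDeriv_comp_le_of_contDiffAt {h : F → G} {g : E → F} {w : E} {n : ℕ}
    (hh : ContDiffAt ℝ n h (g w)) (hg : ContDiffAt ℝ n g w) {C D : ℝ}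
    (hC : ∀ i ≤ n, ‖iteratedFDeriv ℝ i h (g w)‖ ≤ C)
    (hD : ∀ i, 1 ≤ i → i ≤ n → ‖iteratedFDeriv ℝ i g w‖ ≤ D ^ i) :
    ‖iteratedFDeriv ℝ n (fun x => h (g x)) w‖ ≤ n.factorial * C * D ^ n := by
  obtain ⟨V, hV, hwV, hhV⟩ := JetLe.exists_open hh
  obtain ⟨U, hU, hwU, hgU⟩ := JetLe.exists_open hg
  obtain ⟨U', hU', hU'o, hwU'⟩ := mem_nhds_iff.1 (hg.continuousAt.preimage_mem_nhds (hV.mem_nhds hwV))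
  have ho := hU.inter hU'o
  have hw : w ∈ U ∩ U' := ⟨hwU, hwU'⟩
  have := norm_iteratedFDerivWithin_comp_le hhV (hgU.mono inter_subset_left) le_rfl
    hV.uniqueDiffOn ho.uniqueDiffOn (fun x hx => hU' hx.2) hw (C := C) (D := D)
    (fun i hi => by rw [iteratedFDerivWithin_of_isOpen _ hV hwV]; exact hC i hi)
    (fun i h1 hi => by rw [iteratedFDerivWithin_of_isOpen _ ho hw]; exact hD i h1 hi)
  rwa [iteratedFDerivWithin_of_isOpen _ ho hw] at this

/-- The reciprocal of a function bounded away from zero. -/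
theorem JetLe.inv {j : ℕ} {q : E → ℝ} {c b : ℝ} {w : E} (hq : JetLe j q w c) (hc : 1 ≤ c)
    (hb : 1 ≤ b) (hqb : 1 ≤ b * q w) :
    JetLe j (fun x => (q x)⁻¹) w (j.factorial * j.factorial * b ^ (j + 1) * c ^ j) := by
  have hb0 : 0 < b := by linarith
  have hqpos : 0 < q w := by
    by_contra h
    have : b * q w ≤ 0 := mul_nonpos_of_nonneg_of_nonpos hb0.le (not_lt.1 h)
    linarith
  have hinv : (q w)⁻¹ ≤ b := by
    rw [inv_le_iff_one_le_mul₀ hqpos]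
    exact hqb
  refine ⟨hq.1.inv hqpos.ne', fun k hk => ?_⟩
  -- The $i$-th derivative of $1/t$ is $(-1)^i\,i!\,t^{-1-i}$, and $1/q(w)\le b$ with $b\ge1$.
  have hC : ∀ i ≤ k, ‖iteratedFDeriv ℝ i (fun t : ℝ => t⁻¹) (q w)‖ ≤
      j.factorial * b ^ (j + 1) := by
    intro i hi
    rw [norm_iteratedFDeriv_eq_norm_iteratedDeriv, iteratedDeriv_eq_iterate,
      show (fun t : ℝ => t⁻¹) = Inv.inv from rfl, iter_deriv_inv]
    have h1 : (-1 - (i : ℤ)) = -((i + 1 : ℕ) : ℤ) := by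
      push_cast
      ring
    rw [h1, zpow_neg, zpow_natCast, ← inv_pow]
    simp only [norm_mul, norm_pow, norm_neg, norm_one, one_pow, one_mul, norm_inv, Real.norm_natCast,
      Real.norm_of_nonneg hqpos.le]
    have h2 : (i.factorial : ℝ) ≤ j.factorial := by
      exact_mod_cast Nat.factorial_le (hi.trans hk)
    have h3 : (q w)⁻¹ ^ (i + 1) ≤ b ^ (j + 1) :=
      (pow_le_pow_left₀ (by positivity) hinv _).trans (pow_le_pow_right₀ hb (by omega))
    exact mul_le_mul h2 h3 (by positivity) (by positivity)
  have hk' : (k : ℕ∞ω) ≤ j := by exact_mod_cast hk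
  -- Since $c\ge1$, the bound $c$ on each derivative of $q$ is also a bound $c^i$, which is the form
  -- that the composition estimate requires.
  have := norm_iteratedFDeriv_comp_le_of_contDiffAt (h := fun t : ℝ => t⁻¹) (g := q) (w := w)
    (n := k) (contDiffAt_inv ℝ hqpos.ne') (hq.1.of_le hk') hC (D := c)
    (fun i h1 hi => (hq.2 i (hi.trans hk)).trans (le_self_pow₀ hc (by omega)))
  refine this.trans ?_
  have h2 : (k.factorial : ℝ) ≤ j.factorial := by
    exact_mod_cast Nat.factorial_le hk
  have h3 : c ^ k ≤ c ^ j := pow_le_pow_right₀ hc hk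
  rw [← mul_assoc]
  gcongr

/-- The oscillating exponential of a real function. -/
theorem jetLe_exp_I_mul {k : ℕ} {ψ : E → ℝ} {D : ℝ} {w : E} (hψ : ContDiffAt ℝ k ψ w)
    (hD1 : 1 ≤ D) (hD : ∀ i, 1 ≤ i → i ≤ k → ‖iteratedFDeriv ℝ i ψ w‖ ≤ D) :
    JetLe k (fun x => Complex.exp (Complex.I * (ψ x : ℝ))) w (k.factorial * D ^ k) := by
  have hsm : ContDiff ℝ ∞ (fun t : ℝ => Complex.exp (Complex.I * (t : ℝ))) :=
    (contDiff_const.mul Complex.ofRealCLM.contDiff).cexp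
  have hder : ∀ i : ℕ, iteratedDeriv i (fun t : ℝ => Complex.exp (Complex.I * (t : ℝ))) =
      fun t : ℝ => Complex.I ^ i * Complex.exp (Complex.I * (t : ℝ)) := by
    intro i
    induction i with
    | zero => simp
    | succ i ih =>
      rw [iteratedDeriv_succ, ih]
      funext t
      have h1 : HasDerivAt (fun t : ℝ => Complex.I * (t : ℂ)) Complex.I t := by
        simpa using (Complex.ofRealCLM.hasDerivAt (x := t)).const_mul Complex.I
      rw [(h1.cexp.const_mul (Complex.I ^ i)).deriv]
      ring
  -- All derivatives of $e^{it}$ have modulus one, so the size of $\psi$ itself plays no role, only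
  -- its derivatives of order at least one.
  have hC : ∀ (i : ℕ) (t : ℝ),
      ‖iteratedFDeriv ℝ i (fun t : ℝ => Complex.exp (Complex.I * (t : ℝ))) t‖ ≤ 1 := by
    intro i t
    rw [norm_iteratedFDeriv_eq_norm_iteratedDeriv, hder]
    simp only [norm_mul, norm_pow, Complex.norm_I, one_pow, one_mul]
    rw [mul_comm, Complex.norm_exp_ofReal_mul_I]
  refine ⟨(hsm.contDiffAt.of_le (by exact_mod_cast le_top)).comp w hψ, fun i hi => ?_⟩
  refine (norm_iteratedFDeriv_comp_le_of_contDiffAt (n := i) (C := 1) (D := D)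
    (hsm.contDiffAt.of_le (by exact_mod_cast le_top))
    (hψ.of_le (by exact_mod_cast hi)) (fun l _ => hC l _)
    (fun l h1 hl => (hD l h1 (hl.trans hi)).trans (le_self_pow₀ hD1 (by omega)))).trans ?_
  rw [mul_one]
  have h2 : (i.factorial : ℝ) ≤ k.factorial := by
    exact_mod_cast Nat.factorial_le hi
  have h3 : D ^ i ≤ D ^ k := pow_le_pow_right₀ hD1 hi
  gcongr

end Jets

/-! ### Families of jet bounds -/

section Families

variable {ι : Type*} {E E' F G : Type*} [NormedAddCommGroup E] [NormedSpace ℝ E]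
  [NormedAddCommGroup E'] [NormedSpace ℝ E'] [NormedAddCommGroup F] [NormedSpace ℝ F]
  [NormedAddCommGroup G] [NormedSpace ℝ G]

/-- The function `f` in the affine chart `w ↦ z + T w`. -/
def pull (f : E → F) (z : E) (T : E' →L[ℝ] E) (w : E') : F := f (z + T w)

/-- The jets of order `j` at `0` of the functions `F i` are `O(W i)`, uniformly in `i`. -/
def JetO (j : ℕ) (F : ι → E → G) (W : ι → ℝ) : Prop :=
  ∃ C : ℝ, 0 ≤ C ∧ ∀ i, JetLe j (F i) 0 (C * W i)

namespace JetO

variable {j : ℕ} {f g : ι → E → F} {W V : ι → ℝ}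

theorem of_le {i : ℕ} (h : JetO j f W) (hij : i ≤ j) : JetO i f W := by
  obtain ⟨C, hC, h⟩ := h
  exact ⟨C, hC, fun a => (h a).of_le hij⟩

theorem mono (h : JetO j f W) {K : ℝ} (hK : 0 ≤ K) (hWV : ∀ i, W i ≤ K * V i) : JetO j f V := by
  obtain ⟨C, hC, h⟩ := h
  refine ⟨C * K, mul_nonneg hC hK, fun a => (h a).mono ?_⟩
  rw [mul_assoc]
  exact mul_le_mul_of_nonneg_left (hWV a) hC

theorem congr (h : JetO j f W) (hfg : ∀ i, g i =ᶠ[𝓝 0] f i) : JetO j g W := by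
  obtain ⟨C, hC, h⟩ := h
  exact ⟨C, hC, fun a => (h a).congr (hfg a)⟩

theorem add (hf : JetO j f W) (hg : JetO j g W) : JetO j (fun i x => f i x + g i x) W := by
  obtain ⟨C, hC, h⟩ := hf
  obtain ⟨D, hD, h'⟩ := hg
  refine ⟨C + D, add_nonneg hC hD, fun a => ((h a).add (h' a)).mono (le_of_eq (by ring))⟩

theorem mul {A : Type*} [NormedRing A] [NormedAlgebra ℝ A] {f g : ι → E → A}
    (hf : JetO j f W) (hg : JetO j g V) :
    JetO j (fun i x => f i x * g i x) (fun i => W i * V i) := by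
  obtain ⟨C, hC, h⟩ := hf
  obtain ⟨D, hD, h'⟩ := hg
  exact ⟨2 ^ j * (C * D), by positivity,
    fun a => ((h a).mul (h' a)).mono (le_of_eq (by ring))⟩

theorem const (a : F) : JetO j (fun (_ : ι) (_ : E) => a) (fun _ => 1) :=
  ⟨‖a‖, norm_nonneg _, fun _ => by simpa using JetLe.const (E := E) a⟩

theorem sum {κ : Type*} (s : Finset κ) {f : κ → ι → E → F}
    (h : ∀ k ∈ s, JetO j (f k) W) : JetO j (fun i x => ∑ k ∈ s, f k i x) W := by
  classical
  induction s using Finset.induction_on with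
  | empty =>
    refine ⟨0, le_rfl, fun i => ?_⟩
    simpa using JetLe.const (E := E) (j := j) (w := 0) (0 : F)
  | insert a s ha ih =>
    simp only [Finset.sum_insert ha]
    exact (h a (Finset.mem_insert_self a s)).add
      (ih fun i hi => h i (Finset.mem_insert_of_mem hi))

theorem inv {q : ι → E → ℝ} {b : ι → ℝ} (hq : JetO j q W) (hW : ∀ i, 1 ≤ W i)
    (hb : ∀ i, 1 ≤ b i) (hqb : ∀ i, 1 ≤ b i * q i 0) :
    JetO j (fun i x => (q i x)⁻¹) (fun i => b i ^ (j + 1) * W i ^ j) := by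
  obtain ⟨C, hC, h⟩ := hq
  -- `JetLe.inv` asks for a jet bound of at least $1$; this is why $C$ is enlarged to $C+1$.
  refine ⟨j.factorial * j.factorial * (C + 1) ^ j, by positivity, fun i => ?_⟩
  have h1 : JetLe j (q i) 0 ((C + 1) * W i) :=
    (h i).mono (mul_le_mul_of_nonneg_right (by linarith) (by linarith [hW i]))
  refine (h1.inv (one_le_mul_of_one_le_of_one_le (by linarith) (hW i)) (hb i) (hqb i)).mono
    (le_of_eq ?_)
  rw [mul_pow]
  ring

theorem clm_comp (L : F →L[ℝ] G) (hf : JetO j f W) : JetO j (fun i x => L (f i x)) W := by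
  obtain ⟨C, hC, h⟩ := hf
  exact ⟨‖L‖ * C, by positivity, fun i => ((h i).clm_comp L).mono (le_of_eq (by ring))⟩

theorem ofReal {f : ι → E → ℝ} (hf : JetO j f W) : JetO j (fun i x => (f i x : ℂ)) W :=
  hf.clm_comp Complex.ofRealCLM

theorem comp_clm (hf : JetO j f W) (S : ι → E' →L[ℝ] E) {r : ℝ} (hr : 1 ≤ r)
    (hS : ∀ i, ‖S i‖ ≤ r) : JetO j (fun i x => f i (S i x)) W := by
  obtain ⟨C, hC, h⟩ := hf
  refine ⟨r ^ j * C, by positivity, fun i => ?_⟩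
  have h' : JetLe j (f i) (S i 0) (C * W i) := by
    rw [map_zero]
    exact h i
  exact (h'.comp_clm (S i) (hS i) hr).mono (le_of_eq (by ring))

theorem pull_clm {f : ι → E → F} {z : ι → E} {E'' : Type*} [NormedAddCommGroup E'']
    [NormedSpace ℝ E''] {T : ι → E' →L[ℝ] E}
    (hf : JetO j (fun i => pull (f i) (z i) (T i)) W) (T' : ι → E'' →L[ℝ] E)
    (S : ι → E'' →L[ℝ] E') (hT : ∀ i, T' i = (T i).comp (S i)) {r : ℝ} (hr : 1 ≤ r)
    (hS : ∀ i, ‖S i‖ ≤ r) : JetO j (fun i => pull (f i) (z i) (T' i)) W := by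
  obtain rfl : T' = fun i => (T i).comp (S i) := funext hT
  exact hf.comp_clm S hr hS

/-- In the chart $T$, differentiating along $v$ amounts to differentiating along a preimage $v'$ of
$v$, and the length of $v'$ is the price. For the scaling of symbols this is
$\langle\xi\rangle^{-\rho}$ in a $\xi$-direction and $\langle\xi\rangle^{\delta}$ in a
$y$-direction. -/
theorem fderiv_dir {f : ι → E → F} {z : ι → E} {T : ι → E' →L[ℝ] E}
    (hf : JetO (j + 1) (fun i => pull (f i) (z i) (T i)) W)
    (hsm : ∀ i, ContDiffAt ℝ ∞ (f i) (z i)) {v : E} {v' : ι → E'} (hv : ∀ i, T i (v' i) = v)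
    {ρ : ι → ℝ} (hρ : ∀ i, ‖v' i‖ ≤ ρ i) :
    JetO j (fun i => pull (fun z => fderiv ℝ (f i) z v) (z i) (T i)) (fun i => ρ i * W i) := by
  obtain ⟨C, hC, h⟩ := hf
  refine ⟨C, hC, fun i => ?_⟩
  have h1 : JetLe j (fun x => fderiv ℝ (pull (f i) (z i) (T i)) x (v' i)) 0
      (‖v' i‖ * (C * W i)) := (h i).fderiv_apply (v' i)
  have h2 : JetLe j (pull (fun z => fderiv ℝ (f i) z v) (z i) (T i)) 0 (‖v' i‖ * (C * W i)) := by
    refine h1.congr ?_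
    have hev : ∀ᶠ y in 𝓝 (z i), DifferentiableAt ℝ (f i) y := by
      have : ContDiffAt ℝ 1 (f i) (z i) := (hsm i).of_le (by exact_mod_cast le_top)
      filter_upwards [this.eventually (by simp)] with y hy
      exact hy.differentiableAt (by simp)
    have hc : Tendsto (fun w => z i + T i w) (𝓝 0) (𝓝 (z i)) := by
      have : Continuous fun w => z i + T i w := by fun_prop
      simpa using this.tendsto 0
    filter_upwards [hc.eventually hev] with w hw
    have hA : HasFDerivAt (fun w => z i + T i w) (T i) w := (T i).hasFDerivAt.const_add _
    have := (hw.hasFDerivAt.comp w hA).fderiv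
    change fderiv ℝ (f i) (z i + T i w) v = fderiv ℝ (f i ∘ fun w => z i + T i w) w (v' i)
    rw [this, ContinuousLinearMap.comp_apply, hv]
  refine h2.mono ?_
  calc ‖v' i‖ * (C * W i) ≤ ρ i * (C * W i) :=
        mul_le_mul_of_nonneg_right (hρ i) (h i).nonneg
    _ = C * (ρ i * W i) := by ring

end JetO

end Families

/-! ### Anisotropic scalings -/

section Scale

variable {n' n p : ℕ}

/-- The map `(x, y, ξ) ↦ (α x, α y, β ξ)`. -/
def scale (α β : ℝ) : Z n' n p →L[ℝ] Z n' n p :=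
  (α • ContinuousLinearMap.fst ℝ (Rn n') (Rn n × Rn p)).prod
    ((α • (ContinuousLinearMap.fst ℝ (Rn n) (Rn p)).comp
        (ContinuousLinearMap.snd ℝ (Rn n') (Rn n × Rn p))).prod
      (β • (ContinuousLinearMap.snd ℝ (Rn n) (Rn p)).comp
        (ContinuousLinearMap.snd ℝ (Rn n') (Rn n × Rn p))))

theorem scale_apply (α β : ℝ) (z : Z n' n p) :
    scale α β z = (α • z.1, α • z.2.1, β • z.2.2) := rfl

theorem norm_scale_le {α β r : ℝ} (hα : |α| ≤ r) (hβ : |β| ≤ r) :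
    ‖(scale α β : Z n' n p →L[ℝ] Z n' n p)‖ ≤ r := by
  have hr : 0 ≤ r := (abs_nonneg _).trans hα
  refine ContinuousLinearMap.opNorm_le_bound _ hr fun z => ?_
  rw [scale_apply, Prod.norm_mk, Prod.norm_mk, norm_smul, norm_smul, norm_smul]
  have h1 : ‖z.1‖ ≤ ‖z‖ := norm_fst_le z
  have h2 : ‖z.2‖ ≤ ‖z‖ := norm_snd_le z
  have h3 : ‖z.2.1‖ ≤ ‖z‖ := (norm_fst_le z.2).trans h2
  have h4 : ‖z.2.2‖ ≤ ‖z‖ := (norm_snd_le z.2).trans h2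
  refine max_le ?_ (max_le ?_ ?_) <;> gcongr <;> assumption

theorem scale_comp (α β α' β' : ℝ) :
    (scale α β : Z n' n p →L[ℝ] Z n' n p).comp (scale α' β') = scale (α * α') (β * β') := by
  ext z <;> simp [scale_apply, mul_assoc]

/-- The map `x ↦ (α x, 0, 0)`. -/
def xIncl (α : ℝ) : Rn n' →L[ℝ] Z n' n p :=
  (α • ContinuousLinearMap.id ℝ (Rn n')).prod 0

theorem xIncl_apply (α : ℝ) (x : Rn n') : (xIncl α x : Z n' n p) = (α • x, 0, 0) := rfl

theorem norm_xIncl_le {α r : ℝ} (hα : |α| ≤ r) :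
    ‖(xIncl α : Rn n' →L[ℝ] Z n' n p)‖ ≤ r := by
  have hr : 0 ≤ r := (abs_nonneg _).trans hα
  refine ContinuousLinearMap.opNorm_le_bound _ hr fun x => ?_
  rw [xIncl_apply, Prod.norm_mk, norm_smul]
  have : ‖((0, 0) : Rn n × Rn p)‖ = 0 := norm_zero
  rw [this]
  refine max_le ?_ (by positivity)
  gcongr
  assumption

theorem scale_comp_xIncl (α β γ : ℝ) :
    (scale α β : Z n' n p →L[ℝ] Z n' n p).comp (xIncl γ) = xIncl (α * γ) := by
  ext z <;> simp [scale_apply, xIncl_apply, mul_assoc]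

/-- The Japanese bracket `⟨ξ⟩`. -/
def jap (ξ : Rn p) : ℝ := Real.sqrt (1 + ‖ξ‖ ^ 2)

theorem one_le_jap (ξ : Rn p) : 1 ≤ jap ξ := by
  rw [jap, Real.one_le_sqrt]
  nlinarith [sq_nonneg ‖ξ‖]

theorem jap_pos (ξ : Rn p) : 0 < jap ξ := one_pos.trans_le (one_le_jap ξ)

theorem norm_le_jap (ξ : Rn p) : ‖ξ‖ ≤ jap ξ := Real.le_sqrt_of_sq_le (by linarith)

theorem jap_le (ξ : Rn p) : jap ξ ≤ 1 + ‖ξ‖ := by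
  rw [jap, Real.sqrt_le_left (by positivity)]
  nlinarith [norm_nonneg ξ]

theorem jap_rpow (ξ : Rn p) (e : ℝ) : jap ξ ^ e = (1 + ‖ξ‖ ^ 2) ^ (e / 2) := by
  rw [jap, Real.sqrt_eq_rpow, ← Real.rpow_mul (by positivity)]
  congr 1
  ring

end Scale

/-! ### Jets and coordinate derivatives -/

theorem norm_multilinear_le_of_basis {E F β : Type*} [NormedAddCommGroup E] [NormedSpace ℝ E]
    [NormedAddCommGroup F] [NormedSpace ℝ F] [Fintype β] (e : β → E) (c : β → E → ℝ)
    (hc : ∀ b v, |c b v| ≤ ‖v‖) (hsum : ∀ v, ∑ b, c b v • e b = v) {k : ℕ}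
    (L : ContinuousMultilinearMap ℝ (fun _ : Fin k => E) F) {A : ℝ} (hA0 : 0 ≤ A)
    (hA : ∀ t : Fin k → β, ‖L (fun i => e (t i))‖ ≤ A) :
    ‖L‖ ≤ (Fintype.card β : ℝ) ^ k * A := by
  classical
  refine ContinuousMultilinearMap.opNorm_le_bound (by positivity) fun m => ?_
  have h1 : m = fun i => ∑ b, c b (m i) • e b := funext fun i => (hsum (m i)).symm
  have h2 : L m = ∑ t : Fin k → β, L (fun i => c (t i) (m i) • e (t i)) := by
    conv_lhs => rw [h1]
    exact L.toMultilinearMap.map_sum (fun i b => c b (m i) • e b)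
  rw [h2]
  have h3 : ∀ t : Fin k → β, ‖L (fun i => c (t i) (m i) • e (t i))‖ ≤ (∏ i, ‖m i‖) * A := by
    intro t
    rw [L.map_smul_univ, norm_smul, Real.norm_eq_abs, Finset.abs_prod]
    exact mul_le_mul (Finset.prod_le_prod (fun i _ => abs_nonneg _) fun i _ => hc _ _) (hA t)
      (norm_nonneg _) (Finset.prod_nonneg fun i _ => norm_nonneg _)
  refine (norm_sum_le _ _).trans ((Finset.sum_le_sum fun t _ => h3 t).trans (le_of_eq ?_))
  simp only [Finset.sum_const, Finset.card_univ, Fintype.card_fun, Fintype.card_fin, nsmul_eq_mul]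
  push_cast
  ring

theorem sum_coord_stdVec {n : ℕ} (v : Rn n) : ∑ b, v b • stdVec b = v := by
  ext i
  simp [Finset.sum_apply, stdVec, Pi.single_apply]

theorem abs_coord_le {n : ℕ} (v : Rn n) (b : Fin n) : |v b| ≤ ‖v‖ := by
  simpa using PiLp.norm_apply_le v b

section Mixed

variable {n' n p : ℕ} {W : Type} [NormedAddCommGroup W] [NormedSpace ℝ W]

/-- The coordinate directions of `Z n' n p`. -/
def dirAll : Fin p ⊕ (Fin n' ⊕ Fin n) → Z n' n p := Sum.elim dirXi dirBase

/-- The coordinates of `Z n' n p`. -/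
def coordAll : Fin p ⊕ (Fin n' ⊕ Fin n) → Z n' n p → ℝ :=
  Sum.elim (fun j z => z.2.2 j) (Sum.elim (fun i z => z.1 i) (fun k z => z.2.1 k))

theorem abs_coordAll_le (b : Fin p ⊕ (Fin n' ⊕ Fin n)) (v : Z n' n p) :
    |coordAll b v| ≤ ‖v‖ := by
  have h2 : ‖v.2‖ ≤ ‖v‖ := norm_snd_le v
  rcases b with j | i | k
  · exact (abs_coord_le _ _).trans ((norm_snd_le v.2).trans h2)
  · exact (abs_coord_le _ _).trans (norm_fst_le v)
  · exact (abs_coord_le _ _).trans ((norm_fst_le v.2).trans h2)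

theorem sum_coordAll (v : Z n' n p) : ∑ b, coordAll b v • dirAll b = v := by
  obtain ⟨x, y, ξ⟩ := v
  simp only [Fintype.sum_sum_type, coordAll, dirAll, Sum.elim_inl, Sum.elim_inr, dirXi, dirBase,
    dirY]
  refine Prod.ext ?_ (Prod.ext ?_ ?_)
  · simpa [Prod.fst_sum, Prod.snd_sum] using sum_coord_stdVec x
  · simpa [Prod.fst_sum, Prod.snd_sum] using sum_coord_stdVec y
  · simpa [Prod.fst_sum, Prod.snd_sum] using sum_coord_stdVec ξ

/-- Brings the $\xi$-indices in front of the base indices, which is the order used by `mixedDeriv`.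
-/
theorem exists_sorting {A B : Type} {k : ℕ} (t : Fin k → A ⊕ B) :
    ∃ (k₁ l : ℕ) (σ : Fin (k₁ + l) ≃ Fin k) (α : Fin k₁ → A) (β : Fin l → B),
      ∀ i, t (σ i) = Fin.append (fun i => Sum.inl (α i)) (fun i => Sum.inr (β i)) i := by
  classical
  let P : Fin k → Prop := fun i => (t i).isLeft = true
  let e₁ := Fintype.equivFin {i // P i}
  let e₂ := Fintype.equivFin {i // ¬ P i}
  refine ⟨_, _, finSumFinEquiv.symm.trans
    ((Equiv.sumCongr e₁.symm e₂.symm).trans (Equiv.sumCompl P)),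
    fun i => (t (e₁.symm i).1).getLeft (e₁.symm i).2,
    fun i => (t (e₂.symm i).1).getRight (by simpa [P] using (e₂.symm i).2), fun i => ?_⟩
  induction i using Fin.addCases with
  | left i => simp
  | right i => simp

/-- After sorting by symmetry, multilinearity pulls out a factor $b$ for each $\xi$-direction and a
factor $a$ for each base direction. -/
theorem exists_mixedDeriv_eq {f : Z n' n p → W} {z : Z n' n p} {k : ℕ}
    (hf : ContDiffAt ℝ k f z) (a b : ℝ) (t : Fin k → Fin p ⊕ (Fin n' ⊕ Fin n)) :
    ∃ (k₁ l : ℕ) (_ : k₁ + l = k) (α : Fin k₁ → Fin p) (β : Fin l → Fin n' ⊕ Fin n),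
      iteratedFDeriv ℝ k f z (fun i => scale a b (dirAll (t i))) =
        (b ^ k₁ * a ^ l) • mixedDeriv f z α β := by
  obtain ⟨k₁, l, σ, α, β, hσ⟩ := exists_sorting t
  have hk : k₁ + l = k := by simpa using Fintype.card_congr σ
  subst hk
  refine ⟨k₁, l, rfl, α, β, ?_⟩
  rw [← iteratedFDeriv_comp_perm _ hf _ σ, mixedDeriv]
  have h1 : (fun i => scale a b (dirAll (t i))) ∘ σ = fun i : Fin (k₁ + l) =>
      (Fin.append (fun _ : Fin k₁ => b) (fun _ : Fin l => a) i) •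
        (Fin.append (fun i => dirXi (α i)) (fun i => dirBase (β i)) i : Z n' n p) := by
    funext i
    simp only [Function.comp_apply, hσ]
    induction i using Fin.addCases with
    | left i => simp [dirAll, dirXi, scale_apply]
    | right i =>
      simp only [Fin.append_right, dirAll, Sum.elim_inr]
      rcases β i with i' | i' <;> simp [dirBase, dirY, scale_apply]
  rw [h1, ContinuousMultilinearMap.map_smul_univ, Fin.prod_univ_add]
  simp

/-- The coordinate derivatives at $0$ of the rescaled function are the weighted mixed derivatives of
$f$ at $z$, and an operator norm is bounded by values on basis tuples, of which there are
(dimension)$^k$. The extra $1$ in the base makes its powers increase with the exponent. -/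
theorem jetLe_pull_scale {f : Z n' n p → W} {z : Z n' n p} {j : ℕ} (hf : ContDiffAt ℝ j f z)
    {a b D : ℝ} (ha : 0 ≤ a) (hb : 0 ≤ b) (hD0 : 0 ≤ D)
    (hD : ∀ k l, k + l ≤ j → ∀ (α : Fin k → Fin p) (β : Fin l → Fin n' ⊕ Fin n),
      b ^ k * a ^ l * ‖mixedDeriv f z α β‖ ≤ D) :
    JetLe j (pull f z (scale a b)) 0 (((p + (n' + n) : ℕ) + 1 : ℝ) ^ j * D) := by
  have h0 : ContDiffAt ℝ j (fun w => f (z + w)) (scale a b (0 : Z n' n p)) := by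
    rw [map_zero]
    have h1 : ContDiffAt ℝ j f (z + 0) := by simpa using hf
    exact h1.comp 0 (contDiffAt_const.add contDiffAt_id)
  refine ⟨h0.comp 0 (scale a b).contDiff.contDiffAt, fun k hk => ?_⟩
  have h1 := iteratedFDeriv_comp_clm (scale a b) h0 hk
  change ‖iteratedFDeriv ℝ k (fun x => f (z + scale a b x)) 0‖ ≤ _
  rw [h1, map_zero, iteratedFDeriv_comp_add_left, add_zero]
  refine (norm_multilinear_le_of_basis dirAll coordAll abs_coordAll_le sum_coordAll _ hD0
    fun t => ?_).trans ?_
  · rw [ContinuousMultilinearMap.compContinuousLinearMap_apply]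
    obtain ⟨k₁, l, hkl, α, β, h⟩ :=
      exists_mixedDeriv_eq (hf.of_le (by exact_mod_cast hk)) a b t
    rw [h, norm_smul, Real.norm_of_nonneg (by positivity)]
    exact hD k₁ l (by omega) α β
  · refine mul_le_mul_of_nonneg_right ?_ hD0
    simp only [Fintype.card_sum, Fintype.card_fin]
    refine (pow_le_pow_left₀ (by positivity) ?_ k).trans (pow_le_pow_right₀ ?_ hk)
    · linarith
    · linarith [Nat.cast_nonneg (α := ℝ) (p + (n' + n))]

/-- The weights $\langle\xi\rangle^{\rho|\alpha|-\delta|\beta|}$ of the symbol seminorm are exactly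
the factors produced by the rescaling, so only $\langle\xi\rangle^m$ remains. -/
theorem jetLe_of_symbolSeminorm_le {m ρ δ : ℝ} {K : Set (Rn n' × Rn n)} {j : ℕ}
    {a : Z n' n p → ℂ} {A : ℝ} (hA : 0 ≤ A)
    (h : symbolSeminorm m ρ δ K j a ≤ ENNReal.ofReal A) {z : Z n' n p} (hz : (z.1, z.2.1) ∈ K)
    (hf : ContDiffAt ℝ j a z) :
    JetLe j (pull a z (scale (jap z.2.2 ^ (-δ)) (jap z.2.2 ^ ρ))) 0
      (((p + (n' + n) : ℕ) + 1 : ℝ) ^ j * (A * jap z.2.2 ^ m)) := by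
  have hl := jap_pos z.2.2
  refine jetLe_pull_scale hf (by positivity) (by positivity) (by positivity)
    fun k l hkl α β => ?_
  have h1 : ‖mixedDeriv a z α β‖ₑ *
      ENNReal.ofReal ((1 + ‖z.2.2‖ ^ 2) ^ ((-m + ρ * k - δ * l) / 2)) ≤ ENNReal.ofReal A := by
    refine le_trans ?_ h
    exact le_iSup₂_of_le (z.1, z.2.1) hz (le_iSup_of_le z.2.2 (le_iSup₂_of_le k l
      (le_iSup_of_le hkl (le_iSup₂_of_le α β le_rfl))))
  rw [← jap_rpow, ← ofReal_norm, ← ENNReal.ofReal_mul (norm_nonneg _),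
    ENNReal.ofReal_le_ofReal_iff hA] at h1
  have h2 : (jap z.2.2 ^ ρ) ^ k * (jap z.2.2 ^ (-δ)) ^ l =
      jap z.2.2 ^ (-m + ρ * k - δ * l) * jap z.2.2 ^ m := by
    rw [← Real.rpow_natCast, ← Real.rpow_natCast, ← Real.rpow_mul hl.le, ← Real.rpow_mul hl.le,
      ← Real.rpow_add hl, ← Real.rpow_add hl]
    congr 1
    ring
  rw [h2]
  calc _ = ‖mixedDeriv a z α β‖ * jap z.2.2 ^ (-m + ρ * k - δ * l) * jap z.2.2 ^ m := by ring
    _ ≤ _ := mul_le_mul_of_nonneg_right h1 (by positivity)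

/-- The analogue for homogeneous functions: the scaling by $|\xi|$ in $\xi$ absorbs
$|\xi|^{|\alpha|}$ and leaves the degree $1$. -/
theorem jetLe_of_hgSeminorm_le {K : Set (Rn n' × Rn n)} {j : ℕ} {φ : Z n' n p → ℝ} {B : ℝ}
    (hB : 0 ≤ B) (h : hgSeminorm K j φ ≤ ENNReal.ofReal B) {z : Z n' n p}
    (hz : (z.1, z.2.1) ∈ K) (hξ : z.2.2 ≠ 0) (hf : ContDiffAt ℝ j φ z) :
    JetLe j (pull φ z (scale 1 ‖z.2.2‖)) 0
      (((p + (n' + n) : ℕ) + 1 : ℝ) ^ j * (B * ‖z.2.2‖)) := by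
  have hl : 0 < ‖z.2.2‖ := norm_pos_iff.2 hξ
  refine jetLe_pull_scale hf zero_le_one (by positivity) (by positivity) fun k l hkl α β => ?_
  have h1 : ‖mixedDeriv φ z α β‖ₑ * ENNReal.ofReal (‖z.2.2‖ ^ (-1 + (k : ℝ))) ≤
      ENNReal.ofReal B := by
    refine le_trans ?_ h
    exact le_iSup₂_of_le (z.1, z.2.1) hz (le_iSup₂_of_le z.2.2 hξ (le_iSup₂_of_le k l
      (le_iSup_of_le hkl (le_iSup₂_of_le α β le_rfl))))
  rw [← ofReal_norm, ← ENNReal.ofReal_mul (norm_nonneg _),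
    ENNReal.ofReal_le_ofReal_iff hB] at h1
  have h2 : ‖z.2.2‖ ^ k = ‖z.2.2‖ ^ (-1 + (k : ℝ)) * ‖z.2.2‖ := by
    rw [Real.rpow_add hl, Real.rpow_neg_one, Real.rpow_natCast]
    field_simp
  rw [h2, one_pow, mul_one]
  calc _ = ‖mixedDeriv φ z α β‖ * ‖z.2.2‖ ^ (-1 + (k : ℝ)) * ‖z.2.2‖ := by ring
    _ ≤ _ := mul_le_mul_of_nonneg_right h1 (by positivity)

theorem jetLe_of_smoothSeminorm_le {K : Set (Rn n)} {j : ℕ} {u : Rn n → ℂ} {U : ℝ}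
    (hU : 0 ≤ U) (h : smoothSeminorm K j u ≤ ENNReal.ofReal U) {y : Rn n} (hy : y ∈ K)
    (hf : ContDiffAt ℝ j u y) : JetLe j u y ((n + 1 : ℝ) ^ j * U) := by
  refine ⟨hf, fun k hk => ?_⟩
  refine (norm_multilinear_le_of_basis stdVec (fun b v => v b) (fun b v => abs_coord_le v b)
    sum_coord_stdVec _ hU fun t => ?_).trans ?_
  · have h1 : ‖iteratedFDeriv ℝ k u y (fun l => stdVec (t l))‖ₑ ≤ ENNReal.ofReal U := by
      refine le_trans ?_ h
      exact le_iSup₂_of_le y hy (le_iSup₂_of_le k hk (le_iSup_of_le t le_rfl))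
    rwa [← ofReal_norm, ENNReal.ofReal_le_ofReal_iff hU] at h1
  · refine mul_le_mul_of_nonneg_right ?_ hU
    simp only [Fintype.card_fin]
    refine (pow_le_pow_left₀ (by positivity) ?_ k).trans (pow_le_pow_right₀ ?_ hk)
    · linarith
    · linarith [Nat.cast_nonneg (α := ℝ) n]

theorem smoothSeminorm_le_of_norm_le {K : Set (Rn n)} {j : ℕ} {u : Rn n → ℂ} {U : ℝ}
    (h : ∀ y ∈ K, ∀ k ≤ j, ‖iteratedFDeriv ℝ k u y‖ ≤ U) :
    smoothSeminorm K j u ≤ ENNReal.ofReal U := by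
  refine iSup₂_le fun y hy => iSup₂_le fun k hk => iSup_le fun t => ?_
  rw [← ofReal_norm]
  refine ENNReal.ofReal_le_ofReal (((iteratedFDeriv ℝ k u y).le_opNorm _).trans ?_)
  simpa using h y hy k hk

end Mixed

/-! ### Smoothness and homogeneity of phase functions -/

theorem exists_jetLe_of_isCompact {E F : Type*} [NormedAddCommGroup E] [NormedSpace ℝ E]
    [NormedAddCommGroup F] [NormedSpace ℝ F] {f : E → F} {U K : Set E} (hU : IsOpen U)
    (hf : ContDiffOn ℝ ∞ f U) (hK : IsCompact K) (hKU : K ⊆ U) (j : ℕ) :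
    ∃ C : ℝ, 0 ≤ C ∧ ∀ x ∈ K, JetLe j f x C := by
  have hat : ∀ x ∈ U, ∀ k : ℕ, ContDiffAt ℝ k f x := fun x hx k =>
    (hf.contDiffAt (hU.mem_nhds hx)).of_le (by exact_mod_cast le_top)
  have h : ∀ k : ℕ, ∃ C : ℝ, 0 ≤ C ∧ ∀ x ∈ K, ‖iteratedFDeriv ℝ k f x‖ ≤ C := by
    intro k
    have hc : ContinuousOn (iteratedFDeriv ℝ k f) K := fun x hx =>
      ((contDiffAt_iteratedFDeriv (n := 0) (hat x (hKU hx) (0 + k))).continuousAt).continuousWithinAt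
    obtain ⟨C, hC⟩ := hK.exists_bound_of_continuousOn hc
    exact ⟨max C 0, le_max_right _ _, fun x hx => (hC x hx).trans (le_max_left _ _)⟩
  choose C hC0 hC using h
  refine ⟨∑ k ∈ Finset.range (j + 1), C k, Finset.sum_nonneg fun k _ => hC0 k,
    fun x hx => ⟨hat x (hKU hx) j, fun k hk => (hC k x hx).trans ?_⟩⟩
  exact Finset.single_le_sum (f := C) (fun k _ => hC0 k) (Finset.mem_range.2 (by omega))

section Phase

variable {n' n p : ℕ} {Ω' : Opens (Rn n')} {Ω : Opens (Rn n)}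

theorem mem_dom₀_iff {z : Z n' n p} :
    z ∈ dom₀ p Ω' Ω ↔ z.1 ∈ Ω' ∧ z.2.1 ∈ Ω ∧ z.2.2 ≠ 0 := Iff.rfl

theorem dom₀_subset_dom : dom₀ p Ω' Ω ⊆ dom p Ω' Ω := fun _ hz => ⟨hz.1, hz.2.1, trivial⟩

theorem contDiffOn_fderiv_apply {E F : Type*} [NormedAddCommGroup E] [NormedSpace ℝ E]
    [NormedAddCommGroup F] [NormedSpace ℝ F] {U : Set E} (hU : IsOpen U) {f : E → F}
    (hf : ContDiffOn ℝ ∞ f U) (v : E) : ContDiffOn ℝ ∞ (fun z => fderiv ℝ f z v) U :=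
  (hf.fderiv_of_isOpen hU (by simp)).clm_apply contDiffOn_const

theorem scale_one_mem_dom₀ {z : Z n' n p} (hz : z ∈ dom₀ p Ω' Ω) {t : ℝ} (ht : t ≠ 0) :
    scale 1 t z ∈ dom₀ p Ω' Ω := by
  rw [mem_dom₀_iff] at *
  simpa [scale_apply, ht] using hz

theorem normalize_eq_scale (z : Z n' n p) : normalize z = scale 1 ‖z.2.2‖⁻¹ z := by
  simp [normalize, scale_apply]

theorem normalize_mem_dom₀ {z : Z n' n p} (hz : z ∈ dom₀ p Ω' Ω) :
    normalize z ∈ dom₀ p Ω' Ω := by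
  rw [normalize_eq_scale]
  exact scale_one_mem_dom₀ hz (inv_ne_zero (norm_ne_zero_iff.2 hz.2.2))

theorem contDiffOn_normalize : ContDiffOn ℝ ∞ (normalize : Z n' n p → Z n' n p) (dom₀ p Ω' Ω) := by
  have h : ContDiffOn ℝ ∞ (fun z : Z n' n p => ‖z.2.2‖⁻¹) (dom₀ p Ω' Ω) := by
    refine ContDiffOn.inv ?_ fun z hz => norm_ne_zero_iff.2 hz.2.2
    exact ContDiffOn.norm ℝ (by fun_prop) fun z hz => hz.2.2
  unfold normalize
  exact contDiff_fst.contDiffOn.prodMk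
    ((contDiff_fst.comp contDiff_snd).contDiffOn.prodMk
      (h.smul (contDiff_snd.comp contDiff_snd).contDiffOn))

namespace IsPhase

variable {φ : Z n' n p → ℝ} (hφ : IsPhase p Ω' Ω φ)
include hφ

theorem comp_scale {z : Z n' n p} (hz : z ∈ dom p Ω' Ω) {t : ℝ} (ht : 0 < t) :
    φ (scale 1 t z) = t * φ z := by
  have := hφ.homogeneous z.1 hz.1 z.2.1 hz.2.1 z.2.2 t ht
  simpa [scale_apply] using this

theorem eq_zero_of_xi {z : Z n' n p} (hz : z ∈ dom p Ω' Ω) (h0 : z.2.2 = 0) : φ z = 0 := by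
  have h := hφ.comp_scale hz (t := 2) two_pos
  have h' : scale 1 2 z = z := by
    obtain ⟨x, y, ξ⟩ := z
    simp only at h0
    simp [scale_apply, h0]
  rw [h'] at h
  linarith

theorem fderiv_comp_scale {z : Z n' n p} (hz : z ∈ dom₀ p Ω' Ω) {t : ℝ} (ht : 0 < t)
    (v : Z n' n p) : fderiv ℝ φ (scale 1 t z) (scale 1 t v) = t * fderiv ℝ φ z v := by
  have hd : ∀ w ∈ dom₀ p Ω' Ω, DifferentiableAt ℝ φ w := fun w hw =>
    (contDiffAt_of_opens (isOpen_dom₀ p Ω' Ω) hφ.contDiffOn hw 1).differentiableAt (by simp)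
  have h1 := ((hd _ (scale_one_mem_dom₀ hz ht.ne')).hasFDerivAt.comp z
    (scale 1 t : Z n' n p →L[ℝ] Z n' n p).hasFDerivAt).fderiv
  have h2 : (φ ∘ scale 1 t) =ᶠ[𝓝 z] fun w => t * φ w := by
    filter_upwards [(isOpen_dom₀ p Ω' Ω).mem_nhds hz] with w hw
    exact hφ.comp_scale (dom₀_subset_dom hw) ht
  rw [h2.fderiv_eq, fderiv_const_mul (hd z hz)] at h1
  have := congrArg (fun L => L v) h1
  simpa using this.symm

/-- By homogeneity the $\xi$-derivatives of the phase have degree $0$ and its $y$-derivatives degree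
$1$; hence the factor $|\xi|^{-2}$ on the latter. The same weights occur in the coefficients of
$L_\phi$, which makes them sum to $1-\chi$ when paired with the gradient. -/
theorem gradSq_normalize {z : Z n' n p} (hz : z ∈ dom₀ p Ω' Ω) :
    gradSq φ (normalize z) =
      ∑ k : Fin n, (‖z.2.2‖ ^ 2)⁻¹ * (fderiv ℝ φ z (dirY k)) ^ 2 +
        ∑ j : Fin p, (fderiv ℝ φ z (dirXi j)) ^ 2 := by
  have hr : 0 < ‖z.2.2‖ := norm_pos_iff.2 hz.2.2
  rw [normalize_eq_scale, gradSq]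
  congr 1
  · refine Finset.sum_congr rfl fun k _ => ?_
    have h := hφ.fderiv_comp_scale hz (inv_pos.2 hr) (dirY k)
    have h' : scale 1 ‖z.2.2‖⁻¹ (dirY k : Z n' n p) = dirY k := by simp [scale_apply, dirY]
    rw [h'] at h
    rw [h, mul_pow, inv_pow]
  · refine Finset.sum_congr rfl fun j _ => ?_
    have h := hφ.fderiv_comp_scale hz (inv_pos.2 hr) (dirXi j)
    have h' : scale 1 ‖z.2.2‖⁻¹ (dirXi j : Z n' n p) = ‖z.2.2‖⁻¹ • dirXi j := by
      simp [scale_apply, dirXi]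
    rw [h', map_smul, smul_eq_mul] at h
    rw [mul_left_cancel₀ (inv_ne_zero hr.ne') h]

theorem contDiffOn_gradSq : ContDiffOn ℝ ∞ (gradSq φ) (dom₀ p Ω' Ω) := by
  unfold gradSq
  exact (ContDiffOn.sum fun k _ =>
    (contDiffOn_fderiv_apply (isOpen_dom₀ p Ω' Ω) hφ.contDiffOn _).pow 2).add
    (ContDiffOn.sum fun k _ =>
      (contDiffOn_fderiv_apply (isOpen_dom₀ p Ω' Ω) hφ.contDiffOn _).pow 2)

theorem contDiffOn_gradInv :
    ContDiffOn ℝ ∞ (fun z => (gradSq φ (normalize z))⁻¹) (dom₀ p Ω' Ω) :=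
  (hφ.contDiffOn_gradSq.comp contDiffOn_normalize fun _ hz => normalize_mem_dom₀ hz).inv
    fun _ hz => hφ.gradSq_ne_zero _ (normalize_mem_dom₀ hz)

theorem contDiffOn_coeffA {χ : Rn p → ℂ} (hχ : IsCutoff χ) (j : Fin p) :
    ContDiffOn ℝ ∞ (coeffA χ φ j) (dom₀ p Ω' Ω) := by
  have h1 : ContDiffOn ℝ ∞ (fun z : Z n' n p => χ z.2.2) (dom₀ p Ω' Ω) :=
    (hχ.contDiff.comp (contDiff_snd.comp contDiff_snd)).contDiffOn
  exact ((contDiffOn_const.mul (contDiffOn_const.sub h1)).mul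
    (Complex.ofRealCLM.contDiff.comp_contDiffOn hφ.contDiffOn_gradInv)).mul
    (Complex.ofRealCLM.contDiff.comp_contDiffOn
      (contDiffOn_fderiv_apply (isOpen_dom₀ p Ω' Ω) hφ.contDiffOn _))

theorem contDiffOn_coeffB {χ : Rn p → ℂ} (hχ : IsCutoff χ) (k : Fin n) :
    ContDiffOn ℝ ∞ (coeffB χ φ k) (dom₀ p Ω' Ω) := by
  have h1 : ContDiffOn ℝ ∞ (fun z : Z n' n p => χ z.2.2) (dom₀ p Ω' Ω) :=
    (hχ.contDiff.comp (contDiff_snd.comp contDiff_snd)).contDiffOn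
  have h2 : ContDiffOn ℝ ∞ (fun z : Z n' n p => (‖z.2.2‖ ^ 2)⁻¹) (dom₀ p Ω' Ω) := by
    refine ContDiffOn.inv ?_ fun z hz => pow_ne_zero _ (norm_ne_zero_iff.2 hz.2.2)
    exact ((contDiff_snd.comp contDiff_snd).norm_sq ℝ).contDiffOn
  exact (((contDiffOn_const.mul (contDiffOn_const.sub h1)).mul
    (Complex.ofRealCLM.contDiff.comp_contDiffOn h2)).mul
    (Complex.ofRealCLM.contDiff.comp_contDiffOn hφ.contDiffOn_gradInv)).mul
    (Complex.ofRealCLM.contDiff.comp_contDiffOn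
      (contDiffOn_fderiv_apply (isOpen_dom₀ p Ω' Ω) hφ.contDiffOn _))

theorem contDiffOn_coeffC {χ : Rn p → ℂ} (hχ : IsCutoff χ) :
    ContDiffOn ℝ ∞ (coeffC χ φ) (dom₀ p Ω' Ω) := by
  have h1 : ContDiffOn ℝ ∞ (fun z : Z n' n p => χ z.2.2) (dom₀ p Ω' Ω) :=
    (hχ.contDiff.comp (contDiff_snd.comp contDiff_snd)).contDiffOn
  exact (h1.add (ContDiffOn.sum fun j _ => contDiffOn_fderiv_apply (isOpen_dom₀ p Ω' Ω)
    (hφ.contDiffOn_coeffA hχ j) _)).add (ContDiffOn.sum fun k _ =>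
      contDiffOn_fderiv_apply (isOpen_dom₀ p Ω' Ω) (hφ.contDiffOn_coeffB hχ k) _)

theorem contDiffOn_opL {χ : Rn p → ℂ} (hχ : IsCutoff χ) {f : Z n' n p → ℂ}
    (hf : ContDiffOn ℝ ∞ f (dom₀ p Ω' Ω)) : ContDiffOn ℝ ∞ (opL χ φ f) (dom₀ p Ω' Ω) := by
  refine ((ContDiffOn.sum fun j _ => ?_).add (ContDiffOn.sum fun k _ => ?_)).add ?_
  · exact (hφ.contDiffOn_coeffA hχ j).mul (contDiffOn_fderiv_apply (isOpen_dom₀ p Ω' Ω) hf _)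
  · exact (hφ.contDiffOn_coeffB hχ k).mul (contDiffOn_fderiv_apply (isOpen_dom₀ p Ω' Ω) hf _)
  · exact (hφ.contDiffOn_coeffC hχ).mul hf

theorem contDiffOn_opL_iterate {χ : Rn p → ℂ} (hχ : IsCutoff χ) (h : ℕ) {f : Z n' n p → ℂ}
    (hf : ContDiffOn ℝ ∞ f (dom₀ p Ω' Ω)) :
    ContDiffOn ℝ ∞ ((opL χ φ)^[h] f) (dom₀ p Ω' Ω) := by
  induction h generalizing f with
  | zero => exact hf
  | succ h ih =>
    rw [Function.iterate_succ_apply]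
    exact ih (hφ.contDiffOn_opL hχ hf)

end IsPhase

/-! ### The operator near `ξ = 0` -/

theorem eventually_norm_lt {z : Z n' n p} {r : ℝ} (hz : ‖z.2.2‖ < r) :
    ∀ᶠ w : Z n' n p in 𝓝 z, ‖w.2.2‖ < r :=
  (continuous_snd.snd.norm.tendsto z).eventually_lt_const hz

theorem eventually_lt_norm {z : Z n' n p} {r : ℝ} (hz : r < ‖z.2.2‖) :
    ∀ᶠ w : Z n' n p in 𝓝 z, r < ‖w.2.2‖ :=
  (continuous_snd.snd.norm.tendsto z).eventually_const_lt hz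

/-- Where $\chi=1$ the first order coefficients vanish identically and $c=1$. Thus $L_\phi$ is the
identity near $\xi=0$, and the lack of smoothness of the phase there does no harm. -/
theorem opL_of_norm_lt {χ : Rn p → ℂ} (hχ : IsCutoff χ) (φ : Z n' n p → ℝ) (f : Z n' n p → ℂ)
    {z : Z n' n p} (hz : ‖z.2.2‖ < 1 / 4) : opL χ φ f z = f z := by
  have hA : ∀ j, ∀ w : Z n' n p, ‖w.2.2‖ < 1 / 4 → coeffA χ φ j w = 0 := fun j w hw => by
    simp [coeffA, hχ.eq_one _ hw]
  have hB : ∀ k, ∀ w : Z n' n p, ‖w.2.2‖ < 1 / 4 → coeffB χ φ k w = 0 := fun k w hw => by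
    simp [coeffB, hχ.eq_one _ hw]
  have hA' : ∀ j, fderiv ℝ (coeffA χ φ j) z = 0 := fun j => by
    have : coeffA χ φ j =ᶠ[𝓝 z] fun _ => 0 := (eventually_norm_lt hz).mono fun w hw => hA j w hw
    rw [this.fderiv_eq]
    simp
  have hB' : ∀ k, fderiv ℝ (coeffB χ φ k) z = 0 := fun k => by
    have : coeffB χ φ k =ᶠ[𝓝 z] fun _ => 0 := (eventually_norm_lt hz).mono fun w hw => hB k w hw
    rw [this.fderiv_eq]
    simp
  simp [opL, coeffC, hA _ z hz, hB _ z hz, hA', hB', hχ.eq_one _ hz]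

theorem opL_iterate_of_norm_lt {χ : Rn p → ℂ} (hχ : IsCutoff χ) (φ : Z n' n p → ℝ) (h : ℕ)
    (f : Z n' n p → ℂ) {z : Z n' n p} (hz : ‖z.2.2‖ < 1 / 4) : (opL χ φ)^[h] f z = f z := by
  induction h generalizing f with
  | zero => rfl
  | succ h ih => rw [Function.iterate_succ_apply, ih, opL_of_norm_lt hχ φ f hz]

/-- Off $\xi=0$ the smoothness is that of $f$; near $\xi=0$ it is that of $g$, with which $f$
coincides. -/
theorem contDiffOn_dom_of_dom₀ {f g : Z n' n p → ℂ} (hf : ContDiffOn ℝ ∞ f (dom₀ p Ω' Ω))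
    (hg : ContDiffOn ℝ ∞ g (dom p Ω' Ω)) (hfg : ∀ z : Z n' n p, ‖z.2.2‖ < 1 / 4 → f z = g z) :
    ContDiffOn ℝ ∞ f (dom p Ω' Ω) := by
  intro z hz
  refine ContDiffAt.contDiffWithinAt ?_
  by_cases h0 : z.2.2 = 0
  · refine (hg.contDiffAt ((isOpen_dom p Ω' Ω).mem_nhds hz)).congr_of_eventuallyEq ?_
    exact (eventually_norm_lt (by rw [h0]; norm_num)).mono fun w hw => hfg w hw
  · exact hf.contDiffAt ((isOpen_dom₀ p Ω' Ω).mem_nhds ⟨hz.1, hz.2.1, h0⟩)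

theorem IsPhase.contDiffOn_opL_iterate_dom {φ : Z n' n p → ℝ} (hφ : IsPhase p Ω' Ω φ)
    {χ : Rn p → ℂ} (hχ : IsCutoff χ) (h : ℕ) {f : Z n' n p → ℂ}
    (hf : ContDiffOn ℝ ∞ f (dom p Ω' Ω)) : ContDiffOn ℝ ∞ ((opL χ φ)^[h] f) (dom p Ω' Ω) :=
  contDiffOn_dom_of_dom₀ (hφ.contDiffOn_opL_iterate hχ h (hf.mono dom₀_subset_dom)) hf
    fun _ hz => opL_iterate_of_norm_lt hχ φ h f hz

end Phase

/-! ### Jets of the coefficients of `L_φ` -/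

theorem exists_jetLe_inv_normSq (p J : ℕ) : ∃ C : ℝ, 0 ≤ C ∧ ∀ θ : Rn p, ‖θ‖ = 1 →
    JetLe J (fun ξ : Rn p => (‖ξ‖ ^ 2)⁻¹) θ C := by
  have h : ContDiffOn ℝ ∞ (fun ξ : Rn p => (‖ξ‖ ^ 2)⁻¹) {0}ᶜ :=
    (contDiff_id.norm_sq ℝ).contDiffOn.inv fun ξ hξ => pow_ne_zero _ (norm_ne_zero_iff.2 hξ)
  obtain ⟨C, hC, h⟩ := exists_jetLe_of_isCompact isOpen_compl_singleton h
    (isCompact_sphere (0 : Rn p) 1) (fun ξ hξ => by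
      rintro rfl
      simp at hξ) J
  exact ⟨C, hC, fun θ hθ => h θ (by simpa using hθ)⟩

/-- The second bound, with a gain of $|\xi|^{-1}$, holds because the jet vanishes for $|\xi|>1/2$
and $|\xi|^{-1}\ge1$ for $|\xi|\le1$. It lets the term $\chi$ in the coefficient $c$ count as having
order $-1$. -/
theorem exists_jetLe_cutoff {p : ℕ} {χ : Rn p → ℂ} (hχ : IsCutoff χ) (J : ℕ) :
    ∃ C : ℝ, 0 ≤ C ∧ ∀ ξ : Rn p, JetLe J (fun w => χ (ξ + ‖ξ‖ • w)) 0 C ∧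
      (ξ ≠ 0 → JetLe J (fun w => χ (ξ + ‖ξ‖ • w)) 0 (C * ‖ξ‖⁻¹)) := by
  obtain ⟨C, hC, h⟩ := exists_jetLe_of_isCompact isOpen_univ hχ.contDiff.contDiffOn
    (isCompact_closedBall (0 : Rn p) 1) (subset_univ _) J
  have h0 : ∀ ξ : Rn p, 1 / 2 < ‖ξ‖ → ∀ c : ℝ, 0 ≤ c →
      JetLe J (fun w => χ (ξ + ‖ξ‖ • w)) 0 c := by
    intro ξ hξ c hc
    refine ((JetLe.const (E := Rn p) (0 : ℂ)).mono (by simpa using hc)).congr ?_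
    have : Continuous fun w : Rn p => ‖ξ + ‖ξ‖ • w‖ := by fun_prop
    have ht := this.tendsto 0
    simp only [smul_zero, add_zero] at ht
    exact (ht.eventually_const_lt hξ).mono fun w hw => hχ.eq_zero _ hw
  have h1 : ∀ ξ : Rn p, ‖ξ‖ ≤ 1 → JetLe J (fun w => χ (ξ + ‖ξ‖ • w)) 0 C := by
    intro ξ hξ
    have h2 := h ξ (by simpa using hξ)
    have h3 : JetLe J (fun w => χ (ξ + w)) ((‖ξ‖ • ContinuousLinearMap.id ℝ (Rn p)) 0) C := by
      rw [map_zero]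
      refine ⟨ContDiffAt.comp 0 (g := χ) (f := fun w => ξ + w) (by simpa using h2.1)
        (contDiffAt_const.add contDiffAt_id), fun k hk => ?_⟩
      rw [iteratedFDeriv_comp_add_left, add_zero]
      exact h2.2 k hk
    have h4 := h3.comp_clm (r := 1) _ (by
      rw [norm_smul, norm_norm]
      exact mul_le_one₀ hξ (norm_nonneg _) ContinuousLinearMap.norm_id_le) le_rfl
    simpa using h4
  refine ⟨C, hC, fun ξ => ⟨?_, fun hξ => ?_⟩⟩
  · rcases le_or_gt ‖ξ‖ 1 with h2 | h2
    · exact h1 ξ h2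
    · exact h0 ξ (by linarith) C hC
  · have hpos : 0 < ‖ξ‖ := norm_pos_iff.2 hξ
    rcases le_or_gt ‖ξ‖ 1 with h2 | h2
    · refine (h1 ξ h2).mono (le_mul_of_one_le_right hC ?_)
      exact (one_le_inv₀ hpos).2 h2
    · exact h0 ξ (by linarith) _ (by positivity)

section PhaseFamilies

variable {n' n p : ℕ} {Ω' : Opens (Rn n')} {Ω : Opens (Rn n)} {ι : Type*}

/-- A family of phase functions `φ i` with base points `z i` and constants `B i` that control the
jets of order `N` of `φ i` and the size of its gradient at `z i`. -/
structure IsPhaseFamily (Ω' : Opens (Rn n')) (Ω : Opens (Rn n)) (N : ℕ) (φ : ι → Z n' n p → ℝ)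
    (z : ι → Z n' n p) (B : ι → ℝ) : Prop where
  phase : ∀ i, IsPhase p Ω' Ω (φ i)
  mem : ∀ i, z i ∈ dom₀ p Ω' Ω
  one_le : ∀ i, 1 ≤ B i
  jet : JetO N (fun i => pull (φ i) (z i) (scale 1 ‖(z i).2.2‖)) fun i => B i * ‖(z i).2.2‖
  grad : ∀ i, 1 ≤ B i * gradSq (φ i) (normalize (z i))

namespace IsPhaseFamily

variable {N : ℕ} {φ : ι → Z n' n p → ℝ} {z : ι → Z n' n p} {B : ι → ℝ}
  (H : IsPhaseFamily Ω' Ω N φ z B)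
include H

theorem norm_pos (i : ι) : 0 < ‖(z i).2.2‖ := norm_pos_iff.2 (H.mem i).2.2

theorem contDiffAt {f : Z n' n p → ℂ} (hf : ContDiffOn ℝ ∞ f (dom₀ p Ω' Ω)) (i : ι) :
    ContDiffAt ℝ ∞ f (z i) :=
  hf.contDiffAt ((isOpen_dom₀ p Ω' Ω).mem_nhds (H.mem i))

theorem contDiffAt_phase (i : ι) : ContDiffAt ℝ ∞ (φ i) (z i) :=
  (H.phase i).contDiffOn.contDiffAt ((isOpen_dom₀ p Ω' Ω).mem_nhds (H.mem i))

omit H in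
theorem scale_dirXi {r : ℝ} (hr : 0 < r) (a : ℝ) (j : Fin p) :
    scale a r (r⁻¹ • dirXi j : Z n' n p) = dirXi j := by
  simp [scale_apply, dirXi, smul_smul, hr.ne']

omit H in
theorem scale_dirY {a : ℝ} (ha : 0 < a) (r : ℝ) (k : Fin n) :
    scale a r (a⁻¹ • dirY k : Z n' n p) = dirY k := by
  simp [scale_apply, dirY, smul_smul, ha.ne']

omit H in
theorem norm_dirXi (j : Fin p) : ‖(dirXi j : Z n' n p)‖ = 1 := by
  simp [dirXi, Prod.norm_def]

omit H in
theorem norm_dirY (k : Fin n) : ‖(dirY k : Z n' n p)‖ = 1 := by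
  simp [dirY, Prod.norm_def]

theorem jetO_dXi {J : ℕ} (hJ : J + 1 ≤ N) (j : Fin p) :
    JetO J (fun i => pull (fun z => fderiv ℝ (φ i) z (dirXi j)) (z i) (scale 1 ‖(z i).2.2‖)) B := by
  refine ((H.jet.of_le hJ).fderiv_dir H.contDiffAt_phase
    (fun i => scale_dirXi (H.norm_pos i) 1 j) (ρ := fun i => ‖(z i).2.2‖⁻¹) fun i => ?_).mono
    zero_le_one fun i => ?_
  · rw [norm_smul, norm_dirXi, mul_one, norm_inv, norm_norm]
  · have := H.norm_pos i
    rw [one_mul]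
    field_simp
    exact le_rfl

theorem jetO_dY {J : ℕ} (hJ : J + 1 ≤ N) (k : Fin n) :
    JetO J (fun i => pull (fun z => fderiv ℝ (φ i) z (dirY k)) (z i) (scale 1 ‖(z i).2.2‖))
      fun i => B i * ‖(z i).2.2‖ := by
  refine ((H.jet.of_le hJ).fderiv_dir H.contDiffAt_phase
    (fun i => scale_dirY one_pos ‖(z i).2.2‖ k) (ρ := fun _ => 1) fun i => ?_).mono
    zero_le_one fun i => by rw [one_mul]
  simp [norm_dirY]

omit H in
/-- The projection on the variable `ξ`. -/
theorem norm_snd_snd_le :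
    ‖(ContinuousLinearMap.snd ℝ (Rn n) (Rn p)).comp
      (ContinuousLinearMap.snd ℝ (Rn n') (Rn n × Rn p))‖ ≤ 1 :=
  ContinuousLinearMap.opNorm_le_bound _ zero_le_one fun z => by
    rw [one_mul]
    exact (norm_snd_le z.2).trans (norm_snd_le z)

/-- By homogeneity of degree $-2$ the function is, in the chart, $|\xi|^{-2}$ times its own
translate at a point of the unit sphere, where compactness bounds the jets. -/
theorem jetO_invNormSq (J : ℕ) :
    JetO J (fun i => pull (fun z => (‖z.2.2‖ ^ 2)⁻¹) (z i) (scale 1 ‖(z i).2.2‖))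
      fun i => (‖(z i).2.2‖ ^ 2)⁻¹ := by
  obtain ⟨C, hC, h⟩ := exists_jetLe_inv_normSq p J
  refine ⟨C, hC, fun i => ?_⟩
  have hr := H.norm_pos i
  set r := ‖(z i).2.2‖ with hrdef
  set θ : Rn p := r⁻¹ • (z i).2.2
  have hθ : ‖θ‖ = 1 := by
    rw [norm_smul, norm_inv, Real.norm_of_nonneg hr.le, ← hrdef, inv_mul_cancel₀ hr.ne']
  let S := (ContinuousLinearMap.snd ℝ (Rn n) (Rn p)).comp
      (ContinuousLinearMap.snd ℝ (Rn n') (Rn n × Rn p))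
  have h3 : JetLe J (fun w => (‖θ + w‖ ^ 2)⁻¹) (S 0) C := by
    rw [map_zero]
    refine ⟨ContDiffAt.comp 0 (g := fun ξ : Rn p => (‖ξ‖ ^ 2)⁻¹) (f := fun w => θ + w)
      (by simpa using (h θ hθ).1) (contDiffAt_const.add contDiffAt_id), fun k hk => ?_⟩
    rw [iteratedFDeriv_comp_add_left k θ (f := fun ξ : Rn p => (‖ξ‖ ^ 2)⁻¹), add_zero]
    exact (h θ hθ).2 k hk
  have h4 := (h3.comp_clm S norm_snd_snd_le le_rfl).clm_comp ((r ^ 2)⁻¹ • ContinuousLinearMap.id ℝ ℝ)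
  have h5 : (pull (fun z : Z n' n p => (‖z.2.2‖ ^ 2)⁻¹) (z i) (scale 1 r)) = fun x =>
      ((r ^ 2)⁻¹ • ContinuousLinearMap.id ℝ ℝ) ((‖θ + S x‖ ^ 2)⁻¹) := by
    funext w
    have h6 : (z i).2.2 + r • w.2.2 = r • (θ + w.2.2) := by
      simp [θ, smul_add, smul_smul, hr.ne']
    change (‖(z i).2.2 + r • w.2.2‖ ^ 2)⁻¹ = (r ^ 2)⁻¹ * (‖θ + w.2.2‖ ^ 2)⁻¹
    rw [h6, norm_smul, Real.norm_of_nonneg hr.le, mul_pow, mul_inv]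
  change JetLe J (pull (fun z : Z n' n p => (‖z.2.2‖ ^ 2)⁻¹) (z i) (scale 1 r)) 0 (C * (r ^ 2)⁻¹)
  rw [h5]
  refine h4.mono ?_
  rw [one_pow, one_mul, mul_comm]
  refine mul_le_mul_of_nonneg_left ?_ hC
  rw [norm_smul, Real.norm_of_nonneg (by positivity)]
  exact mul_le_of_le_one_right (by positivity) ContinuousLinearMap.norm_id_le

/-- The squared gradient is a quadratic expression with jets $O(B^2)$ and is bounded below by $1/B$.
Taking the reciprocal costs $B^{J+1}(B^2)^J=B^{3J+1}$. -/
theorem jetO_gradInv {J : ℕ} (hJ : J + 1 ≤ N) :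
    JetO J (fun i => pull (fun z => (gradSq (φ i) (normalize z))⁻¹) (z i) (scale 1 ‖(z i).2.2‖))
      fun i => B i ^ (3 * J + 1) := by
  have h1 : JetO J (fun i => pull (fun z => gradSq (φ i) (normalize z)) (z i)
      (scale 1 ‖(z i).2.2‖)) fun i => B i ^ 2 := by
    have h2 : JetO J (fun i w => ∑ k : Fin n,
        (pull (fun z => (‖z.2.2‖ ^ 2)⁻¹) (z i) (scale 1 ‖(z i).2.2‖) w *
          (pull (fun z => fderiv ℝ (φ i) z (dirY k)) (z i) (scale 1 ‖(z i).2.2‖) w *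
          pull (fun z => fderiv ℝ (φ i) z (dirY k)) (z i) (scale 1 ‖(z i).2.2‖) w)))
        fun i => B i ^ 2 := by
      refine JetO.sum _ fun k _ => ((H.jetO_invNormSq J).mul ((H.jetO_dY hJ k).mul
        (H.jetO_dY hJ k))).mono zero_le_one fun i => le_of_eq ?_
      have := H.norm_pos i
      field_simp
    have h3 : JetO J (fun i w => ∑ k : Fin p,
          (pull (fun z => fderiv ℝ (φ i) z (dirXi k)) (z i) (scale 1 ‖(z i).2.2‖) w *
          pull (fun z => fderiv ℝ (φ i) z (dirXi k)) (z i) (scale 1 ‖(z i).2.2‖) w))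
        fun i => B i ^ 2 :=
      JetO.sum _ fun k _ => ((H.jetO_dXi hJ k).mul (H.jetO_dXi hJ k)).mono zero_le_one
        fun i => le_of_eq (by ring)
    refine (h2.add h3).congr fun i => ?_
    have hc : Tendsto (fun w => z i + scale 1 ‖(z i).2.2‖ w) (𝓝 0) (𝓝 (z i)) := by
      have : Continuous fun w : Z n' n p => z i + scale 1 ‖(z i).2.2‖ w := by fun_prop
      simpa using this.tendsto 0
    filter_upwards [hc.eventually ((isOpen_dom₀ p Ω' Ω).mem_nhds (H.mem i))] with w hw
    simp only [pull, (H.phase i).gradSq_normalize hw]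
    simp only [sq]
  refine (h1.inv (fun i => one_le_pow₀ (H.one_le i)) H.one_le fun i => ?_).mono zero_le_one
    fun i => le_of_eq ?_
  · simpa [pull] using H.grad i
  · rw [← pow_mul, ← pow_add, one_mul]
    congr 1
    ring

theorem jetO_cutoff {χ : Rn p → ℂ} (hχ : IsCutoff χ) (J : ℕ) :
    JetO J (fun i => pull (fun z => χ z.2.2) (z i) (scale 1 ‖(z i).2.2‖)) (fun _ => 1) ∧
    JetO J (fun i => pull (fun z => χ z.2.2) (z i) (scale 1 ‖(z i).2.2‖))
      fun i => ‖(z i).2.2‖⁻¹ := by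
  obtain ⟨C, hC, h⟩ := exists_jetLe_cutoff hχ J
  let S := (ContinuousLinearMap.snd ℝ (Rn n) (Rn p)).comp
      (ContinuousLinearMap.snd ℝ (Rn n') (Rn n × Rn p))
  have key : ∀ i c, JetLe J (fun w => χ ((z i).2.2 + ‖(z i).2.2‖ • w)) 0 c →
      JetLe J (pull (fun z => χ z.2.2) (z i) (scale 1 ‖(z i).2.2‖)) 0 c := by
    intro i c hc
    have h1 : JetLe J (fun w => χ ((z i).2.2 + ‖(z i).2.2‖ • w)) (S 0) c := by
      rwa [map_zero]
    have h2 := h1.comp_clm S norm_snd_snd_le le_rfl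
    rwa [one_pow, one_mul] at h2
  exact ⟨⟨C, hC, fun i => key i _ (by simpa using (h _).1)⟩,
    ⟨C, hC, fun i => key i _ ((h _).2 (H.mem i).2.2)⟩⟩

theorem jetO_coeffA {χ : Rn p → ℂ} (hχ : IsCutoff χ) {J : ℕ} (hJ : J + 1 ≤ N) (j : Fin p) :
    JetO J (fun i => pull (coeffA χ (φ i) j) (z i) (scale 1 ‖(z i).2.2‖))
      fun i => B i ^ (3 * J + 2) := by
  have h1 : JetO J (fun i w => 1 - pull (fun z => χ z.2.2) (z i) (scale 1 ‖(z i).2.2‖) w)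
      (fun _ => 1) := by
    have := (JetO.const (ι := ι) (E := Z n' n p) (j := J) (1 : ℂ)).add
      ((H.jetO_cutoff hχ J).1.clm_comp (-ContinuousLinearMap.id ℝ ℂ))
    simpa [sub_eq_add_neg] using this
  exact ((((JetO.const Complex.I).mul h1).mul (H.jetO_gradInv hJ).ofReal).mul
    (H.jetO_dXi hJ j).ofReal).mono zero_le_one fun i => le_of_eq (by ring)

theorem jetO_coeffB {χ : Rn p → ℂ} (hχ : IsCutoff χ) {J : ℕ} (hJ : J + 1 ≤ N) (k : Fin n) :
    JetO J (fun i => pull (coeffB χ (φ i) k) (z i) (scale 1 ‖(z i).2.2‖))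
      fun i => B i ^ (3 * J + 2) * ‖(z i).2.2‖⁻¹ := by
  have h1 : JetO J (fun i w => 1 - pull (fun z => χ z.2.2) (z i) (scale 1 ‖(z i).2.2‖) w)
      (fun _ => 1) := by
    have := (JetO.const (ι := ι) (E := Z n' n p) (j := J) (1 : ℂ)).add
      ((H.jetO_cutoff hχ J).1.clm_comp (-ContinuousLinearMap.id ℝ ℂ))
    simpa [sub_eq_add_neg] using this
  refine (((((JetO.const Complex.I).mul h1).mul (H.jetO_invNormSq J).ofReal).mul
    (H.jetO_gradInv hJ).ofReal).mul (H.jetO_dY hJ k).ofReal).mono zero_le_one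
    fun i => le_of_eq ?_
  have := H.norm_pos i
  field_simp
  ring

/-- The derivatives of $a_j$ and $b_k$ use jets of order $J+1$ of these coefficients, whence the
exponent $3(J+1)+2=3J+5$. A $\xi$-derivative of $a_j$ gains $|\xi|^{-1}$, and $b_k$ has this factor
already. -/
theorem jetO_coeffC {χ : Rn p → ℂ} (hχ : IsCutoff χ) {J : ℕ} (hJ : J + 2 ≤ N) :
    JetO J (fun i => pull (coeffC χ (φ i)) (z i) (scale 1 ‖(z i).2.2‖))
      fun i => B i ^ (3 * J + 5) * ‖(z i).2.2‖⁻¹ := by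
  have hr := fun i => H.norm_pos i
  have h1 := (H.jetO_cutoff hχ J).2.mono (V := fun i => B i ^ (3 * J + 5) * ‖(z i).2.2‖⁻¹)
    zero_le_one fun i => by
      rw [one_mul]
      exact le_mul_of_one_le_left (inv_nonneg.2 (hr i).le) (one_le_pow₀ (H.one_le i))
  have h2 : ∀ j : Fin p, JetO J (fun i => pull (fun z => fderiv ℝ (coeffA χ (φ i) j) z (dirXi j))
      (z i) (scale 1 ‖(z i).2.2‖)) fun i => B i ^ (3 * J + 5) * ‖(z i).2.2‖⁻¹ := fun j =>
    ((H.jetO_coeffA hχ hJ j).fderiv_dir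
      (fun i => H.contDiffAt ((H.phase i).contDiffOn_coeffA hχ j) i)
      (fun i => scale_dirXi (hr i) 1 j) (ρ := fun i => ‖(z i).2.2‖⁻¹) fun i => by
        rw [norm_smul, norm_dirXi, mul_one, norm_inv, norm_norm]).mono zero_le_one
      fun i => le_of_eq (by ring)
  have h3 : ∀ k : Fin n, JetO J (fun i => pull (fun z => fderiv ℝ (coeffB χ (φ i) k) z (dirY k))
      (z i) (scale 1 ‖(z i).2.2‖)) fun i => B i ^ (3 * J + 5) * ‖(z i).2.2‖⁻¹ := fun k =>
    ((H.jetO_coeffB hχ hJ k).fderiv_dir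
      (fun i => H.contDiffAt ((H.phase i).contDiffOn_coeffB hχ k) i)
      (fun i => scale_dirY one_pos ‖(z i).2.2‖ k) (ρ := fun _ => 1) fun i => by
        simp [norm_dirY]).mono zero_le_one
      fun i => le_of_eq (by ring)
  exact (h1.add (JetO.sum _ fun j _ => h2 j)).add (JetO.sum _ fun k _ => h3 k)

end IsPhaseFamily

end PhaseFamilies

/-! ### The order of the iterates of `L_φ` -/

section Iterates

variable {n' n p : ℕ} {Ω' : Opens (Rn n')} {Ω : Opens (Rn n)} {ι : Type*}

/-- The scaling of the variables adapted to symbols of type `(ρ, δ)` at `z`. -/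
def symScale (ρ δ : ℝ) (z : Z n' n p) : Z n' n p →L[ℝ] Z n' n p :=
  scale (jap z.2.2 ^ (-δ)) (jap z.2.2 ^ ρ)

theorem jap_rpow_neg_le_one (ξ : Rn p) {δ : ℝ} (hδ : 0 ≤ δ) : jap ξ ^ (-δ) ≤ 1 :=
  Real.rpow_le_one_of_one_le_of_nonpos (one_le_jap ξ) (by linarith)

theorem jap_rpow_le_jap (ξ : Rn p) {ρ : ℝ} (hρ : ρ ≤ 1) : jap ξ ^ ρ ≤ jap ξ := by
  simpa using Real.rpow_le_rpow_of_exponent_le (one_le_jap ξ) hρ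

theorem jap_le_nine_mul {ξ : Rn p} (hξ : 1 / 8 ≤ ‖ξ‖) : jap ξ ≤ 9 * ‖ξ‖ := by
  have := jap_le ξ
  linarith

/-- For $|\xi|\ge1/8$ the scaling of type $(\rho,\delta)$ is the homogeneous one followed by a
bounded map, since $\langle\xi\rangle^{-\delta}\le1$ and
$\langle\xi\rangle^{\rho}\le\langle\xi\rangle\le9|\xi|$. The threshold $1/8$ stays below $1/4$,
where $L_\phi$ becomes the identity. -/
theorem JetO.symScale_of_scale {j : ℕ} {F : Type*} [NormedAddCommGroup F] [NormedSpace ℝ F]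
    {f : ι → Z n' n p → F} {z : ι → Z n' n p} {W : ι → ℝ}
    (hf : JetO j (fun i => pull (f i) (z i) (scale 1 ‖(z i).2.2‖)) W)
    (hz : ∀ i, 1 / 8 ≤ ‖(z i).2.2‖) {ρ δ : ℝ} (hρ : ρ ≤ 1) (hδ : 0 ≤ δ) :
    JetO j (fun i => pull (f i) (z i) (symScale ρ δ (z i))) W := by
  refine hf.pull_clm (r := 9) _
    (fun i => scale (jap (z i).2.2 ^ (-δ)) (jap (z i).2.2 ^ ρ * ‖(z i).2.2‖⁻¹)) (fun i => ?_)
    (by norm_num) fun i => ?_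
  · have : 0 < ‖(z i).2.2‖ := by linarith [hz i]
    rw [scale_comp, symScale]
    congr 1
    · rw [one_mul]
    · field_simp
  · have h0 : 0 < ‖(z i).2.2‖ := by linarith [hz i]
    have h1 := jap_pos (z i).2.2
    refine norm_scale_le ?_ ?_
    · rw [abs_of_nonneg (by positivity)]
      linarith [jap_rpow_neg_le_one (z i).2.2 hδ]
    · rw [abs_of_nonneg (by positivity), ← div_eq_mul_inv, div_le_iff₀ h0]
      exact (jap_rpow_le_jap _ hρ).trans (jap_le_nine_mul (hz i))

namespace IsPhaseFamily

variable {N : ℕ} {φ : ι → Z n' n p → ℝ} {z : ι → Z n' n p} {B : ι → ℝ}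

/-- The gain of one application of $L_\phi$. The terms $a_j\partial_{\xi_j}$ contribute
$\langle\xi\rangle^{-\rho}$, the terms $b_k\partial_{y_k}$ contribute
$|\xi|^{-1}\langle\xi\rangle^{\delta}$, and $c$ contributes $|\xi|^{-1}$; up to constants each is at
most $\langle\xi\rangle^{-\min\{\rho,1-\delta\}}$. -/
theorem jetO_opL (H : IsPhaseFamily Ω' Ω N φ z B) (hz : ∀ i, 1 / 8 ≤ ‖(z i).2.2‖) {ρ δ : ℝ}
    (hρ : ρ ≤ 1) (hδ : 0 ≤ δ) {χ : Rn p → ℂ} (hχ : IsCutoff χ) {J : ℕ} (hJ : J + 2 ≤ N)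
    {f : ι → Z n' n p → ℂ} (hf : ∀ i, ContDiffOn ℝ ∞ (f i) (dom₀ p Ω' Ω)) {W : ι → ℝ}
    (hW : ∀ i, 0 ≤ W i) (hfW : JetO (J + 1) (fun i => pull (f i) (z i) (symScale ρ δ (z i))) W) :
    JetO J (fun i => pull (opL χ (φ i) (f i)) (z i) (symScale ρ δ (z i)))
      fun i => B i ^ (3 * J + 5) * (jap (z i).2.2 ^ (-min ρ (1 - δ)) * W i) := by
  have hr := fun i => H.norm_pos i
  have hl := fun i => jap_pos (z i).2.2
  have hl1 := fun i => one_le_jap (z i).2.2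
  have hB : ∀ i, B i ^ (3 * J + 2) ≤ B i ^ (3 * J + 5) := fun i =>
    pow_le_pow_right₀ (H.one_le i) (by omega)
  have hB0 : ∀ i, 0 ≤ B i := fun i => zero_le_one.trans (H.one_le i)
  have hlam : ∀ i, ‖(z i).2.2‖⁻¹ ≤ 9 * (jap (z i).2.2)⁻¹ := fun i => by
    rw [← div_eq_mul_inv, le_div_iff₀ (hl i), inv_mul_le_iff₀ (hr i), mul_comm]
    exact jap_le_nine_mul (hz i)
  have hs1 : ∀ i, jap (z i).2.2 ^ (-ρ) ≤ jap (z i).2.2 ^ (-min ρ (1 - δ)) := fun i =>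
    Real.rpow_le_rpow_of_exponent_le (hl1 i) (neg_le_neg (min_le_left _ _))
  have hs2 : ∀ i, ‖(z i).2.2‖⁻¹ * jap (z i).2.2 ^ δ ≤
      9 * jap (z i).2.2 ^ (-min ρ (1 - δ)) := fun i => by
    refine (mul_le_mul_of_nonneg_right (hlam i) (by have := hl i; positivity)).trans ?_
    rw [mul_assoc]
    refine mul_le_mul_of_nonneg_left ?_ (by norm_num)
    rw [← Real.rpow_neg_one, ← Real.rpow_add (hl i)]
    exact Real.rpow_le_rpow_of_exponent_le (hl1 i) (by linarith [min_le_right ρ (1 - δ)])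
  have hs3 : ∀ i, ‖(z i).2.2‖⁻¹ ≤ 9 * jap (z i).2.2 ^ (-min ρ (1 - δ)) := fun i => by
    refine (hlam i).trans (mul_le_mul_of_nonneg_left ?_ (by norm_num))
    rw [← Real.rpow_neg_one]
    exact Real.rpow_le_rpow_of_exponent_le (hl1 i) (by linarith [min_le_left ρ (1 - δ)])
  have hsm : ∀ i, ContDiffAt ℝ ∞ (f i) (z i) := fun i => H.contDiffAt (hf i) i
  have h1 : ∀ j : Fin p, JetO J (fun i w => pull (coeffA χ (φ i) j) (z i) (symScale ρ δ (z i)) w *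
      pull (fun z => fderiv ℝ (f i) z (dirXi j)) (z i) (symScale ρ δ (z i)) w)
      fun i => B i ^ (3 * J + 5) * (jap (z i).2.2 ^ (-min ρ (1 - δ)) * W i) := fun j => by
    have hd := hfW.fderiv_dir hsm (v := dirXi j)
      (v' := fun i => (jap (z i).2.2 ^ ρ)⁻¹ • dirXi j)
      (fun i => scale_dirXi (by have := hl i; positivity) _ j)
      (ρ := fun i => jap (z i).2.2 ^ (-ρ)) fun i => by
        rw [norm_smul, norm_dirXi, mul_one, norm_inv, Real.rpow_neg (hl i).le,
          Real.norm_of_nonneg (by have := hl i; positivity)]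
    refine (((H.jetO_coeffA hχ (by omega : J + 1 ≤ N) j).symScale_of_scale hz hρ hδ).mul hd).mono
      zero_le_one fun i => ?_
    rw [one_mul]
    have := hl i
    have := hW i
    have := hB0 i
    gcongr ?_ * (?_ * ?_)
    · exact hB i
    · exact hs1 i
  have h2 : ∀ k : Fin n, JetO J (fun i w => pull (coeffB χ (φ i) k) (z i) (symScale ρ δ (z i)) w *
      pull (fun z => fderiv ℝ (f i) z (dirY k)) (z i) (symScale ρ δ (z i)) w)
      fun i => B i ^ (3 * J + 5) * (jap (z i).2.2 ^ (-min ρ (1 - δ)) * W i) := fun k => by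
    have hd := hfW.fderiv_dir hsm (v := dirY k)
      (v' := fun i => (jap (z i).2.2 ^ (-δ))⁻¹ • dirY k)
      (fun i => scale_dirY (by have := hl i; positivity) _ k)
      (ρ := fun i => jap (z i).2.2 ^ δ) fun i => by
        rw [norm_smul, norm_dirY, mul_one, norm_inv, Real.rpow_neg (hl i).le, norm_inv, inv_inv,
          Real.norm_of_nonneg (by have := hl i; positivity)]
    refine (((H.jetO_coeffB hχ (by omega : J + 1 ≤ N) k).symScale_of_scale hz hρ hδ).mul hd).mono
      (K := 9) (by norm_num) fun i => ?_
    have h3 := hs2 i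
    have := hl i
    have h4 := hW i
    have := hB0 i
    calc B i ^ (3 * J + 2) * ‖(z i).2.2‖⁻¹ * (jap (z i).2.2 ^ δ * W i) =
        B i ^ (3 * J + 2) * (‖(z i).2.2‖⁻¹ * jap (z i).2.2 ^ δ * W i) := by ring
      _ ≤ B i ^ (3 * J + 5) * (9 * jap (z i).2.2 ^ (-min ρ (1 - δ)) * W i) := by
        refine mul_le_mul (hB i) (mul_le_mul_of_nonneg_right h3 h4) ?_ (by positivity)
        positivity
      _ = _ := by ring
  have h3 : JetO J (fun i w => pull (coeffC χ (φ i)) (z i) (symScale ρ δ (z i)) w *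
      pull (f i) (z i) (symScale ρ δ (z i)) w)
      fun i => B i ^ (3 * J + 5) * (jap (z i).2.2 ^ (-min ρ (1 - δ)) * W i) := by
    refine (((H.jetO_coeffC hχ hJ).symScale_of_scale hz hρ hδ).mul
      (hfW.of_le (Nat.le_succ J))).mono (K := 9) (by norm_num) fun i => ?_
    have h3 := hs3 i
    have := hl i
    have h4 := hW i
    have := hB0 i
    calc B i ^ (3 * J + 5) * ‖(z i).2.2‖⁻¹ * W i =
        B i ^ (3 * J + 5) * (‖(z i).2.2‖⁻¹ * W i) := by ring
      _ ≤ B i ^ (3 * J + 5) * (9 * jap (z i).2.2 ^ (-min ρ (1 - δ)) * W i) := by gcongr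
      _ = _ := by ring
  exact ((JetO.sum _ fun j _ => h1 j).add (JetO.sum _ fun k _ => h2 k)).add h3

/-- Each application consumes one order of the jet of $f$ and multiplies by a power of $B$. The
exponent of $B$ is not sharp; what matters is that it depends only on $h$ and $k$. -/
theorem jetO_opL_iterate (H : IsPhaseFamily Ω' Ω N φ z B) (hz : ∀ i, 1 / 8 ≤ ‖(z i).2.2‖) {ρ δ : ℝ}
    (hρ : ρ ≤ 1) (hδ : 0 ≤ δ) {χ : Rn p → ℂ} (hχ : IsCutoff χ) (h : ℕ) {k : ℕ}
    (hN : k + h + 1 ≤ N) {f : ι → Z n' n p → ℂ} (hf : ∀ i, ContDiffOn ℝ ∞ (f i) (dom₀ p Ω' Ω))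
    {W : ι → ℝ} (hW : ∀ i, 0 ≤ W i)
    (hfW : JetO (k + h) (fun i => pull (f i) (z i) (symScale ρ δ (z i))) W) :
    JetO k (fun i => pull ((opL χ (φ i))^[h] (f i)) (z i) (symScale ρ δ (z i)))
      fun i => B i ^ (h * (3 * (k + h) + 5)) * (jap (z i).2.2 ^ (-(h * min ρ (1 - δ))) * W i) := by
  induction h generalizing f W with
  | zero => simpa using hfW
  | succ h ih =>
    have h1 := H.jetO_opL hz hρ hδ hχ (J := k + h) (by omega) hf hW hfW
    have hl := fun i => jap_pos (z i).2.2
    have hB0 : ∀ i, 0 ≤ B i := fun i => zero_le_one.trans (H.one_le i)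
    have h2 := ih (by omega) (fun i => (H.phase i).contDiffOn_opL hχ (hf i)) (fun i => by
      have := hl i
      have := hB0 i
      have := hW i
      positivity) h1
    simp only [Function.iterate_succ_apply]
    refine h2.mono zero_le_one fun i => ?_
    have h3 : jap (z i).2.2 ^ (-(((h + 1 : ℕ) : ℝ) * min ρ (1 - δ))) =
        jap (z i).2.2 ^ (-(h * min ρ (1 - δ))) * jap (z i).2.2 ^ (-min ρ (1 - δ)) := by
      rw [← Real.rpow_add (hl i)]
      congr 1
      push_cast
      ring
    have h4 : B i ^ (h * (3 * (k + h) + 5) + (3 * (k + h) + 5)) ≤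
        B i ^ ((h + 1) * (3 * (k + (h + 1)) + 5)) := by
      refine pow_le_pow_right₀ (H.one_le i) ?_
      nlinarith
    rw [h3, one_mul]
    have := hl i
    have := hW i
    calc _ = B i ^ (h * (3 * (k + h) + 5) + (3 * (k + h) + 5)) *
          (jap (z i).2.2 ^ (-(h * min ρ (1 - δ))) * jap (z i).2.2 ^ (-min ρ (1 - δ)) * W i) := by
            rw [pow_add]
            ring
      _ ≤ _ := by gcongr

end IsPhaseFamily

/-- The jets of order `N` of `φ` at `z` and the size of its gradient are controlled by `B`. -/
def PhaseBoundAt (N : ℕ) (φ : Z n' n p → ℝ) (B : ℝ) (z : Z n' n p) : Prop :=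
  z.2.2 ≠ 0 → JetLe N (pull φ z (scale 1 ‖z.2.2‖)) 0 (B * ‖z.2.2‖) ∧
    1 ≤ B * gradSq φ (normalize z)

/-- The constants are uniform over all phases, amplitudes and points, and the region near $\xi=0$ is
included. -/
theorem exists_jetLe_opL_iterate (Ω' : Opens (Rn n')) (Ω : Opens (Rn n)) {ρ δ : ℝ} (hρ : ρ ≤ 1)
    (hδ : 0 ≤ δ) {χ : Rn p → ℂ} (hχ : IsCutoff χ) (h k : ℕ) :
    ∃ (C : ℝ) (M : ℕ), 0 ≤ C ∧ ∀ (φ : Z n' n p → ℝ) (f : Z n' n p → ℂ) (z : Z n' n p) (B c : ℝ),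
      IsPhase p Ω' Ω φ → ContDiffOn ℝ ∞ f (dom p Ω' Ω) → z ∈ dom p Ω' Ω → 1 ≤ B →
      PhaseBoundAt (k + h + 1) φ B z → JetLe (k + h) (pull f z (symScale ρ δ z)) 0 c →
      JetLe k (pull ((opL χ φ)^[h] f) z (symScale ρ δ z)) 0
        (C * B ^ M * jap z.2.2 ^ (-(h * min ρ (1 - δ))) * c) := by
  -- All admissible data with $|\xi|\ge1/8$ are made into one family, so the constant in `JetO` is
  -- automatically uniform.
  let I := {d : (Z n' n p → ℝ) × (Z n' n p → ℂ) × Z n' n p × ℝ × ℝ //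
    IsPhase p Ω' Ω d.1 ∧ ContDiffOn ℝ ∞ d.2.1 (dom p Ω' Ω) ∧ d.2.2.1 ∈ dom p Ω' Ω ∧
    1 ≤ d.2.2.2.1 ∧ PhaseBoundAt (k + h + 1) d.1 d.2.2.2.1 d.2.2.1 ∧
    JetLe (k + h) (pull d.2.1 d.2.2.1 (symScale ρ δ d.2.2.1)) 0 d.2.2.2.2 ∧
    1 / 8 ≤ ‖d.2.2.1.2.2‖}
  have hne : ∀ i : I, i.1.2.2.1.2.2 ≠ 0 := fun i hi => by
    have := i.2.2.2.2.2.2.2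
    rw [hi, norm_zero] at this
    norm_num at this
  have H : IsPhaseFamily Ω' Ω (k + h + 1) (fun i : I => i.1.1) (fun i : I => i.1.2.2.1)
      (fun i : I => i.1.2.2.2.1) :=
    ⟨fun i => i.2.1, fun i => ⟨i.2.2.2.1.1, i.2.2.2.1.2.1, hne i⟩, fun i => i.2.2.2.2.1,
      ⟨1, zero_le_one, fun i => by simpa using (i.2.2.2.2.2.1 (hne i)).1⟩,
      fun i => (i.2.2.2.2.2.1 (hne i)).2⟩
  obtain ⟨C, hC, hJ⟩ := H.jetO_opL_iterate (fun i : I => i.2.2.2.2.2.2.2) hρ hδ hχ h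
    (k := k) le_rfl (f := fun i : I => i.1.2.1) (fun i => i.2.2.1.mono dom₀_subset_dom)
    (W := fun i : I => i.1.2.2.2.2) (fun i => i.2.2.2.2.2.2.1.nonneg)
    ⟨1, zero_le_one, fun i => by simpa using i.2.2.2.2.2.2.1⟩
  -- The summand $2^h$ serves $|\xi|<1/8$, where $L_\phi^h$ is the identity: there
  -- $\langle\xi\rangle\le2$ and $hs\le h$, so $2^h\langle\xi\rangle^{-hs}\ge1$.
  refine ⟨C + 2 ^ h, h * (3 * (k + h) + 5), by positivity, fun φ f z B c hφ hf hz hB hφB hfc => ?_⟩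
  have hl := jap_pos z.2.2
  have hc := hfc.nonneg
  have hB0 : 0 ≤ B := by linarith
  rcases le_or_gt (1 / 8) ‖z.2.2‖ with h8 | h8
  · refine (hJ ⟨(φ, f, z, B, c), hφ, hf, hz, hB, hφB, hfc, h8⟩).mono ?_
    calc C * (B ^ (h * (3 * (k + h) + 5)) * (jap z.2.2 ^ (-(h * min ρ (1 - δ))) * c))
        = C * B ^ (h * (3 * (k + h) + 5)) * jap z.2.2 ^ (-(h * min ρ (1 - δ))) * c := by ring
      _ ≤ _ := by
        gcongr
        linarith [pow_pos (two_pos (α := ℝ)) h]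
  · have h1 : JetLe k (pull ((opL χ φ)^[h] f) z (symScale ρ δ z)) 0 c := by
      refine (hfc.of_le (Nat.le_add_right k h)).congr ?_
      have hc : Tendsto (fun w => z + symScale ρ δ z w) (𝓝 0) (𝓝 z) := by
        have : Continuous fun w : Z n' n p => z + symScale ρ δ z w := by fun_prop
        simpa using this.tendsto 0
      filter_upwards [hc.eventually (eventually_norm_lt (h8.trans (by norm_num : (1:ℝ)/8 < 1/4)))]
        with w hw
      exact opL_iterate_of_norm_lt hχ φ h f hw
    refine h1.mono ?_
    have h2 : jap z.2.2 ^ (h * min ρ (1 - δ)) ≤ 2 ^ h := by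
      have h3 : jap z.2.2 ≤ 2 := by linarith [jap_le z.2.2]
      have h4 : (h : ℝ) * min ρ (1 - δ) ≤ h := by
        have : min ρ (1 - δ) ≤ 1 := (min_le_left _ _).trans hρ
        nlinarith [Nat.cast_nonneg (α := ℝ) h]
      refine (Real.rpow_le_rpow_of_exponent_le (one_le_jap _) h4).trans ?_
      rw [Real.rpow_natCast]
      exact pow_le_pow_left₀ hl.le h3 h
    have h5 : 1 ≤ (C + 2 ^ h) * B ^ (h * (3 * (k + h) + 5)) *
        jap z.2.2 ^ (-(h * min ρ (1 - δ))) := by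
      rw [Real.rpow_neg hl.le, ← div_eq_mul_inv, one_le_div (by positivity)]
      refine h2.trans ?_
      have h6 : 1 ≤ B ^ (h * (3 * (k + h) + 5)) := one_le_pow₀ hB
      have h7 : (0 : ℝ) < 2 ^ h := by positivity
      nlinarith
    exact le_mul_of_one_le_left hc h5

/-- The `x`-derivatives of `e^{iφ} L_φ^h f`. -/
theorem exists_bound_slice (Ω' : Opens (Rn n')) (Ω : Opens (Rn n)) {ρ δ : ℝ} (hρ : ρ ≤ 1)
    (hδ : 0 ≤ δ) (hδ1 : δ ≤ 1) {χ : Rn p → ℂ} (hχ : IsCutoff χ) (h k : ℕ) :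
    ∃ (C : ℝ) (M : ℕ), 0 ≤ C ∧ ∀ (φ : Z n' n p → ℝ) (f : Z n' n p → ℂ) (z : Z n' n p) (B c : ℝ),
      IsPhase p Ω' Ω φ → ContDiffOn ℝ ∞ f (dom p Ω' Ω) → z ∈ dom p Ω' Ω → 1 ≤ B →
      PhaseBoundAt (k + h + 1) φ B z → JetLe (k + h) (pull f z (symScale ρ δ z)) 0 c →
      JetLe k (fun x => Complex.exp (Complex.I * (φ (x, z.2) : ℝ)) * (opL χ φ)^[h] f (x, z.2)) z.1
        (C * B ^ M * jap z.2.2 ^ (-(h * min ρ (1 - δ)) + k) * c) := by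
  obtain ⟨C, M, hC, hCM⟩ := exists_jetLe_opL_iterate Ω' Ω hρ hδ hχ h k
  refine ⟨2 ^ k * (k.factorial * C), k + M, by positivity, fun φ f z B c hφ hf hz hB hφB hfc => ?_⟩
  have hl := jap_pos z.2.2
  have hl1 := one_le_jap z.2.2
  have hB0 : 0 ≤ B := by linarith
  have hc := hfc.nonneg
  set lam := jap z.2.2 with hlam
  -- The variable $x$ is rescaled by $\langle\xi\rangle^{-1}$. A derivative of order at least one
  -- then gains at least one factor $\langle\xi\rangle^{-1}$, which compensates the size $B|\xi|$ of
  -- the phase.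
  have hA : JetLe k (fun x => Complex.exp (Complex.I *
      (pull φ z (xIncl lam⁻¹ : Rn n' →L[ℝ] Z n' n p) x : ℝ))) 0 (k.factorial * B ^ k) := by
    -- At $\xi=0$ the phase vanishes for all nearby $x$, and the exponential is constant.
    by_cases h0 : z.2.2 = 0
    · have hev : (fun x => Complex.exp (Complex.I *
          (pull φ z (xIncl lam⁻¹ : Rn n' →L[ℝ] Z n' n p) x : ℝ))) =ᶠ[𝓝 0]
          fun _ => Complex.exp (Complex.I * ((0 : ℝ) : ℂ)) := by
        have hc : Tendsto (fun w => z + (xIncl lam⁻¹ : Rn n' →L[ℝ] Z n' n p) w) (𝓝 0) (𝓝 z) := by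
          have : Continuous fun w => z + (xIncl lam⁻¹ : Rn n' →L[ℝ] Z n' n p) w := by fun_prop
          simpa using this.tendsto 0
        filter_upwards [hc.eventually ((isOpen_dom p Ω' Ω).mem_nhds hz)] with w hw
        have : pull φ z (xIncl lam⁻¹ : Rn n' →L[ℝ] Z n' n p) w = 0 :=
          hφ.eq_zero_of_xi hw (by simp [xIncl_apply, h0])
        rw [this]
      refine ((JetLe.const _).mono ?_).congr hev
      have h1 : (1 : ℝ) ≤ k.factorial := by exact_mod_cast Nat.one_le_iff_ne_zero.2 k.factorial_ne_zero
      have h2 : (1 : ℝ) ≤ B ^ k := one_le_pow₀ hB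
      simpa using one_le_mul_of_one_le_of_one_le h1 h2
    · have hj := ((hφB h0).1).of_le (show k ≤ k + h + 1 by omega)
      have hr : 0 < ‖z.2.2‖ := norm_pos_iff.2 h0
      have hcomp : pull φ z (xIncl lam⁻¹ : Rn n' →L[ℝ] Z n' n p) = fun x =>
          pull φ z (scale 1 ‖z.2.2‖) ((xIncl lam⁻¹ : Rn n' →L[ℝ] Z n' n p) x) := by
        funext x
        have := congrArg (fun L => L x)
          (scale_comp_xIncl (n' := n') (n := n) (p := p) 1 ‖z.2.2‖ lam⁻¹)
        simp only [ContinuousLinearMap.comp_apply, one_mul] at this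
        simp only [pull, this]
      have hj0 : ContDiffAt ℝ k (pull φ z (scale 1 ‖z.2.2‖))
          ((xIncl lam⁻¹ : Rn n' →L[ℝ] Z n' n p) 0) := by
        rw [map_zero]
        exact hj.1
      refine jetLe_exp_I_mul ?_ hB fun i h1 hi => ?_
      · rw [hcomp]
        exact hj0.comp 0 (xIncl lam⁻¹ : Rn n' →L[ℝ] Z n' n p).contDiff.contDiffAt
      · rw [hcomp]
        refine (norm_iteratedFDeriv_comp_clm_le (xIncl lam⁻¹ : Rn n' →L[ℝ] Z n' n p) hj0 hi).trans ?_
        have h2 : ‖(xIncl lam⁻¹ : Rn n' →L[ℝ] Z n' n p)‖ ≤ lam⁻¹ :=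
          norm_xIncl_le (by rw [abs_of_nonneg (by positivity)])
        have h3 : lam⁻¹ ^ i ≤ lam⁻¹ :=
          pow_le_of_le_one (by positivity) (inv_le_one_of_one_le₀ hl1) (by omega)
        have h4 := hj.2 i hi
        rw [map_zero]
        calc _ ≤ lam⁻¹ * (B * ‖z.2.2‖) :=
              mul_le_mul ((pow_le_pow_left₀ (norm_nonneg _) h2 i).trans h3) h4 (norm_nonneg _)
                (by positivity)
          _ = B * (lam⁻¹ * ‖z.2.2‖) := by ring
          _ ≤ B * 1 := by
              gcongr
              rw [inv_mul_le_one₀ hl]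
              exact norm_le_jap _
          _ = B := mul_one B
  -- As $\delta\le1$, the scale $\langle\xi\rangle^{-1}$ in $x$ is at most the scale
  -- $\langle\xi\rangle^{-\delta}$ of the symbol chart, so this restriction does not increase the
  -- bound.
  have hL : JetLe k (pull ((opL χ φ)^[h] f) z (xIncl lam⁻¹ : Rn n' →L[ℝ] Z n' n p)) 0
      (C * B ^ M * lam ^ (-(h * min ρ (1 - δ))) * c) := by
    have h1 := hCM φ f z B c hφ hf hz hB hφB hfc
    have h2 : JetLe k (pull ((opL χ φ)^[h] f) z (symScale ρ δ z))
        ((xIncl (lam ^ δ * lam⁻¹) : Rn n' →L[ℝ] Z n' n p) 0)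
        (C * B ^ M * lam ^ (-(h * min ρ (1 - δ))) * c) := by
      rw [map_zero]
      exact h1
    have h3 := h2.comp_clm (r := 1) (xIncl (lam ^ δ * lam⁻¹) : Rn n' →L[ℝ] Z n' n p)
      (norm_xIncl_le (by
        rw [abs_of_nonneg (by positivity), ← div_eq_mul_inv, div_le_one hl]
        exact jap_rpow_le_jap _ hδ1)) le_rfl
    rw [one_pow, one_mul] at h3
    have hcomp : pull ((opL χ φ)^[h] f) z (xIncl lam⁻¹ : Rn n' →L[ℝ] Z n' n p) = fun x =>
        pull ((opL χ φ)^[h] f) z (symScale ρ δ z)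
          ((xIncl (lam ^ δ * lam⁻¹) : Rn n' →L[ℝ] Z n' n p) x) := by
      funext x
      have := congrArg (fun L => L x)
        (scale_comp_xIncl (n' := n') (n := n) (p := p) (lam ^ (-δ)) (lam ^ ρ) (lam ^ δ * lam⁻¹))
      have h4 : lam ^ (-δ) * (lam ^ δ * lam⁻¹) = lam⁻¹ := by
        rw [← mul_assoc, ← Real.rpow_add hl]
        simp
      rw [h4] at this
      simp only [ContinuousLinearMap.comp_apply] at this
      simp only [pull, symScale, ← hlam, this]
    rwa [hcomp]
  have hG := hA.mul hL
  set G : Rn n' → ℂ := fun x =>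
    Complex.exp (Complex.I * (φ (x, z.2) : ℝ)) * (opL χ φ)^[h] f (x, z.2) with hGdef
  have h5 : JetLe k (fun x => Complex.exp (Complex.I *
      (pull φ z (xIncl lam⁻¹ : Rn n' →L[ℝ] Z n' n p) x : ℝ)) *
      pull ((opL χ φ)^[h] f) z (xIncl lam⁻¹ : Rn n' →L[ℝ] Z n' n p) x)
      ((lam • ContinuousLinearMap.id ℝ (Rn n')) 0)
      (2 ^ k * (k.factorial * B ^ k * (C * B ^ M * lam ^ (-(h * min ρ (1 - δ))) * c))) := by
    rw [map_zero]
    exact hG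
  -- Undoing the rescaling of $x$ costs $\langle\xi\rangle^{k}$.
  have h6 := h5.comp_clm (lam • ContinuousLinearMap.id ℝ (Rn n')) (r := lam) (by
    rw [norm_smul, Real.norm_of_nonneg hl.le]
    exact mul_le_of_le_one_right hl.le ContinuousLinearMap.norm_id_le) hl1
  have h7 : (fun x => Complex.exp (Complex.I *
      (pull φ z (xIncl lam⁻¹ : Rn n' →L[ℝ] Z n' n p) ((lam • ContinuousLinearMap.id ℝ (Rn n')) x) : ℝ)) *
      pull ((opL χ φ)^[h] f) z (xIncl lam⁻¹ : Rn n' →L[ℝ] Z n' n p)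
        ((lam • ContinuousLinearMap.id ℝ (Rn n')) x)) = fun x => G (z.1 + x) := by
    funext x
    have : z + (xIncl lam⁻¹ : Rn n' →L[ℝ] Z n' n p) ((lam • ContinuousLinearMap.id ℝ (Rn n')) x) =
        (z.1 + x, z.2) := by
      ext <;> simp [xIncl_apply, smul_smul, hl.ne']
    simp only [pull, this, hGdef]
  rw [h7] at h6
  have h8 : lam ^ (-(h * min ρ (1 - δ)) + (k : ℝ)) =
      lam ^ (-(h * min ρ (1 - δ))) * lam ^ k := by
    rw [Real.rpow_add hl, Real.rpow_natCast]
  rw [h8]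
  refine ⟨?_, fun l hlk => ?_⟩
  · have h9 := ContDiffAt.comp z.1 (g := fun x => G (z.1 + x)) (f := fun x => x - z.1)
      (by simpa using h6.1) (contDiffAt_id.sub contDiffAt_const)
    simpa [Function.comp_def] using h9
  · have h9 := h6.2 l hlk
    rw [iteratedFDeriv_comp_add_left, add_zero] at h9
    refine h9.trans (le_of_eq ?_)
    rw [pow_add]
    ring

end Iterates

/-! ### Smooth dependence of integrals on parameters -/

section Parametric

variable {X E : Type*} [NormedAddCommGroup X] [NormedSpace ℝ X] [NormedAddCommGroup E]
  [NormedSpace ℝ E] {α : Type*} [MeasurableSpace α] {μ : Measure α}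

/-- Differentiation under the integral sign, with the derivative identified through its values on
vectors. A curried multilinear integral can then be recognised as $D$ by evaluation. -/
theorem hasFDerivAt_integral_of_fderiv_apply {F : X → α → E} {U : Set X} (hU : IsOpen U)
    {g : α → ℝ} (hg : Integrable g μ) {x : X}
    (hmeas : ∀ x ∈ U, AEStronglyMeasurable (F x) μ) (hint : Integrable (F x) μ)
    (hmeas' : AEStronglyMeasurable (fun w => fderiv ℝ (fun x => F x w) x) μ)
    (hbound : ∀ᵐ w ∂μ, ∀ x ∈ U, ‖fderiv ℝ (fun x => F x w) x‖ ≤ g w)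
    (hdiff : ∀ᵐ w ∂μ, ∀ x ∈ U, HasFDerivAt (fun x => F x w) (fderiv ℝ (fun x => F x w) x) x)
    (hx : x ∈ U) {D : X →L[ℝ] E}
    (hD : ∀ v, Integrable (fun w => fderiv ℝ (fun x => F x w) x v) μ →
      D v = ∫ w, fderiv ℝ (fun x => F x w) x v ∂μ) :
    HasFDerivAt (fun x => ∫ w, F x w ∂μ) D x := by
  have h1 := hasFDerivAt_integral_of_dominated_of_fderiv_le (𝕜 := ℝ) (bound := g)
    (F := F) (F' := fun x w => fderiv ℝ (fun x => F x w) x) (hU.mem_nhds hx)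
    ((hU.eventually_mem hx).mono hmeas) hint hmeas' hbound hg hdiff
  have hint' : Integrable (fun w => fderiv ℝ (fun x => F x w) x) μ :=
    hg.mono' hmeas' (hbound.mono fun w hw => hw x hx)
  convert h1 using 1
  ext v
  rw [ContinuousLinearMap.integral_apply hint', hD v (hint'.apply_continuousLinearMap v)]

/-- The integrals of the derivatives form a Taylor series for the integral: one dominating function
$g$ serves all orders up to $k$, so each order may be differentiated under the integral. -/
theorem jetLe_integral [CompleteSpace E] {F : X → α → E} {U : Set X} (hU : IsOpen U) {k : ℕ} {g : α → ℝ}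
    (hg : Integrable g μ) (hF : ∀ᵐ w ∂μ, ∀ x ∈ U, JetLe k (fun x => F x w) x (g w))
    (hmeas : ∀ x ∈ U, ∀ j ≤ k,
      AEStronglyMeasurable (fun w => iteratedFDeriv ℝ j (fun x => F x w) x) μ) {x : X}
    (hx : x ∈ U) : JetLe k (fun x => ∫ w, F x w ∂μ) x (∫ w, g w ∂μ) := by
  have hint : ∀ x ∈ U, ∀ j ≤ k, Integrable (fun w => iteratedFDeriv ℝ j (fun x => F x w) x) μ :=
    fun x hx j hj => hg.mono' (hmeas x hx j hj) (hF.mono fun w hw => (hw x hx).2 j hj)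
  have hdiff : ∀ᵐ w ∂μ, ∀ j < k, ∀ x ∈ U, HasFDerivAt (iteratedFDeriv ℝ j (fun x => F x w))
      (fderiv ℝ (iteratedFDeriv ℝ j (fun x => F x w)) x) x := by
    filter_upwards [hF] with w hw j hj x hx
    have h1 : ContDiffAt ℝ (1 + j : ℕ) (fun x => F x w) x :=
      (hw x hx).1.of_le (by exact_mod_cast (by omega : 1 + j ≤ k))
    exact ((contDiffAt_iteratedFDeriv h1).differentiableAt (by simp)).hasFDerivAt
  let P : X → FormalMultilinearSeries ℝ X E := fun x j =>
    ∫ w, iteratedFDeriv ℝ j (fun x => F x w) x ∂μ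
  have hder : ∀ j < k, ∀ x ∈ U, HasFDerivAt (P · j) (P x j.succ).curryLeft x := by
    intro j hj x hx
    have hmeas' : AEStronglyMeasurable
        (fun w => fderiv ℝ (iteratedFDeriv ℝ j (fun x => F x w)) x) μ := by
      have h1 := hmeas x hx (j + 1) hj
      exact (continuousMultilinearCurryLeftEquiv ℝ (fun _ : Fin (j + 1) => X)
        E).continuous.comp_aestronglyMeasurable h1
    refine hasFDerivAt_integral_of_fderiv_apply hU hg
      (F := fun x w => iteratedFDeriv ℝ j (fun x => F x w) x)
      (fun y hy => hmeas y hy j hj.le) (hint x hx j hj.le) hmeas'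
      (hF.mono fun w hw y hy => by
        rw [norm_fderiv_iteratedFDeriv]
        exact (hw y hy).2 (j + 1) hj)
      (hdiff.mono fun w hw y hy => hw j hj y hy) hx fun v hv => ?_
    ext m
    rw [ContinuousMultilinearMap.integral_apply hv]
    change (∫ w, iteratedFDeriv ℝ (j + 1) (fun x => F x w) x ∂μ) (Fin.cons v m) = _
    rw [ContinuousMultilinearMap.integral_apply (hint x hx (j + 1) hj)]
    rfl
  have hT : HasFTaylorSeriesUpToOn k (fun x => ∫ w, F x w ∂μ) P U := by
    refine ⟨fun y hy => ?_, fun j hj y hy => ?_, fun j hj y hy => ?_⟩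
    · have h2 := (continuousMultilinearCurryFin0 ℝ X
        E).toContinuousLinearEquiv.toContinuousLinearMap.integral_comp_comm (hint y hy 0 (Nat.zero_le k))
      refine h2.symm.trans ?_
      exact integral_congr_ae (Eventually.of_forall fun w => by simp)
    · exact (hder j (by exact_mod_cast hj) y hy).hasFDerivWithinAt
    · have hj' : j ≤ k := by exact_mod_cast hj
      refine continuousWithinAt_of_dominated (bound := g)
        (eventually_mem_nhdsWithin.mono fun z hz => hmeas z hz j hj')
        (eventually_mem_nhdsWithin.mono fun z hz => hF.mono fun w hw => (hw z hz).2 j hj') hg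
        (hF.mono fun w hw => ?_)
      have h1 : ContDiffAt ℝ (0 + j : ℕ) (fun x => F x w) y :=
        (hw y hy).1.of_le (by exact_mod_cast (by omega : 0 + j ≤ k))
      exact (contDiffAt_iteratedFDeriv h1).continuousAt.continuousWithinAt
  refine ⟨hT.contDiffOn.contDiffAt (hU.mem_nhds hx), fun j hj => ?_⟩
  have h1 := hT.eq_iteratedFDerivWithin_of_uniqueDiffOn (m := j) (by exact_mod_cast hj)
    hU.uniqueDiffOn hx
  rw [iteratedFDerivWithin_of_isOpen _ hU hx] at h1
  rw [← h1]
  exact norm_integral_le_of_norm_le hg (hF.mono fun w hw => (hw x hx).2 j hj)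

end Parametric

/-! ### Oscillatory integrals -/

section Oscillatory

variable {n' n p : ℕ} {Ω' : Opens (Rn n')} {Ω : Opens (Rn n)}

/-- The function `e^{iφ} L_φ^h f`. -/
def oscIntegrand (χ : Rn p → ℂ) (h : ℕ) (φ : Z n' n p → ℝ) (f : Z n' n p → ℂ) (z : Z n' n p) : ℂ :=
  Complex.exp (Complex.I * (φ z : ℝ)) * (opL χ φ)^[h] f z

theorem contDiffOn_expPhase {φ : Z n' n p → ℝ} (hφ : IsPhase p Ω' Ω φ) :
    ContDiffOn ℝ ∞ (fun z => Complex.exp (Complex.I * (φ z : ℝ))) (dom₀ p Ω' Ω) :=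
  (contDiffOn_const.mul (Complex.ofRealCLM.contDiff.comp_contDiffOn hφ.contDiffOn)).cexp

theorem IsPhase.contDiffOn_oscIntegrand {φ : Z n' n p → ℝ} (hφ : IsPhase p Ω' Ω φ) {χ : Rn p → ℂ}
    (hχ : IsCutoff χ) (h : ℕ) {f : Z n' n p → ℂ} (hf : ContDiffOn ℝ ∞ f (dom p Ω' Ω)) :
    ContDiffOn ℝ ∞ (oscIntegrand χ h φ f) (dom₀ p Ω' Ω) :=
  (contDiffOn_expPhase hφ).mul (hφ.contDiffOn_opL_iterate hχ h (hf.mono dom₀_subset_dom))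

/-- The $x$-derivatives are the full derivatives of $G$ restricted to the directions of $x$, hence
continuous in the remaining variables. -/
theorem continuousOn_iteratedFDeriv_slice {G : Z n' n p → ℂ} {O : Set (Z n' n p)} (hO : IsOpen O)
    (hG : ContDiffOn ℝ ∞ G O) (x : Rn n') (j : ℕ) :
    ContinuousOn (fun w : Rn n × Rn p => iteratedFDeriv ℝ j (fun x' => G (x', w)) x)
      {w | (x, w) ∈ O} := by
  have hat : ∀ z ∈ O, ∀ k : ℕ, ContDiffAt ℝ k G z := fun z hz k => contDiffAt_of_opens hO hG hz k
  have h1 : ∀ w ∈ {w : Rn n × Rn p | (x, w) ∈ O},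
      iteratedFDeriv ℝ j (fun x' => G (x', w)) x =
      (iteratedFDeriv ℝ j G (x, w)).compContinuousLinearMap
        fun _ => ContinuousLinearMap.inl ℝ (Rn n') (Rn n × Rn p) := by
    intro w hw
    have h2 : ContDiffAt ℝ j (fun z => G ((0, w) + z))
        (ContinuousLinearMap.inl ℝ (Rn n') (Rn n × Rn p) x) := by
      refine ContDiffAt.comp (g := G) (f := fun z => ((0, w) : Z n' n p) + z) _ ?_
        (contDiffAt_const.add contDiffAt_id)
      simpa using hat _ hw j
    have h3 := iteratedFDeriv_comp_clm (ContinuousLinearMap.inl ℝ (Rn n') (Rn n × Rn p)) h2 le_rfl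
    rw [iteratedFDeriv_comp_add_left] at h3
    simpa using h3
  refine ContinuousOn.congr ?_ h1
  have h2 : ContinuousOn (iteratedFDeriv ℝ j G) O := fun z hz =>
    ((contDiffAt_iteratedFDeriv (n := 0) (hat z hz (0 + j))).continuousAt).continuousWithinAt
  have h3 : ContinuousOn (fun w : Rn n × Rn p => iteratedFDeriv ℝ j G (x, w)) {w | (x, w) ∈ O} :=
    h2.comp (by fun_prop) fun w hw => hw
  exact (ContinuousMultilinearMap.compContinuousLinearMapL
    (fun _ : Fin j => ContinuousLinearMap.inl ℝ (Rn n') (Rn n × Rn p))).continuous.comp_continuousOn h3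

/-- The integrand is smooth only for $\xi\ne0$. On $\xi=0$ the phase vanishes and $L_\phi$ is the
identity, so the integrand equals $f$ there. Treating this set separately also covers $p=0$, where
it is not a null set. -/
theorem IsPhase.aestronglyMeasurable_slice {φ : Z n' n p → ℝ} (hφ : IsPhase p Ω' Ω φ)
    {χ : Rn p → ℂ} (hχ : IsCutoff χ) (h : ℕ) {f : Z n' n p → ℂ}
    (hf : ContDiffOn ℝ ∞ f (dom p Ω' Ω)) {x : Rn n'} (hx : x ∈ Ω') (j : ℕ) :
    AEStronglyMeasurable
      (fun w : Rn n × Rn p => iteratedFDeriv ℝ j (fun x' => oscIntegrand χ h φ f (x', w)) x)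
      (volume.restrict ((Ω : Set (Rn n)) ×ˢ univ)) := by
  have hsplit : (Ω : Set (Rn n)) ×ˢ (univ : Set (Rn p)) =
      (Ω : Set (Rn n)) ×ˢ ({0}ᶜ : Set (Rn p)) ∪ (Ω : Set (Rn n)) ×ˢ ({0} : Set (Rn p)) := by
    rw [← prod_union, compl_union_self]
  have hm1 : MeasurableSet ((Ω : Set (Rn n)) ×ˢ ({0}ᶜ : Set (Rn p))) :=
    Ω.2.measurableSet.prod (measurableSet_singleton 0).compl
  have hm2 : MeasurableSet ((Ω : Set (Rn n)) ×ˢ ({0} : Set (Rn p))) :=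
    Ω.2.measurableSet.prod (measurableSet_singleton 0)
  rw [hsplit, aestronglyMeasurable_union_iff]
  constructor
  · refine ContinuousOn.aestronglyMeasurable ?_ hm1
    refine (continuousOn_iteratedFDeriv_slice (isOpen_dom₀ p Ω' Ω)
      (hφ.contDiffOn_oscIntegrand hχ h hf) x j).mono fun w hw => ?_
    exact ⟨hx, hw.1, hw.2⟩
  · refine ContinuousOn.aestronglyMeasurable ?_ hm2
    refine ((continuousOn_iteratedFDeriv_slice (isOpen_dom p Ω' Ω) hf x j).mono
      (s := {w | (x, w) ∈ dom p Ω' Ω}) (t := (Ω : Set (Rn n)) ×ˢ ({0} : Set (Rn p)))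
      fun w hw => ⟨hx, hw.1, trivial⟩).congr fun w hw => ?_
    have hw0 : w.2 = 0 := hw.2
    have hev : (fun x' => oscIntegrand χ h φ f (x', w)) =ᶠ[𝓝 x] fun x' => f (x', w) := by
      filter_upwards [Ω'.2.mem_nhds hx] with x' hx'
      rw [oscIntegrand, hφ.eq_zero_of_xi ⟨hx', hw.1, trivial⟩ hw0,
        opL_iterate_of_norm_lt hχ φ h f (by simp [hw0])]
      simp
    exact (hev.iteratedFDeriv ℝ j).eq_of_nhds

theorem integrable_jap {e : ℝ} (he : e < -(p : ℝ)) :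
    Integrable (fun ξ : Rn p => jap ξ ^ e) := by
  have h := integrable_rpow_neg_one_add_norm_sq (E := Rn p) (μ := volume) (r := -e)
    (by simpa using by linarith)
  refine h.congr (Eventually.of_forall fun ξ => ?_)
  simp only [jap_rpow, neg_neg]

theorem integrable_indicator_jap {K : Set (Rn n)} (hK : IsCompact K) {e : ℝ} (he : e < -(p : ℝ)) :
    Integrable (fun w : Rn n × Rn p => K.indicator (fun _ => (1 : ℝ)) w.1 * jap w.2 ^ e) := by
  refine Integrable.mul_prod (f := K.indicator fun _ => (1 : ℝ)) ?_ (integrable_jap he)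
  exact (integrable_indicator_iff hK.measurableSet).2
    (integrableOn_const (hs := hK.measure_lt_top.ne))

/-- Bounds for oscillatory integrals and their derivatives. -/
theorem exists_jetLe_osc_integral (Ω' : Opens (Rn n')) (Ω : Opens (Rn n)) {ρ δ : ℝ} (hρ : ρ ≤ 1)
    (hδ : 0 ≤ δ) (hδ1 : δ ≤ 1) {χ : Rn p → ℂ} (hχ : IsCutoff χ) (h k : ℕ) {m : ℝ}
    (hm : m - h * min ρ (1 - δ) + k < -(p : ℝ)) (K : CompactIn Ω) :
    ∃ (C : ℝ) (M : ℕ), 0 ≤ C ∧ ∀ (φ : Z n' n p → ℝ) (f : Z n' n p → ℂ) (V : Set (Rn n')) (B c : ℝ),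
      IsOpen V → V ⊆ Ω' → IsPhase p Ω' Ω φ → ContDiffOn ℝ ∞ f (dom p Ω' Ω) →
      (∀ x ∈ Ω', ∀ y ∈ Ω, y ∉ K.1 → ∀ ξ, f (x, y, ξ) = 0) → 1 ≤ B → 0 ≤ c →
      (∀ x ∈ V, ∀ y ∈ K.1, ∀ ξ : Rn p, PhaseBoundAt (k + h + 1) φ B (x, y, ξ) ∧
        JetLe (k + h) (pull f (x, y, ξ) (symScale ρ δ (x, y, ξ))) 0 (c * jap ξ ^ m)) →
      ∀ x ∈ V, IntegrableOn (fun w => oscIntegrand χ h φ f (x, w)) ((Ω : Set (Rn n)) ×ˢ univ) ∧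
        JetLe k (fun x => ∫ w in (Ω : Set (Rn n)) ×ˢ (univ : Set (Rn p)),
          oscIntegrand χ h φ f (x, w)) x (C * B ^ M * c) := by
  obtain ⟨C, M, hC, hCM⟩ := exists_bound_slice Ω' Ω hρ hδ hδ1 hχ h k
  set e : ℝ := m - h * min ρ (1 - δ) + k with he
  have hJ := integrable_indicator_jap K.2.1 hm
  set J : ℝ := ∫ w in (Ω : Set (Rn n)) ×ˢ (univ : Set (Rn p)),
    K.1.indicator (fun _ => (1 : ℝ)) w.1 * jap w.2 ^ e with hJdef
  have hJ0 : 0 ≤ J := integral_nonneg fun w => by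
    have := jap_pos w.2
    refine mul_nonneg (indicator_nonneg (fun _ _ => zero_le_one) _) (by positivity)
  refine ⟨C * J, M, by positivity, fun φ f V B c hV hVΩ hφ hf hf0 hB hc hb x hx => ?_⟩
  have hB0 : 0 ≤ B := by linarith
  have hg : IntegrableOn (fun w : Rn n × Rn p =>
      C * B ^ M * c * (K.1.indicator (fun _ => (1 : ℝ)) w.1 * jap w.2 ^ e))
      ((Ω : Set (Rn n)) ×ˢ univ) := (hJ.const_mul _).integrableOn
  have hjet : ∀ᵐ w ∂(volume.restrict ((Ω : Set (Rn n)) ×ˢ (univ : Set (Rn p)))), ∀ x ∈ V,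
      JetLe k (fun x => oscIntegrand χ h φ f (x, w)) x
        (C * B ^ M * c * (K.1.indicator (fun _ => (1 : ℝ)) w.1 * jap w.2 ^ e)) := by
    refine (ae_restrict_mem (Ω.2.measurableSet.prod MeasurableSet.univ)).mono fun w hw x hx => ?_
    by_cases hwK : w.1 ∈ K.1
    · obtain ⟨h1, h2⟩ := hb x hx w.1 hwK w.2
      have h3 := hCM φ f (x, w) B _ hφ hf ⟨hVΩ hx, hw.1, trivial⟩ hB h1 h2
      refine h3.mono (le_of_eq ?_)
      rw [indicator_of_mem hwK, he]
      have hl := jap_pos w.2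
      rw [show m - h * min ρ (1 - δ) + (k : ℝ) = (-(h * min ρ (1 - δ)) + k) + m by ring,
        Real.rpow_add hl (-(h * min ρ (1 - δ)) + k) m]
      ring
    -- For $y\notin K$ the function vanishes on an open set, and differential operators preserve
    -- this.
    · have hO : IsOpen (dom p Ω' Ω ∩ {z | z.2.1 ∉ K.1}) :=
        (isOpen_dom p Ω' Ω).inter (K.2.1.isClosed.isOpen_compl.preimage (by fun_prop))
      have h0 : ∀ h : ℕ, ∀ f : Z n' n p → ℂ, (∀ z ∈ dom p Ω' Ω ∩ {z | z.2.1 ∉ K.1}, f z = 0) →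
          ∀ z ∈ dom p Ω' Ω ∩ {z | z.2.1 ∉ K.1}, (opL χ φ)^[h] f z = 0 := by
        intro h
        induction h with
        | zero => exact fun f hf => hf
        | succ h ih =>
          intro f hf
          rw [Function.iterate_succ_apply]
          refine ih _ fun z hz => ?_
          have h4 : f =ᶠ[𝓝 z] fun _ => 0 := by
            filter_upwards [hO.mem_nhds hz] with y hy using hf y hy
          simp [opL, h4.fderiv_eq, hf z hz]
      have h1 : (fun x => oscIntegrand χ h φ f (x, w)) =ᶠ[𝓝 x] fun _ => 0 := by
        filter_upwards [hV.mem_nhds hx] with x' hx'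
        rw [oscIntegrand, h0 h f (fun z hz => hf0 z.1 hz.1.1 z.2.1 hz.1.2.1 hz.2 z.2.2) (x', w)
          ⟨⟨hVΩ hx', hw.1, trivial⟩, hwK⟩, mul_zero]
      refine ((JetLe.const (0 : ℂ)).mono ?_).congr h1
      simp [hwK]
  have hmeas : ∀ x ∈ V, ∀ j ≤ k, AEStronglyMeasurable
      (fun w : Rn n × Rn p => iteratedFDeriv ℝ j (fun x' => oscIntegrand χ h φ f (x', w)) x)
      (volume.restrict ((Ω : Set (Rn n)) ×ˢ univ)) := fun x hx j _ =>
    hφ.aestronglyMeasurable_slice hχ h hf (hVΩ hx) j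
  refine ⟨?_, ?_⟩
  · refine Integrable.mono' hg ?_ (hjet.mono fun w hw => (hw x hx).norm_le)
    have h1 := hmeas x hx 0 (Nat.zero_le k)
    have h2 := (continuousMultilinearCurryFin0 ℝ (Rn n') ℂ).continuous.comp_aestronglyMeasurable h1
    refine h2.congr (Eventually.of_forall fun w => ?_)
    simp
  · refine (jetLe_integral hV hg hjet hmeas hx).mono (le_of_eq ?_)
    rw [integral_const_mul, ← hJdef]
    ring

end Oscillatory

/-! ### Integration by parts -/

section ByParts

variable {n' n p : ℕ} {Ω' : Opens (Rn n')} {Ω : Opens (Rn n)}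

/-- `f` vanishes for `y ∉ K`. -/
def VanishesOffBase (Ω' : Opens (Rn n')) (Ω : Opens (Rn n)) (K : Set (Rn n))
    (f : Z n' n p → ℂ) : Prop :=
  ∀ x ∈ Ω', ∀ y ∈ Ω, y ∉ K → ∀ ξ, f (x, y, ξ) = 0

/-- `f` vanishes for `|ξ| > R`. -/
def VanishesForLarge (R : ℝ) (f : Z n' n p → ℂ) : Prop := ∀ z, R < ‖z.2.2‖ → f z = 0

theorem opL_iterate_congr {O : Set (Z n' n p)} (hO : IsOpen O) (χ : Rn p → ℂ) (φ : Z n' n p → ℝ)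
    (h : ℕ) {f g : Z n' n p → ℂ} (hfg : ∀ z ∈ O, f z = g z) {z : Z n' n p} (hz : z ∈ O) :
    (opL χ φ)^[h] f z = (opL χ φ)^[h] g z := by
  induction h generalizing f g z with
  | zero => exact hfg z hz
  | succ h ih =>
    rw [Function.iterate_succ_apply, Function.iterate_succ_apply]
    refine ih (fun z hz => ?_) hz
    have h4 : f =ᶠ[𝓝 z] g := by
      filter_upwards [hO.mem_nhds hz] with y hy using hfg y hy
    simp [opL, h4.fderiv_eq, hfg z hz]

theorem opL_zero (χ : Rn p → ℂ) (φ : Z n' n p → ℝ) : opL χ φ (fun _ => 0) = fun _ => 0 := by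
  funext z
  simp [opL]

theorem opL_iterate_eq_zero {O : Set (Z n' n p)} (hO : IsOpen O) (χ : Rn p → ℂ)
    (φ : Z n' n p → ℝ) (h : ℕ) {f : Z n' n p → ℂ} (hf : ∀ z ∈ O, f z = 0) {z : Z n' n p}
    (hz : z ∈ O) : (opL χ φ)^[h] f z = 0 := by
  rw [opL_iterate_congr hO χ φ h (g := fun _ => 0) hf hz]
  have : (opL χ φ)^[h] (fun _ => 0) = fun _ => 0 := by
    induction h with
    | zero => rfl
    | succ h ih => rw [Function.iterate_succ_apply, opL_zero, ih]
  rw [this]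

theorem isOpen_dom_off {K : Set (Rn n)} (hK : IsCompact K) :
    IsOpen (dom p Ω' Ω ∩ {z | z.2.1 ∉ K}) :=
  (isOpen_dom p Ω' Ω).inter (hK.isClosed.isOpen_compl.preimage (by fun_prop))

theorem VanishesOffBase.opL_iterate {K : Set (Rn n)} (hK : IsCompact K) {f : Z n' n p → ℂ}
    (hf : VanishesOffBase Ω' Ω K f) (χ : Rn p → ℂ) (φ : Z n' n p → ℝ) (h : ℕ) :
    VanishesOffBase Ω' Ω K ((opL χ φ)^[h] f) := fun _ hx _ hy hyK _ =>
  opL_iterate_eq_zero (isOpen_dom_off (Ω' := Ω') (Ω := Ω) hK) χ φ h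
    (fun z hz => hf z.1 hz.1.1 z.2.1 hz.1.2.1 hz.2 z.2.2) ⟨⟨hx, hy, trivial⟩, hyK⟩

theorem VanishesForLarge.opL_iterate {R : ℝ} {f : Z n' n p → ℂ} (hf : VanishesForLarge R f)
    (χ : Rn p → ℂ) (φ : Z n' n p → ℝ) (h : ℕ) : VanishesForLarge R ((opL χ φ)^[h] f) :=
  fun _ hz => opL_iterate_eq_zero (O := {z | R < ‖z.2.2‖})
    (isOpen_lt continuous_const continuous_snd.snd.norm) χ φ h hf hz

theorem opL_add (χ : Rn p → ℂ) (φ : Z n' n p → ℝ) {f g : Z n' n p → ℂ} {z : Z n' n p}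
    (hf : DifferentiableAt ℝ f z) (hg : DifferentiableAt ℝ g z) :
    opL χ φ (fun z => f z + g z) z = opL χ φ f z + opL χ φ g z := by
  have : fderiv ℝ (fun z => f z + g z) z = fderiv ℝ f z + fderiv ℝ g z := fderiv_add hf hg
  simp only [opL, this, add_apply, mul_add, Finset.sum_add_distrib]
  ring

theorem IsPhase.opL_iterate_add {φ : Z n' n p → ℝ} (hφ : IsPhase p Ω' Ω φ) {χ : Rn p → ℂ}
    (hχ : IsCutoff χ) (h : ℕ) {f g : Z n' n p → ℂ} (hf : ContDiffOn ℝ ∞ f (dom p Ω' Ω))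
    (hg : ContDiffOn ℝ ∞ g (dom p Ω' Ω)) {z : Z n' n p} (hz : z ∈ dom p Ω' Ω) :
    (opL χ φ)^[h] (fun z => f z + g z) z = (opL χ φ)^[h] f z + (opL χ φ)^[h] g z := by
  induction h generalizing f g z with
  | zero => rfl
  | succ h ih =>
    simp only [Function.iterate_succ_apply]
    have hf1 : ContDiffOn ℝ ∞ (opL χ φ f) (dom p Ω' Ω) := hφ.contDiffOn_opL_iterate_dom hχ 1 hf
    have hg1 : ContDiffOn ℝ ∞ (opL χ φ g) (dom p Ω' Ω) := hφ.contDiffOn_opL_iterate_dom hχ 1 hg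
    rw [← ih hf1 hg1 hz]
    refine opL_iterate_congr (isOpen_dom p Ω' Ω) χ φ h (fun w hw => ?_) hz
    exact opL_add χ φ
      ((contDiffAt_of_opens (isOpen_dom p Ω' Ω) hf hw 1).differentiableAt (by simp))
      ((contDiffAt_of_opens (isOpen_dom p Ω' Ω) hg hw 1).differentiableAt (by simp))

/-- The function `G (x, ·)`, extended by zero outside `Ω × ℝᵖ`. -/
def sliceExt (Ω : Opens (Rn n)) (G : Z n' n p → ℂ) (x : Rn n') : Rn n × Rn p → ℂ :=
  ((Ω : Set (Rn n)) ×ˢ univ).indicator fun w => G (x, w)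

theorem sliceExt_eventuallyEq_zero {K : CompactIn Ω} {G : Z n' n p → ℂ}
    (hG : VanishesOffBase Ω' Ω K.1 G) {x : Rn n'} (hx : x ∈ Ω') {w : Rn n × Rn p}
    (hw : w.1 ∉ K.1) : sliceExt Ω G x =ᶠ[𝓝 w] fun _ => 0 := by
  have : ∀ᶠ v : Rn n × Rn p in 𝓝 w, v.1 ∉ K.1 :=
    (K.2.1.isClosed.isOpen_compl.preimage continuous_fst).mem_nhds hw
  filter_upwards [this] with v hv
  by_cases hvΩ : v ∈ (Ω : Set (Rn n)) ×ˢ (univ : Set (Rn p))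
  · rw [sliceExt, indicator_of_mem hvΩ]
    exact hG x hx v.1 hvΩ.1 hv v.2
  · rw [sliceExt, indicator_of_notMem hvΩ]

theorem sliceExt_eventuallyEq {G : Z n' n p → ℂ} {x : Rn n'} {w : Rn n × Rn p} (hw : w.1 ∈ Ω) :
    sliceExt Ω G x =ᶠ[𝓝 w] fun v => G (x, v) := by
  filter_upwards [(Ω.isOpen.prod isOpen_univ).mem_nhds (show w ∈ (Ω : Set (Rn n)) ×ˢ univ from
    ⟨hw, trivial⟩)] with v hv
  rw [sliceExt, indicator_of_mem hv]

theorem hasCompactSupport_sliceExt {K : CompactIn Ω} {R : ℝ} {G : Z n' n p → ℂ}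
    (hG : VanishesOffBase Ω' Ω K.1 G) (hR : VanishesForLarge R G) {x : Rn n'} (hx : x ∈ Ω') :
    HasCompactSupport (sliceExt Ω G x) := by
  refine HasCompactSupport.intro (K.2.1.prod (isCompact_closedBall (0 : Rn p) R)) fun w hw => ?_
  by_cases hwK : w.1 ∈ K.1
  · have h1 : R < ‖w.2‖ := by
      by_contra h1
      exact hw ⟨hwK, by simpa using not_lt.1 h1⟩
    rw [sliceExt, indicator_of_mem (show w ∈ (Ω : Set (Rn n)) ×ˢ univ from ⟨K.2.2 hwK, trivial⟩)]
    exact hR (x, w) h1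
  · exact (sliceExt_eventuallyEq_zero hG hx hwK).eq_of_nhds

theorem integrableOn_of_vanishes {K : CompactIn Ω} {R : ℝ} {G : Z n' n p → ℂ}
    (hc : ContinuousOn G (dom p Ω' Ω)) (hG : VanishesOffBase Ω' Ω K.1 G)
    (hR : VanishesForLarge R G) {x : Rn n'} (hx : x ∈ Ω') :
    IntegrableOn (fun w => G (x, w)) ((Ω : Set (Rn n)) ×ˢ univ) := by
  rw [← integrable_indicator_iff (Ω.isOpen.measurableSet.prod MeasurableSet.univ)]
  refine Continuous.integrable_of_hasCompactSupport ?_ (hasCompactSupport_sliceExt hG hR hx)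
  rw [continuous_iff_continuousAt]
  intro w
  by_cases hw : w.1 ∈ K.1
  · refine ContinuousAt.congr ?_ (sliceExt_eventuallyEq (G := G) (x := x) (K.2.2 hw)).symm
    have h1 : ContinuousAt G (x, w) :=
      hc.continuousAt ((isOpen_dom p Ω' Ω).mem_nhds ⟨hx, K.2.2 hw, trivial⟩)
    exact h1.comp (f := fun v : Rn n × Rn p => (x, v)) (by fun_prop)
  · exact continuousAt_const.congr (sliceExt_eventuallyEq_zero hG hx hw).symm

theorem contDiff_sliceExt {K : CompactIn Ω} {G : Z n' n p → ℂ}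
    (hc : ContDiffOn ℝ ∞ G (dom p Ω' Ω)) (hG : VanishesOffBase Ω' Ω K.1 G) {x : Rn n'}
    (hx : x ∈ Ω') : ContDiff ℝ 1 (sliceExt Ω G x) := by
  rw [contDiff_iff_contDiffAt]
  intro w
  by_cases hw : w.1 ∈ K.1
  · refine ContDiffAt.congr_of_eventuallyEq ?_
      (sliceExt_eventuallyEq (G := G) (x := x) (K.2.2 hw))
    have h1 : ContDiffAt ℝ 1 G (x, w) :=
      contDiffAt_of_opens (isOpen_dom p Ω' Ω) hc ⟨hx, K.2.2 hw, trivial⟩ 1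
    exact h1.comp (f := fun v : Rn n × Rn p => (x, v)) w (by fun_prop)
  · exact contDiffAt_const.congr_of_eventuallyEq (sliceExt_eventuallyEq_zero hG hx hw)

/-- Extended by zero, the slice is a compactly supported $C^1$ function on the whole space;
integrating by parts against the constant $1$ shows that its derivatives have integral zero. -/
theorem integral_fderiv_eq_zero_of_vanishes {K : CompactIn Ω} {R : ℝ} {G : Z n' n p → ℂ}
    (hc : ContDiffOn ℝ ∞ G (dom p Ω' Ω)) (hG : VanishesOffBase Ω' Ω K.1 G)
    (hR : VanishesForLarge R G) {x : Rn n'} (hx : x ∈ Ω') (v : Rn n × Rn p) :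
    ∫ w in (Ω : Set (Rn n)) ×ˢ (univ : Set (Rn p)), fderiv ℝ G (x, w) (0, v) = 0 := by
  have h1 := contDiff_sliceExt hc hG hx
  have hs := hasCompactSupport_sliceExt hG hR hx
  have hi : Integrable (sliceExt Ω G x) :=
    h1.continuous.integrable_of_hasCompactSupport hs
  have hi' : Integrable fun w => fderiv ℝ (sliceExt Ω G x) w v :=
    ((h1.continuous_fderiv (by simp)).clm_apply continuous_const).integrable_of_hasCompactSupport
      (hs.fderiv_apply ℝ v)
  have : (volume : Measure (Rn n × Rn p)).IsAddHaarMeasure :=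
    Measure.prod.instIsAddHaarMeasure volume volume
  have h2 := integral_mul_fderiv_eq_neg_fderiv_mul_of_integrable (μ := volume) (𝕜 := ℂ)
    (f := fun _ : Rn n × Rn p => (1 : ℂ)) (g := sliceExt Ω G x) (v := v) (by simp)
    (by simpa using hi') (by simpa using hi) (fun _ _ => by fun_prop)
    (fun w _ => (h1.differentiable (by simp)) w)
  simp only [one_mul, fderiv_fun_const, Pi.zero_apply, zero_apply, zero_mul,
    integral_zero, neg_zero] at h2
  rw [← h2, ← integral_indicator (Ω.isOpen.measurableSet.prod MeasurableSet.univ)]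
  congr 1
  funext w
  by_cases hw : w ∈ (Ω : Set (Rn n)) ×ˢ (univ : Set (Rn p))
  · rw [indicator_of_mem hw, (sliceExt_eventuallyEq (G := G) (x := x) hw.1).fderiv_eq]
    have h3 : DifferentiableAt ℝ G (x, w) :=
      (contDiffAt_of_opens (isOpen_dom p Ω' Ω) hc ⟨hx, hw.1, trivial⟩ 1).differentiableAt (by simp)
    have h4 := (h3.hasFDerivAt.comp w (hasFDerivAt_prodMk_right x w)).fderiv
    change _ = fderiv ℝ (G ∘ Prod.mk x) w v
    rw [h4]
    simp
  · rw [indicator_of_notMem hw,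
      (sliceExt_eventuallyEq_zero hG hx fun hK => hw ⟨K.2.2 hK, trivial⟩).fderiv_eq]
    simp

theorem expPhase_ne (φ : Z n' n p → ℝ) (z : Z n' n p) :
    ‖Complex.exp (Complex.I * (φ z : ℝ))‖ = 1 := by
  rw [mul_comm, Complex.norm_exp_ofReal_mul_I]

theorem IsPhase.continuousOn_expPhase {φ : Z n' n p → ℝ} (hφ : IsPhase p Ω' Ω φ) :
    ContinuousOn (fun z => Complex.exp (Complex.I * (φ z : ℝ))) (dom p Ω' Ω) :=
  (continuousOn_const.mul (Complex.continuous_ofReal.comp_continuousOn hφ.continuousOn)).cexp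

/-- The divergence identity for `L_φ`. -/
theorem IsPhase.expPhase_mul_opL_sub {φ : Z n' n p → ℝ} (hφ : IsPhase p Ω' Ω φ) {χ : Rn p → ℂ}
    (hχ : IsCutoff χ) {f : Z n' n p → ℂ} (hf : ContDiffOn ℝ ∞ f (dom p Ω' Ω)) {z : Z n' n p}
    (hz : z ∈ dom p Ω' Ω) :
    Complex.exp (Complex.I * (φ z : ℝ)) * opL χ φ f z - Complex.exp (Complex.I * (φ z : ℝ)) * f z =
      ∑ j : Fin p, fderiv ℝ (fun z => Complex.exp (Complex.I * (φ z : ℝ)) * coeffA χ φ j z * f z) z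
        (dirXi j) +
      ∑ k : Fin n, fderiv ℝ (fun z => Complex.exp (Complex.I * (φ z : ℝ)) * coeffB χ φ k z * f z) z
        (dirY k) := by
  -- Near $\xi=0$ both sides vanish: $L_\phi$ is the identity and the coefficients $a_j$, $b_k$ are
  -- zero.
  rcases lt_or_ge ‖z.2.2‖ (1 / 4) with h4 | h4
  · rw [opL_of_norm_lt hχ φ f h4, sub_self]
    have hA : ∀ j, (fun z => Complex.exp (Complex.I * (φ z : ℝ)) * coeffA χ φ j z * f z) =ᶠ[𝓝 z]
        fun _ => 0 := fun j => (eventually_norm_lt h4).mono fun w hw => by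
      simp [coeffA, hχ.eq_one _ hw]
    have hB : ∀ k, (fun z => Complex.exp (Complex.I * (φ z : ℝ)) * coeffB χ φ k z * f z) =ᶠ[𝓝 z]
        fun _ => 0 := fun k => (eventually_norm_lt h4).mono fun w hw => by
      simp [coeffB, hχ.eq_one _ hw]
    simp [(hA _).fderiv_eq, (hB _).fderiv_eq]
  have hz0 : z ∈ dom₀ p Ω' Ω := ⟨hz.1, hz.2.1, fun h => by
    rw [h, norm_zero] at h4
    norm_num at h4⟩
  have hO := isOpen_dom₀ p Ω' Ω
  have hd : ∀ {g : Z n' n p → ℂ}, ContDiffOn ℝ ∞ g (dom₀ p Ω' Ω) → DifferentiableAt ℝ g z :=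
    fun hg => (contDiffAt_of_opens hO hg hz0 1).differentiableAt (by simp)
  have hfd := hd (hf.mono dom₀_subset_dom)
  have hφd : DifferentiableAt ℝ φ z :=
    (contDiffAt_of_opens hO hφ.contDiffOn hz0 1).differentiableAt (by simp)
  have hE : HasFDerivAt (fun z => Complex.exp (Complex.I * (φ z : ℝ)))
      (Complex.exp (Complex.I * (φ z : ℝ)) • (Complex.I • Complex.ofRealCLM.comp (fderiv ℝ φ z))) z :=
    ((Complex.ofRealCLM.hasFDerivAt.comp z hφd.hasFDerivAt).const_mul Complex.I).cexp
  have key : ∀ {g : Z n' n p → ℂ}, ContDiffOn ℝ ∞ g (dom₀ p Ω' Ω) → ∀ v,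
      fderiv ℝ (fun z => Complex.exp (Complex.I * (φ z : ℝ)) * g z * f z) z v =
        Complex.exp (Complex.I * (φ z : ℝ)) * (Complex.I * (fderiv ℝ φ z v : ℝ) * g z * f z +
          fderiv ℝ g z v * f z + g z * fderiv ℝ f z v) := by
    intro g hg v
    have h1 := ((hE.mul (hd hg).hasFDerivAt).mul hfd.hasFDerivAt).fderiv
    have h2 := congrArg (fun L => L v) h1
    refine Eq.trans h2 ?_
    simp
    ring
  simp only [key (hφ.contDiffOn_coeffA hχ _), key (hφ.contDiffOn_coeffB hχ _)]
  have hg := hφ.gradSq_ne_zero _ (normalize_mem_dom₀ hz0)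
  have hgc : ((gradSq φ (normalize z) : ℝ) : ℂ) ≠ 0 := by exact_mod_cast hg
  -- The algebraic core: the vector field applied to $i\phi$ gives $-(1-\chi)$, because the
  -- normalised squared gradient cancels against its reciprocal. This combines with the summand
  -- $\chi$ of $c$ to the factor $1$.
  have hsum : ∑ j : Fin p, Complex.I * (fderiv ℝ φ z (dirXi j) : ℝ) * coeffA χ φ j z +
      ∑ k : Fin n, Complex.I * (fderiv ℝ φ z (dirY k) : ℝ) * coeffB χ φ k z = χ z.2.2 - 1 := by
    have h1 : ∑ j : Fin p, Complex.I * (fderiv ℝ φ z (dirXi j) : ℝ) * coeffA χ φ j z +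
        ∑ k : Fin n, Complex.I * (fderiv ℝ φ z (dirY k) : ℝ) * coeffB χ φ k z =
        -(1 - χ z.2.2) * ((gradSq φ (normalize z))⁻¹ : ℝ) * ((gradSq φ (normalize z) : ℝ) : ℂ) := by
      conv_rhs => rw [hφ.gradSq_normalize hz0, ← hφ.gradSq_normalize hz0]
      rw [show ((gradSq φ (normalize z) : ℝ) : ℂ) = ((∑ k : Fin n, (‖z.2.2‖ ^ 2)⁻¹ *
        (fderiv ℝ φ z (dirY k)) ^ 2 + ∑ j : Fin p, (fderiv ℝ φ z (dirXi j)) ^ 2 : ℝ) : ℂ) by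
          rw [hφ.gradSq_normalize hz0]]
      rw [Complex.ofReal_add, Complex.ofReal_sum, Complex.ofReal_sum, mul_add, Finset.mul_sum,
        Finset.mul_sum, add_comm]
      congr 1
      · refine Finset.sum_congr rfl fun k _ => ?_
        simp only [coeffB, Complex.ofReal_mul, Complex.ofReal_pow]
        linear_combination (1 - χ z.2.2) * (((‖z.2.2‖ ^ 2)⁻¹ : ℝ) : ℂ) *
          (((gradSq φ (normalize z))⁻¹ : ℝ) : ℂ) * (fderiv ℝ φ z (dirY k) : ℂ) ^ 2 * Complex.I_sq
      · refine Finset.sum_congr rfl fun j _ => ?_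
        simp only [coeffA, Complex.ofReal_pow]
        linear_combination (1 - χ z.2.2) *
          (((gradSq φ (normalize z))⁻¹ : ℝ) : ℂ) * (fderiv ℝ φ z (dirXi j) : ℂ) ^ 2 * Complex.I_sq
    rw [h1, Complex.ofReal_inv, mul_assoc, inv_mul_cancel₀ hgc]
    ring
  rw [← Finset.mul_sum, ← Finset.mul_sum]
  simp only [Finset.sum_add_distrib, ← Finset.sum_mul]
  rw [opL, coeffC]
  linear_combination -(Complex.exp (Complex.I * (φ z : ℝ)) * f z) * hsum

/-- The two integrands differ by the divergence of the fields $e^{i\phi}a_jf$ and $e^{i\phi}b_kf$.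
These are smooth across $\xi=0$, since the coefficients vanish for $|\xi|<1/4$, and vanish for
$y\notin K$ and for large $\xi$. -/
theorem IsPhase.integral_opL {φ : Z n' n p → ℝ} (hφ : IsPhase p Ω' Ω φ) {χ : Rn p → ℂ}
    (hχ : IsCutoff χ) {f : Z n' n p → ℂ} (hf : ContDiffOn ℝ ∞ f (dom p Ω' Ω)) {K : CompactIn Ω}
    {R : ℝ} (hK : VanishesOffBase Ω' Ω K.1 f) (hR : VanishesForLarge R f) {x : Rn n'}
    (hx : x ∈ Ω') :
    ∫ w in (Ω : Set (Rn n)) ×ˢ (univ : Set (Rn p)),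
      Complex.exp (Complex.I * (φ (x, w) : ℝ)) * opL χ φ f (x, w) =
    ∫ w in (Ω : Set (Rn n)) ×ˢ (univ : Set (Rn p)),
      Complex.exp (Complex.I * (φ (x, w) : ℝ)) * f (x, w) := by
  have hEc := hφ.continuousOn_expPhase
  have hLf : ContDiffOn ℝ ∞ (opL χ φ f) (dom p Ω' Ω) := hφ.contDiffOn_opL_iterate_dom hχ 1 hf
  have hLK : VanishesOffBase Ω' Ω K.1 (opL χ φ f) := hK.opL_iterate K.2.1 χ φ 1
  have hLR : VanishesForLarge R (opL χ φ f) := hR.opL_iterate χ φ 1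
  have hmulK : ∀ (E : Z n' n p → ℂ) {g : Z n' n p → ℂ}, VanishesOffBase Ω' Ω K.1 g →
      VanishesOffBase Ω' Ω K.1 fun z => E z * g z := fun E g hg x hx y hy hyK ξ => by
    change E _ * g _ = 0
    rw [hg x hx y hy hyK, mul_zero]
  have hmulR : ∀ (E : Z n' n p → ℂ) {g : Z n' n p → ℂ}, VanishesForLarge R g →
      VanishesForLarge R fun z => E z * g z := fun E g hg z hz => by
    change E _ * g _ = 0
    rw [hg z hz, mul_zero]
  have hi1 : IntegrableOn (fun w => Complex.exp (Complex.I * (φ (x, w) : ℝ)) * opL χ φ f (x, w))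
      ((Ω : Set (Rn n)) ×ˢ (univ : Set (Rn p))) :=
    integrableOn_of_vanishes (hEc.mul hLf.continuousOn) (hmulK _ hLK) (hmulR _ hLR) hx
  have hi2 : IntegrableOn (fun w => Complex.exp (Complex.I * (φ (x, w) : ℝ)) * f (x, w))
      ((Ω : Set (Rn n)) ×ˢ (univ : Set (Rn p))) :=
    integrableOn_of_vanishes (hEc.mul hf.continuousOn) (hmulK _ hK) (hmulR _ hR) hx
  rw [← sub_eq_zero, ← integral_sub hi1 hi2]
  have hsmooth : ∀ g : Z n' n p → ℂ, ContDiffOn ℝ ∞ g (dom₀ p Ω' Ω) →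
      (∀ z : Z n' n p, ‖z.2.2‖ < 1 / 4 → g z = 0) →
      ContDiffOn ℝ ∞ (fun z => Complex.exp (Complex.I * (φ z : ℝ)) * g z * f z) (dom p Ω' Ω) :=
    fun g hg hg0 => contDiffOn_dom_of_dom₀ (((contDiffOn_expPhase hφ).mul hg).mul
      (hf.mono dom₀_subset_dom)) (g := fun _ => 0) contDiffOn_const fun z hz => by
        rw [hg0 z hz, mul_zero, zero_mul]
  have hA := fun j => hsmooth _ (hφ.contDiffOn_coeffA hχ j) fun z hz => by
    simp [coeffA, hχ.eq_one _ hz]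
  have hB := fun k => hsmooth _ (hφ.contDiffOn_coeffB hχ k) fun z hz => by
    simp [coeffB, hχ.eq_one _ hz]
  have hint : ∀ G : Z n' n p → ℂ, ContDiffOn ℝ ∞ G (dom p Ω' Ω) → VanishesOffBase Ω' Ω K.1 G →
      VanishesForLarge R G → ∀ v, IntegrableOn (fun w => fderiv ℝ G (x, w) v)
        ((Ω : Set (Rn n)) ×ˢ (univ : Set (Rn p))) := by
    intro G hG hGK hGR v
    refine integrableOn_of_vanishes (G := fun z => fderiv ℝ G z v) (K := K) (R := R)
      (contDiffOn_fderiv_apply (isOpen_dom p Ω' Ω) hG v).continuousOn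
      (fun x hx y hy hyK ξ => ?_) (fun z hz => ?_) hx
    · have : G =ᶠ[𝓝 (x, y, ξ)] fun _ => 0 := by
        filter_upwards [(isOpen_dom_off (Ω' := Ω') (Ω := Ω) K.2.1).mem_nhds
          ⟨⟨hx, hy, trivial⟩, hyK⟩] with z hz
        exact hGK z.1 hz.1.1 z.2.1 hz.1.2.1 hz.2 z.2.2
      simp [this.fderiv_eq]
    · have : G =ᶠ[𝓝 z] fun _ => 0 := (eventually_lt_norm hz).mono fun w hw => hGR w hw
      simp [this.fderiv_eq]
  have h1 : ∫ w in (Ω : Set (Rn n)) ×ˢ (univ : Set (Rn p)),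
      (Complex.exp (Complex.I * (φ (x, w) : ℝ)) * opL χ φ f (x, w) -
        Complex.exp (Complex.I * (φ (x, w) : ℝ)) * f (x, w)) =
      ∫ w in (Ω : Set (Rn n)) ×ˢ (univ : Set (Rn p)),
      (∑ j : Fin p, fderiv ℝ (fun z => Complex.exp (Complex.I * (φ z : ℝ)) * coeffA χ φ j z * f z)
        (x, w) (dirXi j) +
      ∑ k : Fin n, fderiv ℝ (fun z => Complex.exp (Complex.I * (φ z : ℝ)) * coeffB χ φ k z * f z)
        (x, w) (dirY k)) :=
    setIntegral_congr_fun (Ω.isOpen.measurableSet.prod MeasurableSet.univ) fun w hw =>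
      hφ.expPhase_mul_opL_sub hχ hf ⟨hx, hw.1, trivial⟩
  rw [h1, integral_add (integrable_finsetSum _ fun j _ => hint _ (hA j) (hmulK _ hK) (hmulR _ hR) _)
    (integrable_finsetSum _ fun k _ => hint _ (hB k) (hmulK _ hK) (hmulR _ hR) _),
    integral_finsetSum _ fun j _ => hint _ (hA j) (hmulK _ hK) (hmulR _ hR) _,
    integral_finsetSum _ fun k _ => hint _ (hB k) (hmulK _ hK) (hmulR _ hR) _]
  have h2 : ∀ j : Fin p, _ = (0 : ℂ) := fun j => integral_fderiv_eq_zero_of_vanishes (hA j)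
    (hmulK _ hK) (hmulR _ hR) hx (0, stdVec j)
  have h3 : ∀ k : Fin n, _ = (0 : ℂ) := fun k => integral_fderiv_eq_zero_of_vanishes (hB k)
    (hmulK _ hK) (hmulR _ hR) hx (stdVec k, 0)
  exact (congrArg₂ _ (Finset.sum_eq_zero fun j _ => h2 j) (Finset.sum_eq_zero fun k _ => h3 k)).trans
    (add_zero 0)

theorem IsPhase.integral_oscIntegrand {φ : Z n' n p → ℝ} (hφ : IsPhase p Ω' Ω φ) {χ : Rn p → ℂ}
    (hχ : IsCutoff χ) (h : ℕ) {f : Z n' n p → ℂ} (hf : ContDiffOn ℝ ∞ f (dom p Ω' Ω))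
    {K : CompactIn Ω} {R : ℝ} (hK : VanishesOffBase Ω' Ω K.1 f) (hR : VanishesForLarge R f)
    {x : Rn n'} (hx : x ∈ Ω') :
    ∫ w in (Ω : Set (Rn n)) ×ˢ (univ : Set (Rn p)), oscIntegrand χ h φ f (x, w) =
    ∫ w in (Ω : Set (Rn n)) ×ˢ (univ : Set (Rn p)),
      Complex.exp (Complex.I * (φ (x, w) : ℝ)) * f (x, w) := by
  induction h generalizing f with
  | zero => rfl
  | succ h ih =>
    have hLf : ContDiffOn ℝ ∞ (opL χ φ f) (dom p Ω' Ω) := hφ.contDiffOn_opL_iterate_dom hχ 1 hf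
    have hLK : VanishesOffBase Ω' Ω K.1 (opL χ φ f) := hK.opL_iterate K.2.1 χ φ 1
    have hLR : VanishesForLarge R (opL χ φ f) := hR.opL_iterate χ φ 1
    rw [← hφ.integral_opL hχ hf hK hR hx, ← ih hLf hLK hLR]
    rfl

end ByParts

/-! ### Truncation in `ξ` -/

section Truncation

variable {n' n p : ℕ} {Ω' : Opens (Rn n')} {Ω : Opens (Rn n)}

/-- The cut-off function `χ(ξ / R)`. -/
def dilate (χ : Rn p → ℂ) (R : ℝ) (z : Z n' n p) : ℂ := χ (R⁻¹ • z.2.2)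

theorem IsCutoff.contDiff_dilate {χ : Rn p → ℂ} (hχ : IsCutoff χ) (R : ℝ) :
    ContDiff ℝ ∞ (dilate χ R : Z n' n p → ℂ) :=
  hχ.contDiff.comp (g := χ) (f := fun z : Z n' n p => R⁻¹ • z.2.2) (by fun_prop)

theorem IsCutoff.vanishesForLarge_dilate {χ : Rn p → ℂ} (hχ : IsCutoff χ) {R : ℝ} (hR : 1 ≤ R)
    (f : Z n' n p → ℂ) : VanishesForLarge R fun z => f z * dilate χ R z := fun z hz => by
  have h0 : 0 < R := by linarith
  have : dilate χ R z = 0 := hχ.eq_zero _ (by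
    rw [norm_smul, norm_inv, Real.norm_of_nonneg h0.le, lt_inv_mul_iff₀ h0]
    linarith)
  simp [this]

/-- As a symbol of order $1$, the function $1-\chi(\xi/R)$ is $O(R^{-1})$: it vanishes for
$|\xi|<R/4$, and elsewhere $1\le4\langle\xi\rangle/R$. The assumption $R\ge1$ keeps that region
inside $|\xi|\ge1/8$. -/
theorem exists_jetLe_one_sub_dilate {χ : Rn p → ℂ} (hχ : IsCutoff χ) {ρ δ : ℝ} (hρ : ρ ≤ 1)
    (hδ : 0 ≤ δ) (J : ℕ) : ∃ C : ℝ, 0 ≤ C ∧ ∀ (R : ℝ), 1 ≤ R → ∀ z : Z n' n p,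
      JetLe J (pull (fun z => 1 - dilate χ R z) z (symScale ρ δ z)) 0 (C * (jap z.2.2 * R⁻¹)) := by
  obtain ⟨C, hC, h⟩ := exists_jetLe_cutoff hχ J
  let ι := {i : ℝ × Z n' n p // 1 ≤ i.1 ∧ i.1 / 4 ≤ ‖i.2.2.2‖}
  let S := (ContinuousLinearMap.snd ℝ (Rn n) (Rn p)).comp
      (ContinuousLinearMap.snd ℝ (Rn n') (Rn n × Rn p))
  have hS : ‖S‖ ≤ 1 := IsPhaseFamily.norm_snd_snd_le
  have h1 : JetO J (fun i : ι => pull (dilate χ i.1.1) i.1.2 (scale 1 ‖i.1.2.2.2‖)) fun _ => 1 := by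
    refine ⟨C, hC, fun i => ?_⟩
    have hi : 0 < i.1.1 := by linarith [i.2.1]
    have h2 : JetLe J (fun w => χ (i.1.1⁻¹ • i.1.2.2.2 + ‖i.1.1⁻¹ • i.1.2.2.2‖ • w)) (S 0) C := by
      rw [map_zero]
      exact (h _).1
    have h3 := h2.comp_clm S hS le_rfl
    rw [one_pow, one_mul] at h3
    rw [mul_one]
    refine h3.congr (Eventually.of_forall fun w => ?_)
    simp only [pull, dilate, scale_apply, norm_smul, norm_inv, Real.norm_of_nonneg hi.le]
    congr 1
    simp [S, smul_smul]
  have h2 := h1.symScale_of_scale (fun i => by linarith [i.2.1, i.2.2]) hρ hδ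
  have h3 := (JetO.const (ι := ι) (E := Z n' n p) (j := J) (1 : ℂ)).add
      (h2.clm_comp (-ContinuousLinearMap.id ℝ ℂ))
  obtain ⟨D, hD, h4⟩ := h3
  refine ⟨4 * D, by positivity, fun R hR z => ?_⟩
  have hR0 : 0 < R := by linarith
  have hl := jap_pos z.2.2
  rcases lt_or_ge ‖z.2.2‖ (R / 4) with hz | hz
  · refine ((JetLe.const (0 : ℂ)).mono (by simp only [norm_zero]; positivity)).congr ?_
    have hc : Continuous fun w : Z n' n p => ‖(z + symScale ρ δ z w).2.2‖ := by fun_prop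
    have ht := hc.tendsto 0
    simp only [map_zero, add_zero] at ht
    refine (ht.eventually_lt_const hz).mono fun w hw => ?_
    have : dilate χ R (z + symScale ρ δ z w) = 1 := hχ.eq_one _ (by
      rw [norm_smul, norm_inv, Real.norm_of_nonneg hR0.le, inv_mul_lt_iff₀ hR0]
      linarith)
    simp [pull, this]
  · have h5 := h4 ⟨(R, z), hR, hz⟩
    refine (h5.mono ?_).congr (Eventually.of_forall fun w => ?_)
    · have h6 : 1 ≤ 4 * (jap z.2.2 * R⁻¹) := by
        have := norm_le_jap z.2.2
        rw [← div_eq_mul_inv, ← mul_div_assoc, le_div_iff₀ hR0]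
        linarith
      nlinarith
    · simp [pull, sub_eq_add_neg]

/-- The data of an oscillatory integral, with bounds `B` for the phase function and `c` for the
amplitude `f` of order `m`. -/
structure OscBound (Ω' : Opens (Rn n')) (Ω : Opens (Rn n)) (ρ δ m : ℝ) (J : ℕ) (K : Set (Rn n))
    (V : Set (Rn n')) (φ : Z n' n p → ℝ) (f : Z n' n p → ℂ) (B c : ℝ) : Prop where
  isOpen : IsOpen V
  subset : V ⊆ Ω'
  isPhase : IsPhase p Ω' Ω φ
  contDiffOn : ContDiffOn ℝ ∞ f (dom p Ω' Ω)
  vanishes : VanishesOffBase Ω' Ω K f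
  one_le : 1 ≤ B
  nonneg : 0 ≤ c
  phase : ∀ x ∈ V, ∀ y ∈ K, ∀ ξ : Rn p, PhaseBoundAt (J + 1) φ B (x, y, ξ)
  jetLe : ∀ x ∈ V, ∀ y ∈ K, ∀ ξ : Rn p,
    JetLe J (pull f (x, y, ξ) (symScale ρ δ (x, y, ξ))) 0 (c * jap ξ ^ m)

variable {ρ δ m : ℝ} {J : ℕ} {V : Set (Rn n')} {φ : Z n' n p → ℝ} {f : Z n' n p → ℂ} {B c : ℝ}

theorem IsPhase.integrableOn_osc_of_vanishes {φ : Z n' n p → ℝ} (hφ : IsPhase p Ω' Ω φ)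
    {χ : Rn p → ℂ} (hχ : IsCutoff χ) (h : ℕ) {f : Z n' n p → ℂ}
    (hf : ContDiffOn ℝ ∞ f (dom p Ω' Ω)) {K : CompactIn Ω} {R : ℝ}
    (hK : VanishesOffBase Ω' Ω K.1 f) (hR : VanishesForLarge R f) {x : Rn n'} (hx : x ∈ Ω') :
    IntegrableOn (fun w => oscIntegrand χ h φ f (x, w)) ((Ω : Set (Rn n)) ×ˢ univ) := by
  refine integrableOn_of_vanishes (K := K) (R := R) (G := oscIntegrand χ h φ f)
    (hφ.continuousOn_expPhase.mul (hφ.contDiffOn_opL_iterate_dom hχ h hf).continuousOn)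
    (fun x hx y hy hyK ξ => ?_) (fun z hz => ?_) hx
  · rw [oscIntegrand, hK.opL_iterate K.2.1 χ φ h x hx y hy hyK ξ, mul_zero]
  · rw [oscIntegrand, hR.opL_iterate χ φ h z hz, mul_zero]

/-- By integration by parts $L_\phi^h$ may be inserted in the truncated integral. The difference is
then the oscillatory integral of $f(1-\chi_0(\xi/R))$, an amplitude of order $m+1$ with bound
$O(c/R)$. The summand $+1$ in the condition on $h$ pays for this extra order. -/
theorem exists_tail_bound (Ω' : Opens (Rn n')) (Ω : Opens (Rn n)) {ρ δ : ℝ} (hρ : ρ ≤ 1)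
    (hδ : 0 ≤ δ) (hδ1 : δ ≤ 1) {χ χ₀ : Rn p → ℂ} (hχ : IsCutoff χ) (hχ₀ : IsCutoff χ₀) (h : ℕ)
    {m : ℝ} (hm : m - h * min ρ (1 - δ) + 1 < -(p : ℝ)) (K : CompactIn Ω) :
    ∃ (C : ℝ) (M : ℕ), 0 ≤ C ∧ ∀ (φ : Z n' n p → ℝ) (f : Z n' n p → ℂ) (V : Set (Rn n')) (B c : ℝ),
      OscBound Ω' Ω ρ δ m h K.1 V φ f B c → ∀ R, 1 ≤ R → ∀ x ∈ V,
      ‖(∫ w in (Ω : Set (Rn n)) ×ˢ (univ : Set (Rn p)), oscIntegrand χ h φ f (x, w)) -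
        ∫ w in (Ω : Set (Rn n)) ×ˢ (univ : Set (Rn p)),
          Complex.exp (Complex.I * (φ (x, w) : ℝ)) * (f (x, w) * dilate χ₀ R (x, w))‖ ≤
        C * B ^ M * c * R⁻¹ := by
  obtain ⟨C, M, hC, hCM⟩ := exists_jetLe_osc_integral Ω' Ω hρ hδ hδ1 hχ h 0 (m := m + 1)
    (by push_cast; linarith) K
  obtain ⟨D, hD, hDR⟩ := exists_jetLe_one_sub_dilate (n' := n') (n := n) hχ₀ hρ hδ h
  refine ⟨C * (2 ^ h * D), M, by positivity, fun φ f V B c H R hR x hx => ?_⟩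
  have hR0 : 0 < R := by linarith
  have hc := H.nonneg
  have hψ : ContDiffOn ℝ ∞ (fun z => f z * (1 - dilate χ₀ R z)) (dom p Ω' Ω) :=
    H.contDiffOn.mul (contDiffOn_const.sub (hχ₀.contDiff_dilate R).contDiffOn)
  have hψ' : ContDiffOn ℝ ∞ (fun z => f z * dilate χ₀ R z) (dom p Ω' Ω) :=
    H.contDiffOn.mul (hχ₀.contDiff_dilate R).contDiffOn
  have hψK : VanishesOffBase Ω' Ω K.1 (fun z => f z * dilate χ₀ R z) :=
    fun x hx y hy hyK ξ => by simp [H.vanishes x hx y hy hyK ξ]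
  obtain ⟨h1, h2⟩ := hCM φ (fun z => f z * (1 - dilate χ₀ R z)) V B (2 ^ h * D * (c * R⁻¹))
    H.isOpen H.subset H.isPhase hψ (fun x hx y hy hyK ξ => by simp [H.vanishes x hx y hy hyK ξ])
    H.one_le (by positivity) (fun x hx y hy ξ => ⟨by simpa using H.phase x hx y hy ξ, by
      have h3 := (H.jetLe x hx y hy ξ).mul (hDR R hR (x, y, ξ))
      have hl := jap_pos ξ
      rw [zero_add]
      refine h3.mono (le_of_eq ?_)
      rw [Real.rpow_add_one hl.ne']
      ring⟩) x hx
  have hxΩ := H.subset hx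
  have hRv := hχ₀.vanishesForLarge_dilate hR f
  rw [← H.isPhase.integral_oscIntegrand hχ h hψ' hψK hRv hxΩ]
  have h4 := H.isPhase.integrableOn_osc_of_vanishes hχ h hψ' hψK hRv hxΩ
  have h5 : ∫ w in (Ω : Set (Rn n)) ×ˢ (univ : Set (Rn p)), oscIntegrand χ h φ f (x, w) =
      (∫ w in (Ω : Set (Rn n)) ×ˢ (univ : Set (Rn p)),
        oscIntegrand χ h φ (fun z => f z * dilate χ₀ R z) (x, w)) +
      ∫ w in (Ω : Set (Rn n)) ×ˢ (univ : Set (Rn p)),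
        oscIntegrand χ h φ (fun z => f z * (1 - dilate χ₀ R z)) (x, w) := by
    rw [← integral_add h4 h1]
    refine setIntegral_congr_fun (Ω.isOpen.measurableSet.prod MeasurableSet.univ) fun w hw => ?_
    have h6 := H.isPhase.opL_iterate_add hχ h hψ' hψ (z := (x, w)) ⟨hxΩ, hw.1, trivial⟩
    simp only [oscIntegrand]
    rw [← mul_add, ← h6]
    congr 2
    refine congrArg (fun g => (opL χ φ)^[h] g (x, w)) (funext fun z => ?_)
    ring
  rw [h5, add_sub_cancel_left]
  refine h2.norm_le.trans (le_of_eq ?_)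
  ring

end Truncation

/-! ### Bounds for the values of Fourier integral operators -/

section Values

variable {n' n p : ℕ} {Ω' : Opens (Rn n')} {Ω : Opens (Rn n)}

/-- The phase function `φ` is bounded by `B` over `L × K`. -/
structure PhaseBound (L : Set (Rn n')) (K : Set (Rn n)) (N : ℕ) (φ : Z n' n p → ℝ) (B : ℝ) :
    Prop where
  one_le : 1 ≤ B
  bound : ∀ x ∈ L, ∀ y ∈ K, ∀ ξ : Rn p, PhaseBoundAt N φ B (x, y, ξ)

theorem gradSq_nonneg (φ : Z n' n p → ℝ) (z : Z n' n p) : 0 ≤ gradSq φ z :=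
  add_nonneg (Finset.sum_nonneg fun _ _ => sq_nonneg _) (Finset.sum_nonneg fun _ _ => sq_nonneg _)

theorem PhaseBound.of_le {L : Set (Rn n')} {K : Set (Rn n)} {N N' : ℕ} {φ : Z n' n p → ℝ}
    {B B' : ℝ} (h : PhaseBound L K N φ B) (hN : N' ≤ N) (hB : B ≤ B') :
    PhaseBound L K N' φ B' :=
  ⟨h.one_le.trans hB, fun x hx y hy ξ hξ => by
    obtain ⟨h1, h2⟩ := h.bound x hx y hy ξ hξ
    exact ⟨(h1.of_le hN).mono (mul_le_mul_of_nonneg_right hB (norm_nonneg _)),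
      h2.trans (mul_le_mul_of_nonneg_right hB (gradSq_nonneg _ _))⟩⟩

/-- Translates the seminorms that define generalized phase functions into the single constant used
in the estimates. -/
theorem IsPhase.phaseBound_of_hgSeminorm_le {φ : Z n' n p → ℝ} (hφ : IsPhase p Ω' Ω φ)
    {L : Set (Rn n')} (hL : L ⊆ Ω') {K : Set (Rn n)} (hK : K ⊆ Ω) {N : ℕ} {B : ℝ} (hB : 1 ≤ B)
    (h : hgSeminorm (L ×ˢ K) N φ ≤ ENNReal.ofReal B)
    (hg : ∀ x ∈ L, ∀ y ∈ K, ∀ ξ : Rn p, ξ ≠ 0 → 1 ≤ B * gradSq φ (normalize (x, y, ξ))) :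
    PhaseBound L K N φ (((p + (n' + n) : ℕ) + 1 : ℝ) ^ N * B) := by
  have h1 : (1 : ℝ) ≤ ((p + (n' + n) : ℕ) + 1 : ℝ) ^ N := one_le_pow₀ (by
    linarith [Nat.cast_nonneg (α := ℝ) (p + (n' + n))])
  refine ⟨by nlinarith, fun x hx y hy ξ hξ => ⟨?_, ?_⟩⟩
  · have hz : ((x, y, ξ) : Z n' n p) ∈ dom₀ p Ω' Ω := ⟨hL hx, hK hy, hξ⟩
    refine (jetLe_of_hgSeminorm_le (z := (x, y, ξ)) (by linarith) h ⟨hx, hy⟩ hξ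
      (contDiffAt_of_opens (isOpen_dom₀ p Ω' Ω) hφ.contDiffOn hz N)).mono (le_of_eq ?_)
    ring
  · refine (hg x hx y hy ξ hξ).trans (mul_le_mul_of_nonneg_right ?_ (gradSq_nonneg _ _))
    nlinarith

/-- Homogeneity reduces the bounds to the compact set $L\times K\times S^{p-1}$. This serves the
qualitative statements for fixed $\varepsilon$, where the size of the constant is irrelevant. -/
theorem IsPhase.exists_phaseBound {φ : Z n' n p → ℝ} (hφ : IsPhase p Ω' Ω φ)
    {L : Set (Rn n')} (hL : IsCompact L) (hLΩ : L ⊆ Ω') {K : Set (Rn n)} (hK : IsCompact K)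
    (hKΩ : K ⊆ Ω) (N : ℕ) : ∃ B, PhaseBound L K N φ B := by
  have hS : IsCompact (L ×ˢ K ×ˢ Metric.sphere (0 : Rn p) 1) :=
    hL.prod (hK.prod (isCompact_sphere 0 1))
  have hS0 : L ×ˢ K ×ˢ Metric.sphere (0 : Rn p) 1 ⊆ dom₀ p Ω' Ω := fun z hz =>
    ⟨hLΩ hz.1, hKΩ hz.2.1, fun h0 => by
      have := hz.2.2
      rw [show z.2.2 = 0 from h0] at this
      simp at this⟩
  have hnorm : ∀ {x : Rn n'} {y : Rn n} {ξ : Rn p}, x ∈ L → y ∈ K → ξ ≠ 0 →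
      normalize (x, y, ξ) ∈ L ×ˢ K ×ˢ Metric.sphere (0 : Rn p) 1 := fun hx hy hξ =>
    ⟨hx, hy, by simp [normalize, norm_smul, norm_ne_zero_iff.2 hξ]⟩
  obtain ⟨C, hC, h1⟩ := exists_jetLe_of_isCompact (isOpen_dom₀ p Ω' Ω) hφ.contDiffOn hS hS0 N
  obtain ⟨D, hD, h2⟩ := exists_jetLe_of_isCompact (f := fun z => (gradSq φ z)⁻¹)
    (isOpen_dom₀ p Ω' Ω) (hφ.contDiffOn_gradSq.inv hφ.gradSq_ne_zero) hS hS0 0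
  refine ⟨max 1 (max C D), le_max_left _ _, fun x hx y hy ξ hξ => ?_⟩
  have hz := hnorm hx hy hξ
  have hr : 0 < ‖ξ‖ := norm_pos_iff.2 hξ
  constructor
  · have h3 := h1 _ hz
    have h4 : JetLe N (fun w => φ (normalize (x, y, ξ) + w)) 0 C :=
      ⟨ContDiffAt.comp 0 (g := φ) (f := fun w => normalize (x, y, ξ) + w)
        (by simpa using h3.1) (contDiffAt_const.add contDiffAt_id), fun k hk => by
          rw [iteratedFDeriv_comp_add_left, add_zero]
          exact h3.2 k hk⟩
    have h5 := h4.clm_comp (‖ξ‖ • ContinuousLinearMap.id ℝ ℝ)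
    have h6 : JetLe N (pull φ (x, y, ξ) (scale 1 ‖ξ‖)) 0 (‖‖ξ‖ • ContinuousLinearMap.id ℝ ℝ‖ * C) := by
      refine h5.congr ?_
      have hc : Continuous fun w : Z n' n p => normalize (x, y, ξ) + w := by fun_prop
      have ht := hc.tendsto 0
      rw [add_zero] at ht
      filter_upwards [ht.eventually ((isOpen_dom₀ p Ω' Ω).mem_nhds (hS0 hz))] with w hw
      have h7 := hφ.comp_scale (dom₀_subset_dom hw) hr
      simp only [pull, FunLike.coe_smul, Pi.smul_apply, ContinuousLinearMap.coe_id', id,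
        smul_eq_mul]
      rw [← h7]
      congr 1
      simp [scale_apply, normalize, smul_smul, mul_inv_cancel₀ hr.ne']
    refine h6.mono ?_
    have h8 : ‖‖ξ‖ • ContinuousLinearMap.id ℝ ℝ‖ = ‖ξ‖ := by simp [norm_smul]
    rw [h8, mul_comm]
    exact mul_le_mul_of_nonneg_right ((le_max_left _ _).trans (le_max_right _ _)) hr.le
  · have h3 := (h2 _ hz).norm_le
    have h4 : 0 < gradSq φ (normalize (x, y, ξ)) :=
      lt_of_le_of_ne (gradSq_nonneg _ _) (hφ.gradSq_ne_zero _ (hS0 hz)).symm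
    rw [norm_inv, Real.norm_of_nonneg h4.le, inv_le_iff_one_le_mul₀ h4] at h3
    exact h3.trans (mul_le_mul_of_nonneg_right ((le_max_right _ _).trans (le_max_right _ _)) h4.le)

theorem contDiffOn_amplitude {a : Z n' n p → ℂ} (ha : ContDiffOn ℝ ∞ a (dom p Ω' Ω))
    {u : Rn n → ℂ} (hu : ContDiffOn ℝ ∞ u Ω) :
    ContDiffOn ℝ ∞ (fun z : Z n' n p => a z * u z.2.1) (dom p Ω' Ω) :=
  ha.mul (hu.comp (g := u) (f := fun z : Z n' n p => z.2.1) (by fun_prop) fun _ hz => hz.2.1)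

/-- The jets of `a(x, y, ξ) u(y)`. -/
theorem exists_oscBound (n' n p : ℕ) {δ : ℝ} (hδ : 0 ≤ δ) (J : ℕ) : ∃ C : ℝ, 0 ≤ C ∧
    ∀ (Ω' : Opens (Rn n')) (Ω : Opens (Rn n)) (ρ m : ℝ) (V L : Set (Rn n')) (K : CompactIn Ω)
      (φ : Z n' n p → ℝ) (a : Z n' n p → ℂ) (u : Rn n → ℂ) (B A U : ℝ),
      IsOpen V → V ⊆ L → V ⊆ Ω' → IsPhase p Ω' Ω φ → ContDiffOn ℝ ∞ a (dom p Ω' Ω) →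
      ContDiffOn ℝ ∞ u Ω → (∀ y ∈ Ω, y ∉ K.1 → u y = 0) → PhaseBound L K.1 (J + 1) φ B →
      0 ≤ A → 0 ≤ U → symbolSeminorm m ρ δ (L ×ˢ K.1) J a ≤ ENNReal.ofReal A →
      smoothSeminorm K.1 J u ≤ ENNReal.ofReal U →
      OscBound Ω' Ω ρ δ m J K.1 V φ (fun z => a z * u z.2.1) B (C * (A * U)) := by
  refine ⟨2 ^ J * (((p + (n' + n) : ℕ) + 1 : ℝ) ^ J * (n + 1 : ℝ) ^ J), by positivity, ?_⟩
  intro Ω' Ω ρ m V L K φ a u B A U hV hVL hVΩ hφ ha hu huK hB hA hU hsA hsU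
  refine ⟨hV, hVΩ, hφ, contDiffOn_amplitude ha hu,
    fun x _ y hy hyK ξ => by simp [huK y hy hyK], hB.one_le, by positivity,
    fun x hx y hy ξ => hB.bound x (hVL hx) y hy ξ, fun x hx y hy ξ => ?_⟩
  have hz : ((x, y, ξ) : Z n' n p) ∈ dom p Ω' Ω := ⟨hVΩ hx, K.2.2 hy, trivial⟩
  have h1 := jetLe_of_symbolSeminorm_le (z := (x, y, ξ)) hA hsA ⟨hVL hx, hy⟩
    (contDiffAt_of_opens (isOpen_dom p Ω' Ω) ha hz J)
  have h2 := jetLe_of_smoothSeminorm_le hU hsU hy (contDiffAt_of_opens Ω.isOpen hu (K.2.2 hy) J)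
  have h3 : JetLe J (fun v => u (y + v)) 0 ((n + 1 : ℝ) ^ J * U) :=
    ⟨ContDiffAt.comp 0 (g := u) (f := fun w => y + w)
      (by simpa using h2.1) (contDiffAt_const.add contDiffAt_id), fun k hk => by
        rw [iteratedFDeriv_comp_add_left, add_zero]
        exact h2.2 k hk⟩
  have hl := jap_pos ξ
  let T : Z n' n p →L[ℝ] Rn n := (jap ξ ^ (-δ)) • (ContinuousLinearMap.fst ℝ (Rn n) (Rn p)).comp
      (ContinuousLinearMap.snd ℝ (Rn n') (Rn n × Rn p))
  have hT : ‖T‖ ≤ 1 := by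
    refine ContinuousLinearMap.opNorm_le_bound _ zero_le_one fun v => ?_
    have hv : ‖v.2.1‖ ≤ ‖v‖ := (norm_fst_le v.2).trans (norm_snd_le v)
    change ‖jap ξ ^ (-δ) • v.2.1‖ ≤ _
    rw [norm_smul, Real.norm_of_nonneg (by positivity)]
    exact mul_le_mul (jap_rpow_neg_le_one ξ hδ) hv (norm_nonneg _) zero_le_one
  have h4 : JetLe J (fun w => u (y + T w)) 0 (1 ^ J * ((n + 1 : ℝ) ^ J * U)) :=
    JetLe.comp_clm (g := fun v => u (y + v)) T (by rwa [map_zero]) hT le_rfl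
  refine ((h1.mul h4).mono (le_of_eq ?_)).congr (Eventually.of_forall fun w => ?_)
  · rw [one_pow]
    ring
  · simp [pull, symScale, scale_apply, T]

/-- The value at `x` of the Fourier integral operator. -/
def fioVal (Ω : Opens (Rn n)) (χ : Rn p → ℂ) (h : ℕ) (φ : Z n' n p → ℝ) (a : Z n' n p → ℂ)
    (u : Rn n → ℂ) (x : Rn n') : ℂ :=
  (((2 * Real.pi) ^ p)⁻¹ : ℝ) *
    ∫ w in (Ω : Set (Rn n)) ×ˢ (univ : Set (Rn p)), fioIntegrand χ h φ a u (x, w)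

/-- The value at `x` of the Fourier integral operator, truncated to `|ξ| ≤ R`. -/
def fioCut (Ω : Opens (Rn n)) (χ : Rn p → ℂ) (R : ℝ) (φ : Z n' n p → ℝ) (a : Z n' n p → ℂ)
    (u : Rn n → ℂ) (x : Rn n') : ℂ :=
  (((2 * Real.pi) ^ p)⁻¹ : ℝ) * ∫ w in (Ω : Set (Rn n)) ×ˢ (univ : Set (Rn p)),
    Complex.exp (Complex.I * (φ (x, w) : ℝ)) * (a (x, w) * u w.1 * dilate χ R ((x, w) : Z n' n p))

theorem norm_two_pi_inv_le (p : ℕ) : ‖((((2 * Real.pi) ^ p)⁻¹ : ℝ) : ℂ)‖ ≤ 1 := by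
  have h1 : (1 : ℝ) ≤ 2 * Real.pi := by linarith [Real.pi_gt_three]
  rw [Complex.norm_real, Real.norm_of_nonneg (by positivity)]
  exact inv_le_one_of_one_le₀ (one_le_pow₀ h1)

theorem exists_compact_nhd {V : Type} [TopologicalSpace V] [LocallyCompactSpace V] {Ω : Opens V}
    (L : CompactIn Ω) : ∃ L₂ : CompactIn Ω, L.1 ⊆ interior L₂.1 := by
  obtain ⟨L₂, h1, h2, h3⟩ := exists_compact_between L.2.1 Ω.isOpen L.2.2
  exact ⟨⟨L₂, h1, h3⟩, h2⟩

/-- The main estimate. Both $C$ and $M$ are chosen before the phase, amplitude and function, so for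
nets the dependence on $\varepsilon$ is confined to $B$, $A$ and $U$, and $B$ enters only through a
power. -/
theorem exists_fioVal_bound {ρ δ : ℝ} (hρ : ρ ≤ 1) (hδ : 0 ≤ δ) (hδ1 : δ ≤ 1) {χ : Rn p → ℂ}
    (hχ : IsCutoff χ) (h k : ℕ) {m : ℝ} (hm : m - h * min ρ (1 - δ) + k < -(p : ℝ))
    {L₂ : Set (Rn n')} (hL₂ : L₂ ⊆ Ω') (K : CompactIn Ω) :
    ∃ (C : ℝ) (M : ℕ), 0 ≤ C ∧ ∀ (φ : Z n' n p → ℝ) (a : Z n' n p → ℂ) (u : Rn n → ℂ) (B A U : ℝ),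
      IsPhase p Ω' Ω φ → ContDiffOn ℝ ∞ a (dom p Ω' Ω) →
      ContDiffOn ℝ ∞ u Ω → (∀ y ∈ Ω, y ∉ K.1 → u y = 0) → PhaseBound L₂ K.1 (k + h + 1) φ B →
      0 ≤ A → 0 ≤ U → symbolSeminorm m ρ δ (L₂ ×ˢ K.1) (k + h) a ≤ ENNReal.ofReal A →
      smoothSeminorm K.1 (k + h) u ≤ ENNReal.ofReal U → ∀ x ∈ interior L₂,
        IntegrableOn (fun w => fioIntegrand χ h φ a u (x, w)) ((Ω : Set (Rn n)) ×ˢ univ) ∧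
        JetLe k (fioVal Ω χ h φ a u) x (C * B ^ M * (A * U)) := by
  obtain ⟨C, M, hC, h1⟩ := exists_jetLe_osc_integral Ω' Ω hρ hδ hδ1 hχ h k hm K
  obtain ⟨D, hD, h2⟩ := exists_oscBound n' n p hδ (k + h)
  refine ⟨C * D, M, by positivity, fun φ a u B A U hφ ha hu huK hB hA hU hsA hsU x hx => ?_⟩
  have H := h2 Ω' Ω ρ m (interior L₂) L₂ K φ a u B A U isOpen_interior interior_subset
    (interior_subset.trans hL₂) hφ ha hu huK hB hA hU hsA hsU
  obtain ⟨h3, h4⟩ := h1 φ _ _ B _ H.isOpen H.subset H.isPhase H.contDiffOn H.vanishes H.one_le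
    H.nonneg (fun x hx y hy ξ => ⟨H.phase x hx y hy ξ, H.jetLe x hx y hy ξ⟩) x hx
  refine ⟨h3, ?_⟩
  have h5 := h4.clm_comp (((((2 * Real.pi) ^ p)⁻¹ : ℝ) : ℂ) • ContinuousLinearMap.id ℝ ℂ)
  have hc := h4.nonneg
  refine (h5.mono ?_).congr (Eventually.of_forall fun x => rfl)
  have h6 : ‖(((((2 * Real.pi) ^ p)⁻¹ : ℝ) : ℂ) • ContinuousLinearMap.id ℝ ℂ)‖ ≤ 1 := by
    rw [norm_smul]
    exact mul_le_one₀ (norm_two_pi_inv_le p) (norm_nonneg _) ContinuousLinearMap.norm_id_le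
  calc _ ≤ 1 * (C * B ^ M * (D * (A * U))) := mul_le_mul_of_nonneg_right h6 hc
    _ = _ := by ring

theorem exists_fioVal_sub_fioCut_bound {ρ δ : ℝ} (hρ : ρ ≤ 1) (hδ : 0 ≤ δ) (hδ1 : δ ≤ 1)
    {χ χ₀ : Rn p → ℂ} (hχ : IsCutoff χ) (hχ₀ : IsCutoff χ₀) (h : ℕ) {m : ℝ}
    (hm : m - h * min ρ (1 - δ) + 1 < -(p : ℝ)) {L₂ : Set (Rn n')} (hL₂ : L₂ ⊆ Ω')
    (K : CompactIn Ω) :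
    ∃ (C : ℝ) (M : ℕ), 0 ≤ C ∧ ∀ (φ : Z n' n p → ℝ) (a : Z n' n p → ℂ) (u : Rn n → ℂ) (B A U : ℝ),
      IsPhase p Ω' Ω φ → ContDiffOn ℝ ∞ a (dom p Ω' Ω) →
      ContDiffOn ℝ ∞ u Ω → (∀ y ∈ Ω, y ∉ K.1 → u y = 0) → PhaseBound L₂ K.1 (h + 1) φ B →
      0 ≤ A → 0 ≤ U → symbolSeminorm m ρ δ (L₂ ×ˢ K.1) h a ≤ ENNReal.ofReal A →
      smoothSeminorm K.1 h u ≤ ENNReal.ofReal U → ∀ R, 1 ≤ R → ∀ x ∈ interior L₂,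
        ‖fioVal Ω χ h φ a u x - fioCut Ω χ₀ R φ a u x‖ ≤ C * B ^ M * (A * U) * R⁻¹ := by
  obtain ⟨C, M, hC, h1⟩ := exists_tail_bound Ω' Ω hρ hδ hδ1 hχ hχ₀ h hm K
  obtain ⟨D, hD, h2⟩ := exists_oscBound n' n p hδ h
  refine ⟨C * D, M, by positivity, fun φ a u B A U hφ ha hu huK hB hA hU hsA hsU R hR x hx => ?_⟩
  have H := h2 Ω' Ω ρ m (interior L₂) L₂ K φ a u B A U isOpen_interior interior_subset
    (interior_subset.trans hL₂) hφ ha hu huK hB hA hU hsA hsU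
  have h3 := h1 φ _ _ B _ H R hR x hx
  rw [fioVal, fioCut, ← mul_sub, norm_mul]
  calc _ ≤ 1 * (C * B ^ M * (D * (A * U)) * R⁻¹) :=
        mul_le_mul (norm_two_pi_inv_le p) h3 (norm_nonneg _) zero_le_one
    _ = _ := by ring

end Values

/-! ### Estimates without derivatives of $u$, and comparison of truncated integrals -/

section Comparison

variable {n' n p : ℕ} {Ω' : Opens (Rn n')} {Ω : Opens (Rn n)}

/-- For amplitudes of sufficiently negative order, the derivatives of the Fourier integral operator
are bounded by the supremum of `|u|`. -/
theorem exists_fioVal_zero_bound {χ : Rn p → ℂ} (hχ : IsCutoff χ) (k : ℕ) {m : ℝ}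
    (hm : m + k < -(p : ℝ)) {L₂ : Set (Rn n')} (hL₂ : L₂ ⊆ Ω') (K : CompactIn Ω) :
    ∃ (C : ℝ) (M : ℕ), 0 ≤ C ∧ ∀ (φ : Z n' n p → ℝ) (a : Z n' n p → ℂ) (u : Rn n → ℂ) (B A U : ℝ),
      IsPhase p Ω' Ω φ → ContDiffOn ℝ ∞ a (dom p Ω' Ω) →
      ContDiffOn ℝ ∞ u Ω → (∀ y ∈ Ω, y ∉ K.1 → u y = 0) → PhaseBound L₂ K.1 (k + 1) φ B →
      0 ≤ A → 0 ≤ U → symbolSeminorm m 1 0 (L₂ ×ˢ K.1) k a ≤ ENNReal.ofReal A →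
      (∀ y ∈ K.1, ‖u y‖ ≤ U) → ∀ x ∈ interior L₂,
        JetLe k (fioVal Ω χ 0 φ a u) x (C * B ^ M * (A * U)) := by
  obtain ⟨C, M, hC, h1⟩ := exists_bound_slice (n' := n') (n := n) Ω' Ω (ρ := 1) (δ := 0) le_rfl
    le_rfl zero_le_one hχ 0 k
  have hJ := integrable_indicator_jap (p := p) K.2.1 hm
  set D : ℝ := ((p + (n' + n) : ℕ) + 1 : ℝ) ^ k with hD
  set I : ℝ := ∫ w in (Ω : Set (Rn n)) ×ˢ (univ : Set (Rn p)),
    K.1.indicator (fun _ => (1 : ℝ)) w.1 * jap w.2 ^ (m + k) with hI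
  have hD0 : 0 ≤ D := by positivity
  have hI0 : 0 ≤ I := integral_nonneg fun w => by
    have := jap_pos w.2
    refine mul_nonneg (indicator_nonneg (fun _ _ => zero_le_one) _) (by positivity)
  refine ⟨2 ^ k * C * D * I, M, by positivity,
    fun φ a u B A U hφ ha hu huK hB hA hU hsA hsU x hx => ?_⟩
  have hB0 : 0 ≤ B := by linarith [hB.one_le]
  have hsub : interior L₂ ⊆ Ω' := interior_subset.trans hL₂
  have hg : IntegrableOn (fun w : Rn n × Rn p =>
      2 ^ k * C * D * B ^ M * (A * U) * (K.1.indicator (fun _ => (1 : ℝ)) w.1 * jap w.2 ^ (m + k)))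
      ((Ω : Set (Rn n)) ×ˢ univ) := (hJ.const_mul _).integrableOn
  have hjet : ∀ᵐ w ∂(volume.restrict ((Ω : Set (Rn n)) ×ˢ (univ : Set (Rn p)))),
      ∀ x ∈ interior L₂, JetLe k (fun x => oscIntegrand χ 0 φ (fun z => a z * u z.2.1) (x, w)) x
        (2 ^ k * C * D * B ^ M * (A * U) *
          (K.1.indicator (fun _ => (1 : ℝ)) w.1 * jap w.2 ^ (m + k))) := by
    refine (ae_restrict_mem (Ω.isOpen.measurableSet.prod MeasurableSet.univ)).mono
      fun w hw x hx => ?_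
    by_cases hwK : w.1 ∈ K.1
    · have hz : ((x, w) : Z n' n p) ∈ dom p Ω' Ω := ⟨hsub hx, hw.1, trivial⟩
      have h2 := jetLe_of_symbolSeminorm_le (z := (x, w)) hA hsA ⟨interior_subset hx, hwK⟩
        (contDiffAt_of_opens (isOpen_dom p Ω' Ω) ha hz k)
      -- With $h=0$ the slice estimate is applied to $a$ alone: $u(y)$ is constant in $x$, so no
      -- derivative of $u$ enters.
      have h3 := h1 φ a (x, w) B _ hφ ha hz hB.one_le
        (hB.bound x (interior_subset hx) w.1 hwK w.2) h2
      have h4 := h3.mul (JetLe.const (E := Rn n') (j := k) (w := x) (u w.1))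
      refine (h4.mono ?_).congr (Eventually.of_forall fun x => ?_)
      · rw [indicator_of_mem hwK]
        have hl := jap_pos w.2
        simp only [CharP.cast_eq_zero, zero_mul, neg_zero, zero_add, one_mul]
        rw [add_comm m, Real.rpow_add hl]
        calc _ = 2 ^ k * C * D * B ^ M * (A * ‖u w.1‖) * (jap w.2 ^ (k : ℝ) * jap w.2 ^ m) := by ring
          _ ≤ _ := by
            have := hsU w.1 hwK
            gcongr
      · simp only [oscIntegrand, Function.iterate_zero, id]
        ring
    · refine ((JetLe.const (0 : ℂ)).mono (by simp [hwK])).congr (Eventually.of_forall fun x => ?_)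
      simp [oscIntegrand, huK w.1 hw.1 hwK]
  have h5 := (jetLe_integral isOpen_interior hg hjet (fun x hx j _ =>
    hφ.aestronglyMeasurable_slice hχ 0 (contDiffOn_amplitude ha hu) (hsub hx) j) hx).clm_comp
      (((((2 * Real.pi) ^ p)⁻¹ : ℝ) : ℂ) • ContinuousLinearMap.id ℝ ℂ)
  refine (h5.mono ?_).congr (Eventually.of_forall fun x => rfl)
  rw [integral_const_mul, ← hI]
  have h6 : ‖(((((2 * Real.pi) ^ p)⁻¹ : ℝ) : ℂ) • ContinuousLinearMap.id ℝ ℂ)‖ ≤ 1 := by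
    rw [norm_smul]
    exact mul_le_one₀ (norm_two_pi_inv_le p) (norm_nonneg _) ContinuousLinearMap.norm_id_le
  calc _ ≤ 1 * (2 ^ k * C * D * B ^ M * (A * U) * I) := mul_le_mul_of_nonneg_right h6 (by positivity)
    _ = _ := by ring

theorem norm_exp_sub_exp_le (s t : ℝ) :
    ‖Complex.exp (Complex.I * (s : ℝ)) - Complex.exp (Complex.I * (t : ℝ))‖ ≤ |s - t| := by
  have h1 : Complex.exp (Complex.I * (s : ℝ)) - Complex.exp (Complex.I * (t : ℝ)) =
      Complex.exp (Complex.I * (t : ℝ)) * (Complex.exp (Complex.I * ((s - t : ℝ) : ℂ)) - 1) := by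
    rw [mul_sub, ← Complex.exp_add, mul_one]
    congr 2
    push_cast
    ring
  rw [h1, norm_mul, mul_comm Complex.I, Complex.norm_exp_ofReal_mul_I, one_mul]
  exact Real.norm_exp_I_mul_ofReal_sub_one_le

theorem integrableOn_fioCut {χ : Rn p → ℂ} (hχ : IsCutoff χ) {R : ℝ} (hR : 1 ≤ R)
    {φ : Z n' n p → ℝ} (hφ : IsPhase p Ω' Ω φ) {a : Z n' n p → ℂ}
    (ha : ContDiffOn ℝ ∞ a (dom p Ω' Ω)) {u : Rn n → ℂ} (hu : ContDiffOn ℝ ∞ u Ω) {K : CompactIn Ω}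
    (huK : ∀ y ∈ Ω, y ∉ K.1 → u y = 0) {x : Rn n'} (hx : x ∈ Ω') :
    IntegrableOn (fun w : Rn n × Rn p => Complex.exp (Complex.I * (φ (x, w) : ℝ)) *
      (a (x, w) * u w.1 * dilate χ R ((x, w) : Z n' n p))) ((Ω : Set (Rn n)) ×ˢ univ) :=
  hφ.integrableOn_osc_of_vanishes hχ 0
    (f := fun z => a z * u z.2.1 * dilate χ R z) (K := K) (R := R)
    ((contDiffOn_amplitude ha hu).mul (hχ.contDiff_dilate R).contDiffOn)
    (fun x _ y hy hyK ξ => by simp [huK y hy hyK])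
    (hχ.vanishesForLarge_dilate hR fun z => a z * u z.2.1) hx

theorem norm_le_of_symbolSeminorm_le {m ρ δ : ℝ} {K : Set (Rn n' × Rn n)}
    {a : Z n' n p → ℂ} (ha : ContDiffOn ℝ ∞ a (dom p Ω' Ω)) {A : ℝ} (hA : 0 ≤ A)
    (h : symbolSeminorm m ρ δ K 0 a ≤ ENNReal.ofReal A) {z : Z n' n p} (hz : (z.1, z.2.1) ∈ K)
    (hzd : z ∈ dom p Ω' Ω) : ‖a z‖ ≤ A * jap z.2.2 ^ m := by
  simpa [pull] using (jetLe_of_symbolSeminorm_le hA h hz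
    (contDiffAt_of_opens (isOpen_dom p Ω' Ω) ha hzd 0)).norm_le

theorem IsPhase.abs_sub_le_of_hgSeminorm_le {φ ψ : Z n' n p → ℝ} (hφ : IsPhase p Ω' Ω φ)
    (hψ : IsPhase p Ω' Ω ψ) {K : Set (Rn n' × Rn n)} {D : ℝ} (hD : 0 ≤ D)
    (h : hgSeminorm K 0 (φ - ψ) ≤ ENNReal.ofReal D) {z : Z n' n p} (hz : (z.1, z.2.1) ∈ K)
    (hzd : z ∈ dom p Ω' Ω) : |φ z - ψ z| ≤ D * ‖z.2.2‖ := by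
  by_cases h0 : z.2.2 = 0
  · simp [hφ.eq_zero_of_xi hzd h0, hψ.eq_zero_of_xi hzd h0, h0]
  · simpa [pull] using (jetLe_of_hgSeminorm_le hD h hz h0 (contDiffAt_of_opens (isOpen_dom₀ p Ω' Ω)
      (hφ.contDiffOn.sub hψ.contDiffOn) ⟨hzd.1, hzd.2.1, h0⟩ 0)).norm_le

/-- The integrand is compared term by term, using $|e^{i\phi}-e^{i\phi'}|\le|\phi-\phi'|\le D|\xi|$.
No integration by parts is needed on $|\xi|\le R$; the price is a power of $R$, which is harmless
when the differences are negligible and $R$ is a power of $\varepsilon^{-1}$. -/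
theorem exists_fioCut_sub_bound {χ : Rn p → ℂ} (hχ : IsCutoff χ) (m ρ δ : ℝ) {L₂ : Set (Rn n')}
    (hL₂ : L₂ ⊆ Ω') (K : CompactIn Ω) :
    ∃ (C : ℝ) (M : ℕ), 0 ≤ C ∧ ∀ (φ φ' : Z n' n p → ℝ) (a a' : Z n' n p → ℂ) (u u' : Rn n → ℂ)
      (D A A' Ad U Ud : ℝ), IsPhase p Ω' Ω φ → IsPhase p Ω' Ω φ' →
      ContDiffOn ℝ ∞ a (dom p Ω' Ω) → ContDiffOn ℝ ∞ a' (dom p Ω' Ω) →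
      ContDiffOn ℝ ∞ u Ω → ContDiffOn ℝ ∞ u' Ω → (∀ y ∈ Ω, y ∉ K.1 → u y = 0) →
      (∀ y ∈ Ω, y ∉ K.1 → u' y = 0) → 0 ≤ D → 0 ≤ A → 0 ≤ A' → 0 ≤ Ad → 0 ≤ U → 0 ≤ Ud →
      hgSeminorm (L₂ ×ˢ K.1) 0 (φ - φ') ≤ ENNReal.ofReal D →
      symbolSeminorm m ρ δ (L₂ ×ˢ K.1) 0 a ≤ ENNReal.ofReal A →
      symbolSeminorm m ρ δ (L₂ ×ˢ K.1) 0 a' ≤ ENNReal.ofReal A' →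
      symbolSeminorm m ρ δ (L₂ ×ˢ K.1) 0 (a - a') ≤ ENNReal.ofReal Ad →
      (∀ y ∈ K.1, ‖u y‖ ≤ U) → (∀ y ∈ K.1, ‖u y - u' y‖ ≤ Ud) → ∀ R, 1 ≤ R → ∀ x ∈ L₂,
        ‖fioCut Ω χ R φ a u x - fioCut Ω χ R φ' a' u' x‖ ≤
          C * R ^ M * (D * A * U + Ad * U + A' * Ud) := by
  obtain ⟨X, hX⟩ : ∃ X : ℝ, ∀ ξ : Rn p, ‖χ ξ‖ ≤ X := by
    have hc : HasCompactSupport χ := HasCompactSupport.intro (isCompact_closedBall (0 : Rn p) (1 / 2))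
      fun ξ hξ => hχ.eq_zero ξ (by simpa using hξ)
    obtain ⟨X, hX⟩ := hc.exists_bound_of_continuous hχ.contDiff.continuous
    exact ⟨X, hX⟩
  have hX0 : 0 ≤ X := (norm_nonneg _).trans (hX 0)
  have he : (-(p : ℝ) - 1) < -(p : ℝ) := by linarith
  have hJ := integrable_indicator_jap (p := p) K.2.1 he
  set I : ℝ := ∫ w in (Ω : Set (Rn n)) ×ˢ (univ : Set (Rn p)),
    K.1.indicator (fun _ => (1 : ℝ)) w.1 * jap w.2 ^ (-(p : ℝ) - 1) with hI
  have hI0 : 0 ≤ I := integral_nonneg fun w => by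
    have := jap_pos w.2
    refine mul_nonneg (indicator_nonneg (fun _ _ => zero_le_one) _) (by positivity)
  -- With this $M$, $\langle\xi\rangle^{m+1}\le\langle\xi\rangle^{-p-1}\langle\xi\rangle^{M}$, and
  -- $\langle\xi\rangle\le2R$ on the truncated region.
  obtain ⟨M, hM⟩ := exists_nat_ge (m + p + 2)
  refine ⟨X * 2 ^ M * I, M, by positivity, fun φ φ' a a' u u' D A A' Ad U Ud hφ hφ' ha ha' hu hu' huK
    huK' hD hA hA' hAd hU hUd hsD hsA hsA' hsAd hsU hsUd R hR x hx => ?_⟩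
  have hR0 : 0 < R := by linarith
  have hxΩ := hL₂ hx
  set S : ℝ := D * A * U + Ad * U + A' * Ud with hS
  have hS0 : 0 ≤ S := by positivity
  have h1 := integrableOn_fioCut hχ hR hφ ha hu huK hxΩ
  have h2 := integrableOn_fioCut hχ hR hφ' ha' hu' huK' hxΩ
  have hg : IntegrableOn (fun w : Rn n × Rn p =>
      X * 2 ^ M * R ^ M * S * (K.1.indicator (fun _ => (1 : ℝ)) w.1 * jap w.2 ^ (-(p : ℝ) - 1)))
      ((Ω : Set (Rn n)) ×ˢ univ) := (hJ.const_mul _).integrableOn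
  rw [fioCut, fioCut, ← mul_sub, norm_mul, ← integral_sub h1 h2]
  have key : ‖∫ w in (Ω : Set (Rn n)) ×ˢ (univ : Set (Rn p)),
      (Complex.exp (Complex.I * (φ (x, w) : ℝ)) * (a (x, w) * u w.1 * dilate χ R ((x, w) : Z n' n p)) -
      Complex.exp (Complex.I * (φ' (x, w) : ℝ)) *
        (a' (x, w) * u' w.1 * dilate χ R ((x, w) : Z n' n p)))‖ ≤ X * 2 ^ M * R ^ M * S * I := by
    rw [hI, ← integral_const_mul]
    refine norm_integral_le_of_norm_le hg ?_
    refine (ae_restrict_mem (Ω.isOpen.measurableSet.prod MeasurableSet.univ)).mono fun w hw => ?_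
    have hl := jap_pos w.2
    by_cases hwK : w.1 ∈ K.1
    swap
    · simp [huK w.1 hw.1 hwK, huK' w.1 hw.1 hwK, hwK]
    rw [indicator_of_mem hwK, one_mul]
    rcases lt_or_ge R ‖w.2‖ with hwR | hwR
    · have h3 : dilate χ R ((x, w) : Z n' n p) = 0 := by
        simpa using hχ.vanishesForLarge_dilate (n' := n') (n := n) hR (fun _ => 1) (x, w) hwR
      rw [h3]
      simp only [mul_zero, sub_zero, norm_zero]
      positivity
    have hz : ((x, w) : Z n' n p) ∈ dom p Ω' Ω := ⟨hxΩ, hw.1, trivial⟩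
    have hzK : ((x, w.1) : Rn n' × Rn n) ∈ L₂ ×ˢ K.1 := ⟨hx, hwK⟩
    have e1 := hφ.abs_sub_le_of_hgSeminorm_le hφ' hD hsD (z := (x, w)) hzK hz
    have e2 := norm_le_of_symbolSeminorm_le ha hA hsA (z := (x, w)) hzK hz
    have e3 := norm_le_of_symbolSeminorm_le ha' hA' hsA' (z := (x, w)) hzK hz
    have e4 : ‖a (x, w) - a' (x, w)‖ ≤ _ :=
      norm_le_of_symbolSeminorm_le (ha.sub ha') hAd hsAd (z := (x, w)) hzK hz
    have e5 := hsU w.1 hwK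
    have e6 := hsUd w.1 hwK
    have e7 : ‖dilate χ R ((x, w) : Z n' n p)‖ ≤ X := hX _
    have e8 := (norm_exp_sub_exp_le (φ (x, w)) (φ' (x, w))).trans e1
    have e9 : ‖Complex.exp (Complex.I * (φ' (x, w) : ℝ))‖ = 1 := expPhase_ne φ' (x, w)
    simp only at e1 e2 e3 e4 e8
    have hj := norm_le_jap w.2
    have hj1 := one_le_jap w.2
    have hm0 : 0 ≤ jap w.2 ^ m := by positivity
    have h4 : Complex.exp (Complex.I * (φ (x, w) : ℝ)) *
        (a (x, w) * u w.1 * dilate χ R ((x, w) : Z n' n p)) -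
        Complex.exp (Complex.I * (φ' (x, w) : ℝ)) *
          (a' (x, w) * u' w.1 * dilate χ R ((x, w) : Z n' n p)) =
        ((Complex.exp (Complex.I * (φ (x, w) : ℝ)) - Complex.exp (Complex.I * (φ' (x, w) : ℝ))) *
          a (x, w) * u w.1 + Complex.exp (Complex.I * (φ' (x, w) : ℝ)) *
            ((a (x, w) - a' (x, w)) * u w.1) + Complex.exp (Complex.I * (φ' (x, w) : ℝ)) *
            (a' (x, w) * (u w.1 - u' w.1))) * dilate χ R ((x, w) : Z n' n p) := by ring
    rw [h4, norm_mul]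
    have h5 : jap w.2 ^ m * jap w.2 ≤ jap w.2 ^ (-(p : ℝ) - 1) * (2 ^ M * R ^ M) := by
      have h6 : jap w.2 ^ m * jap w.2 ≤ jap w.2 ^ (-(p : ℝ) - 1) * jap w.2 ^ (M : ℝ) := by
        rw [← Real.rpow_add hl, ← Real.rpow_add_one hl.ne']
        exact Real.rpow_le_rpow_of_exponent_le hj1 (by linarith)
      refine h6.trans (mul_le_mul_of_nonneg_left ?_ (by positivity))
      rw [Real.rpow_natCast, ← mul_pow]
      exact pow_le_pow_left₀ hl.le ((jap_le w.2).trans (by linarith)) M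
    calc _ ≤ (D * ‖w.2‖ * (A * jap w.2 ^ m) * U + 1 * ((Ad * jap w.2 ^ m) * U) +
          1 * ((A' * jap w.2 ^ m) * Ud)) * X := by
          refine mul_le_mul ?_ e7 (norm_nonneg _) (by positivity)
          refine (norm_add₃_le).trans (add_le_add (add_le_add ?_ ?_) ?_)
          · rw [norm_mul, norm_mul]
            gcongr
          · rw [norm_mul, norm_mul, e9]
            gcongr
          · rw [norm_mul, norm_mul, e9]
            gcongr
      _ ≤ (D * jap w.2 * (A * jap w.2 ^ m) * U + jap w.2 * ((Ad * jap w.2 ^ m) * U) +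
          jap w.2 * ((A' * jap w.2 ^ m) * Ud)) * X := by gcongr
      _ = X * S * (jap w.2 ^ m * jap w.2) := by ring
      _ ≤ X * S * (jap w.2 ^ (-(p : ℝ) - 1) * (2 ^ M * R ^ M)) :=
          mul_le_mul_of_nonneg_left h5 (by positivity)
      _ = _ := by ring
  calc _ ≤ 1 * (X * 2 ^ M * R ^ M * S * I) :=
        mul_le_mul (norm_two_pi_inv_le p) key (norm_nonneg _) zero_le_one
    _ = _ := by ring

end Comparison

/-! ### Fourier integrals for a fixed value of the parameter -/

section FixedParameter

variable {n' n p : ℕ} {Ω' : Opens (Rn n')} {Ω : Opens (Rn n)}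

/-- The product of compact sets as a compact subset of `Ω' × Ω`. -/
def CompactIn.prod (L : CompactIn Ω') (K : CompactIn Ω) : CompactIn (base Ω' Ω) :=
  ⟨L.1 ×ˢ K.1, L.2.1.prod K.2.1, prod_mono L.2.2 K.2.2⟩

theorem exists_smoothSeminorm_le {u : Rn n → ℂ} (hu : ContDiffOn ℝ ∞ u Ω) (K : CompactIn Ω)
    (i : ℕ) : ∃ U : ℝ, 0 ≤ U ∧ smoothSeminorm K.1 i u ≤ ENNReal.ofReal U := by
  obtain ⟨U, hU, h⟩ := exists_jetLe_of_isCompact Ω.isOpen hu K.2.1 K.2.2 i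
  exact ⟨U, hU, smoothSeminorm_le_of_norm_le fun y hy => (h y hy).2⟩

theorem exists_symbolSeminorm_le {m ρ δ : ℝ} {a : Z n' n p → ℂ} (ha : a ∈ Sym p Ω' Ω m ρ δ)
    (L : CompactIn Ω') (K : CompactIn Ω) (j : ℕ) :
    ∃ A : ℝ, 0 ≤ A ∧ symbolSeminorm m ρ δ (L.1 ×ˢ K.1) j a ≤ ENNReal.ofReal A :=
  ⟨_, ENNReal.toReal_nonneg, (ENNReal.ofReal_toReal (ha.2 (L.prod K) j).ne).ge⟩

theorem exists_nhd_compact {x : Rn n'} (hx : x ∈ Ω') :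
    ∃ L : CompactIn Ω', x ∈ interior L.1 := by
  obtain ⟨L, hL⟩ := exists_compact_nhd (Ω := Ω') ⟨{x}, isCompact_singleton, by simpa using hx⟩
  exact ⟨L, hL rfl⟩

theorem exists_order {s : ℝ} (hs : 0 < s) (m r : ℝ) : ∃ h : ℕ, m - h * s + r < -(p : ℝ) := by
  obtain ⟨h, hh⟩ := exists_nat_gt ((m + r + p) / s)
  refine ⟨h, ?_⟩
  rw [div_lt_iff₀ hs] at hh
  linarith

variable {m ρ δ : ℝ} {φ : Z n' n p → ℝ} {a : Z n' n p → ℂ} {u : Rn n → ℂ} {K : CompactIn Ω}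

theorem integrableOn_fioIntegrand (hρ : ρ ≤ 1) (hδ : 0 ≤ δ) (hδ1 : δ ≤ 1) {χ : Rn p → ℂ}
    (hχ : IsCutoff χ) {h : ℕ} (hm : m - h * min ρ (1 - δ) + 1 < -(p : ℝ)) (hφ : IsPhase p Ω' Ω φ)
    (ha : a ∈ Sym p Ω' Ω m ρ δ) (hu : ContDiffOn ℝ ∞ u Ω) (huK : ∀ y ∈ Ω, y ∉ K.1 → u y = 0)
    {x : Rn n'} (hx : x ∈ Ω') :
    IntegrableOn (fun w => fioIntegrand χ h φ a u (x, w)) ((Ω : Set (Rn n)) ×ˢ univ) := by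
  obtain ⟨L, hL⟩ := exists_nhd_compact hx
  obtain ⟨B, hB⟩ := hφ.exists_phaseBound L.2.1 L.2.2 K.2.1 K.2.2 (0 + h + 1)
  obtain ⟨A, hA, hA'⟩ := exists_symbolSeminorm_le ha L K (0 + h)
  obtain ⟨U, hU, hU'⟩ := exists_smoothSeminorm_le hu K (0 + h)
  obtain ⟨C, M, -, h1⟩ := exists_fioVal_bound hρ hδ hδ1 hχ h 0 (m := m) (by push_cast; linarith)
    L.2.2 K
  exact (h1 φ a u B A U hφ ha.1 hu huK hB hA hU hA' hU' x hL).1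

/-- Both values are limits, as $R\to\infty$, of one and the same truncated integral, in which
neither exponent occurs and the truncating cut-off is fixed. -/
theorem fioVal_eq_fioVal (hρ : ρ ≤ 1) (hδ : 0 ≤ δ) (hδ1 : δ ≤ 1) {χ χ' : Rn p → ℂ}
    (hχ : IsCutoff χ) (hχ' : IsCutoff χ') {h h' : ℕ} (hm : m - h * min ρ (1 - δ) + 1 < -(p : ℝ))
    (hm' : m - h' * min ρ (1 - δ) + 1 < -(p : ℝ)) (hφ : IsPhase p Ω' Ω φ)
    (ha : a ∈ Sym p Ω' Ω m ρ δ) (hu : ContDiffOn ℝ ∞ u Ω) (huK : ∀ y ∈ Ω, y ∉ K.1 → u y = 0)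
    {x : Rn n'} (hx : x ∈ Ω') : fioVal Ω χ h φ a u x = fioVal Ω χ' h' φ a u x := by
  obtain ⟨L, hL⟩ := exists_nhd_compact hx
  have key : ∀ {χ₁ : Rn p → ℂ} {h : ℕ}, IsCutoff χ₁ → m - h * min ρ (1 - δ) + 1 < -(p : ℝ) →
      Tendsto (fun R => fioCut Ω χ R φ a u x) atTop (𝓝 (fioVal Ω χ₁ h φ a u x)) := by
    intro χ₁ h hχ₁ hm
    obtain ⟨B, hB⟩ := hφ.exists_phaseBound L.2.1 L.2.2 K.2.1 K.2.2 (h + 1)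
    obtain ⟨A, hA, hA'⟩ := exists_symbolSeminorm_le ha L K h
    obtain ⟨U, hU, hU'⟩ := exists_smoothSeminorm_le hu K h
    obtain ⟨C, M, -, h1⟩ := exists_fioVal_sub_fioCut_bound hρ hδ hδ1 hχ₁ hχ h hm L.2.2 K
    have h2 := h1 φ a u B A U hφ ha.1 hu huK hB hA hU hA' hU'
    rw [tendsto_iff_norm_sub_tendsto_zero]
    refine squeeze_zero' (Eventually.of_forall fun _ => norm_nonneg _)
      ((eventually_ge_atTop 1).mono fun R hR => ?_)
      (by simpa using tendsto_inv_atTop_zero.const_mul (C * B ^ M * (A * U)))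
    rw [norm_sub_rev]
    exact h2 R hR x hL
  exact tendsto_nhds_unique (key hχ hm) (key hχ' hm')

/-- The given $h$ guarantees only the convergence of the integral. For $C^k$ regularity it is
replaced by a larger exponent, which does not change the function. -/
theorem contDiffOn_fioVal (hρ0 : 0 < ρ) (hρ : ρ ≤ 1) (hδ : 0 ≤ δ) (hδ1 : δ < 1) {χ : Rn p → ℂ}
    (hχ : IsCutoff χ) {h : ℕ} (hm : m - h * min ρ (1 - δ) + 1 < -(p : ℝ)) (hφ : IsPhase p Ω' Ω φ)
    (ha : a ∈ Sym p Ω' Ω m ρ δ) (hu : ContDiffOn ℝ ∞ u Ω) (huK : ∀ y ∈ Ω, y ∉ K.1 → u y = 0) :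
    ContDiffOn ℝ ∞ (fioVal Ω χ h φ a u) Ω' := by
  refine contDiffOn_infty.2 fun k x hx => ContDiffAt.contDiffWithinAt ?_
  have hs : 0 < min ρ (1 - δ) := lt_min hρ0 (by linarith)
  obtain ⟨h', hh'⟩ := exists_order (p := p) hs m (k + 1)
  obtain ⟨L, hL⟩ := exists_nhd_compact hx
  obtain ⟨B, hB⟩ := hφ.exists_phaseBound L.2.1 L.2.2 K.2.1 K.2.2 (k + h' + 1)
  obtain ⟨A, hA, hA'⟩ := exists_symbolSeminorm_le ha L K (k + h')
  obtain ⟨U, hU, hU'⟩ := exists_smoothSeminorm_le hu K (k + h')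
  obtain ⟨C, M, -, h1⟩ := exists_fioVal_bound hρ hδ hδ1.le hχ h' k (m := m) (by linarith) L.2.2 K
  refine (h1 φ a u B A U hφ ha.1 hu huK hB hA hU hA' hU' x hL).2.1.congr_of_eventuallyEq ?_
  filter_upwards [Ω'.isOpen.mem_nhds hx] with z hz
  exact fioVal_eq_fioVal hρ hδ hδ1.le hχ hχ hm (by
    have := Nat.cast_nonneg (α := ℝ) k
    linarith) hφ ha hu huK hz

theorem opL_const_mul (χ : Rn p → ℂ) (φ : Z n' n p → ℝ) (c : ℂ) {f : Z n' n p → ℂ} {z : Z n' n p}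
    (hf : DifferentiableAt ℝ f z) :
    opL χ φ (fun z => c * f z) z = c * opL χ φ f z := by
  have : fderiv ℝ (fun z => c * f z) z = c • fderiv ℝ f z := fderiv_const_mul hf c
  simp only [opL, this, smul_apply, mul_add, Finset.mul_sum, smul_eq_mul]
  congr 1
  · congr 1 <;>
    exact Finset.sum_congr rfl fun _ _ => by ring
  · ring

theorem IsPhase.opL_iterate_const_mul {φ : Z n' n p → ℝ} (hφ : IsPhase p Ω' Ω φ) {χ : Rn p → ℂ}
    (hχ : IsCutoff χ) (h : ℕ) (c : ℂ) {f : Z n' n p → ℂ} (hf : ContDiffOn ℝ ∞ f (dom p Ω' Ω))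
    {z : Z n' n p} (hz : z ∈ dom p Ω' Ω) :
    (opL χ φ)^[h] (fun z => c * f z) z = c * (opL χ φ)^[h] f z := by
  induction h generalizing f z with
  | zero => rfl
  | succ h ih =>
    simp only [Function.iterate_succ_apply]
    have hf1 : ContDiffOn ℝ ∞ (opL χ φ f) (dom p Ω' Ω) := hφ.contDiffOn_opL_iterate_dom hχ 1 hf
    rw [← ih hf1 hz]
    refine opL_iterate_congr (isOpen_dom p Ω' Ω) χ φ h (fun w hw => ?_) hz
    exact opL_const_mul χ φ c
      ((contDiffAt_of_opens (isOpen_dom p Ω' Ω) hf hw 1).differentiableAt (by simp))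

theorem fioVal_const_mul {χ : Rn p → ℂ} (hχ : IsCutoff χ) (h : ℕ) (hφ : IsPhase p Ω' Ω φ)
    (ha : ContDiffOn ℝ ∞ a (dom p Ω' Ω)) (hu : ContDiffOn ℝ ∞ u Ω) (c : ℂ) {x : Rn n'}
    (hx : x ∈ Ω') : fioVal Ω χ h φ a (fun y => c * u y) x = c * fioVal Ω χ h φ a u x := by
  rw [fioVal, fioVal, mul_left_comm, ← integral_const_mul c]
  congr 1
  refine setIntegral_congr_fun (Ω.isOpen.measurableSet.prod MeasurableSet.univ) fun w hw => ?_
  have h1 := hφ.opL_iterate_const_mul hχ h c (contDiffOn_amplitude ha hu) (z := (x, w))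
    ⟨hx, hw.1, trivial⟩
  simp only [fioIntegrand]
  rw [mul_left_comm, ← h1]
  congr 2
  refine congrArg (fun g : Z n' n p → ℂ => (opL χ φ)^[h] g (x, w)) (funext fun z => ?_)
  ring

theorem fioVal_add (hρ : ρ ≤ 1) (hδ : 0 ≤ δ) (hδ1 : δ ≤ 1) {χ : Rn p → ℂ}
    (hχ : IsCutoff χ) {h : ℕ} (hm : m - h * min ρ (1 - δ) + 1 < -(p : ℝ)) (hφ : IsPhase p Ω' Ω φ)
    (ha : a ∈ Sym p Ω' Ω m ρ δ) {v : Rn n → ℂ} {K' : CompactIn Ω} (hu : ContDiffOn ℝ ∞ u Ω)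
    (huK : ∀ y ∈ Ω, y ∉ K.1 → u y = 0)
    (hv : ContDiffOn ℝ ∞ v Ω) (hvK : ∀ y ∈ Ω, y ∉ K'.1 → v y = 0) {x : Rn n'} (hx : x ∈ Ω') :
    fioVal Ω χ h φ a (fun y => u y + v y) x = fioVal Ω χ h φ a u x + fioVal Ω χ h φ a v x := by
  rw [fioVal, fioVal, fioVal, ← mul_add, ← integral_add
    (integrableOn_fioIntegrand hρ hδ hδ1 hχ hm hφ ha hu huK hx)
    (integrableOn_fioIntegrand hρ hδ hδ1 hχ hm hφ ha hv hvK hx)]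
  congr 1
  refine setIntegral_congr_fun (Ω.isOpen.measurableSet.prod MeasurableSet.univ) fun w hw => ?_
  have h1 := hφ.opL_iterate_add hχ h (contDiffOn_amplitude ha.1 hu) (contDiffOn_amplitude ha.1 hv)
    (z := (x, w)) ⟨hx, hw.1, trivial⟩
  simp only [fioIntegrand]
  rw [← mul_add, ← h1]
  congr 2
  refine congrArg (fun g : Z n' n p → ℂ => (opL χ φ)^[h] g (x, w)) (funext fun z => ?_)
  ring

theorem exists_isCutoff (p : ℕ) : ∃ χ : Rn p → ℂ, IsCutoff χ := by
  let b : ContDiffBump (0 : Rn p) := ⟨1 / 4, 1 / 2, by norm_num, by norm_num⟩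
  refine ⟨fun ξ => (b ξ : ℂ), Complex.ofRealCLM.contDiff.comp b.contDiff, fun ξ hξ => ?_,
    fun ξ hξ => ?_⟩
  · rw [b.one_of_mem_closedBall (by rw [mem_closedBall_zero_iff]; exact hξ.le), Complex.ofReal_one]
  · rw [b.zero_of_le_dist (by rw [dist_zero_right]; exact hξ.le), Complex.ofReal_zero]

end FixedParameter

/-! ### Asymptotics of nets -/

section Asymptotics

theorem eventually_toZero_le {η : ℝ} (hη : 0 < η) : ∀ᶠ ε : Eps in toZero, (ε : ℝ) ≤ η :=
  (eventually_le_nhds hη).comap _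

theorem IsBigOPow.of_eventually_le {f : Eps → ℝ≥0∞} {b C : ℝ}
    (h : ∀ᶠ ε : Eps in toZero, f ε ≤ ENNReal.ofReal (C * (ε : ℝ) ^ b)) : IsBigOPow f b := by
  refine ⟨C.toNNReal, h.mono fun ε hε => hε.trans (le_of_eq ?_)⟩
  rw [ENNReal.ofReal_mul' (Real.rpow_nonneg ε.2.1.le _)]
  rfl

theorem IsBigOPow.exists_const {f : Eps → ℝ≥0∞} {b : ℝ} (h : IsBigOPow f b) :
    ∃ C : ℝ, 0 ≤ C ∧ ∀ᶠ ε : Eps in toZero, f ε ≤ ENNReal.ofReal (C * (ε : ℝ) ^ b) := by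
  obtain ⟨C, hC⟩ := h
  refine ⟨C, C.coe_nonneg, hC.mono fun ε hε => hε.trans (le_of_eq ?_)⟩
  rw [ENNReal.ofReal_mul C.coe_nonneg, ENNReal.ofReal_coe_nnreal]

theorem Eps.one_le_inv (ε : Eps) : 1 ≤ (ε : ℝ)⁻¹ := (one_le_inv₀ ε.2.1).2 ε.2.2

theorem eventually_const_le_inv (C : ℝ) : ∀ᶠ ε : Eps in toZero, C ≤ (ε : ℝ)⁻¹ := by
  have h0 : 0 < max C 1 := lt_max_of_lt_right one_pos
  filter_upwards [eventually_toZero_le (inv_pos.2 h0)] with ε hε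
  exact (le_max_left _ _).trans ((le_inv_comm₀ ε.2.1 h0).1 hε)

/-- One further power of $\varepsilon^{-1}$ absorbs the implied constant. -/
theorem IsBigOPow.eventually_le_neg {f : Eps → ℝ≥0∞} {N : ℕ} (h : IsBigOPow f (-(N : ℝ))) :
    ∀ᶠ ε : Eps in toZero, f ε ≤ ENNReal.ofReal ((ε : ℝ)⁻¹ ^ (N + 1)) := by
  obtain ⟨C, -, hC⟩ := h.exists_const
  filter_upwards [hC, eventually_const_le_inv C] with ε h1 h2
  refine h1.trans (ENNReal.ofReal_le_ofReal ?_)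
  have := ε.2.1
  rw [Real.rpow_neg this.le, Real.rpow_natCast, ← inv_pow, pow_succ, mul_comm]
  exact mul_le_mul_of_nonneg_left h2 (by positivity)

theorem IsBigOPow.eventually_le_pos {f : Eps → ℝ≥0∞} (h : ∀ q : ℕ, IsBigOPow f q) (q : ℕ) :
    ∀ᶠ ε : Eps in toZero, f ε ≤ ENNReal.ofReal ((ε : ℝ) ^ q) := by
  obtain ⟨C, -, hC⟩ := (h (q + 1)).exists_const
  filter_upwards [hC, eventually_const_le_inv C] with ε h1 h2
  refine h1.trans (ENNReal.ofReal_le_ofReal ?_)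
  have h0 := ε.2.1
  rw [Real.rpow_natCast, pow_succ, mul_comm, mul_assoc]
  refine mul_le_of_le_one_right (by positivity) ?_
  calc (ε : ℝ) * C ≤ ε * (ε : ℝ)⁻¹ := mul_le_mul_of_nonneg_left h2 h0.le
    _ = 1 := mul_inv_cancel₀ h0.ne'

/-- The first derivative at the centre of a ball, in terms of the function and of the oscillation
of its derivative on the ball. -/
theorem norm_fderiv_le_of_closedBall {E F : Type*} [NormedAddCommGroup E] [NormedSpace ℝ E]
    [NormedAddCommGroup F] [NormedSpace ℝ F] {f : E → F} {x : E} {t M D : ℝ} (ht : 0 < t)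
    (hf : ∀ y ∈ Metric.closedBall x t, DifferentiableAt ℝ f y)
    (hM : ∀ y ∈ Metric.closedBall x t, ‖f y‖ ≤ M)
    (hD : ∀ y ∈ Metric.closedBall x t, ‖fderiv ℝ f y - fderiv ℝ f x‖ ≤ D) :
    ‖fderiv ℝ f x‖ ≤ 2 * M * t⁻¹ + D := by
  have hx : x ∈ Metric.closedBall x t := Metric.mem_closedBall_self ht.le
  have hM0 : 0 ≤ M := (norm_nonneg _).trans (hM x hx)
  have hD0 : 0 ≤ D := (norm_nonneg _).trans (hD x hx)
  refine ContinuousLinearMap.opNorm_le_of_unit_norm (by positivity) fun z hz => ?_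
  have hy : x + t • z ∈ Metric.closedBall x t := by
    simp [norm_smul, hz, abs_of_pos ht]
  have h1 := (convex_closedBall x t).norm_image_sub_le_of_norm_fderiv_le' (f := f)
    (φ := fderiv ℝ f x) (C := D) hf hD hx hy
  rw [add_sub_cancel_left, map_smul, norm_smul, hz, mul_one, Real.norm_of_nonneg ht.le] at h1
  have h2 : ‖t • fderiv ℝ f x z‖ ≤ D * t + (M + M) := by
    have h3 : t • fderiv ℝ f x z = (f (x + t • z) - f x) - (f (x + t • z) - f x - t • fderiv ℝ f x z) :=
      by abel
    rw [h3]
    refine (norm_sub_le _ _).trans ?_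
    rw [add_comm]
    exact add_le_add h1 ((norm_sub_le _ _).trans (add_le_add (hM _ hy) (hM _ hx)))
  rw [norm_smul, Real.norm_of_nonneg ht.le] at h2
  have h4 : ‖fderiv ℝ f x z‖ = t⁻¹ * (t * ‖fderiv ℝ f x z‖) := by field_simp
  rw [h4]
  refine (mul_le_mul_of_nonneg_left h2 (inv_nonneg.2 ht.le)).trans (le_of_eq ?_)
  field_simp
  ring

/-- An interpolation inequality of Landau type, with the radius $t$ free: the derivative of
intermediate order is controlled by its two neighbours. -/
theorem norm_iteratedFDeriv_succ_le_of_closedBall {n : ℕ} {Ω : Opens (Rn n)} {f : Rn n → ℂ}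
    (hf : ContDiffOn ℝ ∞ f Ω) {x : Rn n} {t M D : ℝ} (ht : 0 < t)
    (hΩ : Metric.closedBall x t ⊆ Ω) (i : ℕ)
    (hM : ∀ y ∈ Metric.closedBall x t, ‖iteratedFDeriv ℝ i f y‖ ≤ M)
    (hD : ∀ y ∈ Metric.closedBall x t, ‖iteratedFDeriv ℝ (i + 2) f y‖ ≤ D) :
    ‖iteratedFDeriv ℝ (i + 1) f x‖ ≤ 2 * M * t⁻¹ + D * t := by
  have hdiff : ∀ j : ℕ, ∀ y ∈ Metric.closedBall x t, DifferentiableAt ℝ (iteratedFDeriv ℝ j f) y :=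
    fun j y hy => (contDiffAt_iteratedFDeriv (n := 1) (m := j)
      (contDiffAt_of_opens Ω.isOpen hf (hΩ hy) _)).differentiableAt (by simp)
  have hx : x ∈ Metric.closedBall x t := Metric.mem_closedBall_self ht.le
  have hD0 : 0 ≤ D := (norm_nonneg _).trans (hD x hx)
  rw [← norm_fderiv_iteratedFDeriv]
  refine norm_fderiv_le_of_closedBall ht (hdiff i) hM fun y hy => ?_
  rw [fderiv_iteratedFDeriv]
  simp only [Function.comp_apply]
  rw [← LinearIsometryEquiv.map_sub, LinearIsometryEquiv.norm_map]
  have h1 := (convex_closedBall x t).norm_image_sub_le_of_norm_fderiv_le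
    (f := iteratedFDeriv ℝ (i + 1) f) (C := D) (hdiff (i + 1)) (fun z hz => by
      rw [norm_fderiv_iteratedFDeriv]
      exact hD z hz) hx hy
  exact h1.trans (mul_le_mul_of_nonneg_left (by simpa [dist_eq_norm] using hy) hD0)

/-- A moderate net of smooth functions that is negligible of order zero on compact sets is
negligible. -/
theorem isBigOPow_of_order_zero {n : ℕ} {Ω : Opens (Rn n)} {v : Eps → Rn n → ℂ}
    (hv : ∀ ε, ContDiffOn ℝ ∞ (v ε) Ω)
    (hmod : ∀ (K : CompactIn Ω) (i : ℕ), ∃ N : ℕ,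
      IsBigOPow (fun ε => smoothSeminorm K.1 i (v ε)) (-(N : ℝ)))
    (h0 : ∀ (K : CompactIn Ω) (q : ℕ), IsBigOPow (fun ε => smoothSeminorm K.1 0 (v ε)) q)
    (i : ℕ) (K : CompactIn Ω) (q : ℕ) : IsBigOPow (fun ε => smoothSeminorm K.1 i (v ε)) q := by
  induction i generalizing K q with
  | zero => exact h0 K q
  | succ i ih =>
    obtain ⟨K₂, hK₂⟩ := exists_compact_nhd K
    obtain ⟨η, hη, hηK⟩ := K.2.1.exists_cthickening_subset_open isOpen_interior hK₂
    obtain ⟨N, hN⟩ := hmod K₂ (i + 2)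
    -- With radius $t=\varepsilon^{q+N+1}$ both terms of the interpolation inequality are
    -- $O(\varepsilon^q)$: $\varepsilon^{Q}/t=\varepsilon^{q}$ and
    -- $\varepsilon^{-(N+1)}t=\varepsilon^{q}$.
    set Q : ℕ := q + (q + N + 1) with hQ
    refine IsBigOPow.of_eventually_le (C := 2 * (n + 1 : ℝ) ^ i + (n + 1 : ℝ) ^ (i + 2)) ?_
    filter_upwards [hN.eventually_le_neg, IsBigOPow.eventually_le_pos (ih K₂) Q,
      eventually_toZero_le hη] with ε h1 h2 h3
    have hε := ε.2.1
    have hε1 : (ε : ℝ) ≤ 1 := ε.2.2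
    rw [Real.rpow_natCast]
    have hjet : ∀ y ∈ K₂.1, ∀ k ≤ i, ‖iteratedFDeriv ℝ k (v ε) y‖ ≤ (n + 1 : ℝ) ^ i * (ε : ℝ) ^ Q :=
      fun y hy => (jetLe_of_smoothSeminorm_le (by positivity) h2 hy
        (contDiffAt_of_opens Ω.isOpen (hv ε) (K₂.2.2 hy) i)).2
    have hjet2 : ∀ y ∈ K₂.1, ‖iteratedFDeriv ℝ (i + 2) (v ε) y‖ ≤
        (n + 1 : ℝ) ^ (i + 2) * (ε : ℝ)⁻¹ ^ (N + 1) := fun y hy =>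
      (jetLe_of_smoothSeminorm_le (by positivity) h1 hy
        (contDiffAt_of_opens Ω.isOpen (hv ε) (K₂.2.2 hy) _)).2 _ le_rfl
    refine smoothSeminorm_le_of_norm_le fun y hy k hk => ?_
    have hqQ : (ε : ℝ) ^ Q ≤ (ε : ℝ) ^ q := pow_le_pow_of_le_one hε.le hε1 (by omega)
    rcases Nat.lt_or_ge i k with hk' | hk'
    · obtain rfl : k = i + 1 := by omega
      have ht : 0 < (ε : ℝ) ^ (q + N + 1) := by positivity
      have hball : Metric.closedBall y ((ε : ℝ) ^ (q + N + 1)) ⊆ K₂.1 := by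
        refine ((Metric.closedBall_subset_cthickening hy _).trans
          ((Metric.cthickening_mono ?_ _).trans hηK)).trans interior_subset
        calc (ε : ℝ) ^ (q + N + 1) ≤ (ε : ℝ) ^ 1 := pow_le_pow_of_le_one hε.le hε1 (by omega)
          _ ≤ η := by rwa [pow_one]
      refine (norm_iteratedFDeriv_succ_le_of_closedBall (hv ε) ht (hball.trans K₂.2.2) i
        (fun z hz => hjet z (hball hz) i le_rfl) (fun z hz => hjet2 z (hball hz))).trans
        (le_of_eq ?_)
      rw [hQ, pow_add _ q (q + N + 1), add_assoc q N 1, pow_add _ q (N + 1), inv_pow]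
      field_simp
    · refine (hjet y (interior_subset (hK₂ hy)) k hk').trans ?_
      have : 0 ≤ (n + 1 : ℝ) ^ i := by positivity
      have h5 : 0 ≤ (n + 1 : ℝ) ^ (i + 2) := by positivity
      have h6 : 0 < (ε : ℝ) ^ q := by positivity
      nlinarith [mul_le_mul_of_nonneg_left hqQ this, mul_nonneg this h6.le, mul_nonneg h5 h6.le]

end Asymptotics

/-! ### Representatives with compact support -/

section CutoffRep

variable {n : ℕ} {Ω : Opens (Rn n)}

theorem exists_contDiff_one_nhds {K K' : Set (Rn n)} (hK : IsCompact K) (hKK' : K ⊆ interior K') :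
    ∃ κ : Rn n → ℂ, ContDiff ℝ ∞ κ ∧ (∀ᶠ x in 𝓝ˢ K, κ x = 1) ∧ ∀ x ∉ K', κ x = 0 := by
  obtain ⟨f, h1, h2, -⟩ := exists_contMDiffMap_one_nhds_of_subset_interior (n := (⊤ : ℕ∞))
    (modelWithCornersSelf ℝ (Rn n)) hK.isClosed hKK'
  refine ⟨fun x => (f x : ℂ), Complex.ofRealCLM.contDiff.comp f.contMDiff.contDiff,
    h1.mono fun x hx => by simp [hx], fun x hx => by simp [h2 x hx]⟩

theorem smoothSeminorm_mono {K K' : Set (Rn n)} (h : K ⊆ K') {i i' : ℕ} (hi : i ≤ i')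
    (u : Rn n → ℂ) : smoothSeminorm K i u ≤ smoothSeminorm K' i' u :=
  iSup₂_le fun x hx => iSup₂_le fun k hk =>
    le_iSup₂_of_le x (h hx) (le_iSup₂_of_le k (hk.trans hi) le_rfl)

theorem smoothSeminorm_union_le (K K' : Set (Rn n)) (i : ℕ) (u : Rn n → ℂ) :
    smoothSeminorm (K ∪ K') i u ≤ smoothSeminorm K i u + smoothSeminorm K' i u := by
  unfold smoothSeminorm
  rw [iSup_union]
  exact sup_le le_self_add le_add_self

theorem smoothSeminorm_empty (i : ℕ) (u : Rn n → ℂ) : smoothSeminorm ∅ i u = 0 := by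
  simp [smoothSeminorm]

theorem smoothSeminorm_congr {K : Set (Rn n)} (hK : K ⊆ Ω) (i : ℕ) {u v : Rn n → ℂ}
    (h : ∀ x ∈ Ω, u x = v x) : smoothSeminorm K i u = smoothSeminorm K i v := by
  unfold smoothSeminorm
  refine iSup_congr fun x => iSup_congr fun hx => iSup_congr fun k => ?_
  have : u =ᶠ[𝓝 x] v := by
    filter_upwards [Ω.isOpen.mem_nhds (hK hx)] with y hy using h y hy
  rw [(this.iteratedFDeriv ℝ k).eq_of_nhds]

/-- Only the points of $K$ near which $\kappa$ is not identically zero matter, and they lie in $F$.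
Applied to $1-\kappa$, this localises to the set where $\kappa$ is not locally $1$. -/
theorem exists_smoothSeminorm_mul_le {κ : Rn n → ℂ} (hκ : ContDiffOn ℝ ∞ κ Ω) (K : CompactIn Ω)
    (i : ℕ) : ∃ C : ℝ, 1 ≤ C ∧ ∀ u : Rn n → ℂ, ContDiffOn ℝ ∞ u Ω → ∀ F : Set (Rn n),
      (∀ x ∈ K.1, x ∉ F → κ =ᶠ[𝓝 x] fun _ => 0) →
      smoothSeminorm K.1 i (fun x => κ x * u x) ≤ ENNReal.ofReal C * smoothSeminorm F i u := by
  obtain ⟨D, hD, h⟩ := exists_jetLe_of_isCompact Ω.isOpen hκ K.2.1 K.2.2 i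
  refine ⟨max 1 (2 ^ i * (D * (n + 1 : ℝ) ^ i)), le_max_left _ _, fun u hu F hF => ?_⟩
  have h1 : (1 : ℝ) ≤ max 1 (2 ^ i * (D * (n + 1 : ℝ) ^ i)) := le_max_left _ _
  by_cases hU : smoothSeminorm F i u = ⊤
  · rw [hU, ENNReal.mul_top]
    · exact le_top
    · exact (ENNReal.ofReal_pos.2 (by linarith)).ne'
  rw [← ENNReal.ofReal_toReal hU, ← ENNReal.ofReal_mul (by linarith)]
  set U := (smoothSeminorm F i u).toReal with hUdef
  have hU0 : 0 ≤ U := ENNReal.toReal_nonneg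
  refine smoothSeminorm_le_of_norm_le fun x hx k hk => ?_
  by_cases hxF : x ∈ F
  · have h2 := jetLe_of_smoothSeminorm_le hU0 (ENNReal.ofReal_toReal hU).ge hxF
      (contDiffAt_of_opens Ω.isOpen hu (K.2.2 hx) i)
    refine (((h x hx).mul h2).2 k hk).trans ?_
    calc 2 ^ i * (D * ((n + 1 : ℝ) ^ i * U)) = 2 ^ i * (D * (n + 1 : ℝ) ^ i) * U := by ring
      _ ≤ _ := mul_le_mul_of_nonneg_right (le_max_right _ _) hU0
  · have h2 : (fun x => κ x * u x) =ᶠ[𝓝 x] fun _ => 0 :=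
      (hF x hx hxF).mono fun y hy => by simp [hy]
    have h3 : JetLe i (fun x => κ x * u x) x 0 := by
      simpa using (JetLe.const (0 : ℂ)).congr h2
    exact (h3.2 k hk).trans (by positivity)

/-- The product of a net with a smooth function. -/
def mulNet (κ : Rn n → ℂ) (hκ : ContDiff ℝ ∞ κ) (r : Moderate (smoothFam Ω)) :
    Moderate (smoothFam Ω) :=
  ⟨fun ε => ⟨fun x => κ x * (r.1 ε).1 x, hκ.contDiffOn.mul (r.1 ε).2⟩, fun i => by
    obtain ⟨N, D, hD⟩ := r.2 i
    obtain ⟨C, hC, h⟩ := exists_smoothSeminorm_mul_le (Ω := Ω) hκ.contDiffOn i.1 i.2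
    refine ⟨N, C.toNNReal * D, hD.mono fun ε hε => ?_⟩
    refine (h _ (r.1 ε).2 i.1.1 fun x hx hx' => (hx' hx).elim).trans ?_
    rw [ENNReal.coe_mul, mul_assoc]
    exact mul_le_mul_right hε _⟩

/-- Each point of $F$ has a neighbourhood on which the net is negligible, and finitely many such
neighbourhoods cover $F$. The local representative may be exchanged for $r$, the difference being
negligible. -/
theorem isBigOPow_of_disjoint_supp {r : Moderate (smoothFam Ω)} {F : Set (Rn n)} (hF : IsCompact F)
    (hFΩ : F ⊆ Ω) (hd : ∀ x ∈ F, x ∉ supp (GE.mk r)) (i q : ℕ) :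
    IsBigOPow (fun ε => smoothSeminorm F i (r.1 ε).1) q := by
  refine hF.induction_on (p := fun S => IsBigOPow (fun ε => smoothSeminorm S i (r.1 ε).1) q)
    ?_ ?_ ?_ ?_
  · simpa only [smoothSeminorm_empty] using IsBigOPow.zero _
  · exact fun s t hst ht => ht.of_le fun ε => smoothSeminorm_mono hst le_rfl _
  · exact fun s t hs ht => (hs.add ht).of_le fun ε => smoothSeminorm_union_le _ _ _ _
  · intro x hx
    have h1 := hd x hx
    rw [supp, mem_ofPred_eq, not_and, not_not] at h1
    obtain ⟨V, hV, hxV, s, hs, hsV⟩ := h1 (hFΩ hx)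
    obtain ⟨η, hη, hηV⟩ := Metric.nhds_basis_closedBall.mem_iff.1
      (Filter.inter_mem (hV.mem_nhds hxV) (Ω.isOpen.mem_nhds (hFΩ hx)))
    let T : CompactIn Ω := ⟨Metric.closedBall x η, isCompact_closedBall x η,
      hηV.trans inter_subset_right⟩
    refine ⟨T.1, mem_nhdsWithin_of_mem_nhds (Metric.closedBall_mem_nhds x hη), ?_⟩
    have h2 : r - s ∈ Negligible (smoothFam Ω) := (GE.mk_eq_mk_iff r s).1 hs.symm
    refine ((h2 (T, i) q).add (hsV T (hηV.trans inter_subset_left) i q)).of_le fun ε => ?_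
    have h3 := (smoothFam Ω).add_le (T, i) ((r - s).1 ε) (s.1 ε)
    have h4 : (r - s).1 ε + s.1 ε = r.1 ε := sub_add_cancel (r.1 ε) (s.1 ε)
    rw [h4] at h3
    exact h3

/-- The difference is $(1-\kappa)u$. On a compact set it is controlled by $u$ on a compact subset
disjoint from the support, where $u$ is negligible. -/
theorem mk_mulNet_eq {κ : Rn n → ℂ} (hκ : ContDiff ℝ ∞ κ) {K : Set (Rn n)}
    (hκK : ∀ᶠ x in 𝓝ˢ K, κ x = 1) {r : Moderate (smoothFam Ω)} (hr : GE.mk r ∈ GK Ω K) :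
    GE.mk (mulNet κ hκ r) = GE.mk r := by
  rw [eq_comm, GE.mk_eq_mk_iff]
  rintro ⟨L, i⟩ q
  have hκ' : ContDiff ℝ ∞ fun x => 1 - κ x := contDiff_const.sub hκ
  obtain ⟨C, hC, h⟩ := exists_smoothSeminorm_mul_le (Ω := Ω) hκ'.contDiffOn L i
  have hF : IsCompact (L.1 \ interior {x | κ x = 1}) := L.2.1.diff isOpen_interior
  have h1 : IsBigOPow (fun ε => smoothSeminorm (L.1 \ interior {x | κ x = 1}) i (r.1 ε).1) q :=
    isBigOPow_of_disjoint_supp hF (sdiff_subset.trans L.2.2)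
      (fun x hx hxs => hx.2 (subset_interior_iff_mem_nhdsSet.2 hκK (hr hxs))) i q
  obtain ⟨D, hD⟩ := h1
  refine ⟨C.toNNReal * D, hD.mono fun ε hε => ?_⟩
  have h2 := h (r.1 ε).1 (r.1 ε).2 (L.1 \ interior {x | κ x = 1}) fun x hx hx' => by
    have hx1 : x ∈ interior {x | κ x = 1} := by
      by_contra h3
      exact hx' ⟨hx, h3⟩
    filter_upwards [isOpen_interior.mem_nhds hx1] with y hy
    have h4 : y ∈ {x | κ x = 1} := interior_subset hy
    rw [show κ y = 1 from h4, sub_self]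
  have h3 : (((r - mulNet κ hκ r).1 ε).1 : Rn n → ℂ) = fun x => (1 - κ x) * (r.1 ε).1 x := by
    funext x
    change (r.1 ε).1 x - κ x * (r.1 ε).1 x = _
    ring
  change smoothSeminorm L.1 i ((r - mulNet κ hκ r).1 ε).1 ≤ _
  rw [h3, ENNReal.coe_mul, mul_assoc]
  exact h2.trans (mul_le_mul_right hε _)

/-- Replacing the representatives of elements of `𝒢_K(Ω)` by representatives with support in a
fixed compact neighbourhood of `K`. -/
theorem exists_cutoff_rep {K : Set (Rn n)} (hK : IsCompact K) (K' : CompactNhd Ω K) :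
    ∃ T : Moderate (smoothFam Ω) → Moderate (smoothFam Ω),
      (∀ r ε, ∀ y ∉ K'.1.1, ((T r).1 ε).1 y = 0) ∧
      (∀ r, GE.mk r ∈ GK Ω K → GE.mk (T r) = GE.mk r) ∧
      ∀ i, ∃ C : ℝ, 1 ≤ C ∧ ∀ r ε, smoothSeminorm K'.1.1 i ((T r).1 ε).1 ≤
        ENNReal.ofReal C * smoothSeminorm K'.1.1 i (r.1 ε).1 := by
  obtain ⟨κ, hκ, h1, h2⟩ := exists_contDiff_one_nhds hK K'.2
  refine ⟨mulNet κ hκ, fun r ε y hy => by simp [mulNet, h2 y hy],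
    fun r hr => mk_mulNet_eq hκ h1 hr, fun i => ?_⟩
  obtain ⟨C, hC, h⟩ := exists_smoothSeminorm_mul_le (Ω := Ω) hκ.contDiffOn K'.1 i
  exact ⟨C, hC, fun r ε => h _ (r.1 ε).2 K'.1.1 fun x hx hx' => (hx' hx).elim⟩

end CutoffRep

/-! ### Fourier integral operators on nets -/

section Nets

variable {n' n p : ℕ} {Ω' : Opens (Rn n')} {Ω : Opens (Rn n)}

theorem ModeratePhaseNet.eventually_phaseBound (φ : ModeratePhaseNet p Ω' Ω) (L : CompactIn Ω')
    (K : CompactIn Ω) (J : ℕ) :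
    ∃ T : ℕ, ∀ᶠ ε : Eps in toZero, PhaseBound L.1 K.1 J (φ.1 ε) ((ε : ℝ)⁻¹ ^ T) := by
  obtain ⟨N, hN⟩ := φ.2.moderate (L.prod K) J
  obtain ⟨r, -, η, hη, -, hr⟩ := φ.2.strictlyNonzero L K
  obtain ⟨R, hR⟩ := exists_nat_ge r
  refine ⟨N + 1 + R + 1, ?_⟩
  filter_upwards [hN.eventually_le_neg, eventually_toZero_le hη,
    eventually_const_le_inv (((p + (n' + n) : ℕ) + 1 : ℝ) ^ J)] with ε h1 h2 h3
  have hε := ε.2.1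
  have he := Eps.one_le_inv ε
  have h4 : PhaseBound L.1 K.1 J (φ.1 ε) _ :=
    (φ.2.isPhase ε).phaseBound_of_hgSeminorm_le L.2.2 K.2.2 (B := (ε : ℝ)⁻¹ ^ (N + 1 + R))
      (one_le_pow₀ he) (h1.trans (ENNReal.ofReal_le_ofReal (pow_le_pow_right₀ he (by omega))))
      fun x hx y hy ξ hξ => by
        have h5 := hr ε h2 x hx y hy ξ hξ
        have h6 : (ε : ℝ) ^ R ≤ (ε : ℝ) ^ r := by
          rw [← Real.rpow_natCast]
          exact Real.rpow_le_rpow_of_exponent_ge hε ε.2.2 hR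
        calc (1 : ℝ) = (ε : ℝ)⁻¹ ^ R * (ε : ℝ) ^ R := by
              rw [← mul_pow, inv_mul_cancel₀ hε.ne', one_pow]
          _ ≤ (ε : ℝ)⁻¹ ^ (N + 1 + R) * gradSq (φ.1 ε) (normalize (x, y, ξ)) := by
              refine mul_le_mul (pow_le_pow_right₀ he (by omega)) (h6.trans h5) (by positivity)
                (by positivity)
  refine h4.of_le le_rfl ?_
  rw [pow_succ _ (N + 1 + R), mul_comm]
  exact mul_le_mul_of_nonneg_left h3 (by positivity)

/-- A slow scale phase function is bounded by nets all of whose powers are `O(ε⁻²)`. -/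
theorem eventually_phaseBound_of_slowScale {r : ModeratePhaseNet p Ω' Ω} (L : CompactIn Ω')
    (K : CompactIn Ω) (J M : ℕ) (h1 : IsSlowScaleBounded fun ε => hgSeminorm (L.prod K).1 J (r.1 ε))
    (h2 : ∃ s : Eps → ℂ, IsSlowScaleNet s ∧
      ∃ η : ℝ, 0 < η ∧ η ≤ 1 ∧ ∀ ε : Eps, (ε : ℝ) ≤ η →
        ∀ x ∈ L.1, ∀ y ∈ K.1, ∀ ξ : Rn p, ξ ≠ 0 →
          1 ≤ ‖s ε‖ * gradSq (r.1 ε) (normalize (x, y, ξ))) :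
    ∀ᶠ ε : Eps in toZero, ∃ B, PhaseBound L.1 K.1 J (r.1 ε) B ∧ B ^ M ≤ (ε : ℝ)⁻¹ ^ 2 := by
  obtain ⟨s, hs, C, hC⟩ := h1
  obtain ⟨s', hs', η, hη, -, hr⟩ := h2
  obtain ⟨c, hc, hcs⟩ := hs M (Nat.cast_nonneg M)
  obtain ⟨c', hc', hcs'⟩ := hs' M (Nat.cast_nonneg M)
  set D : ℝ := ((p + (n' + n) : ℕ) + 1 : ℝ) ^ J with hD
  -- The slow scale property with $q=M$ bounds the $M$-th powers by a constant times
  -- $\varepsilon^{-1}$, and a second factor $\varepsilon^{-1}$ absorbs all constants. The resulting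
  -- exponent $2$ does not depend on $M$.
  filter_upwards [hC, eventually_toZero_le hη,
    eventually_const_le_inv (D ^ M * (1 + C ^ M * c + c'))] with ε e1 e2 e3
  have hε := ε.2.1
  have he := Eps.one_le_inv ε
  have hC0 : (0 : ℝ) ≤ C := C.coe_nonneg
  have hn : 0 ≤ (C : ℝ) * ‖s ε‖ := by positivity
  have hB1 : 1 ≤ 1 + (C : ℝ) * ‖s ε‖ + ‖s' ε‖ := by
    have := norm_nonneg (s' ε)
    linarith
  set B : ℝ := max 1 (max ((C : ℝ) * ‖s ε‖) ‖s' ε‖) with hB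
  refine ⟨D * B, (r.2.isPhase ε).phaseBound_of_hgSeminorm_le L.2.2 K.2.2 (le_max_left _ _) ?_ ?_, ?_⟩
  · refine e1.trans ?_
    rw [← ofReal_norm, ← ENNReal.ofReal_coe_nnreal, ← ENNReal.ofReal_mul hC0]
    exact ENNReal.ofReal_le_ofReal ((le_max_left _ _).trans (le_max_right _ _))
  · intro x hx y hy ξ hξ
    refine (hr ε e2 x hx y hy ξ hξ).trans (mul_le_mul_of_nonneg_right ?_ (gradSq_nonneg _ _))
    exact (le_max_right _ _).trans (le_max_right _ _)
  · have h3 := hcs ε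
    have h4 := hcs' ε
    rw [Real.rpow_natCast] at h3 h4
    have h5 : B ^ M ≤ 1 + C ^ M * ‖s ε‖ ^ M + ‖s' ε‖ ^ M := by
      have p1 : 0 ≤ (C : ℝ) ^ M * ‖s ε‖ ^ M := by positivity
      have p2 : 0 ≤ ‖s' ε‖ ^ M := by positivity
      rcases max_choice 1 (max ((C : ℝ) * ‖s ε‖) ‖s' ε‖) with h | h
      · rw [hB, h, one_pow]
        linarith
      · rcases max_choice ((C : ℝ) * ‖s ε‖) ‖s' ε‖ with h' | h'
        · rw [hB, h, h', mul_pow]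
          linarith
        · rw [hB, h, h']
          linarith
    calc (D * B) ^ M = D ^ M * B ^ M := mul_pow _ _ _
      _ ≤ D ^ M * ((1 + C ^ M * c + c') * (ε : ℝ)⁻¹) := by
        refine mul_le_mul_of_nonneg_left (h5.trans ?_) (by positivity)
        have h6 : (C : ℝ) ^ M * ‖s ε‖ ^ M ≤ C ^ M * (c * (ε : ℝ)⁻¹) :=
          mul_le_mul_of_nonneg_left h3 (by positivity)
        nlinarith
      _ = (D ^ M * (1 + C ^ M * c + c')) * (ε : ℝ)⁻¹ := by ring
      _ ≤ (ε : ℝ)⁻¹ * (ε : ℝ)⁻¹ := mul_le_mul_of_nonneg_right e3 (by positivity)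
      _ = _ := by ring

variable {m ρ δ : ℝ}

/-- For each order $k$ of differentiation the exponent $h$ is replaced by a sufficiently large $h'$
without changing the values. The main estimate is then polynomial in $\varepsilon^{-1}$. -/
theorem exists_fioNet (hρ0 : 0 < ρ) (hρ : ρ ≤ 1) (hδ : 0 ≤ δ) (hδ1 : δ < 1) {χ : Rn p → ℂ}
    (hχ : IsCutoff χ) {h : ℕ} (hm : m - h * min ρ (1 - δ) + 1 < -(p : ℝ))
    (φ : ModeratePhaseNet p Ω' Ω) (a : Moderate (symFam p Ω' Ω m ρ δ))
    (u : Moderate (smoothFam Ω)) {K : CompactIn Ω}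
    (huK : ∀ ε, ∀ y ∈ Ω, y ∉ K.1 → (u.1 ε).1 y = 0) :
    ∃ v : Moderate (smoothFam Ω'),
      ∀ ε, (v.1 ε).1 = fioVal Ω χ h (φ.1 ε) (a.1 ε).1 (u.1 ε).1 := by
  have hs : 0 < min ρ (1 - δ) := lt_min hρ0 (by linarith)
  have hsm := fun ε => contDiffOn_fioVal hρ0 hρ hδ hδ1 hχ hm (φ.2.isPhase ε) (a.1 ε).2 (u.1 ε).2
    (huK ε)
  refine ⟨⟨fun ε => ⟨_, hsm ε⟩, ?_⟩, fun ε => rfl⟩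
  rintro ⟨L, k⟩
  obtain ⟨h', hh'⟩ := exists_order (p := p) hs m (k + 1)
  obtain ⟨L₂, hL₂⟩ := exists_compact_nhd L
  obtain ⟨C, M, hC, hb⟩ := exists_fioVal_bound hρ hδ hδ1.le hχ h' k (m := m) (by linarith) L₂.2.2 K
  obtain ⟨T, hT⟩ := φ.eventually_phaseBound L₂ K (k + h' + 1)
  obtain ⟨N, hN⟩ := a.2 (L₂.prod K, k + h')
  obtain ⟨N', hN'⟩ := u.2 (K, k + h')
  refine ⟨T * M + (N + 1 + (N' + 1)), IsBigOPow.of_eventually_le (C := C) ?_⟩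
  filter_upwards [hT, hN.eventually_le_neg, hN'.eventually_le_neg] with ε h1 h2 h3
  have hε := ε.2.1
  have he := Eps.one_le_inv ε
  change smoothSeminorm L.1 k (fioVal Ω χ h (φ.1 ε) (a.1 ε).1 (u.1 ε).1) ≤ _
  rw [smoothSeminorm_congr (Ω := Ω') L.2.2 k fun x hx => fioVal_eq_fioVal hρ hδ hδ1.le hχ hχ hm
    (h' := h') (by
      have := Nat.cast_nonneg (α := ℝ) k
      linarith) (φ.2.isPhase ε) (a.1 ε).2 (u.1 ε).2 (huK ε) hx]
  refine smoothSeminorm_le_of_norm_le fun x hx i hi => ?_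
  refine ((hb (φ.1 ε) (a.1 ε).1 (u.1 ε).1 _ _ _ (φ.2.isPhase ε) (a.1 ε).2.1 (u.1 ε).2 (huK ε) h1
    (by positivity) (by positivity) h2 h3 x (hL₂ hx)).2.2 i hi).trans (le_of_eq ?_)
  rw [Real.rpow_neg hε.le, Real.rpow_natCast, ← inv_pow, ← pow_mul, ← pow_add, mul_assoc, ← pow_add]

theorem IsBigOPow.eventually_le_inv_pow {f : Eps → ℝ≥0∞} {N N' : ℕ} (h : IsBigOPow f (-(N : ℝ)))
    (hN : N + 1 ≤ N') : ∀ᶠ ε : Eps in toZero, f ε ≤ ENNReal.ofReal ((ε : ℝ)⁻¹ ^ N') :=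
  h.eventually_le_neg.mono fun ε hε =>
    hε.trans (ENNReal.ofReal_le_ofReal (pow_le_pow_right₀ (Eps.one_le_inv ε) hN))

theorem norm_le_of_smoothSeminorm_zero_le {K : Set (Rn n)} {u : Rn n → ℂ} {i : ℕ} {U : ℝ}
    (hU : 0 ≤ U) (h : smoothSeminorm K i u ≤ ENNReal.ofReal U) {y : Rn n} (hy : y ∈ K) :
    ‖u y‖ ≤ U := by
  have h1 : ‖iteratedFDeriv ℝ 0 u y (fun l : Fin 0 => stdVec (l.elim0))‖ₑ ≤ ENNReal.ofReal U :=
    le_trans (le_iSup₂_of_le y hy (le_iSup₂_of_le 0 (Nat.zero_le i)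
      (le_iSup (fun J : Fin 0 → Fin n => ‖iteratedFDeriv ℝ 0 u y fun l => stdVec (J l)‖ₑ)
        fun l : Fin 0 => l.elim0))) h
  rwa [iteratedFDeriv_zero_apply, ← ofReal_norm, ENNReal.ofReal_le_ofReal_iff hU] at h1

theorem pow_mul_inv_pow_le {e : ℝ} (he : 1 ≤ e) {a b c : ℕ} (h : a + c ≤ b) :
    e ^ a * (e ^ b)⁻¹ ≤ (e ^ c)⁻¹ := by
  have he0 : 0 < e := by linarith
  rw [← div_eq_mul_inv, div_le_iff₀ (by positivity), ← div_eq_inv_mul, le_div_iff₀ (by positivity),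
    ← pow_add]
  exact pow_le_pow_right₀ he h

/-- The class of the net of values does not depend on the choices of representatives, cut-off
function and exponent. -/
theorem mk_fioNet_eq (hρ : ρ ≤ 1) (hδ : 0 ≤ δ) (hδ1 : δ < 1) {χ χ' : Rn p → ℂ}
    (hχ : IsCutoff χ) (hχ' : IsCutoff χ') {h h' : ℕ}
    (hm : m - h * min ρ (1 - δ) + 1 < -(p : ℝ)) (hm' : m - h' * min ρ (1 - δ) + 1 < -(p : ℝ))
    {φ φ' : ModeratePhaseNet p Ω' Ω} (hφ : φ ≈ φ') {a a' : Moderate (symFam p Ω' Ω m ρ δ)}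
    (ha : a - a' ∈ Negligible (symFam p Ω' Ω m ρ δ)) {u u' : Moderate (smoothFam Ω)}
    (hu : u - u' ∈ Negligible (smoothFam Ω)) {K : CompactIn Ω}
    (huK : ∀ ε, ∀ y ∈ Ω, y ∉ K.1 → (u.1 ε).1 y = 0)
    (huK' : ∀ ε, ∀ y ∈ Ω, y ∉ K.1 → (u'.1 ε).1 y = 0) {v v' : Moderate (smoothFam Ω')}
    (hv : ∀ ε, ∀ x ∈ Ω', (v.1 ε).1 x = fioVal Ω χ h (φ.1 ε) (a.1 ε).1 (u.1 ε).1 x)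
    (hv' : ∀ ε, ∀ x ∈ Ω', (v'.1 ε).1 x = fioVal Ω χ' h' (φ'.1 ε) (a'.1 ε).1 (u'.1 ε).1 x) :
    GE.mk v = GE.mk v' := by
  rw [GE.mk_eq_mk_iff]
  rintro ⟨L, i⟩ q
  -- Since $v-v'$ is moderate, it suffices to compare values; the derivatives of the truncated
  -- integrals need not be examined.
  refine isBigOPow_of_order_zero (v := fun ε => ((v - v').1 ε).1) (fun ε => ((v - v').1 ε).2)
    (fun K i => (v - v').2 (K, i)) (fun L q => ?_) i L q
  clear i
  obtain ⟨L₂, hL₂⟩ := exists_compact_nhd L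
  obtain ⟨C₁, M₁, hC₁, b₁⟩ :=
    exists_fioVal_sub_fioCut_bound hρ hδ hδ1.le hχ hχ h hm L₂.2.2 K
  obtain ⟨C₂, M₂, hC₂, b₂⟩ :=
    exists_fioVal_sub_fioCut_bound hρ hδ hδ1.le hχ' hχ h' hm' L₂.2.2 K
  obtain ⟨C₀, M₀, hC₀, b₀⟩ := exists_fioCut_sub_bound hχ m ρ δ L₂.2.2 K
  obtain ⟨T₁, hT₁⟩ := φ.eventually_phaseBound L₂ K (h + 1)
  obtain ⟨T₂, hT₂⟩ := φ'.eventually_phaseBound L₂ K (h' + 1)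
  obtain ⟨N₁, hN₁⟩ := a.2 (L₂.prod K, h)
  obtain ⟨N₂, hN₂⟩ := a'.2 (L₂.prod K, h')
  obtain ⟨N₃, hN₃⟩ := a.2 (L₂.prod K, 0)
  obtain ⟨N₄, hN₄⟩ := a'.2 (L₂.prod K, 0)
  obtain ⟨N₅, hN₅⟩ := u.2 (K, h)
  obtain ⟨N₆, hN₆⟩ := u'.2 (K, h')
  -- $N$ bounds all the growth exponents. The truncation radius is $R=\varepsilon^{-S}$, with $S$
  -- large enough that the tails $\varepsilon^{-NM_i-2N}R^{-1}$ are at most $\varepsilon^q$. Then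
  -- $Q$ is chosen so that differences of size $\varepsilon^Q$ outweigh $R^{M_0}\varepsilon^{-2N}$.
  set N := T₁ + T₂ + N₁ + N₂ + N₃ + N₄ + N₅ + N₆ + 1 with hN
  set S := q + N * (M₁ + M₂) + 2 * N with hS
  set Q := q + S * M₀ + 2 * N with hQ
  refine IsBigOPow.of_eventually_le (C := C₁ + 3 * C₀ + C₂) ?_
  filter_upwards [hT₁, hT₂, hN₁.eventually_le_inv_pow (N' := N) (by omega),
    hN₂.eventually_le_inv_pow (N' := N) (by omega), hN₃.eventually_le_inv_pow (N' := N) (by omega),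
    hN₄.eventually_le_inv_pow (N' := N) (by omega), hN₅.eventually_le_inv_pow (N' := N) (by omega),
    hN₆.eventually_le_inv_pow (N' := N) (by omega),
    IsBigOPow.eventually_le_pos (hφ (L₂.prod K) 0) Q,
    IsBigOPow.eventually_le_pos (ha (L₂.prod K, 0)) Q,
    IsBigOPow.eventually_le_pos (hu (K, 0)) Q] with ε t₁ t₂ n₁ n₂ n₃ n₄ n₅ n₆ d₁ d₂ d₃
  have hε := ε.2.1
  have he := Eps.one_le_inv ε
  rw [Real.rpow_natCast]
  refine smoothSeminorm_le_of_norm_le fun x hx k hk => ?_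
  obtain rfl : k = 0 := by omega
  rw [norm_iteratedFDeriv_zero]
  have hxΩ : x ∈ Ω' := L.2.2 hx
  have hxi := hL₂ hx
  change ‖(v.1 ε).1 x - (v'.1 ε).1 x‖ ≤ _
  rw [hv ε x hxΩ, hv' ε x hxΩ]
  set e := (ε : ℝ)⁻¹ with hedef
  have hεe : ∀ k : ℕ, (ε : ℝ) ^ k = (e ^ k)⁻¹ := fun k => by rw [hedef, inv_pow, inv_inv]
  have he0 : 0 < e := by linarith
  have hpos : ∀ k : ℕ, 0 ≤ e ^ k := fun k => by positivity
  have p₁ := t₁.of_le le_rfl (pow_le_pow_right₀ he (by omega : T₁ ≤ N))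
  have p₂ := t₂.of_le le_rfl (pow_le_pow_right₀ he (by omega : T₂ ≤ N))
  have r₁ := b₁ (φ.1 ε) (a.1 ε).1 (u.1 ε).1 _ _ _ (φ.2.isPhase ε) (a.1 ε).2.1 (u.1 ε).2 (huK ε) p₁
    (hpos N) (hpos N) n₁ n₅ (e ^ S) (one_le_pow₀ he) x hxi
  have r₂ := b₂ (φ'.1 ε) (a'.1 ε).1 (u'.1 ε).1 _ _ _ (φ'.2.isPhase ε) (a'.1 ε).2.1 (u'.1 ε).2
    (huK' ε) p₂ (hpos N) (hpos N) n₂ n₆ (e ^ S) (one_le_pow₀ he) x hxi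
  have r₀ := b₀ (φ.1 ε) (φ'.1 ε) (a.1 ε).1 (a'.1 ε).1 (u.1 ε).1 (u'.1 ε).1 _ _ _ _ _ _
    (φ.2.isPhase ε) (φ'.2.isPhase ε) (a.1 ε).2.1 (a'.1 ε).2.1 (u.1 ε).2 (u'.1 ε).2 (huK ε) (huK' ε)
    (by positivity) (hpos N) (hpos N) (by positivity) (hpos N) (by positivity) d₁ n₃ n₄ d₂
    (fun y hy => norm_le_of_smoothSeminorm_zero_le (hpos N) n₅ hy)
    (fun y hy => norm_le_of_smoothSeminorm_zero_le (u := fun y => (u.1 ε).1 y - (u'.1 ε).1 y)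
      (by positivity) d₃ hy) (e ^ S) (one_le_pow₀ he) x (interior_subset hxi)
  have hq : ∀ M : ℕ, M ≤ M₁ + M₂ → (e ^ N) ^ M * (e ^ N * e ^ N) * (e ^ S)⁻¹ ≤ (ε : ℝ) ^ q := by
    intro M hM
    rw [hεe, ← pow_mul, ← pow_add, ← pow_add]
    refine pow_mul_inv_pow_le he ?_
    have : N * M ≤ N * (M₁ + M₂) := Nat.mul_le_mul_left _ hM
    omega
  have hq0 : ∀ k : ℕ, k ≤ 2 * N → (e ^ S) ^ M₀ * ((ε : ℝ) ^ Q * e ^ k) ≤ (ε : ℝ) ^ q := by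
    intro k hk
    rw [hεe, hεe, mul_comm _ (e ^ k), ← mul_assoc, ← pow_mul, ← pow_add]
    exact pow_mul_inv_pow_le he (by omega)
  rw [norm_sub_rev] at r₂
  calc _ ≤ ‖fioVal Ω χ h (φ.1 ε) (a.1 ε).1 (u.1 ε).1 x -
        fioCut Ω χ (e ^ S) (φ.1 ε) (a.1 ε).1 (u.1 ε).1 x‖ +
      ‖fioCut Ω χ (e ^ S) (φ.1 ε) (a.1 ε).1 (u.1 ε).1 x -
        fioCut Ω χ (e ^ S) (φ'.1 ε) (a'.1 ε).1 (u'.1 ε).1 x‖ +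
      ‖fioCut Ω χ (e ^ S) (φ'.1 ε) (a'.1 ε).1 (u'.1 ε).1 x -
        fioVal Ω χ' h' (φ'.1 ε) (a'.1 ε).1 (u'.1 ε).1 x‖ := by
        refine le_trans (le_of_eq ?_) norm_add₃_le
        congr 1
        ring
    _ ≤ C₁ * (e ^ N) ^ M₁ * (e ^ N * e ^ N) * (e ^ S)⁻¹ + C₀ * (e ^ S) ^ M₀ *
        ((ε : ℝ) ^ Q * e ^ N * e ^ N + (ε : ℝ) ^ Q * e ^ N + e ^ N * (ε : ℝ) ^ Q) +
        C₂ * (e ^ N) ^ M₂ * (e ^ N * e ^ N) * (e ^ S)⁻¹ := add_le_add (add_le_add r₁ r₀) r₂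
    _ = C₁ * ((e ^ N) ^ M₁ * (e ^ N * e ^ N) * (e ^ S)⁻¹) + C₀ * ((e ^ S) ^ M₀ *
        ((ε : ℝ) ^ Q * e ^ (2 * N)) + (e ^ S) ^ M₀ * ((ε : ℝ) ^ Q * e ^ N) +
          (e ^ S) ^ M₀ * ((ε : ℝ) ^ Q * e ^ N)) +
        C₂ * ((e ^ N) ^ M₂ * (e ^ N * e ^ N) * (e ^ S)⁻¹) := by ring
    _ ≤ C₁ * (ε : ℝ) ^ q + C₀ * ((ε : ℝ) ^ q + (ε : ℝ) ^ q + (ε : ℝ) ^ q) + C₂ * (ε : ℝ) ^ q := by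
        have := hq M₁ (by omega)
        have := hq M₂ (by omega)
        have := hq0 (2 * N) le_rfl
        have := hq0 N (by omega)
        gcongr
    _ = _ := by ring

end Nets

/-! ### Existence, uniqueness and basic estimates -/

section Operators

variable {n' n p : ℕ} {Ω' : Opens (Rn n')} {Ω : Opens (Rn n)}

theorem exists_compact_rep {u : G Ω} (hu : u ∈ Gc Ω) :
    ∃ r : Moderate (smoothFam Ω), GE.mk r = u ∧
      ∃ K : CompactIn Ω, ∀ ε, ∀ y ∈ Ω, y ∉ K.1 → (r.1 ε).1 y = 0 := by
  obtain ⟨K, hK⟩ := hu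
  obtain ⟨K', hK'⟩ := exists_compact_nhd K
  obtain ⟨r, rfl⟩ := GE.mk_surjective u
  obtain ⟨T, h1, h2, -⟩ := exists_cutoff_rep K.2.1 (⟨K', hK'⟩ : CompactNhd Ω K.1)
  exact ⟨T r, h2 r hK, K', fun ε y _ hy => h1 r ε y hy⟩

/-- $A$ is defined by fixing one representative of everything, a cut-off function and an exponent;
linearity and the defining property for all other choices both follow from `mk_fioNet_eq`. General
sets $\mathcal A$ and $\mathcal H$ are allowed so that amplitudes of order $-\infty$ are covered as
well. -/
theorem existsUnique_isFIOWith {m ρ δ : ℝ} (hρ0 : 0 < ρ) (hρ : ρ ≤ 1) (hδ : 0 ≤ δ) (hδ1 : δ < 1)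
    (φ : GPhase p Ω' Ω) (a : GSym p Ω' Ω m ρ δ) {𝒜 : Set (Eps → Z n' n p → ℂ)} {ℋ : Set ℕ}
    (h𝒜 : 𝒜 ⊆ {ar | ∃ r : Moderate (symFam p Ω' Ω m ρ δ), GE.mk r = a ∧ ∀ ε, ar ε = (r.1 ε).1})
    (h𝒜' : 𝒜.Nonempty) (hℋ : ℋ ⊆ {h | m - h * min ρ (1 - δ) + 1 < -(p : ℝ)}) (hℋ' : ℋ.Nonempty) :
    ∃! A : Gc Ω →ₗ[CTilde] G Ω', IsFIOWith φ 𝒜 ℋ A := by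
  obtain ⟨φr, rfl⟩ := Quotient.exists_rep φ
  obtain ⟨ar, har⟩ := h𝒜'
  obtain ⟨h, hh⟩ := hℋ'
  obtain ⟨χ, hχ⟩ := exists_isCutoff p
  obtain ⟨r, hr, hr'⟩ := h𝒜 har
  have hm := hℋ hh
  choose rep hrep K hK using fun u : Gc Ω => exists_compact_rep u.2
  choose net hnet using fun u : Gc Ω => exists_fioNet hρ0 hρ hδ hδ1 hχ hm φr r (rep u) (hK u)
  let join : CompactIn Ω → CompactIn Ω → CompactIn Ω := fun K L =>
    ⟨K.1 ∪ L.1, K.2.1.union L.2.1, union_subset K.2.2 L.2.2⟩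
  have hr0 : r - r ∈ Negligible (symFam p Ω' Ω m ρ δ) := by
    rw [sub_self]
    exact zero_mem _
  let A : Gc Ω →ₗ[CTilde] G Ω' :=
    { toFun := fun u => GE.mk (net u)
      map_add' := fun u v => by
        rw [← GE.mk_add]
        refine mk_fioNet_eq hρ hδ hδ1 hχ hχ hm hm (Setoid.refl φr) hr0 (u := rep (u + v))
          (u' := rep u + rep v) (K := join (K (u + v)) (join (K u) (K v))) ?_ ?_ ?_
          (fun ε x _ => congrFun (hnet (u + v) ε) x) fun ε x hx => ?_
        · rw [← GE.mk_eq_mk_iff, GE.mk_add, hrep, hrep, hrep]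
          rfl
        · exact fun ε y hy hyK => hK (u + v) ε y hy fun h => hyK (Or.inl h)
        · intro ε y hy hyK
          have h1 := hK u ε y hy fun h => hyK (Or.inr (Or.inl h))
          have h2 := hK v ε y hy fun h => hyK (Or.inr (Or.inr h))
          change ((rep u).1 ε).1 y + ((rep v).1 ε).1 y = 0
          rw [h1, h2, add_zero]
        · change ((net u).1 ε).1 x + ((net v).1 ε).1 x = _
          rw [hnet, hnet]
          exact (fioVal_add hρ hδ hδ1.le hχ hm (φr.2.isPhase ε) (r.1 ε).2 ((rep u).1 ε).2 (hK u ε)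
            ((rep v).1 ε).2 (hK v ε) hx).symm
      map_smul' := fun c u => by
        obtain ⟨c, rfl⟩ := CTilde.mk_surjective c
        rw [RingHom.id_apply, ← GE.mk_smul]
        refine mk_fioNet_eq hρ hδ hδ1 hχ hχ hm hm (Setoid.refl φr) hr0 (u := rep (CTilde.mk c • u))
          (u' := c • rep u) (K := join (K (CTilde.mk c • u)) (K u)) ?_ ?_ ?_
          (fun ε x _ => congrFun (hnet (CTilde.mk c • u) ε) x) fun ε x hx => ?_
        · rw [← GE.mk_eq_mk_iff, GE.mk_smul, hrep, hrep]
          rfl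
        · exact fun ε y hy hyK => hK (CTilde.mk c • u) ε y hy fun h => hyK (Or.inl h)
        · intro ε y hy hyK
          have h1 := hK u ε y hy fun h => hyK (Or.inr h)
          change c.1 ε * ((rep u).1 ε).1 y = 0
          rw [h1, mul_zero]
        · change c.1 ε * ((net u).1 ε).1 x = _
          rw [hnet]
          exact (fioVal_const_mul hχ h (φr.2.isPhase ε) (r.1 ε).2.1 ((rep u).1 ε).2 (c.1 ε)
            hx).symm }
  refine ⟨A, ?_, fun A' hA' => ?_⟩
  · rintro φr' hφ' ar' har' ur hu ⟨L, hL⟩ χ' hχ' h' hh'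
    obtain ⟨r', hrr, hr''⟩ := h𝒜 har'
    have hm' := hℋ hh'
    obtain ⟨v, hv⟩ := exists_fioNet hρ0 hρ hδ hδ1 hχ' hm' φr' r' ur hL
    refine ⟨v, fun ε x hx => ?_, ?_⟩
    · rw [hr'' ε]
      exact ⟨integrableOn_fioIntegrand hρ hδ hδ1.le hχ' hm' (φr'.2.isPhase ε) (r'.1 ε).2
        (ur.1 ε).2 (hL ε) hx, congrFun (hv ε) x⟩
    · refine mk_fioNet_eq hρ hδ hδ1 hχ hχ' hm hm' (Quotient.exact hφ'.symm) (a := r) (a' := r') ?_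
        (u := rep ⟨GE.mk ur, hu⟩) (u' := ur) ?_ (K := join (K ⟨GE.mk ur, hu⟩) L) ?_ ?_
        (fun ε x _ => congrFun (hnet _ ε) x) fun ε x hx => congrFun (hv ε) x
      · rw [← GE.mk_eq_mk_iff, hr, hrr]
      · rw [← GE.mk_eq_mk_iff, hrep]
      · exact fun ε y hy hyK => hK _ ε y hy fun h => hyK (Or.inl h)
      · exact fun ε y hy hyK => hL ε y hy fun h => hyK (Or.inr h)
  -- Uniqueness: every element of $\mathcal G_c(\Omega)$ has a representative with supports in a
  -- fixed compact set, so the defining property for a single choice of data determines all values.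
  · refine LinearMap.ext fun u => ?_
    have hu : GE.mk (rep u) ∈ Gc Ω := by
      rw [hrep]
      exact u.2
    obtain ⟨v, hv, hv'⟩ := hA' φr rfl ar har (rep u) hu ⟨K u, hK u⟩ χ hχ h hh
    have h1 : (⟨GE.mk (rep u), hu⟩ : Gc Ω) = u := Subtype.ext (hrep u)
    rw [h1] at hv'
    rw [hv']
    refine mk_fioNet_eq hρ hδ hδ1 hχ hχ hm hm (Setoid.refl φr) hr0 (u := rep u) (u' := rep u)
      (K := K u) ?_ (hK u) (hK u) (fun ε x hx => ?_) fun ε x _ => congrFun (hnet u ε) x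
    · rw [sub_self]
      exact zero_mem _
    · rw [(hv ε x hx).2, hr' ε]
      rfl

/-- Negligible nets are $O(\varepsilon^b)$ for every real $b$, so a growth bound holds for all
representatives or for none. -/
theorem IsBigOPow.of_mk_eq {E ι : Type} [AddCommGroup E] [Module ℂ E] {P : SeminormFam E ι}
    {r s : Moderate P} (hrs : GE.mk r = GE.mk s) {i : ι} {b : ℝ}
    (h : IsBigOPow (fun ε => P.p i (s.1 ε)) b) : IsBigOPow (fun ε => P.p i (r.1 ε)) b := by
  obtain ⟨q, hq⟩ := exists_nat_ge b
  have h1 := (((GE.mk_eq_mk_iff r s).1 hrs) i q).mono hq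
  refine (h1.add h).of_le fun ε => ?_
  have h2 := P.add_le i ((r - s).1 ε) (s.1 ε)
  rwa [show (r - s).1 ε + s.1 ε = r.1 ε from sub_add_cancel (r.1 ε) (s.1 ε)] at h2

theorem Eps.rpow_sub_natCast (ε : Eps) (b : ℝ) (N : ℕ) :
    (ε : ℝ) ^ (b - N) = (ε : ℝ) ^ b * (ε : ℝ)⁻¹ ^ N := by
  rw [Real.rpow_sub ε.2.1, Real.rpow_natCast, inv_pow, div_eq_mul_inv]

/-- The estimate of a Fourier integral operator with slow scale phase function and regular
amplitude. -/
theorem IsFIO.exists_estimate {m ρ δ : ℝ} (hρ0 : 0 < ρ) (hρ : ρ ≤ 1) (hδ : 0 ≤ δ) (hδ1 : δ < 1)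
    {φ : GPhase p Ω' Ω} (hφ : IsSlowScalePhase φ) {a : GSym p Ω' Ω m ρ δ} (ha : IsRegularSymbol a)
    {A : Gc Ω →ₗ[CTilde] G Ω'} (hA : IsFIO φ a A) (L : CompactIn Ω') {K : Set (Rn n)}
    (hK : IsCompact K) (K' : CompactNhd Ω K) :
    ∃ N : ℕ, ∀ (u : Gc Ω), u.1 ∈ GK Ω K → ∀ (r : Moderate (smoothFam Ω)), GE.mk r = u.1 → ∀ b : ℝ,
      (∀ i, IsBigOPow (fun ε => smoothSeminorm K'.1.1 i (r.1 ε).1) b) →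
      ∃ v : Moderate (smoothFam Ω'), GE.mk v = A u ∧
        ∀ i, IsBigOPow (fun ε => smoothSeminorm L.1 i (v.1 ε).1) (b - N) := by
  have hs : 0 < min ρ (1 - δ) := lt_min hρ0 (by linarith)
  obtain ⟨φr, hφr, hφ1, hφ2⟩ := hφ
  obtain ⟨L₂, hL₂⟩ := exists_compact_nhd L
  obtain ⟨ar, har, Na, hNa⟩ := ha (L₂.prod K'.1)
  obtain ⟨χ, hχ⟩ := exists_isCutoff p
  obtain ⟨h, hh⟩ := exists_order (p := p) hs m 1
  obtain ⟨T, hT1, hT2, hT3⟩ := exists_cutoff_rep hK K'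
  -- The loss consists of $N_a+1$ powers from the amplitude and $2$ from the phase, for every order
  -- of differentiation.
  refine ⟨Na + 3, fun u hu r hr b hb => ?_⟩
  have hTr : GE.mk (T r) = u.1 := by rw [hT2 r (by rwa [hr]), hr]
  have hTK : ∀ ε, ∀ y ∈ Ω, y ∉ K'.1.1 → ((T r).1 ε).1 y = 0 := fun ε y _ hy => hT1 r ε y hy
  obtain ⟨v, hv, hv'⟩ := hA φr hφr (fun ε => (ar.1 ε).1) ⟨ar, har, fun _ => rfl⟩ (T r)
    (by rw [hTr]; exact u.2) ⟨K'.1, hTK⟩ χ hχ h hh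
  refine ⟨v, ?_, fun i => ?_⟩
  · rw [← hv']
    exact congrArg A (Subtype.ext hTr)
  -- Here $h'$, $C$ and $M$ depend on the order $i$; the slow scale bound on $B^M$ removes this
  -- dependence from the power of $\varepsilon$.
  obtain ⟨h', hh'⟩ := exists_order (p := p) hs m (i + 1)
  obtain ⟨C, M, hC, hb'⟩ := exists_fioVal_bound hρ hδ hδ1.le hχ h' i (m := m) (by linarith) L₂.2.2
    K'.1
  obtain ⟨D, hD, hD'⟩ := hT3 (i + h')
  obtain ⟨E, hE, hE'⟩ := (hb (i + h')).exists_const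
  refine IsBigOPow.of_eventually_le (C := C * (D * E)) ?_
  filter_upwards [eventually_phaseBound_of_slowScale L₂ K'.1 (i + h' + 1) M (hφ1 _ _) (hφ2 _ _),
    (hNa (i + h')).eventually_le_neg, hE'] with ε ⟨B, hB, hBM⟩ h2 h3
  have hε := ε.2.1
  have he := Eps.one_le_inv ε
  have hv1 : ∀ x ∈ Ω', (v.1 ε).1 x = fioVal Ω χ h' (φr.1 ε) (ar.1 ε).1 ((T r).1 ε).1 x := fun x hx =>
    (hv ε x hx).2.trans (fioVal_eq_fioVal hρ hδ hδ1.le hχ hχ hh (by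
      have := Nat.cast_nonneg (α := ℝ) i
      linarith) (φr.2.isPhase ε) (ar.1 ε).2 ((T r).1 ε).2 (hTK ε) hx)
  rw [smoothSeminorm_congr (Ω := Ω') L.2.2 i hv1]
  refine smoothSeminorm_le_of_norm_le fun x hx k hk => ?_
  have h4 : smoothSeminorm K'.1.1 (i + h') ((T r).1 ε).1 ≤
      ENNReal.ofReal (D * (E * (ε : ℝ) ^ b)) := by
    refine (hD' r ε).trans ?_
    rw [ENNReal.ofReal_mul (by linarith)]
    exact mul_le_mul_right h3 _
  have hεb : 0 ≤ (ε : ℝ) ^ b := by positivity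
  refine ((hb' (φr.1 ε) (ar.1 ε).1 ((T r).1 ε).1 _ _ _ (φr.2.isPhase ε) (ar.1 ε).2.1 ((T r).1 ε).2
    (hTK ε) hB (by positivity) (by positivity) h2 h4 x (hL₂ hx)).2.2 k hk).trans ?_
  rw [Eps.rpow_sub_natCast]
  calc C * B ^ M * ((ε : ℝ)⁻¹ ^ (Na + 1) * (D * (E * (ε : ℝ) ^ b))) ≤
      C * (ε : ℝ)⁻¹ ^ 2 * ((ε : ℝ)⁻¹ ^ (Na + 1) * (D * (E * (ε : ℝ) ^ b))) := by gcongr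
    _ = _ := by ring

/-- The estimate of a Fourier integral operator with slow scale phase function and regular
amplitude of order `-∞`. -/
theorem IsFIONegInf.exists_estimate {φ : GPhase p Ω' Ω} (hφ : IsSlowScalePhase φ)
    {a : GSymNegInf p Ω' Ω} (ha : IsRegularSymbolNegInf a)
    {A : Gc Ω →ₗ[CTilde] G Ω'} (hA : IsFIONegInf φ a A) (L : CompactIn Ω') {K : Set (Rn n)}
    (hK : IsCompact K) (K' : CompactNhd Ω K) :
    ∃ N : ℕ, ∀ (u : Gc Ω), u.1 ∈ GK Ω K → ∀ (r : Moderate (smoothFam Ω)), GE.mk r = u.1 → ∀ b : ℝ,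
      IsBigOPow (fun ε => smoothSeminorm K'.1.1 0 (r.1 ε).1) b →
      ∃ v : Moderate (smoothFam Ω'), GE.mk v = A u ∧
        ∀ i, IsBigOPow (fun ε => smoothSeminorm L.1 i (v.1 ε).1) (b - N) := by
  obtain ⟨φr, hφr, hφ1, hφ2⟩ := hφ
  obtain ⟨L₂, hL₂⟩ := exists_compact_nhd L
  obtain ⟨ar, har, Na, hNa⟩ := ha (L₂.prod K'.1)
  obtain ⟨χ, hχ⟩ := exists_isCutoff p
  obtain ⟨T, hT1, hT2, hT3⟩ := exists_cutoff_rep hK K'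
  refine ⟨Na + 3, fun u hu r hr b hb => ?_⟩
  have hTr : GE.mk (T r) = u.1 := by rw [hT2 r (by rwa [hr]), hr]
  have hTK : ∀ ε, ∀ y ∈ Ω, y ∉ K'.1.1 → ((T r).1 ε).1 y = 0 := fun ε y _ hy => hT1 r ε y hy
  obtain ⟨v, hv, hv'⟩ := hA φr hφr (fun ε => (ar.1 ε).1) ⟨ar, har, fun _ => rfl⟩ (T r)
    (by rw [hTr]; exact u.2) ⟨K'.1, hTK⟩ χ hχ 0 (mem_univ _)
  refine ⟨v, ?_, fun i => ?_⟩
  · rw [← hv']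
    exact congrArg A (Subtype.ext hTr)
  -- The order $-p-1-i$ makes the integral of $i$ derivatives converge. Regularity of $a$ provides
  -- the same $N_a$ for all these orders.
  obtain ⟨C, M, hC, hb'⟩ := exists_fioVal_zero_bound hχ i (m := -(p : ℝ) - 1 - i) (by linarith)
    L₂.2.2 K'.1
  obtain ⟨D, hD, hD'⟩ := hT3 0
  obtain ⟨E, hE, hE'⟩ := hb.exists_const
  refine IsBigOPow.of_eventually_le (C := C * (D * E)) ?_
  filter_upwards [eventually_phaseBound_of_slowScale L₂ K'.1 (i + 1) M (hφ1 _ _) (hφ2 _ _),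
    (hNa (-(p : ℝ) - 1 - i) i).eventually_le_neg, hE'] with ε ⟨B, hB, hBM⟩ h2 h3
  have hε := ε.2.1
  have he := Eps.one_le_inv ε
  have hv1 : ∀ x ∈ Ω', (v.1 ε).1 x = fioVal Ω χ 0 (φr.1 ε) (ar.1 ε).1 ((T r).1 ε).1 x := fun x hx =>
    (hv ε x hx).2
  rw [smoothSeminorm_congr (Ω := Ω') L.2.2 i hv1]
  refine smoothSeminorm_le_of_norm_le fun x hx k hk => ?_
  have h4 : smoothSeminorm K'.1.1 0 ((T r).1 ε).1 ≤
      ENNReal.ofReal (D * (E * (ε : ℝ) ^ b)) := by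
    refine (hD' r ε).trans ?_
    rw [ENNReal.ofReal_mul (by linarith)]
    exact mul_le_mul_right h3 _
  have hεb : 0 ≤ (ε : ℝ) ^ b := by positivity
  refine ((hb' (φr.1 ε) (ar.1 ε).1 ((T r).1 ε).1 _ _ _ (φr.2.isPhase ε)
    (contDiffOn_of_mem_symNegInf p Ω' Ω (ar.1 ε).2) ((T r).1 ε).2
    (hTK ε) hB (by positivity) (by positivity) h2
    (fun y hy => norm_le_of_smoothSeminorm_zero_le (by positivity) h4 hy) x (hL₂ hx)).2 k
      hk).trans ?_
  rw [Eps.rpow_sub_natCast]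
  calc C * B ^ M * ((ε : ℝ)⁻¹ ^ (Na + 1) * (D * (E * (ε : ℝ) ^ b))) ≤
      C * (ε : ℝ)⁻¹ ^ 2 * ((ε : ℝ)⁻¹ ^ (Na + 1) * (D * (E * (ε : ℝ) ^ b))) := by gcongr
    _ = _ := by ring

/-- A generalized symbol of order `-∞` as a generalized symbol of order `m`. -/
theorem exists_moderate_sym (m : ℝ) (r : Moderate (symNegInfFam p Ω' Ω)) :
    ∃ s : Moderate (symFam p Ω' Ω m 1 0), ∀ ε, (s.1 ε).1 = (r.1 ε).1 :=
  ⟨⟨fun ε => ⟨(r.1 ε).1, (Submodule.mem_iInf _).1 (r.1 ε).2 m⟩, fun i => r.2 (m, i)⟩, fun _ => rfl⟩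

theorem existsUnique_isFIO {m ρ δ : ℝ} (hρ0 : 0 < ρ) (hρ : ρ ≤ 1) (hδ : 0 ≤ δ) (hδ1 : δ < 1)
    (φ : GPhase p Ω' Ω) (a : GSym p Ω' Ω m ρ δ) : ∃! A : Gc Ω →ₗ[CTilde] G Ω', IsFIO φ a A := by
  obtain ⟨r, hr⟩ := GE.mk_surjective a
  exact existsUnique_isFIOWith hρ0 hρ hδ hδ1 φ a Subset.rfl ⟨_, r, hr, fun _ => rfl⟩ Subset.rfl
    (exists_order (lt_min hρ0 (by linarith)) m 1)

/-- The amplitude is regarded as one of order $-p-2$ and type $(1,0)$, for which every $h\ge0$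
satisfies $-p-2-h+1<-p$. -/
theorem existsUnique_isFIONegInf (φ : GPhase p Ω' Ω) (a : GSymNegInf p Ω' Ω) :
    ∃! A : Gc Ω →ₗ[CTilde] G Ω', IsFIONegInf φ a A := by
  obtain ⟨r, hr⟩ := GE.mk_surjective a
  obtain ⟨s, hs⟩ := exists_moderate_sym (-(p : ℝ) - 2) r
  refine existsUnique_isFIOWith one_pos le_rfl le_rfl zero_lt_one φ (GE.mk s) ?_
    ⟨_, r, hr, fun _ => rfl⟩ (fun h _ => ?_) univ_nonempty
  · rintro ar ⟨r', hr', har⟩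
    obtain ⟨s', hs'⟩ := exists_moderate_sym (-(p : ℝ) - 2) r'
    refine ⟨s', ?_, fun ε => (har ε).trans (hs' ε).symm⟩
    rw [GE.mk_eq_mk_iff]
    intro i q
    have h1 := (GE.mk_eq_mk_iff r' r).1 (hr'.trans hr.symm) (-(p : ℝ) - 2, i) q
    refine h1.of_le fun ε => le_of_eq ?_
    change symbolSeminorm _ _ _ _ _ ((s'.1 ε).1 - (s.1 ε).1) = _
    rw [hs, hs']
    rfl
  · have : (0 : ℝ) ≤ h * min 1 (1 - 0) := by positivity
    change -(p : ℝ) - 2 - h * min 1 (1 - 0) + 1 < -(p : ℝ)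
    linarith

end Operators

/-! ### Topologies given by ultra-pseudo-seminorms -/

/-- Ultra-pseudo-seminorms on a `ℂ̃`-module. -/
structure IsUltraSeminorm {M : Type} [AddCommGroup M] [Module CTilde M] (P : M → ℝ≥0∞) : Prop where
  map_zero : P 0 = 0
  lt_top : ∀ u, P u < ⊤
  add_lt : ∀ {u v r}, P u < r → P v < r → P (u + v) < r
  map_neg : ∀ u, P (-u) = P u
  smul_lt : ∀ {c u s r}, CTilde.absE c < s → P u < r → P (c • u) < s * r

/-- The supremum defining a valuation need not be attained, but a strict inequality is always
witnessed by a single exponent $b$. For this reason ultra-pseudo-seminorms are handled through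
strict inequalities. -/
theorem exp_neg_sSup_lt_iff (p : ℝ → Prop) (r : ℝ≥0∞) :
    EReal.exp (-sSup {x : EReal | ∃ b : ℝ, x = b ∧ p b}) < r ↔
      ∃ b : ℝ, p b ∧ ENNReal.ofReal (Real.exp (-b)) < r := by
  have key : ∀ x : EReal, EReal.exp (-x) < r ↔ -ENNReal.log r < x := fun x => by
    rw [← EReal.neg_lt_comm, ← EReal.exp_lt_exp_iff (b := ENNReal.log r), ENNReal.exp_log]
  rw [key, lt_sSup_iff]
  constructor
  · rintro ⟨_, ⟨b, rfl, hb⟩, h⟩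
    refine ⟨b, hb, ?_⟩
    rwa [← key, ← EReal.coe_neg, EReal.exp_coe] at h
  · rintro ⟨b, hb, h⟩
    refine ⟨b, ⟨b, rfl, hb⟩, ?_⟩
    rwa [← key, ← EReal.coe_neg, EReal.exp_coe]

theorem CTilde.absE_lt_iff {z : CTilde} {r : ℝ≥0∞} : z.absE < r ↔
    ∃ b : ℝ, (∃ c : CModerate, CTilde.mk c = z ∧ IsBigOPow (fun ε => ‖c.1 ε‖ₑ) b) ∧
      ENNReal.ofReal (Real.exp (-b)) < r :=
  exp_neg_sSup_lt_iff _ _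

theorem CTilde.absE_lt_top (z : CTilde) : z.absE < ⊤ := by
  obtain ⟨⟨c, N, hN⟩, rfl⟩ := CTilde.mk_surjective z
  exact CTilde.absE_lt_iff.2 ⟨_, ⟨_, rfl, hN⟩, ENNReal.ofReal_lt_top⟩

theorem exists_exp_neg_lt {r : ℝ≥0∞} (hr : 0 < r) : ∃ b : ℝ, ENNReal.ofReal (Real.exp (-b)) < r := by
  obtain ⟨q, hq0, hqr⟩ := ENNReal.lt_iff_exists_nnreal_btwn.1 hr
  have hq : (0 : ℝ) < q := by exact_mod_cast hq0
  refine ⟨-Real.log q, ?_⟩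
  rwa [neg_neg, Real.exp_log hq, ENNReal.ofReal_coe_nnreal]

theorem ofReal_exp_neg_add (b c : ℝ) : ENNReal.ofReal (Real.exp (-(b + c))) =
    ENNReal.ofReal (Real.exp (-b)) * ENNReal.ofReal (Real.exp (-c)) := by
  rw [neg_add, Real.exp_add, ENNReal.ofReal_mul (Real.exp_pos _).le]

/-! ### The ultra-pseudo-seminorms of $\widetilde{\mathbb C}$ and $\mathcal G_E$ -/

section Ups

variable {E ι : Type} [AddCommGroup E] [Module ℂ E] {P : SeminormFam E ι}

theorem GE.ups_lt_iff {S : Set ι} {g : GE P} {r : ℝ≥0∞} : g.ups S < r ↔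
    ∃ b : ℝ, (∃ u : Moderate P, GE.mk u = g ∧ ∀ i ∈ S, IsBigOPow (fun ε => P.p i (u.1 ε)) b) ∧
      ENNReal.ofReal (Real.exp (-b)) < r :=
  exp_neg_sSup_lt_iff _ _

theorem GE.ups_zero (S : Set ι) : (0 : GE P).ups S = 0 := by
  refine nonpos_iff_eq_zero.1 (le_of_forall_gt fun r hr => ?_)
  obtain ⟨b, hb⟩ := exists_exp_neg_lt hr
  exact GE.ups_lt_iff.2 ⟨b, ⟨0, GE.mk_zero, fun i _ =>
    (IsBigOPow.zero b).of_le fun _ => (P.map_zero i).le⟩, hb⟩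

theorem GE.ups_add_lt {S : Set ι} {g h : GE P} {r : ℝ≥0∞} (hg : g.ups S < r) (hh : h.ups S < r) :
    (g + h).ups S < r := by
  obtain ⟨b, ⟨u, rfl, hu⟩, hb⟩ := GE.ups_lt_iff.1 hg
  obtain ⟨c, ⟨v, rfl, hv⟩, hc⟩ := GE.ups_lt_iff.1 hh
  refine GE.ups_lt_iff.2 ⟨min b c, ⟨u + v, GE.mk_add u v, fun i hi =>
    (((hu i hi).mono (min_le_left b c)).add ((hv i hi).mono (min_le_right b c))).of_le
      fun ε => P.add_le i (u.1 ε) (v.1 ε)⟩, ?_⟩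
  rcases min_choice b c with h | h <;> rwa [h]

theorem GE.ups_smul_lt {S : Set ι} {c : CTilde} {g : GE P} {s r : ℝ≥0∞} (hc : c.absE < s)
    (hg : g.ups S < r) : (c • g).ups S < s * r := by
  obtain ⟨b, ⟨z, rfl, hz⟩, hb⟩ := CTilde.absE_lt_iff.1 hc
  obtain ⟨d, ⟨u, rfl, hu⟩, hd⟩ := GE.ups_lt_iff.1 hg
  refine GE.ups_lt_iff.2 ⟨b + d, ⟨z • u, GE.mk_smul z u, fun i hi =>
    (hz.mul (hu i hi)).of_le fun ε => P.smul_le i (z.1 ε) (u.1 ε)⟩, ?_⟩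
  rw [ofReal_exp_neg_add]
  exact ENNReal.mul_lt_mul hb hd

theorem GE.ups_neg (S : Set ι) (g : GE P) : (-g).ups S = g.ups S := by
  have key : ∀ g : GE P, (-g).ups S ≤ g.ups S := fun g => by
    refine le_of_forall_gt fun r hr => ?_
    obtain ⟨b, ⟨u, rfl, hu⟩, hb⟩ := GE.ups_lt_iff.1 hr
    refine GE.ups_lt_iff.2 ⟨b, ⟨-u, rfl, fun i hi => (hu i hi).of_le fun ε => ?_⟩, hb⟩
    have := P.smul_le i (-1) (u.1 ε)
    rw [enorm_neg, enorm_one, one_mul, neg_one_smul] at this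
    exact this
  refine le_antisymm (key g) ?_
  conv_lhs => rw [← neg_neg g]
  exact key _

theorem isUltraSeminorm_absE : IsUltraSeminorm CTilde.absE where
  map_zero := by
    refine nonpos_iff_eq_zero.1 (le_of_forall_gt fun r hr => ?_)
    obtain ⟨b, hb⟩ := exists_exp_neg_lt hr
    exact CTilde.absE_lt_iff.2 ⟨b, ⟨0, _root_.map_zero _,
      (IsBigOPow.zero b).of_le fun _ => by simp⟩, hb⟩
  lt_top := CTilde.absE_lt_top
  add_lt := fun {g h r} hg hh => by
    obtain ⟨b, ⟨u, rfl, hu⟩, hb⟩ := CTilde.absE_lt_iff.1 hg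
    obtain ⟨c, ⟨v, rfl, hv⟩, hc⟩ := CTilde.absE_lt_iff.1 hh
    refine CTilde.absE_lt_iff.2 ⟨min b c, ⟨u + v, _root_.map_add _ u v,
      ((hu.mono (min_le_left b c)).add (hv.mono (min_le_right b c))).of_le
        fun ε => enorm_add_le (u.1 ε) (v.1 ε)⟩, ?_⟩
    rcases min_choice b c with h | h <;> rwa [h]
  map_neg := fun g => by
    have key : ∀ g : CTilde, (-g).absE ≤ g.absE := fun g => by
      refine le_of_forall_gt fun r hr => ?_
      obtain ⟨b, ⟨u, rfl, hu⟩, hb⟩ := CTilde.absE_lt_iff.1 hr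
      exact CTilde.absE_lt_iff.2 ⟨b, ⟨-u, _root_.map_neg _ u,
        hu.of_le fun ε => (enorm_neg (u.1 ε)).le⟩, hb⟩
    refine le_antisymm (key g) ?_
    conv_lhs => rw [← neg_neg g]
    exact key _
  smul_lt := fun {c g s r} hc hg => by
    obtain ⟨b, ⟨z, rfl, hz⟩, hb⟩ := CTilde.absE_lt_iff.1 hc
    obtain ⟨d, ⟨u, rfl, hu⟩, hd⟩ := CTilde.absE_lt_iff.1 hg
    refine CTilde.absE_lt_iff.2 ⟨b + d, ⟨z * u, _root_.map_mul _ z u,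
      (hz.mul hu).of_le fun ε => (enorm_mul (z.1 ε) (u.1 ε)).le⟩, ?_⟩
    rw [ofReal_exp_neg_add]
    exact ENNReal.mul_lt_mul hb hd

theorem isUltraSeminorm_ups (S : Set ι) {N : Submodule CTilde (GE P)}
    (hN : ∀ u ∈ N, u.ups S < ⊤) : IsUltraSeminorm fun u : N => u.1.ups S where
  map_zero := GE.ups_zero S
  lt_top := fun u => hN u.1 u.2
  add_lt := GE.ups_add_lt
  map_neg := fun u => GE.ups_neg S u.1
  smul_lt := GE.ups_smul_lt

end Ups

/-! ### Locally convex module topologies and inductive limits -/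

section SeminormTopology

variable {M N J I : Type} [AddCommGroup M] [Module CTilde M] [AddCommGroup N] [Module CTilde N]

theorem IsUltraSeminorm.comp {P : N → ℝ≥0∞} (hP : IsUltraSeminorm P) (f : M →ₗ[CTilde] N) :
    IsUltraSeminorm fun u => P (f u) where
  map_zero := by rw [_root_.map_zero, hP.map_zero]
  lt_top := fun u => hP.lt_top _
  add_lt := fun hu hv => by
    rw [_root_.map_add]
    exact hP.add_lt hu hv
  map_neg := fun u => by rw [_root_.map_neg, hP.map_neg]
  smul_lt := fun hc hu => by
    rw [_root_.map_smul]
    exact hP.smul_lt hc hu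

theorem isOpen_ball {M : Type} [AddCommGroup M] (P : J → M → ℝ≥0∞) (j : J) (g : M) {r : ℝ≥0∞} (hr : 0 < r) :
    IsOpen[seminormTopology P] {h | P j (h - g) < r} :=
  GenerateOpen.basic _ ⟨j, g, r, hr, rfl⟩

theorem IsUltraSeminorm.sub_lt_of_lt {P : M → ℝ≥0∞} (hP : IsUltraSeminorm P) {a b c : M} {r : ℝ≥0∞}
    (h1 : P (a - b) < r) (h2 : P (b - c) < r) : P (a - c) < r := by
  rw [← sub_add_sub_cancel a b c]
  exact hP.add_lt h1 h2

theorem IsUltraSeminorm.mem_ball {P : M → ℝ≥0∞} (hP : IsUltraSeminorm P) (a : M) {r : ℝ≥0∞}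
    (hr : 0 < r) : P (a - a) < r := by
  rwa [sub_self, hP.map_zero]

theorem isTopologicalAddGroup_seminormTopology {P : J → M → ℝ≥0∞} (hP : ∀ j, IsUltraSeminorm (P j)) :
    @IsTopologicalAddGroup M (seminormTopology P) _ := by
  let _ := seminormTopology P
  refine { continuous_add := ?_, continuous_neg := ?_ }
  · refine continuous_generateFrom_iff.2 ?_
    rintro _ ⟨j, g, r, hr, rfl⟩
    refine isOpen_prod_iff.2 fun a b hab => ⟨_, _, isOpen_ball P j a hr, isOpen_ball P j b hr,
      (hP j).mem_ball a hr, (hP j).mem_ball b hr, ?_⟩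
    rintro ⟨a', b'⟩ ⟨ha, hb⟩
    refine (hP j).sub_lt_of_lt ?_ hab
    change P j (a' + b' - (a + b)) < r
    rw [add_sub_add_comm]
    exact (hP j).add_lt ha hb
  · refine continuous_generateFrom_iff.2 ?_
    rintro _ ⟨j, g, r, hr, rfl⟩
    convert isOpen_ball P j (-g) hr using 1
    ext h
    change P j (-h - g) < r ↔ P j (h - -g) < r
    rw [← (hP j).map_neg, neg_sub, sub_neg_eq_add, sub_neg_eq_add, add_comm]

/-- Uses $c'u'-cu=(c'-c)(u'-u)+(c'-c)u+c(u'-u)$. The radii are chosen to make each summand smaller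
than $r$, which by the ultrametric inequality bounds the sum; finiteness of the seminorms provides
the bounds $S$ and $T$ for $c$ and $u$. -/
theorem continuousSMul_seminormTopology {P : J → M → ℝ≥0∞} (hP : ∀ j, IsUltraSeminorm (P j)) :
    @ContinuousSMul CTilde M _ CTilde.topology (seminormTopology P) := by
  let _ := seminormTopology P
  let _ := CTilde.topology
  refine ⟨continuous_generateFrom_iff.2 ?_⟩
  rintro _ ⟨j, g, r, hr, rfl⟩
  refine isOpen_prod_iff.2 fun c u hcu => ?_
  obtain ⟨S, hS, hS'⟩ := ENNReal.lt_iff_exists_nnreal_btwn.1 (CTilde.absE_lt_top c)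
  obtain ⟨T, hT, hT'⟩ := ENNReal.lt_iff_exists_nnreal_btwn.1 ((hP j).lt_top u)
  have hS0 : (S : ℝ≥0∞) ≠ 0 := (pos_of_gt hS).ne'
  have hT0 : (T : ℝ≥0∞) ≠ 0 := (pos_of_gt hT).ne'
  have hs : 0 < min 1 (r / T) := lt_min one_pos (ENNReal.div_pos hr.ne' hT'.ne)
  have ht : 0 < min r (r / S) := lt_min hr (ENNReal.div_pos hr.ne' hS'.ne)
  refine ⟨_, _, isOpen_ball (fun _ : Unit => CTilde.absE) () c hs, isOpen_ball P j u ht,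
    isUltraSeminorm_absE.mem_ball c hs, (hP j).mem_ball u ht, ?_⟩
  rintro ⟨c', u'⟩ ⟨hc, hu⟩
  refine (hP j).sub_lt_of_lt (b := c • u) ?_ hcu
  change P j (c' • u' - c • u) < r
  have h1 := (hP j).smul_lt (hc.trans_le (min_le_left _ _)) (hu.trans_le (min_le_left _ _))
  have h2 := (hP j).smul_lt (hc.trans_le (min_le_right _ _)) hT
  have h3 := (hP j).smul_lt hS (hu.trans_le (min_le_right _ _))
  rw [one_mul] at h1
  rw [ENNReal.div_mul_cancel hT0 hT'.ne] at h2
  rw [ENNReal.mul_div_cancel hS0 hS'.ne] at h3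
  have h4 := (hP j).add_lt ((hP j).add_lt h1 h2) h3
  convert h4 using 2
  simp only [sub_smul, smul_sub]
  abel

/-- A ball that contains $0$ contains the ball of the same radius about $0$, and the latter is
closed under addition by the ultrametric inequality. Both facts pass to finite intersections and
unions of generating sets. -/
theorem isLocallyConvexTopology_seminormTopology {P : J → M → ℝ≥0∞}
    (hP : ∀ j, IsUltraSeminorm (P j)) : IsLocallyConvexTopology (seminormTopology P) where
  addGroup := isTopologicalAddGroup_seminormTopology hP
  smul := continuousSMul_seminormTopology hP
  basis := by
    let _ := seminormTopology P
    have key : ∀ V : Set M, IsOpen V → 0 ∈ V → ∃ W : Set M, IsOpen W ∧ 0 ∈ W ∧ W ⊆ V ∧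
        ∀ u ∈ W, ∀ v ∈ W, u + v ∈ W := by
      intro V hV
      induction hV with
      | basic V hV =>
        obtain ⟨j, g, r, hr, rfl⟩ := hV
        intro h0
        refine ⟨_, isOpen_ball P j 0 hr, (hP j).mem_ball 0 hr,
          fun h hh => (hP j).sub_lt_of_lt hh h0, fun u hu v hv => ?_⟩
        change P j (u - 0) < r at hu
        change P j (v - 0) < r at hv
        change P j (u + v - 0) < r
        rw [sub_zero] at hu hv ⊢
        exact (hP j).add_lt hu hv
      | univ => exact fun _ => ⟨univ, isOpen_univ, mem_univ _, Subset.rfl, fun _ _ _ _ => mem_univ _⟩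
      | inter V₁ V₂ _ _ h1 h2 =>
        intro h0
        obtain ⟨W₁, ho, hz, hs, ha⟩ := h1 h0.1
        obtain ⟨W₂, ho', hz', hs', ha'⟩ := h2 h0.2
        exact ⟨W₁ ∩ W₂, ho.inter ho', ⟨hz, hz'⟩, inter_subset_inter hs hs',
          fun u hu v hv => ⟨ha u hu.1 v hv.1, ha' u hu.2 v hv.2⟩⟩
      | sUnion 𝒱 _ h =>
        rintro ⟨V, hV, h0⟩
        obtain ⟨W, ho, hz, hs, ha⟩ := h V hV h0
        exact ⟨W, ho, hz, hs.trans (subset_sUnion_of_mem hV), ha⟩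
    intro U hU
    obtain ⟨V, hVU, hV, h0⟩ := mem_nhds_iff.1 hU
    obtain ⟨W, ho, hz, hs, ha⟩ := key V hV h0
    exact ⟨W, ho.mem_nhds hz, hs.trans hVU, ha⟩

/-- A linear map out of an inductive limit is continuous as soon as its restrictions to the steps
satisfy seminorm estimates. -/
theorem continuous_inductiveLimitTopology {X : J → Type} [∀ j, AddCommGroup (X j)]
    [∀ j, Module CTilde (X j)] {I : J → Type} {L : Type} {Q : ∀ j, I j → X j → ℝ≥0∞}
    (hQ : ∀ j i, Q j i 0 = 0) (f : ∀ j, X j →ₗ[CTilde] M) {P : L → N → ℝ≥0∞}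
    (hP : ∀ l, IsUltraSeminorm (P l)) (B : M →ₗ[CTilde] N)
    (h : ∀ j l, ∃ (i : I j) (C : ℝ≥0∞), C ≠ 0 ∧ C ≠ ⊤ ∧
      ∀ (x : X j) (s : ℝ≥0∞), Q j i x < s → P l (B (f j x)) < C * s) :
    Continuous[inductiveLimitTopology (fun j => seminormTopology (Q j)) (fun j => f j),
      seminormTopology P] B := by
  -- The topology pulled back along $B$ is locally convex, and the estimates make every map of the
  -- inductive system continuous for it. The inductive limit topology is therefore finer.
  let t : TopologicalSpace M := seminormTopology fun l u => P l (B u)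
  have ht : inductiveLimitTopology (fun j => seminormTopology (Q j)) (fun j => f j) ≤ t := by
    refine sInf_le ⟨isLocallyConvexTopology_seminormTopology fun l => (hP l).comp B, fun j => ?_⟩
    let _ := seminormTopology (Q j)
    refine continuous_generateFrom_iff.2 ?_
    rintro _ ⟨l, g, r, hr, rfl⟩
    obtain ⟨i, C, hC0, hC, hCi⟩ := h j l
    have hr' : 0 < r / C := ENNReal.div_pos hr.ne' hC
    refine isOpen_iff_forall_mem_open.2 fun x hx => ⟨_, fun y hy => ?_, isOpen_ball (Q j) i x hr', ?_⟩
    · refine ((hP l).comp B).sub_lt_of_lt (b := f j x) ?_ hx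
      have := hCi _ _ hy
      rwa [ENNReal.mul_div_cancel hC0 hC, _root_.map_sub] at this
    · change Q j i (x - x) < r / C
      rwa [sub_self, hQ]
  refine continuous_le_dom ht ?_
  refine continuous_generateFrom_iff.2 ?_
  rintro _ ⟨l, g, r, hr, rfl⟩
  refine isOpen_iff_forall_mem_open.2 fun x hx => ⟨_, fun y hy => ?_,
    isOpen_ball (fun l u => P l (B u)) l x hr, ((hP l).comp B).mem_ball x hr⟩
  refine (hP l).sub_lt_of_lt (b := B x) ?_ hx
  rw [← _root_.map_sub]
  exact hy

end SeminormTopology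

/-! ### Continuity of Fourier integral operators -/

section Continuity

variable {n' n p : ℕ} {Ω' : Opens (Rn n')} {Ω : Opens (Rn n)}

theorem upsInf_lt_iff {K : CompactIn Ω} {u : G Ω} {r : ℝ≥0∞} : upsInf Ω K u < r ↔
    ∃ b : ℝ, (∃ v : Moderate (smoothFam Ω), GE.mk v = u ∧
      ∀ i, IsBigOPow (fun ε => smoothSeminorm K.1 i (v.1 ε).1) b) ∧
      ENNReal.ofReal (Real.exp (-b)) < r := by
  refine GE.ups_lt_iff.trans (exists_congr fun b => and_congr_left fun _ => exists_congr fun v =>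
    and_congr_right fun _ => ⟨fun h i => h (K, i) rfl, ?_⟩)
  rintro h ⟨_, i⟩ rfl
  exact h i

theorem upsInf_lt_top (K : CompactIn Ω) {u : G Ω} (hu : u ∈ GInf Ω) : upsInf Ω K u < ⊤ := by
  obtain ⟨r, rfl, hr⟩ := hu
  obtain ⟨N, hN⟩ := hr K
  exact upsInf_lt_iff.2 ⟨_, ⟨r, rfl, hN⟩, ENNReal.ofReal_lt_top⟩

theorem isUltraSeminorm_upsInf (K : CompactIn Ω) :
    IsUltraSeminorm fun u : GInf Ω => upsInf Ω K u.1 :=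
  isUltraSeminorm_ups _ fun _ hu => upsInf_lt_top K hu

/-- The representative may depend on the compact set, since growth bounds do not depend on the
representative. -/
theorem mem_GInf_of_forall {u : G Ω} (h : ∀ K : CompactIn Ω, ∃ v : Moderate (smoothFam Ω),
    GE.mk v = u ∧ ∃ b : ℝ, ∀ i, IsBigOPow (fun ε => smoothSeminorm K.1 i (v.1 ε).1) b) :
    u ∈ GInf Ω := by
  obtain ⟨r, rfl⟩ := GE.mk_surjective u
  refine ⟨r, rfl, fun K => ?_⟩
  obtain ⟨v, hv, b, hb⟩ := h K
  obtain ⟨N, hN⟩ := exists_nat_ge (-b)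
  exact ⟨N, fun i => (IsBigOPow.of_mk_eq (P := smoothFam Ω) (i := (K, i)) hv.symm (hb i)).mono
    (neg_le.1 hN)⟩

/-- Losing $N$ powers of $\varepsilon$ multiplies an ultra-pseudo-seminorm by $e^N$. -/
theorem ofReal_exp_neg_sub_lt {b : ℝ} {N : ℕ} {s : ℝ≥0∞} (h : ENNReal.ofReal (Real.exp (-b)) < s) :
    ENNReal.ofReal (Real.exp (-(b - N))) < ENNReal.ofReal (Real.exp N) * s := by
  rw [sub_eq_add_neg, add_comm, ofReal_exp_neg_add, neg_neg]
  exact ENNReal.mul_lt_mul_right (ENNReal.ofReal_pos.2 (Real.exp_pos _)).ne' ENNReal.ofReal_ne_top h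

theorem IsFIO.apply_mem_GInf {m ρ δ : ℝ} (hρ0 : 0 < ρ) (hρ : ρ ≤ 1) (hδ : 0 ≤ δ)
    (hδ1 : δ < 1) {φ : GPhase p Ω' Ω} (hφ : IsSlowScalePhase φ) {a : GSym p Ω' Ω m ρ δ}
    (ha : IsRegularSymbol a) {A : Gc Ω →ₗ[CTilde] G Ω'} (hA : IsFIO φ a A) (u : Gc Ω)
    (hu : u.1 ∈ GInf Ω) : A u ∈ GInf Ω' := by
  obtain ⟨r, hr, hr'⟩ := hu
  obtain ⟨K, hK⟩ := u.2
  obtain ⟨K', hK'⟩ := exists_compact_nhd K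
  refine mem_GInf_of_forall fun L => ?_
  obtain ⟨N, hN⟩ := hA.exists_estimate hρ0 hρ hδ hδ1 hφ ha L K.2.1 ⟨K', hK'⟩
  obtain ⟨M, hM⟩ := hr' K'
  obtain ⟨v, hv, hv'⟩ := hN u hK r hr _ hM
  exact ⟨v, hv, _, hv'⟩

theorem IsFIO.mapsGcInfContinuouslyIntoGInf {m ρ δ : ℝ} (hρ0 : 0 < ρ) (hρ : ρ ≤ 1) (hδ : 0 ≤ δ)
    (hδ1 : δ < 1) {φ : GPhase p Ω' Ω} (hφ : IsSlowScalePhase φ) {a : GSym p Ω' Ω m ρ δ}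
    (ha : IsRegularSymbol a) {A : Gc Ω →ₗ[CTilde] G Ω'} (hA : IsFIO φ a A) :
    MapsGcInfContinuouslyIntoGInf A := by
  let R : GcInf Ω →ₗ[CTilde] Gc Ω := Submodule.inclusion inf_le_right
  have hmem : ∀ u : GcInf Ω, (A ∘ₗ R) u ∈ GInf Ω' := fun u =>
    hA.apply_mem_GInf hρ0 hρ hδ hδ1 hφ ha (R u) u.2.1
  refine ⟨hmem, ?_⟩
  -- The uniform loss $N$ yields $\mathcal P(Au)\le e^N\mathcal P(u)$ on each step of the inductive
  -- limit.
  have key : ∀ (K : CompactIn Ω) (L : CompactIn Ω'), ∃ (i : CompactNhd Ω K.1) (C : ℝ≥0∞),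
      C ≠ 0 ∧ C ≠ ⊤ ∧ ∀ (u : GInfK Ω K.1) (s : ℝ≥0∞), upsInf Ω i.1 u.1 < s →
        upsInf Ω' L (A ⟨u.1, K, u.2.2⟩) < C * s := fun K L => by
    obtain ⟨K', hK'⟩ := exists_compact_nhd K
    obtain ⟨N, hN⟩ := hA.exists_estimate hρ0 hρ hδ hδ1 hφ ha L K.2.1 ⟨K', hK'⟩
    refine ⟨⟨K', hK'⟩, ENNReal.ofReal (Real.exp N), (ENNReal.ofReal_pos.2 (Real.exp_pos _)).ne',
      ENNReal.ofReal_ne_top, fun u s hs => ?_⟩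
    obtain ⟨b, ⟨r, hr, hb⟩, hbs⟩ := upsInf_lt_iff.1 hs
    obtain ⟨v, hv, hv'⟩ := hN ⟨u.1, K, u.2.2⟩ u.2.2 r hr b hb
    exact upsInf_lt_iff.2 ⟨_, ⟨v, hv, hv'⟩, ofReal_exp_neg_sub_lt hbs⟩
  exact continuous_inductiveLimitTopology
    (Q := fun (K : CompactIn Ω) (j : CompactNhd Ω K.1) (u : GInfK Ω K.1) => upsInf Ω j.1 u.1)
    (fun K j => GE.ups_zero _)
    (fun K => Submodule.inclusion (GInfK_le_GcInf Ω K)) isUltraSeminorm_upsInf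
    ((A ∘ₗ R).codRestrict (GInf Ω') hmem) key

theorem IsFIONegInf.mapsGcContinuouslyIntoGInf {φ : GPhase p Ω' Ω} (hφ : IsSlowScalePhase φ)
    {a : GSymNegInf p Ω' Ω} (ha : IsRegularSymbolNegInf a) {A : Gc Ω →ₗ[CTilde] G Ω'}
    (hA : IsFIONegInf φ a A) : MapsGcContinuouslyIntoGInf A := by
  have hmem : ∀ u : Gc Ω, A u ∈ GInf Ω' := by
    rintro ⟨u, K, hK⟩
    obtain ⟨K', hK'⟩ := exists_compact_nhd K
    refine mem_GInf_of_forall fun L => ?_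
    obtain ⟨N, hN⟩ := hA.exists_estimate hφ ha L K.2.1 ⟨K', hK'⟩
    obtain ⟨r, hr⟩ := GE.mk_surjective u
    obtain ⟨M, hM⟩ := r.2 (K', 0)
    obtain ⟨v, hv, hv'⟩ := hN ⟨u, K, hK⟩ hK r hr _ hM
    exact ⟨v, hv, _, hv'⟩
  refine ⟨hmem, ?_⟩
  have key : ∀ (K : CompactIn Ω) (L : CompactIn Ω'), ∃ (i : CompactNhd Ω K.1 × ℕ) (C : ℝ≥0∞),
      C ≠ 0 ∧ C ≠ ⊤ ∧ ∀ (u : GK Ω K.1) (s : ℝ≥0∞), u.1.ups {(i.1.1, i.2)} < s →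
        upsInf Ω' L (A ⟨u.1, K, u.2⟩) < C * s := fun K L => by
    obtain ⟨K', hK'⟩ := exists_compact_nhd K
    obtain ⟨N, hN⟩ := hA.exists_estimate hφ ha L K.2.1 ⟨K', hK'⟩
    -- The seminorm of order $0$ on $\mathcal G_K(\Omega)$ suffices, as no derivative of $u$ enters
    -- the estimate.
    refine ⟨⟨⟨K', hK'⟩, 0⟩, ENNReal.ofReal (Real.exp N),
      (ENNReal.ofReal_pos.2 (Real.exp_pos _)).ne', ENNReal.ofReal_ne_top, fun u s hs => ?_⟩
    obtain ⟨b, ⟨r, hr, hb⟩, hbs⟩ := GE.ups_lt_iff.1 hs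
    obtain ⟨v, hv, hv'⟩ := hN ⟨u.1, K, u.2⟩ u.2 r hr b (hb (K', 0) (mem_singleton _))
    exact upsInf_lt_iff.2 ⟨_, ⟨v, hv, hv'⟩, ofReal_exp_neg_sub_lt hbs⟩
  exact continuous_inductiveLimitTopology
    (Q := fun (K : CompactIn Ω) (j : CompactNhd Ω K.1 × ℕ) (u : GK Ω K.1) =>
      u.1.ups {(j.1.1, j.2)})
    (fun K j => GE.ups_zero _)
    (fun K => Submodule.inclusion (GK_le_Gc Ω K)) isUltraSeminorm_upsInf
    (A.codRestrict (GInf Ω') hmem) key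

end Continuity

end Colombeau

end

theorem mainTheorem2 {n' n p : ℕ} (Ω' : TopologicalSpace.Opens (Rn n'))
    (Ω : TopologicalSpace.Opens (Rn n)) (φ : GPhase p Ω' Ω) (hφ : IsSlowScalePhase φ) :
    (∀ (m ρ δ : ℝ), 0 < ρ → ρ ≤ 1 → 0 ≤ δ → δ < 1 →
      ∀ a : GSym p Ω' Ω m ρ δ, IsRegularSymbol a →
        (∃! A : Gc Ω →ₗ[CTilde] G Ω', IsFIO φ a A) ∧
        ∀ A : Gc Ω →ₗ[CTilde] G Ω', IsFIO φ a A → MapsGcInfContinuouslyIntoGInf A) ∧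
    (∀ a : GSymNegInf p Ω' Ω, IsRegularSymbolNegInf a →
        (∃! A : Gc Ω →ₗ[CTilde] G Ω', IsFIONegInf φ a A) ∧
        ∀ A : Gc Ω →ₗ[CTilde] G Ω', IsFIONegInf φ a A → MapsGcContinuouslyIntoGInf A) :=
  ⟨fun _ _ _ hρ0 hρ hδ hδ1 a ha => ⟨existsUnique_isFIO hρ0 hρ hδ hδ1 φ a, fun _ hA =>
      hA.mapsGcInfContinuouslyIntoGInf hρ0 hρ hδ hδ1 hφ ha⟩,
    fun a ha => ⟨existsUnique_isFIONegInf φ a, fun _ hA =>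
      hA.mapsGcContinuouslyIntoGInf hφ ha⟩⟩
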